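/- \textbf{Problem.} Let $T>0$, $n,l,m,d_\varphi,d_\eta\in\mathbb N$, and let $f_0,\dots,f_m:\mathbb R^{n}\times\mathbb R^l\to\mathbb R^n$, $\varphi_0,\dots,\varphi_{d_\varphi},\eta_1,\dots,\eta_{d_\eta}:\mathbb R^{n}\times\mathbb R^n\to\mathbb R$ have Lipschitz-continuous second derivatives. Put $F(x,u,v)=f_0(x,u)+\sum_{i=1}^m v_if_i(x,u)$ and consider the problem (P) of minimizing $\varphi_0(x_0,x_T)$ over $w=(x,u,v)\in W^{1,\infty}(0,T;\mathbb R^n)\times L^\infty(0,T;\mathbb R^l)\times L^\infty(0,T;\mathbb R^m)$ subject to $$\dot x_t=F(x_t,u_t,v_t)\ \text{ a.e. on }[0,T],\qquad \eta_j(x_0,x_T)=0\ (1\le j\le d_\eta),\qquad \varphi_i(x_0,x_T)\le 0\ (1\le i\le d_\varphi).$$ A feasible $\hat w=(\hat x,\hat u,\hat v)$ is a \emph{weak minimum} if for some $\varepsilon>0$ it minimizes the cost among all feasible $w$ with $\|x-\hat x\|_\infty,\|u-\hat u\|_\infty,\|v-\hat v\|_\infty<\varepsilon$. Fix a feasible $\hat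 w$ such that $\hat u,\hat v$ are smooth ($C^\infty$) on $[0,T]$ and $\varphi_i(\hat x_0,\hat x_T)=0$ for $i=1,\dots,d_\varphi$. \textbf{Multipliers.} For $\lambda=(\alpha,\beta,p)\in\mathbb R^{d_\varphi+1}\times\mathbb R^{d_\eta}\times W^{1,\infty}(0,T;\mathbb R^n)$ (with $p_t$ regarded as a row vector) let $H[\lambda](x,u,v,t)=p_tF(x,u,v)$ and $\ell[\lambda]=\sum_{i=0}^{d_\varphi}\alpha_i\varphi_i+\sum_{j=1}^{d_\eta}\beta_j\eta_j$. Functions and derivatives without arguments are evaluated along $\hat w$. Let $\Lambda$ be the set of all $\lambda$ with $\sum_i|\alpha_i|+\sum_j|\beta_j|=1$, $\alpha\ge0$, $-\dot p_t=H_x[\lambda]$ a.e., $p_0=-D_{x_0}\ell[\lambda](\hat x_0,\hat x_T)$, $p_T=D_{x_T}\ell[\lambda](\hat x_0,\hat x_T)$, and $H_u[\lambda]=0$, $H_v[\lambda]=0$ a.e. on $[0,T]$. For $\bar w=(\bar x,\bar u,\bar v)\in W^{1,2}\times L^2\times L^2$ put $$\Omega[\lambda](\bar w)=\tfrac12D^2\ell[\lambda](\hat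 x_0,\hat x_T)(\bar x_0,\bar x_T)^2+\int_0^T\Big[\tfrac12\bar x^\top H_{xx}\bar x+\bar u^\top H_{ux}\bar x+\bar v^\top H_{vx}\bar x+\tfrac12\bar u^\top H_{uu}\bar u+\bar v^\top H_{vu}\bar u\Big]dt ,$$ and let $\Lambda^{\#}$ be the set of $\lambda\in\Lambda$ for which $\Omega[\lambda]$ is weakly (sequentially) lower semicontinuous on the space $\{\bar w\in W^{1,2}\times L^2\times L^2:\dot{\bar x}=F_x\bar x+F_u\bar u+F_v\bar v\text{ a.e.}\}$. With $V[\lambda]=\frac12\big(H_{vx}F_v-(H_{vx}F_v)^\top\big)$ set $$G(\mathrm{co}\,\Lambda^{\#})=\{\lambda\in\mathrm{co}\,\Lambda^{\#}:\ V[\lambda]\equiv0\text{ on }[0,T]\},$$ where $\mathrm{co}$ is the convex hull. \textbf{Transformed cone and quadratic form.} Let $B=F_xF_v-\frac{d}{dt}F_v$, $M=F_v^\top H_{xx}-\dot H_{vx}-H_{vx}F_x$, $E=F_v^\top H_{ux}^\top-H_{vx}F_u$, $S=\frac12\big(H_{vx}F_v+(H_{vx}F_v)^\top\big)$, $R=F_v^\top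 H_{xx}F_v-\big(H_{vx}B+(H_{vx}B)^\top\big)-\dot S$, and $$g[\lambda](\zeta_0,\zeta_T,h)=\tfrac12D^2\ell[\lambda](\hat x_0,\hat x_T)(\zeta_0,\zeta_T+F_{v,T}h)^2+h^\top\big(H_{vx,T}\zeta_T+\tfrac12S_Th\big).$$ Let $\mathcal P_2$ be the set of $(\bar\xi,\bar u,\bar y,\bar h)\in W^{1,2}(0,T;\mathbb R^n)\times L^2(0,T;\mathbb R^l)\times L^2(0,T;\mathbb R^m)\times\mathbb R^m$ with $\dot{\bar\xi}=F_x\bar\xi+F_u\bar u+B\bar y$ a.e., $D\eta_j(\hat x_0,\hat x_T)(\bar\xi_0,\bar\xi_T+F_{v,T}\bar h)=0$ for $1\le j\le d_\eta$, and $D\varphi_i(\hat x_0,\hat x_T)(\bar\xi_0,\bar\xi_T+F_{v,T}\bar h)\le0$ for $0\le i\le d_\varphi$; and put $$\Omega_{\mathcal P_2}[\lambda](\bar\xi,\bar u,\bar y,\bar h)=g[\lambda](\bar\xi_0,\bar\xi_T,\bar h)+\int_0^T\Big[\tfrac12\bar\xi^\top H_{xx}\bar\xi+\bar u^\top H_{ux}\bar\xi+\bar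 y^\top M\bar\xi+\tfrac12\bar u^\top H_{uu}\bar u+\bar y^\top E\bar u+\tfrac12\bar y^\top R\bar y\Big]dt .$$ \textbf{Theorem.} If $\hat w$ is a weak minimum of (P), then for every $(\bar\xi,\bar u,\bar y,\bar h)\in\mathcal P_2$ the maximum below is attained and $$\max_{\lambda\in G(\mathrm{co}\,\Lambda^{\#})}\Omega_{\mathcal P_2}[\lambda](\bar\xi,\bar u,\bar y,\bar h)\ \ge\ 0 .$$ -/

import Mathlib

open Set Filter Topology MeasureTheory Matrix
open scoped ContDiff

noncomputable section

/-- Lebesgue measure on `[0, T]`. -/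
abbrev timeMeasure (T : ℝ) : Measure ℝ := volume.restrict (Icc 0 T)

/-- Membership in the Sobolev space `W^{1,q}(0,T;ℝᵏ)` (continuous representative):
`x` is on `[0,T]` the primitive of an `L^q` function. -/
def IsSobolev (T : ℝ) (q : ENNReal) {k : ℕ} (x : ℝ → Fin k → ℝ) : Prop :=
  ∃ g : ℝ → Fin k → ℝ, MemLp g q (timeMeasure T) ∧
    ∀ t ∈ Icc 0 T, x t = x 0 + ∫ s in (0 : ℝ)..t, g s

/-- Weak convergence in `L²(0,T;ℝᵏ)`. -/
def WeakTendstoL2 (T : ℝ) {k : ℕ} (z : ℕ → ℝ → Fin k → ℝ) (z' : ℝ → Fin k → ℝ) : Prop :=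
  ∀ g : ℝ → Fin k → ℝ, MemLp g 2 (timeMeasure T) →
    Tendsto (fun j => ∫ t in (0 : ℝ)..T, z j t ⬝ᵥ g t) atTop
      (𝓝 (∫ t in (0 : ℝ)..T, z' t ⬝ᵥ g t))

/-- The second derivative of `g` exists and is Lipschitz continuous. -/
def HasLipschitzSecondDeriv {E F : Type*} [NormedAddCommGroup E] [NormedSpace ℝ E]
    [NormedAddCommGroup F] [NormedSpace ℝ F] (g : E → F) : Prop :=
  ContDiff ℝ 2 g ∧ ∃ K : NNReal, LipschitzWith K (fderiv ℝ (fderiv ℝ g))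

/-- The Jacobian matrix of `g` at `z`. -/
def jac {a b : ℕ} (g : (Fin a → ℝ) → Fin b → ℝ) (z : Fin a → ℝ) : Matrix (Fin b) (Fin a) ℝ :=
  LinearMap.toMatrix' (fderiv ℝ g z : (Fin a → ℝ) →ₗ[ℝ] (Fin b → ℝ))

/-- The vector of first partial derivatives of the scalar function `g` at `z`. -/
def grad {a : ℕ} (g : (Fin a → ℝ) → ℝ) (z : Fin a → ℝ) : Fin a → ℝ :=
  fun i => fderiv ℝ g z (Pi.single i 1)

/-- The entrywise time derivative of a matrix-valued function. -/
def matDeriv {a b : ℕ} (A : ℝ → Matrix (Fin a) (Fin b) ℝ) (t : ℝ) : Matrix (Fin a) (Fin b) ℝ :=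
  Matrix.of fun i j => deriv (fun s => A s i j) t

/-- A triple `(x, u, v)` of functions of time: state, nonlinear control, affine control. -/
structure StateControl (n l m : ℕ) where
  x : ℝ → Fin n → ℝ
  u : ℝ → Fin l → ℝ
  v : ℝ → Fin m → ℝ

/-- A tuple `(ξ, u, y, h)`: three functions of time and a vector of `ℝᵐ`. -/
structure TransformedDirection (n l m : ℕ) where
  ξ : ℝ → Fin n → ℝ
  u : ℝ → Fin l → ℝ
  y : ℝ → Fin m → ℝ
  h : Fin m → ℝ

/-- Triples `(α, β, p)`. -/
abbrev Multiplier (n dφ dη : ℕ) : Type :=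
  (Fin (dφ + 1) → ℝ) × (Fin dη → ℝ) × (ℝ → Fin n → ℝ)

/-- The data of the optimal control problem: minimize `φ 0 (x 0, x T)` subject to
`ẋ = f 0 (x,u) + ∑ vᵢ f i (x,u)`, `η j (x 0, x T) = 0`, and `φ i (x 0, x T) ≤ 0` for `i ≥ 1`. -/
structure ControlProblem (n l m dφ dη : ℕ) where
  T : ℝ
  f : Fin (m + 1) → (Fin n → ℝ) × (Fin l → ℝ) → Fin n → ℝ
  φ : Fin (dφ + 1) → (Fin n → ℝ) × (Fin n → ℝ) → ℝ
  η : Fin dη → (Fin n → ℝ) × (Fin n → ℝ) → ℝ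

namespace ControlProblem

variable {n l m dφ dη : ℕ} (P : ControlProblem n l m dφ dη)

/-- All data functions have Lipschitz continuous second derivatives. -/
def IsRegular : Prop :=
  (∀ i, HasLipschitzSecondDeriv (P.f i)) ∧ (∀ i, HasLipschitzSecondDeriv (P.φ i)) ∧
    ∀ j, HasLipschitzSecondDeriv (P.η j)

/-- The dynamics `F(x,u,v) = ∑_{i=0}^m vᵢ fᵢ(x,u)` with `v₀ = 1`. -/
def F (x : Fin n → ℝ) (u : Fin l → ℝ) (v : Fin m → ℝ) : Fin n → ℝ :=
  P.f 0 (x, u) + ∑ i : Fin m, v i • P.f i.succ (x, u)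

/-- `w` belongs to `W^{1,∞} × L^∞ × L^∞`. -/
def MemW (w : StateControl n l m) : Prop :=
  IsSobolev P.T ⊤ w.x ∧ MemLp w.u ⊤ (timeMeasure P.T) ∧ MemLp w.v ⊤ (timeMeasure P.T)

/-- `w` belongs to `W^{1,2} × L² × L²`. -/
def MemW2 (w : StateControl n l m) : Prop :=
  IsSobolev P.T 2 w.x ∧ MemLp w.u 2 (timeMeasure P.T) ∧ MemLp w.v 2 (timeMeasure P.T)

def IsTrajectory (w : StateControl n l m) : Prop :=
  P.MemW w ∧ ∀ᵐ t ∂timeMeasure P.T, HasDerivAt w.x (P.F (w.x t) (w.u t) (w.v t)) t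

def IsFeasible (w : StateControl n l m) : Prop :=
  P.IsTrajectory w ∧ (∀ j, P.η j (w.x 0, w.x P.T) = 0) ∧
    ∀ i : Fin dφ, P.φ i.succ (w.x 0, w.x P.T) ≤ 0

def IsWeakMinimum (w : StateControl n l m) : Prop :=
  P.IsFeasible w ∧ ∃ ε : ℝ, 0 < ε ∧ ∀ w' : StateControl n l m, P.IsFeasible w' →
    eLpNorm (fun t => w'.x t - w.x t) ⊤ (timeMeasure P.T) < ENNReal.ofReal ε →
    eLpNorm (fun t => w'.u t - w.u t) ⊤ (timeMeasure P.T) < ENNReal.ofReal ε →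
    eLpNorm (fun t => w'.v t - w.v t) ⊤ (timeMeasure P.T) < ENNReal.ofReal ε →
    P.φ 0 (w.x 0, w.x P.T) ≤ P.φ 0 (w'.x 0, w'.x P.T)

/-- The pre-Hamiltonian `p F(x,u,v)`. -/
def H (p x : Fin n → ℝ) (u : Fin l → ℝ) (v : Fin m → ℝ) : ℝ := p ⬝ᵥ P.F x u v

/-- The endpoint Lagrangian. -/
def ell (lam : Multiplier n dφ dη) (q : (Fin n → ℝ) × (Fin n → ℝ)) : ℝ :=
  ∑ i, lam.1 i * P.φ i q + ∑ j, lam.2.1 j * P.η j q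

/-! First derivatives of `H`. -/

def gradHx (p x : Fin n → ℝ) (u : Fin l → ℝ) (v : Fin m → ℝ) : Fin n → ℝ :=
  grad (fun x' => P.H p x' u v) x

def gradHu (p x : Fin n → ℝ) (u : Fin l → ℝ) (v : Fin m → ℝ) : Fin l → ℝ :=
  grad (fun u' => P.H p x u' v) u

def gradHv (p x : Fin n → ℝ) (u : Fin l → ℝ) (v : Fin m → ℝ) : Fin m → ℝ :=
  grad (fun v' => P.H p x u v') v

/-- The set of Lagrange multipliers associated with `w`. -/
def multipliers (w : StateControl n l m) : Set (Multiplier n dφ dη) :=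
  {lam | ∑ i, |lam.1 i| + ∑ j, |lam.2.1 j| = 1 ∧ (∀ i, 0 ≤ lam.1 i) ∧
    IsSobolev P.T ⊤ lam.2.2 ∧
    (∀ᵐ t ∂timeMeasure P.T,
      HasDerivAt lam.2.2 (-P.gradHx (lam.2.2 t) (w.x t) (w.u t) (w.v t)) t) ∧
    lam.2.2 0 = -grad (fun a => P.ell lam (a, w.x P.T)) (w.x 0) ∧
    lam.2.2 P.T = grad (fun b => P.ell lam (w.x 0, b)) (w.x P.T) ∧
    ∀ᵐ t ∂timeMeasure P.T,
      P.gradHu (lam.2.2 t) (w.x t) (w.u t) (w.v t) = 0 ∧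
      P.gradHv (lam.2.2 t) (w.x t) (w.u t) (w.v t) = 0}

/-! Derivatives of `F`, and second derivatives of `H`, along the process `w` as functions of time.
`Hab` has rows indexed by the components of `a` and columns by those of `b`. -/

def Fx (w : StateControl n l m) (t : ℝ) : Matrix (Fin n) (Fin n) ℝ :=
  jac (fun x => P.F x (w.u t) (w.v t)) (w.x t)

def Fu (w : StateControl n l m) (t : ℝ) : Matrix (Fin n) (Fin l) ℝ :=
  jac (fun u => P.F (w.x t) u (w.v t)) (w.u t)

def Fv (w : StateControl n l m) (t : ℝ) : Matrix (Fin n) (Fin m) ℝ :=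
  jac (fun v => P.F (w.x t) (w.u t) v) (w.v t)

def Hxx (w : StateControl n l m) (lam : Multiplier n dφ dη) (t : ℝ) : Matrix (Fin n) (Fin n) ℝ :=
  jac (fun x => P.gradHx (lam.2.2 t) x (w.u t) (w.v t)) (w.x t)

def Hux (w : StateControl n l m) (lam : Multiplier n dφ dη) (t : ℝ) : Matrix (Fin l) (Fin n) ℝ :=
  jac (fun x => P.gradHu (lam.2.2 t) x (w.u t) (w.v t)) (w.x t)

def Hvx (w : StateControl n l m) (lam : Multiplier n dφ dη) (t : ℝ) : Matrix (Fin m) (Fin n) ℝ :=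
  jac (fun x => P.gradHv (lam.2.2 t) x (w.u t) (w.v t)) (w.x t)

def Huu (w : StateControl n l m) (lam : Multiplier n dφ dη) (t : ℝ) : Matrix (Fin l) (Fin l) ℝ :=
  jac (fun u => P.gradHu (lam.2.2 t) (w.x t) u (w.v t)) (w.u t)

def Hvu (w : StateControl n l m) (lam : Multiplier n dφ dη) (t : ℝ) : Matrix (Fin m) (Fin l) ℝ :=
  jac (fun u => P.gradHv (lam.2.2 t) (w.x t) u (w.v t)) (w.u t)

/-- The quadratic form `D²ℓ(x̂₀, x̂_T)(ζ)²`. -/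
def ellSecond (w : StateControl n l m) (lam : Multiplier n dφ dη)
    (ζ : (Fin n → ℝ) × (Fin n → ℝ)) : ℝ :=
  fderiv ℝ (fderiv ℝ (P.ell lam)) (w.x 0, w.x P.T) ζ ζ

/-- The second variation `Ω[λ]` of the Lagrangian at `w`, in the direction `d`. -/
def Omega (w : StateControl n l m) (lam : Multiplier n dφ dη) (d : StateControl n l m) : ℝ :=
  (1 / 2) * P.ellSecond w lam (d.x 0, d.x P.T) +
    ∫ t in (0 : ℝ)..P.T,
      ((1 / 2) * (d.x t ⬝ᵥ P.Hxx w lam t *ᵥ d.x t) + d.u t ⬝ᵥ P.Hux w lam t *ᵥ d.x t +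
        d.v t ⬝ᵥ P.Hvx w lam t *ᵥ d.x t + (1 / 2) * (d.u t ⬝ᵥ P.Huu w lam t *ᵥ d.u t) +
        d.v t ⬝ᵥ P.Hvu w lam t *ᵥ d.u t)

/-- The space of solutions in `W^{1,2} × L² × L²` of the linearized state equation at `w`. -/
def linearizedSpace (w : StateControl n l m) : Set (StateControl n l m) :=
  {d | P.MemW2 d ∧ ∀ᵐ t ∂timeMeasure P.T,
    HasDerivAt d.x (P.Fx w t *ᵥ d.x t + P.Fu w t *ᵥ d.u t + P.Fv w t *ᵥ d.v t) t}

/-- Weak convergence in `W^{1,2} × L² × L²`. -/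
def WeakTendstoW2 (d : ℕ → StateControl n l m) (d' : StateControl n l m) : Prop :=
  WeakTendstoL2 P.T (fun j => (d j).x) d'.x ∧
    WeakTendstoL2 P.T (fun j => deriv (d j).x) (deriv d'.x) ∧
    WeakTendstoL2 P.T (fun j => (d j).u) d'.u ∧ WeakTendstoL2 P.T (fun j => (d j).v) d'.v

/-- Weak (sequential) lower semicontinuity on the linearized space. -/
def IsWeaklyLsc (w : StateControl n l m) (Q : StateControl n l m → ℝ) : Prop :=
  ∀ (d : ℕ → StateControl n l m) (d' : StateControl n l m),
    (∀ j, d j ∈ P.linearizedSpace w) → d' ∈ P.linearizedSpace w → P.WeakTendstoW2 d d' →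
    ∀ a : ℝ, a < Q d' → ∀ᶠ j in atTop, a < Q (d j)

/-- `Λ^#`: the multipliers for which the second variation is weakly l.s.c. -/
def multipliersSharp (w : StateControl n l m) : Set (Multiplier n dφ dη) :=
  {lam | lam ∈ P.multipliers w ∧ P.IsWeaklyLsc w (P.Omega w lam)}

/-! The matrices produced by Goh's transformation. -/

def gohB (w : StateControl n l m) (t : ℝ) : Matrix (Fin n) (Fin m) ℝ :=
  P.Fx w t * P.Fv w t - matDeriv (P.Fv w) t

def gohM (w : StateControl n l m) (lam : Multiplier n dφ dη) (t : ℝ) : Matrix (Fin m) (Fin n) ℝ :=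
  (P.Fv w t)ᵀ * P.Hxx w lam t - matDeriv (P.Hvx w lam) t - P.Hvx w lam t * P.Fx w t

def gohE (w : StateControl n l m) (lam : Multiplier n dφ dη) (t : ℝ) : Matrix (Fin m) (Fin l) ℝ :=
  (P.Fv w t)ᵀ * (P.Hux w lam t)ᵀ - P.Hvx w lam t * P.Fu w t

def gohS (w : StateControl n l m) (lam : Multiplier n dφ dη) (t : ℝ) : Matrix (Fin m) (Fin m) ℝ :=
  (1 / 2 : ℝ) • (P.Hvx w lam t * P.Fv w t + (P.Hvx w lam t * P.Fv w t)ᵀ)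

def gohV (w : StateControl n l m) (lam : Multiplier n dφ dη) (t : ℝ) : Matrix (Fin m) (Fin m) ℝ :=
  (1 / 2 : ℝ) • (P.Hvx w lam t * P.Fv w t - (P.Hvx w lam t * P.Fv w t)ᵀ)

def gohR (w : StateControl n l m) (lam : Multiplier n dφ dη) (t : ℝ) : Matrix (Fin m) (Fin m) ℝ :=
  (P.Fv w t)ᵀ * P.Hxx w lam t * P.Fv w t -
    (P.Hvx w lam t * P.gohB w t + (P.Hvx w lam t * P.gohB w t)ᵀ) - matDeriv (P.gohS w lam) t

/-- The endpoint term `g[λ](ζ₀, ζ_T, h)`. -/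
def gohEndpoint (w : StateControl n l m) (lam : Multiplier n dφ dη) (ζ₀ ζT : Fin n → ℝ)
    (h : Fin m → ℝ) : ℝ :=
  (1 / 2) * P.ellSecond w lam (ζ₀, ζT + P.Fv w P.T *ᵥ h) +
    h ⬝ᵥ (P.Hvx w lam P.T *ᵥ ζT + (1 / 2 : ℝ) • (P.gohS w lam P.T *ᵥ h))

/-- `G(co Λ^#)`: the elements of the convex hull of `Λ^#` for which `V[λ]` vanishes on `[0,T]`. -/
def multipliersG (w : StateControl n l m) : Set (Multiplier n dφ dη) :=
  {lam | lam ∈ convexHull ℝ (P.multipliersSharp w) ∧ ∀ t ∈ Icc 0 P.T, P.gohV w lam t = 0}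

/-- The transformed critical cone `P₂`. -/
def coneP2 (w : StateControl n l m) : Set (TransformedDirection n l m) :=
  {d | IsSobolev P.T 2 d.ξ ∧ MemLp d.u 2 (timeMeasure P.T) ∧ MemLp d.y 2 (timeMeasure P.T) ∧
    (∀ᵐ t ∂timeMeasure P.T,
      HasDerivAt d.ξ (P.Fx w t *ᵥ d.ξ t + P.Fu w t *ᵥ d.u t + P.gohB w t *ᵥ d.y t) t) ∧
    (∀ j, fderiv ℝ (P.η j) (w.x 0, w.x P.T) (d.ξ 0, d.ξ P.T + P.Fv w P.T *ᵥ d.h) = 0) ∧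
    ∀ i, fderiv ℝ (P.φ i) (w.x 0, w.x P.T) (d.ξ 0, d.ξ P.T + P.Fv w P.T *ᵥ d.h) ≤ 0}

/-- The transformed second variation `Ω_{P₂}[λ](ξ, u, y, h)`. -/
def OmegaP2 (w : StateControl n l m) (lam : Multiplier n dφ dη)
    (d : TransformedDirection n l m) : ℝ :=
  P.gohEndpoint w lam (d.ξ 0) (d.ξ P.T) d.h +
    ∫ t in (0 : ℝ)..P.T,
      ((1 / 2) * (d.ξ t ⬝ᵥ P.Hxx w lam t *ᵥ d.ξ t) + d.u t ⬝ᵥ P.Hux w lam t *ᵥ d.ξ t +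
        d.y t ⬝ᵥ P.gohM w lam t *ᵥ d.ξ t + (1 / 2) * (d.u t ⬝ᵥ P.Huu w lam t *ᵥ d.u t) +
        d.y t ⬝ᵥ P.gohE w lam t *ᵥ d.u t + (1 / 2) * (d.y t ⬝ᵥ P.gohR w lam t *ᵥ d.y t))

end ControlProblem

end

/-! Everything is reduced to the existence of one multiplier of finite index. Perturb the initial
state by a vector and the controls by continuous functions. The state follows through a C² solution
map, and composing it with the endpoint functions gives a C² map `G` from a Banach space to a
finite-dimensional space. Weak minimality says that near 0 no perturbation makes all cost and
inequality components of `G` negative and all equality components zero. For such a system and a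
critical direction `h` there is a unit vector `μ`, nonnegative on the inequality components,
orthogonal to the range of `G'`, with `⟨μ, G''hh⟩ ≥ 0`, such that `⟨μ, G''⟩` is negative definite on
no subspace whose dimension exceeds a bound depending only on the number of components
(`exists_multiplier_of_finite_index`). No regularity of the constraints is needed.

To obtain `μ` in finite dimension, put `c = εh + εz + ε²γ` with `z` in the common kernel of `G'` and
`G''h` and with `γ` free, and minimize the deviation of the rescaled system from its cone plus
`δ‖(z, γ)‖²`. Infeasibility keeps the deviation away from 0, and its normalized value is an
approximate multiplier. Optimality in `γ` gives approximate stationarity. Optimality in `z`, with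
the positivity of the pairing of the multiplier with the rescaled system, gives the sign in the
direction `h`. The second-order condition in `z` gives the index. Compactness of the unit sphere
then yields an exact multiplier in infinite dimension.

Integration by parts against the adjoint state identifies `⟨μ, G''cc⟩` with `2Ω`. Finite index has
three consequences. If `H_vu` were nonzero, perturbations supported in a short interval would span
negative subspaces of every dimension (`IndexLt.Hvu_eq_zero`). The same happens for nonzero `V`,
with primitives of the control rotating in a plane (`IndexLt.gohV_eq_zero`). Finally, a form of
finite index becomes nonnegative after adding finitely many squares of weakly continuous
functionals, hence is weakly lower semicontinuous (`IndexLt.isWeaklyLsc`), so that the multiplier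
lies in Λ^#.

Once `H_vu` and `V` vanish, Goh's transformation turns `Ω` exactly into `Ω_{P₂}`
(`Omega_dir_eq_goh_of_index`), which is continuous for L² convergence of the transformed variables.
An element of `P₂` is a limit of transforms of smooth critical directions; the index bound is the
same for all of them, so their multipliers have a limit with the required properties. Nonnegativity
is thus reached at an element of Λ^# itself, and the convex hull only enlarges the set over which
the maximum is taken. The maximum is attained because a multiplier is determined on `[0, T]` by `(α,
β)`: the endpoint parts of Λ^# form a compact set, its hull is compact in finite dimension, `V = 0`
is a closed linear condition, and `Ω_{P₂}` is linear in the multiplier. -/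

noncomputable section

set_option linter.unusedSectionVars false

/-! ### Superposition operators on continuous functions -/

section Superposition

variable {I : Type} [TopologicalSpace I] [CompactSpace I]
  {E F : Type} [NormedAddCommGroup E] [NormedSpace ℝ E] [NormedAddCommGroup F] [NormedSpace ℝ F]

/-- The superposition operator `z ↦ f ∘ z` on continuous functions. -/
def superpose (f : E → F) (hf : Continuous f) (z : C(I, E)) : C(I, F) :=
  (⟨f, hf⟩ : C(E, F)).comp z

@[simp] lemma superpose_apply (f : E → F) (hf : Continuous f) (z : C(I, E)) (t : I) :
    superpose f hf z t = f (z t) := rfl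

/-- Pointwise application of a continuous family of operators. -/
def pointwiseApply : C(I, E →L[ℝ] F) →L[ℝ] C(I, E) →L[ℝ] C(I, F) :=
  LinearMap.mkContinuous₂
    (LinearMap.mk₂ ℝ (fun (A : C(I, E →L[ℝ] F)) (h : C(I, E)) =>
        (⟨fun t => A t (h t), by fun_prop⟩ : C(I, F)))
      (fun _ _ _ => by ext; simp) (fun _ _ _ => by ext; simp)
      (fun _ _ _ => by ext; simp) (fun _ _ _ => by ext; simp)) 1
    (fun A h => by
      rw [ContinuousMap.norm_le _ (by positivity)]
      intro t
      simp only [LinearMap.mk₂_apply, ContinuousMap.coe_mk, one_mul]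
      exact (A t).le_of_opNorm_le_of_le (A.norm_coe_le_norm t) (h.norm_coe_le_norm t))

@[simp] lemma pointwiseApply_apply (A : C(I, E →L[ℝ] F)) (h : C(I, E)) (t : I) :
    pointwiseApply A h t = A t (h t) := rfl

/-- Since `I` is compact, superposition by `fderiv ℝ f` is continuous in the uniform norm, so the
derivative varies by at most `c` along all the segments from `z t` to `z t + h t` at once, and the
mean value inequality is uniform in `t`. -/
lemma hasFDerivAt_superpose {f : E → F} (hf : ContDiff ℝ 1 f) (z : C(I, E)) :
    HasFDerivAt (superpose (I := I) f hf.continuous)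
      (pointwiseApply (superpose (fderiv ℝ f) (hf.continuous_fderiv one_ne_zero) z)) z := by
  have hcont : Continuous (superpose (I := I) (fderiv ℝ f) (hf.continuous_fderiv one_ne_zero)) :=
    ContinuousMap.continuous_postcomp _
  rw [hasFDerivAt_iff_isLittleO_nhds_zero, Asymptotics.isLittleO_iff]
  intro c hc
  have hnear := (Metric.continuous_iff'.1 hcont) z c hc
  obtain ⟨δ, hδ, hball⟩ := Metric.eventually_nhds_iff.1 hnear
  filter_upwards [Metric.ball_mem_nhds (0 : C(I, E)) hδ] with h hh
  rw [mem_ball_zero_iff] at hh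
  rw [ContinuousMap.norm_le _ (by positivity)]
  intro t
  simp only [ContinuousMap.sub_apply, superpose_apply, ContinuousMap.add_apply,
    pointwiseApply_apply]
  have hb : ∀ y ∈ segment ℝ (z t) (z t + h t), ‖fderiv ℝ f y - fderiv ℝ f (z t)‖ ≤ c := by
    intro y hy
    obtain ⟨θ, hθ, rfl⟩ := (segment_eq_image' ℝ (z t) (z t + h t)) ▸ hy
    have h1 : dist (z + θ • h) z < δ := by
      rw [dist_eq_norm, add_sub_cancel_left, norm_smul, Real.norm_of_nonneg hθ.1]
      exact lt_of_le_of_lt (mul_le_of_le_one_left (norm_nonneg _) hθ.2) hh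
    have h2 := hball h1
    rw [dist_eq_norm] at h2
    have h3 := ContinuousMap.norm_coe_le_norm (superpose (I := I) (fderiv ℝ f)
      (hf.continuous_fderiv one_ne_zero) (z + θ • h) -
        superpose (fderiv ℝ f) (hf.continuous_fderiv one_ne_zero) z) t
    simpa using h3.trans h2.le
  have := (convex_segment (𝕜 := ℝ) (z t) (z t + h t)).norm_image_sub_le_of_norm_hasFDerivWithin_le'
    (f := f) (f' := fderiv ℝ f) (φ := fderiv ℝ f (z t)) (C := c)
    (fun y _ => ((hf.differentiable one_ne_zero) y).hasFDerivAt.hasFDerivWithinAt)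
    hb (left_mem_segment ℝ _ _) (right_mem_segment ℝ _ _)
  rw [add_sub_cancel_left] at this
  exact this.trans (mul_le_mul_of_nonneg_left (h.norm_coe_le_norm t) hc.le)

/-- The derivative of a superposition operator is again a superposition operator followed by the
bounded map `pointwiseApply`, so smoothness goes up by induction. The target is quantified inside
the induction because differentiation replaces `F` by `E →L[ℝ] F`. -/
lemma contDiff_superpose_nat (k : ℕ) : ∀ {F : Type} [NormedAddCommGroup F] [NormedSpace ℝ F]
    {f : E → F} (hf : ContDiff ℝ k f), ContDiff ℝ k (superpose (I := I) f hf.continuous) := by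
  induction k with
  | zero =>
    intro F _ _ f hf
    exact contDiff_zero.2 (ContinuousMap.continuous_postcomp _)
  | succ k ih =>
    intro F _ _ f hf
    have h1 : ContDiff ℝ 1 f := hf.of_le (by norm_cast; omega)
    have h2 : ContDiff ℝ k (fderiv ℝ f) := hf.fderiv_right (by norm_cast)
    refine contDiff_succ_iff_hasFDerivAt.2 ⟨fun z => pointwiseApply
      (superpose (fderiv ℝ f) (h1.continuous_fderiv one_ne_zero) z), ?_, fun z =>
      hasFDerivAt_superpose h1 z⟩
    exact (ContinuousLinearMap.contDiff (pointwiseApply (I := I) (E := E) (F := F))).comp (ih h2)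

lemma contDiff_superpose {f : E → F} (hf : ContDiff ℝ 2 f) :
    ContDiff ℝ 2 (superpose (I := I) f hf.continuous) := by
  exact_mod_cast contDiff_superpose_nat (I := I) 2 (f := f) (by exact_mod_cast hf)

end Superposition

/-! ### Linear Volterra equations -/

section Volterra

variable {E : Type} [NormedAddCommGroup E] [NormedSpace ℝ E] [CompleteSpace E]

/-- The primitive vanishing at `0` of a continuous function on `[0, T]`. -/
def primitive {T : ℝ} (hT : 0 ≤ T) : C(Icc 0 T, E) →L[ℝ] C(Icc 0 T, E) :=
  LinearMap.mkContinuous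
    { toFun := fun g => ⟨fun t => ∫ s in (0 : ℝ)..t, IccExtend hT g s,
        (intervalIntegral.continuous_primitive
          (fun a b => (g.continuous.Icc_extend' (h := hT)).intervalIntegrable a b) 0).comp
          continuous_subtype_val⟩
      map_add' := fun g h => by
        ext t
        simp only [ContinuousMap.coe_mk, ContinuousMap.add_apply]
        rw [← intervalIntegral.integral_add
          ((g.continuous.Icc_extend' (h := hT)).intervalIntegrable _ _)
          ((h.continuous.Icc_extend' (h := hT)).intervalIntegrable _ _)]
        rfl
      map_smul' := fun c g => by
        ext t
        simp only [ContinuousMap.coe_mk, ContinuousMap.smul_apply, RingHom.id_apply]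
        rw [← intervalIntegral.integral_smul]
        rfl } T (fun g => by
      rw [ContinuousMap.norm_le _ (by positivity)]
      intro t
      simp only [LinearMap.coe_mk, AddHom.coe_mk, ContinuousMap.coe_mk]
      refine (intervalIntegral.norm_integral_le_of_norm_le_const (C := ‖g‖)
        fun s _ => g.norm_coe_le_norm _).trans ?_
      rw [sub_zero, abs_of_nonneg t.2.1, mul_comm]
      exact mul_le_mul_of_nonneg_right t.2.2 (norm_nonneg _))

lemma primitive_apply {T : ℝ} (hT : 0 ≤ T) (g : C(Icc 0 T, E)) (t : Icc 0 T) :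
    primitive hT g t = ∫ s in (0 : ℝ)..t, IccExtend hT g s := rfl

lemma IccExtend_continuous {T : ℝ} (hT : 0 ≤ T) (g : C(Icc 0 T, E)) :
    Continuous (IccExtend hT g) := g.continuous.Icc_extend'

/-- The Volterra operator `x ↦ ∫₀ᵗ A x`. -/
def volterra {T : ℝ} (hT : 0 ≤ T) (A : C(Icc 0 T, E →L[ℝ] E)) :
    C(Icc 0 T, E) →L[ℝ] C(Icc 0 T, E) :=
  (primitive hT).comp (pointwiseApply A)

/-- The factorial comes from integrating `s ^ k` repeatedly. It makes some power of the operator a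
contraction for every `T` and `A`, so the resolvent exists on the whole interval without a smallness
condition. -/
lemma volterra_pow_apply_norm_le {T : ℝ} (hT : 0 ≤ T) (A : C(Icc 0 T, E →L[ℝ] E)) (k : ℕ)
    (x : C(Icc 0 T, E)) (t : Icc 0 T) :
    ‖(volterra hT A ^ k) x t‖ ≤ (‖A‖ * t) ^ k / k.factorial * ‖x‖ := by
  induction k generalizing t with
  | zero => simpa using x.norm_coe_le_norm t
  | succ k ih =>
    rw [pow_succ']
    simp only [mul_apply_eq_comp, volterra, ContinuousLinearMap.comp_apply,
      primitive_apply]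
    have hb : ∀ s ∈ Ioc (0 : ℝ) t, ‖IccExtend hT (pointwiseApply A ((volterra hT A ^ k) x)) s‖ ≤
        ‖A‖ * ((‖A‖ * s) ^ k / k.factorial * ‖x‖) := by
      intro s hs
      have hs' : s ∈ Icc 0 T := ⟨hs.1.le, hs.2.trans t.2.2⟩
      rw [IccExtend_of_mem hT _ hs', pointwiseApply_apply]
      exact (A _).le_of_opNorm_le_of_le (A.norm_coe_le_norm _) (ih ⟨s, hs'⟩)
    refine (intervalIntegral.norm_integral_le_of_norm_le t.2.1
      (ae_of_all _ hb) (Continuous.intervalIntegrable (by fun_prop) _ _)).trans (le_of_eq ?_)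
    have : ∀ s : ℝ, ‖A‖ * ((‖A‖ * s) ^ k / k.factorial * ‖x‖) =
        (‖A‖ ^ (k + 1) / k.factorial * ‖x‖) * s ^ k := by intro s; ring
    simp_rw [this]
    rw [intervalIntegral.integral_const_mul, integral_pow, Nat.factorial_succ]
    push_cast
    have : (k.factorial : ℝ) ≠ 0 := by positivity
    field_simp
    ring

/-- Some power `V ^ k` has norm below 1, so `1 - V ^ k` is a unit. It is the product of `1 - V` and
a geometric sum that commutes with it, and both factors of a commuting product that is a unit are
units. -/
lemma isUnit_one_sub_volterra {T : ℝ} (hT : 0 ≤ T) (A : C(Icc 0 T, E →L[ℝ] E)) :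
    IsUnit (1 - volterra hT A) := by
  have h0 := (FloorSemiring.tendsto_pow_div_factorial_atTop (‖A‖ * T)).eventually
    (gt_mem_nhds (show (0 : ℝ) < 1 by norm_num))
  obtain ⟨k, hk⟩ := h0.exists
  have hn : ‖volterra hT A ^ k‖ < 1 := by
    refine lt_of_le_of_lt (ContinuousLinearMap.opNorm_le_bound _ (by positivity) fun x => ?_) hk
    rw [ContinuousMap.norm_le _ (by positivity)]
    intro t
    refine (volterra_pow_apply_norm_le hT A k x t).trans ?_
    have := t.2.1
    have := t.2.2
    gcongr
  have h1 : IsUnit (1 - volterra hT A ^ k) := 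
    isUnit_one_sub_of_norm_lt_one (R := C(Icc 0 T, E) →L[ℝ] C(Icc 0 T, E)) hn
  have h2 : (1 - volterra hT A) * ∑ i ∈ Finset.range k, volterra hT A ^ i
      = 1 - volterra hT A ^ k := mul_neg_geom_sum _ _
  have h3 : Commute (1 - volterra hT A) (∑ i ∈ Finset.range k, volterra hT A ^ i) :=
    Commute.sum_right _ _ _ fun i _ => by
      exact ((Commute.one_left _).sub_left (Commute.refl _)).pow_right i
  exact (h3.isUnit_mul_iff.1 (h2 ▸ h1)).1

/-- The resolvent `(1 - J A)⁻¹` of the linear Volterra equation `x = ∫₀ᵗ A x + r`. -/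
def volterraResolvent {T : ℝ} (hT : 0 ≤ T) (A : C(Icc 0 T, E →L[ℝ] E)) :
    C(Icc 0 T, E) →L[ℝ] C(Icc 0 T, E) :=
  ↑(isUnit_one_sub_volterra hT A).unit⁻¹

lemma eq_volterraResolvent_iff {T : ℝ} (hT : 0 ≤ T) (A : C(Icc 0 T, E →L[ℝ] E))
    (x r : C(Icc 0 T, E)) :
    x = volterraResolvent hT A r ↔ x = volterra hT A x + r := by
  have h1 : volterraResolvent hT A * (1 - volterra hT A) = 1 :=
    (isUnit_one_sub_volterra hT A).val_inv_mul
  have h2 : (1 - volterra hT A) * volterraResolvent hT A = 1 :=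
    (isUnit_one_sub_volterra hT A).mul_val_inv
  constructor
  · rintro rfl
    have := DFunLike.congr_fun h2 r
    simp only [mul_apply_eq_comp, _root_.sub_apply,
      one_apply_eq_self] at this
    nth_rewrite 3 [← this]
    abel
  · intro h
    have := DFunLike.congr_fun h1 x
    simp only [mul_apply_eq_comp, _root_.sub_apply,
      one_apply_eq_self] at this
    rw [show x - volterra hT A x = r by nth_rewrite 1 [h]; abel] at this
    exact this.symm

end Volterra

/-! ### Optimality conditions for a penalized deviation from a cone -/

section SecondOrder

/-- If `a` were negative, the second derivative test would make 0 a local maximum as well; then `f`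
would be constant near 0 and its second derivative would be 0. -/
lemma nonneg_of_isLocalMin_of_hasDerivAt {f f' : ℝ → ℝ} {a : ℝ}
    (hmin : IsLocalMin f 0) (h1 : ∀ᶠ s in 𝓝 0, HasDerivAt f (f' s) s)
    (h2 : HasDerivAt f' a 0) : f' 0 = 0 ∧ 0 ≤ a := by
  have h10 : f' 0 = 0 := hmin.hasDerivAt_eq_zero h1.self_of_nhds
  refine ⟨h10, ?_⟩
  by_contra! ha
  have hd : deriv f =ᶠ[𝓝 0] f' := h1.mono fun s hs => hs.deriv
  have hdd : deriv (deriv f) 0 = a := by rw [hd.deriv_eq, h2.deriv]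
  have hmax : IsLocalMax f 0 := isLocalMax_of_deriv_deriv_neg (by rw [hdd]; exact ha)
    (by rw [hd.self_of_nhds, h10]) h1.self_of_nhds.continuousAt
  have hc : f =ᶠ[𝓝 0] fun _ => f 0 := by
    filter_upwards [hmin, hmax] with s h1 h2
    exact le_antisymm h2 h1
  have h3 : deriv f =ᶠ[𝓝 0] fun _ => 0 := by
    filter_upwards [hc.eventuallyEq_nhds] with s hs
    rw [hs.deriv_eq, deriv_const]
  have : deriv (deriv f) 0 = 0 := by rw [h3.deriv_eq, deriv_const]
  rw [hdd] at this
  exact ha.ne this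

variable {κ : Type} [Fintype κ]

/-- The deviation of `g` from the cone `{y | y k ≤ 0 for p k, y k = 0 otherwise}`. -/
def coneDeviation (p : κ → Prop) [DecidablePred p] (g : EuclideanSpace ℝ κ) :
    EuclideanSpace ℝ κ :=
  WithLp.toLp 2 fun k => if p k then max (g k) 0 else g k

variable {p : κ → Prop} [DecidablePred p]

lemma coneDeviation_continuous : Continuous (coneDeviation p) := by
  unfold coneDeviation
  refine (PiLp.continuous_toLp 2 _).comp (continuous_pi fun k => ?_)
  split_ifs <;> fun_prop

lemma norm_coneDeviation_le_norm (g : EuclideanSpace ℝ κ) :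
    ‖coneDeviation p g‖ ≤ ‖g‖ := by
  rw [EuclideanSpace.norm_eq, EuclideanSpace.norm_eq]
  refine Real.sqrt_le_sqrt (Finset.sum_le_sum fun k _ => ?_)
  simp only [coneDeviation, Real.norm_eq_abs, sq_abs]
  split_ifs
  · rcases le_total (g k) 0 with h | h
    · rw [max_eq_right h, zero_pow two_ne_zero]; positivity
    · rw [max_eq_left h]
  · rfl

/-- The vector on the right is `g'` minus the projection of `g` onto the cone, and the left side is
the distance of `g'` to the cone. A nonsmooth distance is thereby bounded by the norm of an
expression affine in `g'`, with equality at `g' = g`. -/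
lemma norm_coneDeviation_le (g g' : EuclideanSpace ℝ κ) :
    ‖coneDeviation p g'‖ ≤ ‖coneDeviation p g + (g' - g)‖ := by
  rw [EuclideanSpace.norm_eq, EuclideanSpace.norm_eq]
  refine Real.sqrt_le_sqrt (Finset.sum_le_sum fun k _ => ?_)
  simp only [coneDeviation, Real.norm_eq_abs, sq_abs, PiLp.add_apply, PiLp.sub_apply]
  split_ifs
  · rw [sq_le_sq, abs_of_nonneg (le_max_right _ _)]
    rcases le_total (g k) 0 with h' | h'
    · rw [max_eq_right h', zero_add]
      exact max_le (by linarith [le_abs_self (g' k - g k)]) (abs_nonneg _)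
    · rw [max_eq_left h', add_sub_cancel]
      exact max_le (le_abs_self _) (abs_nonneg _)
  · apply le_of_eq; ring

/-- The residual of the projection onto the cone is orthogonal to the projection. -/
lemma inner_coneDeviation (g : EuclideanSpace ℝ κ) :
    inner ℝ (coneDeviation p g) g = ‖coneDeviation p g‖ ^ 2 := by
  rw [← real_inner_self_eq_norm_sq, PiLp.inner_apply, PiLp.inner_apply]
  refine Finset.sum_congr rfl fun k _ => ?_
  simp only [coneDeviation]
  split_ifs
  · rcases le_total (g k) 0 with h | h
    · simp [max_eq_right h]
    · simp [max_eq_left h]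
  · rfl


lemma contDiffAt_two_eventually_hasFDerivAt {E W : Type} [NormedAddCommGroup E] [NormedSpace ℝ E]
    [NormedAddCommGroup W] [NormedSpace ℝ W] {G : E → W} {c : E} (hG : ContDiffAt ℝ 2 G c) :
    (∀ᶠ c' in 𝓝 c, HasFDerivAt G (fderiv ℝ G c') c') ∧
      HasFDerivAt (fderiv ℝ G) (fderiv ℝ (fderiv ℝ G) c) c := by
  constructor
  · filter_upwards [hG.eventually (by simp)] with c' hc'
    exact (hc'.differentiableAt (by simp)).hasFDerivAt
  · exact ((hG.fderiv_right (m := 1) (by norm_num)).differentiableAt one_ne_zero).hasFDerivAt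

/-- First and second order conditions at a local minimum of the penalized deviation. -/
lemma penalized_conditions {E Y : Type} [NormedAddCommGroup E] [NormedSpace ℝ E]
    [NormedAddCommGroup Y] [InnerProductSpace ℝ Y] {G : E → EuclideanSpace ℝ κ} {c₀ : E}
    (L : Y →L[ℝ] E) (a δ : ℝ) (b : EuclideanSpace ℝ κ) (y : Y)
    (hG : ContDiffAt ℝ 2 G (c₀ + L y))
    (hpos : coneDeviation p (a • G (c₀ + L y) + b) ≠ 0)
    (hmin : IsLocalMin (fun y => ‖coneDeviation p (a • G (c₀ + L y) + b)‖ + δ * ‖y‖ ^ 2) y) :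
    ∃ μ : EuclideanSpace ℝ κ, ‖μ‖ = 1 ∧ (∀ k, p k → 0 ≤ μ k) ∧
      0 < inner ℝ μ (a • G (c₀ + L y) + b) ∧
      (∀ v, a * inner ℝ μ (fderiv ℝ G (c₀ + L y) (L v)) = -(2 * δ * inner ℝ y v)) ∧
      ∀ v, fderiv ℝ G (c₀ + L y) (L v) = 0 →
        -(2 * δ * ‖v‖ ^ 2) ≤ a * inner ℝ μ (fderiv ℝ (fderiv ℝ G) (c₀ + L y) (L v) (L v)) := by
  set g₀ := a • G (c₀ + L y) + b with hg₀
  set m := coneDeviation p g₀ with hm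
  have hr : 0 < ‖m‖ := norm_pos_iff.2 hpos
  obtain ⟨hd1, hd2⟩ := contDiffAt_two_eventually_hasFDerivAt hG
  set D := fderiv ℝ G with hD
  set D2 := fderiv ℝ D (c₀ + L y) with hD2
  have main : ∀ v, a * inner ℝ (‖m‖⁻¹ • m) (D (c₀ + L y) (L v)) + 2 * δ * inner ℝ y v = 0 ∧
      0 ≤ ‖m‖⁻¹ * (a ^ 2 * ‖D (c₀ + L y) (L v)‖ ^ 2) +
        a * inner ℝ (‖m‖⁻¹ • m) (D2 (L v) (L v)) + 2 * δ * ‖v‖ ^ 2 := by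
    intro v
    let c : ℝ → E := fun s => c₀ + L (y + s • v)
    have hc : ∀ s, HasDerivAt c (L v) s := by
      intro s
      have : HasDerivAt (fun s : ℝ => y + s • v) v s := by
        simpa using ((hasDerivAt_id s).smul_const v).const_add y
      exact (L.hasFDerivAt.comp_hasDerivAt s this).const_add c₀
    have hc0 : c 0 = c₀ + L y := by simp [c]
    let q : ℝ → EuclideanSpace ℝ κ := fun s => m + (a • G (c s) + b - g₀)
    let q' : ℝ → EuclideanSpace ℝ κ := fun s => a • D (c s) (L v)
    have hq : ∀ᶠ s in 𝓝 0, HasDerivAt q (q' s) s := by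
      have h1 : Tendsto c (𝓝 0) (𝓝 (c₀ + L y)) := by
        rw [← hc0]; exact (hc 0).continuousAt
      filter_upwards [h1.eventually hd1] with s hs
      exact ((((hs.comp_hasDerivAt s (hc s)).const_smul a).add_const b).sub_const g₀).const_add m
    have hq' : HasDerivAt q' (a • D2 (L v) (L v)) 0 := by
      have h1 : HasDerivAt (fun s => D (c s)) (D2 (L v)) 0 := by
        have h2 : HasFDerivAt D D2 (c 0) := by rw [hc0]; exact hd2
        exact h2.comp_hasDerivAt (0 : ℝ) (hc 0)
      exact ((ContinuousLinearMap.apply ℝ (EuclideanSpace ℝ κ) (L v)).hasFDerivAt.comp_hasDerivAt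
        (0 : ℝ) h1).const_smul a
    have hy : ∀ s : ℝ, HasDerivAt (fun s : ℝ => y + s • v) v s := fun s => by
      simpa using ((hasDerivAt_id s).smul_const v).const_add y
    -- The deviation is at most `‖q s‖`, and `‖q s‖ ≤ ‖q s‖² / (2‖m‖) + ‖m‖ / 2` with equality at `s
    -- = 0`. So `f` plus the constant `‖m‖ / 2` is a smooth majorant that touches the nonsmooth
    -- objective at 0, and `f` inherits the local minimum.
    let f : ℝ → ℝ := fun s => (2 * ‖m‖)⁻¹ * ‖q s‖ ^ 2 + δ * ‖y + s • v‖ ^ 2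
    let f' : ℝ → ℝ := fun s => (2 * ‖m‖)⁻¹ * (2 * inner ℝ (q s) (q' s)) +
      δ * (2 * inner ℝ (y + s • v) v)
    have hf : ∀ᶠ s in 𝓝 0, HasDerivAt f (f' s) s := by
      filter_upwards [hq] with s hs
      exact (hs.norm_sq.const_mul _).add ((hy s).norm_sq.const_mul _)
    have q0 : q 0 = m := by simp only [q, hc0]; rw [← hg₀]; simp
    have q'0 : q' 0 = a • D (c₀ + L y) (L v) := by simp only [q', hc0]
    have hf' : HasDerivAt f' ((2 * ‖m‖)⁻¹ * (2 * (inner ℝ (q 0) (a • D2 (L v) (L v)) +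
        inner ℝ (q' 0) (q' 0))) + δ * (2 * inner ℝ v v)) 0 := by
      refine (((hq.self_of_nhds.inner ℝ hq').const_mul 2).const_mul _).add ?_
      have := (((hy 0).inner ℝ (hasDerivAt_const (0 : ℝ) v)).const_mul 2).const_mul δ
      simpa using this
    have hfmin : IsLocalMin f 0 := by
      have h1 : Tendsto (fun s : ℝ => y + s • v) (𝓝 0) (𝓝 y) := by
        simpa using (hy 0).continuousAt.tendsto
      filter_upwards [h1.eventually hmin] with s hs
      have e0 : f 0 = (2 * ‖m‖)⁻¹ * ‖m‖ ^ 2 + δ * ‖y‖ ^ 2 := by simp [f, q0]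
      have e1 : ‖coneDeviation p (a • G (c₀ + L (y + s • v)) + b)‖ ≤ ‖q s‖ :=
        norm_coneDeviation_le g₀ _
      have e2 : ‖q s‖ ≤ (2 * ‖m‖)⁻¹ * ‖q s‖ ^ 2 + (2 * ‖m‖)⁻¹ * ‖m‖ ^ 2 := by
        rw [← mul_add, ← div_eq_inv_mul, le_div_iff₀ (by positivity)]
        nlinarith [sq_nonneg (‖q s‖ - ‖m‖)]
      have e3 : (2 * ‖m‖)⁻¹ * ‖m‖ ^ 2 = ‖m‖ / 2 := by field_simp
      have hs' : ‖m‖ + δ * ‖y‖ ^ 2 ≤ ‖coneDeviation p (a • G (c₀ + L (y + s • v)) + b)‖ +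
        δ * ‖y + s • v‖ ^ 2 := hs
      rw [e0]
      simp only [f]
      linarith
    obtain ⟨h1, h2⟩ := nonneg_of_isLocalMin_of_hasDerivAt hfmin hf hf'
    simp only [f', q0, q'0, zero_smul, add_zero] at h1
    rw [q0, q'0] at h2
    simp only [inner_smul_right, inner_smul_left, real_inner_self_eq_norm_sq,
      RCLike.conj_to_real] at h1 h2 ⊢
    rw [mul_inv] at h1 h2
    constructor
    · rw [← h1]; ring
    · refine h2.trans (le_of_eq ?_)
      ring
  -- The multiplier is the normalized residual; its components on the inequality constraints are
  -- positive parts, hence nonnegative.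
  refine ⟨‖m‖⁻¹ • m, ?_, ?_, ?_, ?_, ?_⟩
  · rw [norm_smul, norm_inv, norm_norm, inv_mul_cancel₀ hr.ne']
  · intro k hk
    simp only [PiLp.smul_apply, smul_eq_mul]
    refine mul_nonneg (inv_nonneg.2 hr.le) ?_
    simp only [hm, coneDeviation, if_pos hk]
    exact le_max_right _ _
  · rw [inner_smul_left, hm, inner_coneDeviation, ← hm]
    simp only [RCLike.conj_to_real]
    positivity
  · intro v
    linarith [(main v).1]
  -- When the first derivative vanishes along `v`, the term `‖DG (L v)‖²` contributed by the
  -- majorant disappears, and only the second derivative and the penalty remain.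
  · intro v hv
    have := (main v).2
    rw [hv] at this
    simp only [norm_zero] at this
    linarith

end SecondOrder

/-! ### Taylor estimates and the penalized minimizer -/

section SecondOrder

variable {κ : Type} [Fintype κ] {p : κ → Prop} [DecidablePred p]

/-- By symmetry of the second derivative, the quadratic remainder has derivative `G'(x) - G'(0) -
G''(0) x`. This is at most `θ‖c‖` on the ball of radius `‖c‖`, and the mean value inequality
supplies the second factor `‖c‖`. -/
lemma taylor_estimates {E W : Type} [NormedAddCommGroup E] [NormedSpace ℝ E]
    [NormedAddCommGroup W] [NormedSpace ℝ W] {G : E → W} (hG : ContDiffAt ℝ 2 G 0)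
    (h0 : G 0 = 0) {θ : ℝ} (hθ : 0 < θ) :
    ∀ᶠ c in 𝓝 (0 : E),
      ‖fderiv ℝ G c - fderiv ℝ G 0 - fderiv ℝ (fderiv ℝ G) 0 c‖ ≤ θ * ‖c‖ ∧
      ‖G c - fderiv ℝ G 0 c - (1 / 2 : ℝ) • fderiv ℝ (fderiv ℝ G) 0 c c‖ ≤ θ * ‖c‖ ^ 2 ∧
      ‖fderiv ℝ (fderiv ℝ G) c - fderiv ℝ (fderiv ℝ G) 0‖ ≤ θ ∧
      ‖fderiv ℝ G c - fderiv ℝ G 0‖ ≤ θ := by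
  obtain ⟨hd1, hd2⟩ := contDiffAt_two_eventually_hasFDerivAt hG
  have hC1 : ContDiffAt ℝ 1 (fderiv ℝ G) 0 := hG.fderiv_right (by norm_num)
  have hC0 : ContinuousAt (fderiv ℝ (fderiv ℝ G)) 0 :=
    (hC1.fderiv_right (m := 0) (by norm_num)).continuousAt
  have hsym := (hG.isSymmSndFDerivAt (by simp)).eq
  have e1 : ∀ᶠ c in 𝓝 (0 : E),
      ‖fderiv ℝ G c - fderiv ℝ G 0 - fderiv ℝ (fderiv ℝ G) 0 c‖ ≤ θ * ‖c‖ := by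
    have := (hasFDerivAt_iff_isLittleO_nhds_zero.1 hd2).def hθ
    simpa using this
  have e3 : ∀ᶠ c in 𝓝 (0 : E), ‖fderiv ℝ (fderiv ℝ G) c - fderiv ℝ (fderiv ℝ G) 0‖ < θ := by
    have h1 : Tendsto (fderiv ℝ (fderiv ℝ G)) (𝓝 0) (𝓝 (fderiv ℝ (fderiv ℝ G) 0)) := hC0
    have h2 := Metric.tendsto_nhds (α := E →L[ℝ] E →L[ℝ] W).1 h1 θ hθ
    filter_upwards [h2] with c hc
    exact lt_of_eq_of_lt (dist_eq_norm (E := E →L[ℝ] E →L[ℝ] W) _ _).symm hc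
  have e4 := Metric.continuousAt_iff'.1 hC1.continuousAt θ hθ
  obtain ⟨r, hr, hball⟩ := Metric.eventually_nhds_iff_ball.1 (hd1.and e1)
  filter_upwards [e1, e3, e4, Metric.ball_mem_nhds (0 : E) hr] with c h1 h3 h4 hc
  rw [dist_eq_norm] at h4
  refine ⟨h1, ?_, h3.le, h4.le⟩
  rw [mem_ball_zero_iff] at hc
  let R : E → W := fun c => G c - fderiv ℝ G 0 c - (1 / 2 : ℝ) • fderiv ℝ (fderiv ℝ G) 0 c c
  have hR : ∀ x ∈ Metric.closedBall (0 : E) ‖c‖, HasFDerivWithinAt R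
      (fderiv ℝ G x - fderiv ℝ G 0 - fderiv ℝ (fderiv ℝ G) 0 x)
      (Metric.closedBall (0 : E) ‖c‖) x := by
    intro x hx
    have hx' : x ∈ Metric.ball (0 : E) r := by
      rw [mem_ball_zero_iff]; rw [mem_closedBall_zero_iff] at hx; linarith
    have h2 : HasFDerivAt (fun c => fderiv ℝ (fderiv ℝ G) 0 c c)
        (fderiv ℝ (fderiv ℝ G) 0 x + (fderiv ℝ (fderiv ℝ G) 0).flip x) x := by
      have := (fderiv ℝ (fderiv ℝ G) 0).hasFDerivAt.clm_apply (hasFDerivAt_id x)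
      refine this.congr_fderiv ?_
      ext v; simp
    refine ((((hball x hx').1.sub (fderiv ℝ G 0).hasFDerivAt).sub
      (h2.const_smul (1 / 2 : ℝ))).congr_fderiv ?_).hasFDerivWithinAt
    ext v
    simp only [_root_.sub_apply, _root_.smul_apply, _root_.add_apply,
      ContinuousLinearMap.flip_apply, hsym v x]
    rw [← two_smul ℝ, smul_smul]
    norm_num
  have hb := (convex_closedBall (0 : E) ‖c‖).norm_image_sub_le_of_norm_hasFDerivWithin_le
    (C := θ * ‖c‖) hR (fun x hx => by
      rw [mem_closedBall_zero_iff] at hx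
      refine (hball x ?_).2.trans (mul_le_mul_of_nonneg_left hx hθ.le)
      rw [mem_ball_zero_iff]; linarith)
    (Metric.mem_closedBall_self (norm_nonneg _)) (x := 0) (y := c) (by simp)
  simp only [R, h0, map_zero, sub_zero, smul_zero] at hb
  calc _ ≤ _ := hb
    _ = _ := by ring

/-- A minimizer of the penalized deviation over a ball, with its optimality conditions. -/
lemma exists_penalized_minimizer {E Y : Type} [NormedAddCommGroup E] [NormedSpace ℝ E]
    [NormedAddCommGroup Y] [InnerProductSpace ℝ Y] [FiniteDimensional ℝ Y]
    {G : E → EuclideanSpace ℝ κ} (c₀ : E) (L : Y →L[ℝ] E) (a : ℝ) {δ R C₀ : ℝ} (hδ : 0 < δ)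
    (hR : √(C₀ / δ) < R) (b : EuclideanSpace ℝ κ)
    (hG : ∀ y : Y, ‖y‖ ≤ R → ContDiffAt ℝ 2 G (c₀ + L y))
    (hpos : ∀ y : Y, ‖y‖ ≤ R → coneDeviation p (a • G (c₀ + L y) + b) ≠ 0)
    (hC₀ : ‖a • G c₀ + b‖ ≤ C₀) :
    ∃ y : Y, ‖y‖ ≤ R ∧ δ * ‖y‖ ≤ √(δ * C₀) ∧ ∃ μ : EuclideanSpace ℝ κ,
      ‖μ‖ = 1 ∧ (∀ k, p k → 0 ≤ μ k) ∧
      0 < inner ℝ μ (a • G (c₀ + L y) + b) ∧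
      (∀ v, a * inner ℝ μ (fderiv ℝ G (c₀ + L y) (L v)) = -(2 * δ * inner ℝ y v)) ∧
      ∀ v, fderiv ℝ G (c₀ + L y) (L v) = 0 →
        -(2 * δ * ‖v‖ ^ 2) ≤ a * inner ℝ μ (fderiv ℝ (fderiv ℝ G) (c₀ + L y) (L v) (L v)) := by
  have hR0 : 0 ≤ R := (Real.sqrt_nonneg _).trans hR.le
  let ψ : Y → ℝ := fun y => ‖coneDeviation p (a • G (c₀ + L y) + b)‖ + δ * ‖y‖ ^ 2
  obtain ⟨y, hyR, hymin⟩ : ∃ y ∈ Metric.closedBall (0 : Y) R,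
      IsMinOn ψ (Metric.closedBall (0 : Y) R) y := by
    have : ProperSpace Y := FiniteDimensional.proper_real Y
    have hcont : ContinuousOn ψ (Metric.closedBall (0 : Y) R) := by
      intro y hy
      rw [mem_closedBall_zero_iff] at hy
      have h3 : ContinuousAt (fun y => G (c₀ + L y)) y :=
        (hG y hy).continuousAt.comp (f := fun y => c₀ + L y)
          (continuous_const.add L.continuous).continuousAt
      have h4 := coneDeviation_continuous (p := p) |>.continuousAt.comp
        ((h3.const_smul a).add_const b)
      exact (h4.norm.add (((continuous_norm.pow 2).const_mul δ).continuousAt)).continuousWithinAt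
    exact (isCompact_closedBall (0 : Y) R).exists_isMinOn
      ⟨0, Metric.mem_closedBall_self hR0⟩ hcont
  have hψ0 : ψ y ≤ C₀ := by
    refine (hymin (show (0 : Y) ∈ Metric.closedBall (0 : Y) R by simpa using hR0)).trans ?_
    have : ψ 0 = ‖coneDeviation p (a • G c₀ + b)‖ := by simp [ψ]
    rw [this]
    exact (norm_coneDeviation_le_norm _).trans hC₀
  have hyC : δ * ‖y‖ ^ 2 ≤ C₀ := by
    have : 0 ≤ ‖coneDeviation p (a • G (c₀ + L y) + b)‖ := norm_nonneg _
    simp only [ψ] at hψ0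
    linarith
  -- Comparison with `y = 0` gives `δ‖y‖² ≤ C₀`. As `R` exceeds `√(C₀ / δ)`, the minimizer is
  -- interior and the unconstrained conditions apply.
  have hyR' : ‖y‖ < R := by
    have : ‖y‖ ≤ √(C₀ / δ) := Real.le_sqrt_of_sq_le (by rw [le_div_iff₀ hδ]; linarith)
    linarith
  -- The available bound on `‖y‖` grows as `δ` decreases, but this bound on `δ‖y‖` tends to 0; it
  -- makes the first-order condition an approximate stationarity.
  have hyδ : δ * ‖y‖ ≤ √(δ * C₀) := Real.le_sqrt_of_sq_le (by
    calc (δ * ‖y‖) ^ 2 = δ * (δ * ‖y‖ ^ 2) := by ring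
      _ ≤ δ * C₀ := by gcongr)
  exact ⟨y, hyR'.le, hyδ, penalized_conditions L a δ b y (hG y hyR'.le) (hpos y hyR'.le)
    (hymin.isLocalMin (Metric.closedBall_mem_nhds_of_mem (by rwa [mem_ball_zero_iff])))⟩

end SecondOrder

/-! ### The sign of the second derivative in the critical direction -/

section SecondOrder

variable {κ : Type} [Fintype κ] {p : κ → Prop} [DecidablePred p]

set_option maxHeartbeats 1000000 in
/-- Second order estimate for a multiplier of a penalized minimizer. -/
lemma neg_le_inner_second_of_penalized {E : Type} [NormedAddCommGroup E] [InnerProductSpace ℝ E]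
    (G1 D : E →L[ℝ] EuclideanSpace ℝ κ) (G2 : E →L[ℝ] E →L[ℝ] EuclideanSpace ℝ κ)
    (hsym : ∀ v w, G2 v w = G2 w v) (h z γ c : E) (Gc one μ : EuclideanSpace ℝ κ)
    {ε δ θ τ R M : ℝ} (hε : 0 < ε) (hδ : 0 < δ) (hθ : 0 < θ) (hR1 : 1 ≤ R)
    (hM : M = ‖h‖ + 2 * R) (hθM : θ * M ^ 2 ≤ τ / 16)
    (hεB : ε * (‖G2‖ * (3 * M ^ 2)) ≤ τ / 16) (hεone : ε * ‖one‖ ≤ τ / 16)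
    (hzX : G1 z = 0 ∧ G2 h z = 0) (hzR : ‖z‖ ≤ R) (hγR : ‖γ‖ ≤ R)
    (hcy : c = ε • (h + z + ε • γ)) (heM : ‖h + z + ε • γ‖ ≤ M)
    (t1 : ‖D - G1 - G2 c‖ ≤ θ * ‖c‖)
    (t2 : ‖Gc - G1 c - (1 / 2 : ℝ) • G2 c c‖ ≤ θ * ‖c‖ ^ 2) (t4 : ‖D - G1‖ ≤ θ)
    (hμ1 : ‖μ‖ = 1)
    (hμg : 0 < inner ℝ μ ((ε ^ 2)⁻¹ • Gc + (-(ε⁻¹ • G1 h) + ε • one)))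
    (dγ : inner ℝ μ (D γ) = -(2 * δ * ‖γ‖ ^ 2))
    (dz : ε⁻¹ * inner ℝ μ (D z) = -(2 * δ * ‖z‖ ^ 2)) :
    -τ ≤ inner ℝ μ (G2 h h) := by
  have habs : ∀ w : EuclideanSpace ℝ κ, |inner ℝ μ w| ≤ ‖w‖ := fun w => by
    have := abs_real_inner_le_norm μ w
    rwa [hμ1, one_mul] at this
  have hRM : 2 * R ≤ M := by rw [hM]; linarith [norm_nonneg h]
  have hR0 : 0 ≤ R := by linarith
  have hM0 : 0 ≤ M := by linarith
  have hτ : 0 ≤ τ := by nlinarith [mul_nonneg hθ.le (sq_nonneg M)]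
  have hcM : ‖c‖ ≤ ε * M := by
    rw [hcy, norm_smul, Real.norm_of_nonneg hε.le]
    exact mul_le_mul_of_nonneg_left heM hε.le
  have hG1c : G1 c = ε • G1 h + ε ^ 2 • G1 γ := by
    rw [hcy]; simp only [map_smul, map_add, hzX.1, smul_add, smul_smul, smul_zero, add_zero, pow_two]
  -- At `c = ε(h + z + εγ)` the term `ε⁻¹ G'h` of `ε⁻² G(c)` cancels against the shift, and `G'z =
  -- 0`. The terms of order one are `G'γ` and half of `G''` at `h + z`. Since the whole pairing is
  -- positive, it remains to see that `⟨μ, G'γ⟩` and `⟨μ, G''zz⟩` are almost nonpositive.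
  have x1 : inner ℝ μ ((ε ^ 2)⁻¹ • Gc + (-(ε⁻¹ • G1 h) + ε • one)) =
      (ε ^ 2)⁻¹ * inner ℝ μ (Gc - G1 c - (1 / 2 : ℝ) • G2 c c) +
      inner ℝ μ (G1 γ) + 1 / 2 * inner ℝ μ (G2 (h + z + ε • γ) (h + z + ε • γ)) +
      ε * inner ℝ μ one := by
    simp only [inner_add_right, inner_sub_right, inner_smul_right, inner_neg_right, hG1c]
    rw [hcy]
    simp only [map_smul, _root_.smul_apply, inner_smul_right]
    field_simp
    ring
  have x2 : |(ε ^ 2)⁻¹ * inner ℝ μ (Gc - G1 c - (1 / 2 : ℝ) • G2 c c)| ≤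
      τ / 16 := by
    rw [abs_mul, abs_of_nonneg (by positivity : 0 ≤ (ε ^ 2)⁻¹)]
    calc _ ≤ (ε ^ 2)⁻¹ * (θ * (ε * M) ^ 2) := by
          gcongr
          exact (habs _).trans (t2.trans (by gcongr))
      _ = θ * M ^ 2 := by field_simp
      _ ≤ _ := hθM
  -- The cross terms in `h` and `z` vanish because `z` is taken in the kernel of `G''h`.
  have x3 : G2 (h + z + ε • γ) (h + z + ε • γ) = G2 h h + G2 z z +
      ε • (G2 (h + z) γ + G2 γ (h + z + ε • γ)) := by
    have : G2 z h = 0 := by rw [hsym]; exact hzX.2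
    simp only [map_add, map_smul, _root_.add_apply, _root_.smul_apply, hzX.2, this, smul_add,
      smul_smul]
    abel
  have x4 : |inner ℝ μ (ε • (G2 (h + z) γ + G2 γ (h + z + ε • γ)))| ≤ τ / 16 := by
    refine (habs _).trans ?_
    rw [norm_smul, Real.norm_of_nonneg hε.le]
    refine le_trans (mul_le_mul_of_nonneg_left ?_ hε.le) hεB
    have h1 : ‖h + z‖ ≤ M := (norm_add_le _ _).trans (by rw [hM]; linarith)
    calc _ ≤ ‖G2 (h + z) γ‖ + ‖G2 γ (h + z + ε • γ)‖ := norm_add_le _ _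
      _ ≤ ‖G2‖ * ‖h + z‖ * ‖γ‖ + ‖G2‖ * ‖γ‖ * ‖h + z + ε • γ‖ :=
          add_le_add (G2.le_opNorm₂ _ _) (G2.le_opNorm₂ _ _)
      _ ≤ ‖G2‖ * M * M + ‖G2‖ * M * M := by
          have : ‖γ‖ ≤ M := by linarith
          gcongr
      _ ≤ _ := by nlinarith [norm_nonneg G2, sq_nonneg M]
  -- Stationarity in `γ`, tested with `γ` itself, gives `⟨μ, Dγ⟩ = -2δ‖γ‖² ≤ 0`; replacing `D` by
  -- `G'` costs at most `θ‖γ‖`.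
  have x5 : inner ℝ μ (G1 γ) ≤ τ / 16 := by
    have h1 : inner ℝ μ (G1 γ) = inner ℝ μ (D γ) - inner ℝ μ ((D - G1) γ) := by
      simp [inner_sub_right]
    have h2 : |inner ℝ μ ((D - G1) γ)| ≤ θ * ‖γ‖ :=
      (habs _).trans ((D - G1).le_of_opNorm_le t4 γ)
    have h3 : θ * ‖γ‖ ≤ θ * M ^ 2 := by gcongr; nlinarith
    rw [dγ] at h1
    have : 0 ≤ 2 * δ * ‖γ‖ ^ 2 := by positivity
    linarith [(abs_le.1 h2).1]
  -- Since `G'z = 0` and `G''hz = 0`, the vector `D z` is `ε G''zz` up to smaller terms.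
  -- Stationarity in `z`, tested with `z` and divided by `ε`, therefore makes `⟨μ, G''zz⟩` nearly
  -- equal to `-2δ‖z‖²`.
  have x6 : inner ℝ μ (G2 z z) ≤ τ / 8 := by
    have h1 : inner ℝ μ (G2 z z) = ε⁻¹ * inner ℝ μ (D z) -
        ε⁻¹ * inner ℝ μ ((D - G1 - G2 c) z) - ε * inner ℝ μ (G2 γ z) := by
      rw [hcy]
      simp only [_root_.sub_apply, hzX.1, map_smul, map_add, _root_.smul_apply,
        _root_.add_apply, hzX.2, inner_sub_right, inner_add_right, inner_smul_right,
        inner_zero_right]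
      field_simp
      ring
    have h2 : |ε⁻¹ * inner ℝ μ ((D - G1 - G2 c) z)| ≤ τ / 16 := by
      rw [abs_mul, abs_of_nonneg (by positivity : 0 ≤ ε⁻¹)]
      calc _ ≤ ε⁻¹ * (θ * (ε * M) * ‖z‖) := by
            gcongr
            exact (habs _).trans ((D - G1 - G2 c).le_of_opNorm_le
              (t1.trans (by gcongr)) z)
        _ = θ * M * ‖z‖ := by field_simp
        _ ≤ θ * M ^ 2 := by
            rw [pow_two, ← mul_assoc]; gcongr; linarith
        _ ≤ _ := hθM
    have h3 : |ε * inner ℝ μ (G2 γ z)| ≤ τ / 16 := by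
      rw [abs_mul, abs_of_nonneg hε.le]
      refine le_trans (mul_le_mul_of_nonneg_left ?_ hε.le) hεB
      refine (habs _).trans ((G2.le_opNorm₂ _ _).trans ?_)
      rw [mul_assoc]
      have : ‖γ‖ * ‖z‖ ≤ M * M := mul_le_mul (by linarith) (by linarith) (norm_nonneg _) hM0
      exact mul_le_mul_of_nonneg_left (by nlinarith [sq_nonneg M]) G2.opNorm_nonneg
    rw [h1, dz]
    have : 0 ≤ 2 * δ * ‖z‖ ^ 2 := by positivity
    linarith [(abs_le.1 h2).1, (abs_le.1 h3).1]
  have x7 : ε * inner ℝ μ one ≤ τ / 16 := by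
    refine le_trans ?_ hεone
    exact mul_le_mul_of_nonneg_left ((le_abs_self _).trans (habs _)) hε.le
  rw [x1, x3, inner_add_right, inner_add_right] at hμg
  linarith [(abs_le.1 x2).2, (abs_le.1 x4).2]

end SecondOrder

/-! ### Approximate multipliers in finite dimension -/

section SecondOrder

variable {κ : Type} [Fintype κ] {p : κ → Prop} [DecidablePred p]

set_option maxHeartbeats 1000000 in
/-- Approximate multipliers, with the scaled variables `(z, γ)` ranging over a space `Y` with
projections `pz`, `pg`. -/
lemma exists_approximate_multiplier_of_splitting {ι : Type} [Fintype ι]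
    {G : EuclideanSpace ℝ ι → EuclideanSpace ℝ κ}
    (hG : ContDiffAt ℝ 2 G 0) (h0 : G 0 = 0)
    (hinf : ∀ᶠ c in 𝓝 0, ¬ ((∀ k, p k → G c k < 0) ∧ ∀ k, ¬ p k → G c k = 0))
    (h : EuclideanSpace ℝ ι) (hh1 : ∀ k, p k → fderiv ℝ G 0 h k ≤ 0)
    (hh2 : ∀ k, ¬ p k → fderiv ℝ G 0 h k = 0) {τ : ℝ} (hτ : 0 < τ)
    {Y : Type} [NormedAddCommGroup Y] [InnerProductSpace ℝ Y] [FiniteDimensional ℝ Y]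
    (pz pg : Y →L[ℝ] EuclideanSpace ℝ ι)
    (hinner : ∀ y v, inner ℝ y v = inner ℝ (pz y) (pz v) + inner ℝ (pg y) (pg v))
    (hpzX : ∀ y, fderiv ℝ G 0 (pz y) = 0 ∧ fderiv ℝ (fderiv ℝ G) 0 h (pz y) = 0)
    (hsurj : ∀ z γ, fderiv ℝ G 0 z = 0 → fderiv ℝ (fderiv ℝ G) 0 h z = 0 →
      ∃ y, pz y = z ∧ pg y = γ) :
    ∃ μ : EuclideanSpace ℝ κ, ‖μ‖ = 1 ∧ (∀ k, p k → 0 ≤ μ k) ∧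
      (∀ γ, |inner ℝ μ (fderiv ℝ G 0 γ)| ≤ τ * ‖γ‖) ∧
      -τ ≤ inner ℝ μ (fderiv ℝ (fderiv ℝ G) 0 h h) ∧
      ∀ j : EuclideanSpace ℝ (Fin (3 * Fintype.card κ + 1)) →ₗ[ℝ] EuclideanSpace ℝ ι,
        ∃ c, ‖c‖ = 1 ∧
          -(τ * ‖j c‖ ^ 2) ≤ inner ℝ μ (fderiv ℝ (fderiv ℝ G) 0 (j c) (j c)) := by
  set G1 := fderiv ℝ G 0 with hG1
  set G2 := fderiv ℝ (fderiv ℝ G) 0 with hG2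
  have hsym : ∀ v w, G2 v w = G2 w v := (hG.isSymmSndFDerivAt (by simp)).eq
  have hnorm : ∀ y : Y, ‖y‖ ^ 2 = ‖pz y‖ ^ 2 + ‖pg y‖ ^ 2 := fun y => by
    simp only [← real_inner_self_eq_norm_sq, hinner]
  -- A push towards the interior of the cone. With `ε • one` added to the rescaled system, a
  -- vanishing deviation would give `G c k ≤ -ε³` on the inequality components and 0 on the others,
  -- which `hinf` excludes.
  let one : EuclideanSpace ℝ κ := WithLp.toLp 2 fun k => if p k then 1 else 0
  set C₀ : ℝ := ‖G2 h h‖ + 2 with hC₀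
  have hC₀pos : 0 < C₀ := by positivity
  -- the penalty parameter
  obtain ⟨δ, hδ, hδ1, hδ2⟩ : ∃ δ : ℝ, 0 < δ ∧ δ ≤ τ / 4 ∧ 2 * √(δ * C₀) ≤ τ / 2 := by
    refine ⟨min (τ / 4) (τ ^ 2 / (16 * C₀)), by positivity, min_le_left _ _, ?_⟩
    have : min (τ / 4) (τ ^ 2 / (16 * C₀)) * C₀ ≤ (τ / 4) ^ 2 := by
      calc _ ≤ τ ^ 2 / (16 * C₀) * C₀ := by gcongr; exact min_le_right _ _
        _ = _ := by field_simp; norm_num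
    have := Real.sqrt_le_sqrt this
    rw [Real.sqrt_sq (by positivity)] at this
    linarith
  -- The order of choice is `δ`, `R`, `M`, `θ`, `ε`: the radius may be large when `δ` is small, and
  -- `θ` and `ε` are then taken small relative to it.
  set R : ℝ := √(C₀ / δ) + 1 with hR
  have hR1 : 1 ≤ R := by rw [hR]; linarith [Real.sqrt_nonneg (C₀ / δ)]
  set M : ℝ := ‖h‖ + 2 * R with hM
  have hMpos : 0 < M := by positivity
  obtain ⟨θ, hθ, hθ1, hθ2⟩ : ∃ θ : ℝ, 0 < θ ∧ θ ≤ τ / 16 ∧ θ * M ^ 2 ≤ min (τ / 16) 1 := by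
    refine ⟨min (τ / 16) (min (τ / 16) 1 / M ^ 2), by positivity, min_le_left _ _, ?_⟩
    calc _ ≤ min (τ / 16) 1 / M ^ 2 * M ^ 2 := by gcongr; exact min_le_right _ _
      _ = _ := by field_simp
  have hest := ((taylor_estimates hG h0 hθ).and (hinf.and (hG.eventually (by simp))))
  obtain ⟨r, hr, hball⟩ := Metric.eventually_nhds_iff_ball.1 hest
  obtain ⟨ε, hε, hε1, hεr, hεB, hεone⟩ : ∃ ε : ℝ, 0 < ε ∧ ε ≤ 1 ∧ ε * M < r ∧
      ε * (‖G2‖ * (3 * M ^ 2)) ≤ τ / 16 ∧ ε * ‖one‖ ≤ min (τ / 16) 1 := by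
    refine ⟨min 1 (min (r / (2 * M)) (min (τ / 16 / (‖G2‖ * (3 * M ^ 2) + 1))
      (min (τ / 16) 1 / (‖one‖ + 1)))), by positivity, min_le_left _ _, ?_, ?_, ?_⟩
    · calc _ ≤ r / (2 * M) * M := by
            gcongr; exact (min_le_right _ _).trans (min_le_left _ _)
        _ = r / 2 := by field_simp
        _ < r := by linarith
    · calc _ ≤ τ / 16 / (‖G2‖ * (3 * M ^ 2) + 1) * (‖G2‖ * (3 * M ^ 2) + 1) := by
            gcongr
            · exact (min_le_right _ _).trans ((min_le_right _ _).trans (min_le_left _ _))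
            · linarith
        _ = _ := by field_simp
    · calc _ ≤ min (τ / 16) 1 / (‖one‖ + 1) * (‖one‖ + 1) := by
            gcongr
            · exact (min_le_right _ _).trans ((min_le_right _ _).trans (min_le_right _ _))
            · linarith
        _ = _ := by field_simp
  -- Two scales: the first derivative vanishes on the `z` part, so steps of size `ε` there act at
  -- order `ε²`, the same order as steps of size `ε²` in the unrestricted part.
  let L : Y →L[ℝ] EuclideanSpace ℝ ι := ε • pz + (ε ^ 2) • pg
  have hL : ∀ y, L y = ε • pz y + (ε ^ 2) • pg y := fun y => rfl
  let b : EuclideanSpace ℝ κ := -(ε⁻¹ • G1 h) + ε • one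
  let c : Y → EuclideanSpace ℝ ι := fun y => ε • h + L y
  have hcdef : ∀ y, c y = ε • (h + pz y + ε • pg y) := fun y => by
    simp only [c, hL, smul_add, smul_smul, pow_two, add_assoc]
  have hpz : ∀ y : Y, ‖pz y‖ ≤ ‖y‖ := fun y => by
    have := hnorm y
    exact abs_le_of_sq_le_sq' (by nlinarith [sq_nonneg ‖pg y‖]) (norm_nonneg _) |>.2
  have hpg : ∀ y : Y, ‖pg y‖ ≤ ‖y‖ := fun y => by
    have := hnorm y
    exact abs_le_of_sq_le_sq' (by nlinarith [sq_nonneg ‖pz y‖]) (norm_nonneg _) |>.2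
  have he : ∀ y : Y, ‖y‖ ≤ R → ‖h + pz y + ε • pg y‖ ≤ M := by
    intro y hy
    calc _ ≤ ‖h‖ + ‖pz y‖ + ‖ε • pg y‖ := norm_add₃_le
      _ ≤ ‖h‖ + R + 1 * R := by
          rw [norm_smul, Real.norm_of_nonneg hε.le]
          have := (hpz y).trans hy
          have := (hpg y).trans hy
          gcongr
      _ = M := by rw [hM]; ring
  have hcn : ∀ y : Y, ‖y‖ ≤ R → ‖c y‖ ≤ ε * M := by
    intro y hy
    rw [hcdef, norm_smul, Real.norm_of_nonneg hε.le]
    exact mul_le_mul_of_nonneg_left (he y hy) hε.le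
  have hcb : ∀ y : Y, ‖y‖ ≤ R → c y ∈ Metric.ball (0 : EuclideanSpace ℝ ι) r := by
    intro y hy
    rw [mem_ball_zero_iff]
    exact (hcn y hy).trans_lt hεr
  let g : Y → EuclideanSpace ℝ κ := fun y => (ε ^ 2)⁻¹ • G (c y) + b
  have hgdev : ∀ y : Y, ‖y‖ ≤ R → coneDeviation p (g y) ≠ 0 := by
    intro y hy h0
    refine (hball _ (hcb y hy)).2.1 ⟨fun k hk => ?_, fun k hk => ?_⟩
    · have h1 : (coneDeviation p (g y)) k = 0 := by rw [h0]; rfl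
      have h2 : g y k ≤ 0 := by
        simp only [coneDeviation, if_pos hk] at h1
        exact (le_max_left _ _).trans h1.le
      have h3 : g y k = (ε ^ 2)⁻¹ * G (c y) k + (-(ε⁻¹ * G1 h k) + ε * 1) := by
        simp [g, b, one, hk]
      have h4 : G (c y) k = ε ^ 2 * g y k + ε * G1 h k - ε ^ 3 := by
        rw [h3]; field_simp; ring
      have h5 : ε ^ 2 * g y k ≤ 0 := mul_nonpos_of_nonneg_of_nonpos (by positivity) h2
      have h6 : ε * G1 h k ≤ 0 := mul_nonpos_of_nonneg_of_nonpos hε.le (hh1 k hk)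
      have h7 : 0 < ε ^ 3 := by positivity
      linarith
    · have h1 : (coneDeviation p (g y)) k = 0 := by rw [h0]; rfl
      simp only [coneDeviation, if_neg hk] at h1
      have h3 : g y k = (ε ^ 2)⁻¹ * G (c y) k + (-(ε⁻¹ * G1 h k) + ε * 0) := by
        simp [g, b, one, hk]
      rw [h1, hh2 k hk] at h3
      simpa [hε.ne'] using h3.symm
  have hg0 : ‖g 0‖ ≤ C₀ := by
    obtain ⟨-, h2, -⟩ := (hball (c 0) (hcb 0 (by simp; positivity))).1
    have hc0 : c 0 = ε • h := by simp [c]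
    have h3 : g 0 = (ε ^ 2)⁻¹ • (G (c 0) - G1 (c 0) - (1 / 2 : ℝ) • G2 (c 0) (c 0)) +
        (1 / 2 : ℝ) • G2 h h + ε • one := by
      have e1 : (ε ^ 2)⁻¹ * ε = ε⁻¹ := by field_simp
      have e2 : (ε ^ 2)⁻¹ * (1 / 2 * (ε * ε)) = 1 / 2 := by field_simp
      simp only [g, b, hc0, map_smul, _root_.smul_apply, smul_sub, smul_smul, e1, e2]
      abel
    have h4 := hcn 0 (by simp; positivity)
    have h5 : (ε ^ 2)⁻¹ * (θ * ‖c 0‖ ^ 2) ≤ 1 := by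
      calc _ ≤ (ε ^ 2)⁻¹ * (θ * (ε * M) ^ 2) := by gcongr
        _ = θ * M ^ 2 := by field_simp
        _ ≤ 1 := hθ2.trans (min_le_right _ _)
    calc ‖g 0‖ ≤ ‖(ε ^ 2)⁻¹ • (G (c 0) - G1 (c 0) - (1 / 2 : ℝ) • G2 (c 0) (c 0))‖ +
        ‖(1 / 2 : ℝ) • G2 h h‖ + ‖ε • one‖ := by rw [h3]; exact norm_add₃_le
      _ ≤ 1 + ‖G2 h h‖ + 1 := by
        gcongr
        · rw [norm_smul, norm_inv, Real.norm_of_nonneg (by positivity : 0 ≤ ε ^ 2)]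
          refine le_trans ?_ h5
          gcongr
        · rw [norm_smul]
          norm_num
          linarith [norm_nonneg (G2 h h)]
        · rw [norm_smul, Real.norm_of_nonneg hε.le]
          exact hεone.trans (min_le_right _ _)
      _ = C₀ := by rw [hC₀]; ring
  obtain ⟨y, hyR', hyδ, μ, hμ1, hμp, hμg, hμd, hμdd⟩ := exists_penalized_minimizer (p := p)
    (G := G) (ε • h) L ((ε ^ 2)⁻¹) hδ (R := R) (C₀ := C₀) (by rw [hR]; linarith) b
    (fun y hy => (hball _ (hcb y hy)).2.2) hgdev (by simpa [g, c] using hg0)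
  obtain ⟨⟨t1, t2, t3, t4⟩, -, tC⟩ := hball (c y) (hcb y hyR')
  change 0 < inner ℝ μ ((ε ^ 2)⁻¹ • G (c y) + (-(ε⁻¹ • G1 h) + ε • one)) at hμg
  change ∀ v, (ε ^ 2)⁻¹ * inner ℝ μ (fderiv ℝ G (c y) (L v)) = -(2 * δ * inner ℝ y v) at hμd
  change ∀ v, fderiv ℝ G (c y) (L v) = 0 → -(2 * δ * ‖v‖ ^ 2) ≤
    (ε ^ 2)⁻¹ * inner ℝ μ (fderiv ℝ (fderiv ℝ G) (c y) (L v) (L v)) at hμdd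
  set D := fderiv ℝ G (c y) with hD
  set z := pz y with hz
  set γ := pg y with hγ
  have hzX : G1 z = 0 ∧ G2 h z = 0 := hpzX y
  have habs : ∀ w : EuclideanSpace ℝ κ, |inner ℝ μ w| ≤ ‖w‖ := fun w => by
    have := abs_real_inner_le_norm μ w
    rwa [hμ1, one_mul] at this
  have dγ : ∀ γ', inner ℝ μ (D γ') = -(2 * δ * inner ℝ γ γ') := by
    intro γ'
    obtain ⟨v, hv1, hv2⟩ := hsurj 0 γ' (map_zero _) (map_zero _)
    have h1 := hμd v
    have h2 : L v = ε ^ 2 • γ' := by rw [hL, hv1, hv2, smul_zero, zero_add]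
    have h3 : inner ℝ y v = inner ℝ γ γ' := by
      rw [hinner, hv1, hv2, inner_zero_right, zero_add]
    rw [h2, h3, map_smul, inner_smul_right, ← mul_assoc, inv_mul_cancel₀ (by positivity),
      one_mul] at h1
    exact h1
  have dz : ε⁻¹ * inner ℝ μ (D z) = -(2 * δ * ‖z‖ ^ 2) := by
    obtain ⟨v, hv1, hv2⟩ := hsurj z 0 hzX.1 hzX.2
    have h1 := hμd v
    have h2 : L v = ε • z := by rw [hL, hv1, hv2, smul_zero, add_zero]
    have h3 : inner ℝ y v = ‖z‖ ^ 2 := by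
      rw [hinner, hv1, hv2, inner_zero_right, add_zero, ← hz, real_inner_self_eq_norm_sq]
    rw [h2, h3, map_smul, inner_smul_right, ← mul_assoc] at h1
    rw [← h1]
    congr 1
    field_simp
  have hzR : ‖z‖ ≤ R := (hpz y).trans hyR'
  have hγR : ‖γ‖ ≤ R := (hpg y).trans hyR'
  have hcy : c y = ε • (h + z + ε • γ) := hcdef y
  have heM : ‖h + z + ε • γ‖ ≤ M := he y hyR'
  refine ⟨μ, hμ1, hμp, fun γ' => ?_, ?_, fun j => ?_⟩
  · have h1 : inner ℝ μ (G1 γ') = inner ℝ μ (D γ') - inner ℝ μ ((D - G1) γ') := by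
      simp [inner_sub_right]
    rw [h1, dγ]
    have h2 : |inner ℝ μ ((D - G1) γ')| ≤ θ * ‖γ'‖ :=
      (habs _).trans ((D - G1).le_of_opNorm_le t4 γ')
    have h3 : |2 * δ * inner ℝ γ γ'| ≤ τ / 2 * ‖γ'‖ := by
      rw [abs_mul, abs_of_nonneg (by positivity : 0 ≤ 2 * δ)]
      calc 2 * δ * |inner ℝ γ γ'| ≤ 2 * δ * (‖y‖ * ‖γ'‖) := by
            gcongr
            exact (abs_real_inner_le_norm _ _).trans (by gcongr; exact hpg y)
        _ = 2 * (δ * ‖y‖) * ‖γ'‖ := by ring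
        _ ≤ τ / 2 * ‖γ'‖ := by gcongr; linarith
    have h4 : θ * ‖γ'‖ ≤ τ / 2 * ‖γ'‖ := by gcongr; linarith
    rw [abs_le] at h2 h3 ⊢
    constructor <;> linarith
  · exact neg_le_inner_second_of_penalized G1 D G2 hsym h z γ (c y) (G (c y)) one μ hε hδ hθ hR1
      hM (hθ2.trans (min_le_left _ _)) hεB (hεone.trans (min_le_left _ _)) hzX hzR hγR hcy heM
      t1 t2 t4 hμ1 hμg (by rw [dγ, real_inner_self_eq_norm_sq]) dz
  -- Three linear conditions with values in the `κ`-space: the first two make `j c` an admissible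
  -- `z`, and the third makes the second-order condition applicable. On a space of dimension `3 *
  -- card κ + 1` they have a common nonzero solution.
  · let K : EuclideanSpace ℝ (Fin (3 * Fintype.card κ + 1)) →ₗ[ℝ]
        EuclideanSpace ℝ κ × EuclideanSpace ℝ κ × EuclideanSpace ℝ κ :=
      (G1.toLinearMap.prod ((G2 h).toLinearMap.prod D.toLinearMap)).comp j
    have hker : LinearMap.ker K ≠ ⊥ := by
      apply LinearMap.ker_ne_bot_of_finrank_lt
      simp only [Module.finrank_prod, finrank_euclideanSpace, Fintype.card_fin]
      omega
    obtain ⟨c₁, hc₁, hc₁0⟩ := Submodule.exists_mem_ne_zero_of_ne_bot hker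
    have hn : 0 < ‖c₁‖ := norm_pos_iff.2 hc₁0
    set c₂ := ‖c₁‖⁻¹ • c₁ with hc₂
    have hc₂K : K c₂ = 0 := by
      rw [hc₂, map_smul, LinearMap.mem_ker.1 hc₁, smul_zero]
    have hK : G1 (j c₂) = 0 ∧ G2 h (j c₂) = 0 ∧ D (j c₂) = 0 := by
      simpa [K, Prod.ext_iff] using hc₂K
    refine ⟨c₂, by rw [hc₂, norm_smul, norm_inv, norm_norm, inv_mul_cancel₀ hn.ne'], ?_⟩
    obtain ⟨v, hv1, hv2⟩ := hsurj (j c₂) 0 hK.1 hK.2.1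
    have hLv : L v = ε • j c₂ := by rw [hL, hv1, hv2, smul_zero, add_zero]
    have hvn : ‖v‖ ^ 2 = ‖j c₂‖ ^ 2 := by rw [hnorm, hv1, hv2]; simp
    have h1 := hμdd v (by rw [hLv, map_smul, hK.2.2, smul_zero])
    rw [hLv, hvn] at h1
    simp only [map_smul, _root_.smul_apply, inner_smul_right] at h1
    have h2 : (ε ^ 2)⁻¹ * (ε * (ε * inner ℝ μ (fderiv ℝ (fderiv ℝ G) (c y) (j c₂) (j c₂)))) =
        inner ℝ μ (fderiv ℝ (fderiv ℝ G) (c y) (j c₂) (j c₂)) := by field_simp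
    rw [h2] at h1
    have h3 : |inner ℝ μ ((fderiv ℝ (fderiv ℝ G) (c y) - G2) (j c₂) (j c₂))| ≤
        θ * ‖j c₂‖ ^ 2 := by
      refine (habs _).trans ((ContinuousLinearMap.le_opNorm₂ _ _ _).trans ?_)
      rw [mul_assoc, ← pow_two]
      gcongr
    simp only [_root_.sub_apply, inner_sub_right] at h3
    have h4 : θ * ‖j c₂‖ ^ 2 ≤ τ / 16 * ‖j c₂‖ ^ 2 := by gcongr
    have h5 : 2 * δ * ‖j c₂‖ ^ 2 ≤ τ / 2 * ‖j c₂‖ ^ 2 := by gcongr; linarith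
    have h6 : 0 ≤ τ * ‖j c₂‖ ^ 2 := by positivity
    linarith [(abs_le.1 h3).2]

/-- Approximate multipliers of finite index for an infeasible finite-dimensional system. -/
lemma exists_approximate_multiplier {ι : Type} [Fintype ι]
    {G : EuclideanSpace ℝ ι → EuclideanSpace ℝ κ}
    (hG : ContDiffAt ℝ 2 G 0) (h0 : G 0 = 0)
    (hinf : ∀ᶠ c in 𝓝 0, ¬ ((∀ k, p k → G c k < 0) ∧ ∀ k, ¬ p k → G c k = 0))
    (h : EuclideanSpace ℝ ι) (hh1 : ∀ k, p k → fderiv ℝ G 0 h k ≤ 0)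
    (hh2 : ∀ k, ¬ p k → fderiv ℝ G 0 h k = 0) {τ : ℝ} (hτ : 0 < τ) :
    ∃ μ : EuclideanSpace ℝ κ, ‖μ‖ = 1 ∧ (∀ k, p k → 0 ≤ μ k) ∧
      (∀ γ, |inner ℝ μ (fderiv ℝ G 0 γ)| ≤ τ * ‖γ‖) ∧
      -τ ≤ inner ℝ μ (fderiv ℝ (fderiv ℝ G) 0 h h) ∧
      ∀ j : EuclideanSpace ℝ (Fin (3 * Fintype.card κ + 1)) →ₗ[ℝ] EuclideanSpace ℝ ι,
        ∃ c, ‖c‖ = 1 ∧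
          -(τ * ‖j c‖ ^ 2) ≤ inner ℝ μ (fderiv ℝ (fderiv ℝ G) 0 (j c) (j c)) := by
  set X₀ : Submodule ℝ (EuclideanSpace ℝ ι) :=
    LinearMap.ker ((fderiv ℝ G 0).prod (fderiv ℝ (fderiv ℝ G) 0 h)).toLinearMap with hX₀
  have memX : ∀ z, z ∈ X₀ ↔ fderiv ℝ G 0 z = 0 ∧ fderiv ℝ (fderiv ℝ G) 0 h z = 0 := by
    intro z
    simp [hX₀, LinearMap.mem_ker]
  exact exists_approximate_multiplier_of_splitting hG h0 hinf h hh1 hh2 hτ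
    (Y := WithLp 2 (X₀ × EuclideanSpace ℝ ι))
    (X₀.subtypeL.comp (WithLp.fstL 2 ℝ _ _)) (WithLp.sndL 2 ℝ _ _)
    (fun y v => WithLp.prod_inner_apply y v) (fun y => (memX _).1 (WithLp.fst y).2)
    (fun z γ h1 h2 => ⟨WithLp.toLp 2 (⟨z, (memX z).2 ⟨h1, h2⟩⟩, γ), rfl, rfl⟩)

end SecondOrder

/-! ### Multipliers of finite index in infinite dimension -/

section FiniteIndex

lemma fderiv_fderiv_comp_continuousLinearMap {E X W : Type} [NormedAddCommGroup E]
    [NormedSpace ℝ E] [NormedAddCommGroup X] [NormedSpace ℝ X] [NormedAddCommGroup W]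
    [NormedSpace ℝ W] {G : X → W} (Φ : E →L[ℝ] X) {a : E} (hG : ContDiffAt ℝ 2 G (Φ a)) :
    fderiv ℝ (fun c => G (Φ c)) a = (fderiv ℝ G (Φ a)).comp Φ ∧
    ∀ v w, fderiv ℝ (fderiv ℝ (fun c => G (Φ c))) a v w =
      fderiv ℝ (fderiv ℝ G) (Φ a) (Φ v) (Φ w) := by
  obtain ⟨h1, h2⟩ := contDiffAt_two_eventually_hasFDerivAt hG
  have h3 : fderiv ℝ (fun c => G (Φ c)) =ᶠ[𝓝 a] fun c => (fderiv ℝ G (Φ c)).comp Φ := by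
    filter_upwards [Φ.continuous.continuousAt.eventually h1] with c hc
    exact (hc.comp c Φ.hasFDerivAt).fderiv
  refine ⟨h3.self_of_nhds, fun v w => ?_⟩
  rw [h3.fderiv_eq]
  have h4 : HasFDerivAt (fun c => fderiv ℝ G (Φ c)) ((fderiv ℝ (fderiv ℝ G) (Φ a)).comp Φ) a :=
    h2.comp a Φ.hasFDerivAt
  have h5 := (((ContinuousLinearMap.compL ℝ E X W).flip Φ).hasFDerivAt
    (x := fderiv ℝ G (Φ a))).comp a h4
  have h6 : (fun c => (fderiv ℝ G (Φ c)).comp Φ) =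
      (((ContinuousLinearMap.compL ℝ E X W).flip Φ) ∘ fun c => fderiv ℝ G (Φ c)) := by
    ext; simp
  rw [h6, h5.fderiv]
  simp

/-- Projection along a compact factor is a closed map. This is what lets the index condition, an
existential over a unit sphere, survive limits in the multiplier. -/
lemma isClosed_setOf_exists_mem_le {A B : Type} [TopologicalSpace A] [TopologicalSpace B]
    {S : Set B} (hS : IsCompact S) {f : A → B → ℝ} (hf : Continuous fun x : A × B => f x.1 x.2)
    (r : ℝ) : IsClosed {a | ∃ b ∈ S, r ≤ f a b} := by
  have h1 : IsClosed {x : A × S | r ≤ f x.1 x.2} :=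
    isClosed_le continuous_const
      (hf.comp (continuous_fst.prodMk (continuous_subtype_val.comp continuous_snd)))
  have : CompactSpace S := isCompact_iff_compactSpace.1 hS
  convert isClosedMap_fst_of_compactSpace _ h1 using 1
  ext a
  simp

variable {κ : Type} [Fintype κ] {p : κ → Prop} [DecidablePred p]

set_option maxHeartbeats 1000000 in
/-- A multiplier of finite index for an infeasible system, nonnegative in a given critical
direction. -/
theorem exists_multiplier_of_finite_index {X : Type} [NormedAddCommGroup X] [NormedSpace ℝ X]
    {G : X → EuclideanSpace ℝ κ} (hG : ContDiffAt ℝ 2 G 0) (h0 : G 0 = 0)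
    (hinf : ∀ᶠ c in 𝓝 0, ¬ ((∀ k, p k → G c k < 0) ∧ ∀ k, ¬ p k → G c k = 0))
    (h : X) (hh1 : ∀ k, p k → fderiv ℝ G 0 h k ≤ 0)
    (hh2 : ∀ k, ¬ p k → fderiv ℝ G 0 h k = 0) :
    ∃ μ : EuclideanSpace ℝ κ, ‖μ‖ = 1 ∧ (∀ k, p k → 0 ≤ μ k) ∧
      (∀ x, inner ℝ μ (fderiv ℝ G 0 x) = 0) ∧
      0 ≤ inner ℝ μ (fderiv ℝ (fderiv ℝ G) 0 h h) ∧
      ∀ v : Fin (3 * Fintype.card κ + 1) → X,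
        ∃ c : EuclideanSpace ℝ (Fin (3 * Fintype.card κ + 1)), ‖c‖ = 1 ∧
          0 ≤ inner ℝ μ (fderiv ℝ (fderiv ℝ G) 0 (∑ i, c i • v i) (∑ i, c i • v i)) := by
  classical
  set L := 3 * Fintype.card κ + 1 with hL
  set G1 := fderiv ℝ G 0 with hG1
  set G2 := fderiv ℝ (fderiv ℝ G) 0 with hG2
  let q : (Fin L → X) → EuclideanSpace ℝ κ → EuclideanSpace ℝ (Fin L) → ℝ := fun v μ c =>
    inner ℝ μ (G2 (∑ i, c i • v i) (∑ i, c i • v i))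
  have hq : ∀ v, Continuous fun x : EuclideanSpace ℝ κ × EuclideanSpace ℝ (Fin L) =>
      q v x.1 x.2 := by
    intro v
    have h1 : Continuous fun x : EuclideanSpace ℝ κ × EuclideanSpace ℝ (Fin L) =>
        ∑ i, x.2 i • v i := by fun_prop
    exact continuous_fst.inner ((G2.continuous.comp h1).clm_apply h1)
  let S : Set (EuclideanSpace ℝ (Fin L)) := Metric.sphere 0 1
  have hS : IsCompact S := isCompact_sphere _ _
  -- An index prescribes finitely many test vectors and an accuracy `1 / (n + 1)`, and `C` is the
  -- closed set of vectors meeting the requirements for these data. The multiplier is a point of the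
  -- unit sphere common to all these sets, provided by the finite intersection property.
  let C : (Fin L → X) × ℕ → Set (EuclideanSpace ℝ κ) := fun a =>
    ((⋂ k, ⋂ _ : p k, {μ | 0 ≤ μ k}) ∩ ((⋂ i, {μ | |inner ℝ μ (G1 (a.1 i))| ≤ 1 / (a.2 + 1 : ℝ)}) ∩
      {μ | -(1 / (a.2 + 1 : ℝ)) ≤ inner ℝ μ (G2 h h)})) ∩
    {μ | ∃ c ∈ S, -(1 / (a.2 + 1 : ℝ)) ≤ q a.1 μ c}
  have hC : ∀ a, IsClosed (C a) := fun a =>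
    ((isClosed_iInter fun k => isClosed_iInter fun _ =>
      isClosed_le continuous_const (by fun_prop)).inter
      ((isClosed_iInter fun i => isClosed_le (by fun_prop) continuous_const).inter
        (isClosed_le continuous_const (by fun_prop)))).inter
      (isClosed_setOf_exists_mem_le hS (hq a.1) _)
  have memC : ∀ a μ, μ ∈ C a ↔ ((∀ k, p k → 0 ≤ μ k) ∧
      (∀ i, |inner ℝ μ (G1 (a.1 i))| ≤ 1 / (a.2 + 1 : ℝ)) ∧
      -(1 / (a.2 + 1 : ℝ)) ≤ inner ℝ μ (G2 h h)) ∧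
      ∃ c ∈ S, -(1 / (a.2 + 1 : ℝ)) ≤ q a.1 μ c := by
    intro a μ
    simp only [C, mem_inter_iff, mem_iInter, mem_ofPred_eq]
  have hne : (Metric.sphere (0 : EuclideanSpace ℝ κ) 1 ∩ ⋂ a, C a).Nonempty := by
    refine (isCompact_sphere _ _).inter_iInter_nonempty C hC fun u => ?_
    -- Finitely many indices involve finitely many vectors of `X`. The map `Φ` pulls `G` back to a
    -- coordinate space for these vectors and `h`, where the finite-dimensional result applies with
    -- the coordinate `none` as critical direction.
    let ι := Option (u × Fin L)
    let b : ι → X := fun o => o.elim h fun a => a.1.1.1 a.2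
    let Φ : EuclideanSpace ℝ ι →L[ℝ] X :=
      ∑ i, (EuclideanSpace.proj i : EuclideanSpace ℝ ι →L[ℝ] ℝ).smulRight (b i)
    have hΦ : ∀ c, Φ c = ∑ i, c i • b i := by
      intro c
      simp [Φ, _root_.sum_apply]
    have hΦs : ∀ i, Φ (EuclideanSpace.single i 1) = b i := by
      intro i
      rw [hΦ, Finset.sum_eq_single i]
      · simp
      · intro j _ hj
        simp [hj]
      · simp
    have hG' : ContDiffAt ℝ 2 G (Φ 0) := by rwa [map_zero]
    obtain ⟨f1, f2⟩ := fderiv_fderiv_comp_continuousLinearMap Φ hG'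
    rw [map_zero] at f1 f2
    set N := u.sup fun a => a.2 with hN
    -- The image `j c` of a unit vector has norm at most `L`, so the error `τ‖j c‖²` is at most `τ
    -- (L² + 1)`, which stays below every accuracy in the finite family.
    set τ : ℝ := 1 / ((N + 1) * ((L : ℝ) ^ 2 + 1)) with hτ
    have hτ0 : 0 < τ := by positivity
    have hle : ∀ a ∈ u, τ * ((L : ℝ) ^ 2 + 1) ≤ 1 / (a.2 + 1 : ℝ) := by
      intro a ha
      have h1 : (a.2 : ℝ) ≤ N := by exact_mod_cast Finset.le_sup (f := fun a => a.2) ha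
      have h2 : τ * ((L : ℝ) ^ 2 + 1) = 1 / (N + 1) := by
        rw [hτ]; field_simp
      rw [h2]
      gcongr
    obtain ⟨μ, m1, m2, m3, m4, m5⟩ := exists_approximate_multiplier (p := p)
      (G := fun c => G (Φ c)) (hG'.comp (0 : EuclideanSpace ℝ ι) Φ.contDiff.contDiffAt)
      (by simp only [map_zero, h0])
      (by
        have : Tendsto Φ (𝓝 0) (𝓝 0) := by simpa using Φ.continuous.tendsto 0
        exact this.eventually hinf)
      (EuclideanSpace.single none 1)
      (by intro k hk; rw [f1, ContinuousLinearMap.comp_apply, hΦs]; exact hh1 k hk)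
      (by intro k hk; rw [f1, ContinuousLinearMap.comp_apply, hΦs]; exact hh2 k hk) hτ0
    refine ⟨μ, by simpa using m1, ?_⟩
    simp only [mem_iInter]
    intro a ha
    have hla := hle a ha
    have hla' : τ ≤ 1 / (a.2 + 1 : ℝ) := by
      refine le_trans ?_ hla
      nlinarith [sq_nonneg (L : ℝ)]
    refine (memC a μ).2 ⟨⟨m2, fun i => ?_, ?_⟩, ?_⟩
    · have := m3 (EuclideanSpace.single (some (⟨a, ha⟩, i)) 1)
      rw [f1, ContinuousLinearMap.comp_apply, hΦs] at this
      rw [PiLp.norm_single, norm_one, mul_one] at this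
      exact this.trans hla'
    · rw [f2, hΦs] at m4
      exact (neg_le_neg hla').trans m4
    · let j : EuclideanSpace ℝ (Fin L) →ₗ[ℝ] EuclideanSpace ℝ ι :=
        ∑ i, ((EuclideanSpace.proj i : EuclideanSpace ℝ (Fin L) →L[ℝ] ℝ).smulRight
          (EuclideanSpace.single (some (⟨a, ha⟩, i)) (1 : ℝ) : EuclideanSpace ℝ ι)).toLinearMap
      have hj : ∀ c, j c = ∑ i, c i •
          (EuclideanSpace.single (some (⟨a, ha⟩, i)) (1 : ℝ) : EuclideanSpace ℝ ι) := by
        intro c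
        simp [j]
      obtain ⟨c, c1, c2⟩ := m5 j
      refine ⟨c, by simpa [S] using c1, ?_⟩
      have hjn : ‖j c‖ ≤ L := by
        rw [hj]
        refine (norm_sum_le _ _).trans ?_
        calc _ ≤ ∑ i : Fin L, (1 : ℝ) := by
              refine Finset.sum_le_sum fun i _ => ?_
              rw [norm_smul, PiLp.norm_single, norm_one, mul_one, ← c1]
              exact PiLp.norm_apply_le c i
          _ = L := by simp
      rw [f2] at c2
      have hΦj : Φ (j c) = ∑ i, c i • a.1 i := by
        rw [hj, map_sum]
        refine Finset.sum_congr rfl fun i _ => ?_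
        rw [map_smul, hΦs]
        rfl
      rw [hΦj] at c2
      refine le_trans (neg_le_neg ?_) c2
      calc τ * ‖j c‖ ^ 2 ≤ τ * ((L : ℝ) ^ 2 + 1) := by
            gcongr
            nlinarith [norm_nonneg (j c), hjn]
        _ ≤ _ := hla
  obtain ⟨μ, hμ1, hμ2⟩ := hne
  rw [mem_iInter] at hμ2
  simp only [memC] at hμ2
  have hlim : Tendsto (fun n : ℕ => 1 / ((n : ℝ) + 1)) atTop (𝓝 0) :=
    tendsto_one_div_add_atTop_nhds_zero_nat
  refine ⟨μ, by simpa using hμ1, (hμ2 (0, 0)).1.1, fun x => ?_, ?_, fun v => ?_⟩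
  · have h1 : ∀ n : ℕ, |inner ℝ μ (G1 x)| ≤ 1 / ((n : ℝ) + 1) := fun n =>
      (hμ2 (fun _ => x, n)).1.2.1 ⟨0, by omega⟩
    have := ge_of_tendsto' hlim h1
    exact abs_eq_zero.1 (le_antisymm this (abs_nonneg _))
  · have h1 : ∀ n : ℕ, -(1 / ((n : ℝ) + 1)) ≤ inner ℝ μ (G2 h h) := fun n =>
      (hμ2 (fun _ => h, n)).1.2.2
    simpa using ge_of_tendsto' hlim fun n => neg_le.1 (h1 n)
  -- The unit vectors obtained for different accuracies may differ; a maximizer of the form over the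
  -- compact sphere serves all of them.
  · obtain ⟨c₀, hc₀, -⟩ := (hμ2 (v, 0)).2
    obtain ⟨c, hc, hmax⟩ := hS.exists_isMaxOn ⟨c₀, hc₀⟩
      ((hq v).comp (Continuous.prodMk_right μ)).continuousOn
    refine ⟨c, by simpa [S] using hc, ?_⟩
    have h1 : ∀ n : ℕ, -(1 / ((n : ℝ) + 1)) ≤ q v μ c := fun n => by
      obtain ⟨c', hc', h2⟩ := (hμ2 (v, n)).2
      exact h2.trans (hmax hc')
    exact neg_nonpos.1 (ge_of_tendsto' hlim fun n => neg_le.1 (h1 n))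

end FiniteIndex

/-! ### The solution map of the controlled integral equation -/

section SolutionMap

variable {E U : Type} [NormedAddCommGroup E] [NormedSpace ℝ E] [CompleteSpace E]
  [NormedAddCommGroup U] [NormedSpace ℝ U] [CompleteSpace U] {I : Type} [TopologicalSpace I]
  [CompactSpace I]

/-- The embedding of `E` as constant functions. -/
def constFun : E →L[ℝ] C(I, E) :=
  LinearMap.mkContinuous
    { toFun := fun e => ContinuousMap.const I e
      map_add' := fun _ _ => rfl
      map_smul' := fun _ _ => rfl } 1 (fun e => by
      rw [ContinuousMap.norm_le _ (by positivity)]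
      intro t
      rw [one_mul]
      exact le_rfl)

@[simp] lemma constFun_apply (e : E) (t : I) : constFun e t = e := rfl

/-- Pairing of continuous functions. -/
def pairFun : C(I, E) × C(I, U) →L[ℝ] C(I, E × U) :=
  ((ContinuousLinearMap.inl ℝ E U).compLeftContinuous ℝ I).comp (ContinuousLinearMap.fst ℝ _ _) +
  ((ContinuousLinearMap.inr ℝ E U).compLeftContinuous ℝ I).comp (ContinuousLinearMap.snd ℝ _ _)

@[simp] lemma pairFun_apply (x : C(I, E)) (u : C(I, U)) (t : I) :
    pairFun (x, u) t = (x t, u t) := by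
  simp [pairFun]

/-- Solutions `y = a + K c + M (b + Z (c, y))` depending on the parameter `c`. -/
theorem exists_implicit_solution {X Y Q : Type} [NormedAddCommGroup X] [NormedSpace ℝ X]
    [CompleteSpace X] [NormedAddCommGroup Y] [NormedSpace ℝ Y] [CompleteSpace Y]
    [NormedAddCommGroup Q] [NormedSpace ℝ Q] {M : Q → Y} (hM : ContDiff ℝ 2 M) (a y₀ : Y) (b q : Q)
    (K : X →L[ℝ] Y) (Z : X × Y →L[ℝ] Q) (hq : q = b + Z (0, y₀)) (h0 : y₀ = a + M q)
    (hinv : IsUnit (1 - (fderiv ℝ M q).comp (Z.comp (ContinuousLinearMap.inr ℝ X Y)))) :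
    ∃ S : X → Y, ContDiffAt ℝ 2 S 0 ∧ S 0 = y₀ ∧
      (∀ᶠ c in 𝓝 0, S c = a + K c + M (b + Z (c, S c))) ∧
      (∀ c, fderiv ℝ S 0 c = K c + fderiv ℝ M q (Z (c, fderiv ℝ S 0 c))) ∧
      ∀ c, fderiv ℝ (fderiv ℝ S) 0 c c = fderiv ℝ M q (Z (0, fderiv ℝ (fderiv ℝ S) 0 c c)) +
        fderiv ℝ (fderiv ℝ M) q (Z (c, fderiv ℝ S 0 c)) (Z (c, fderiv ℝ S 0 c)) := by
  have hMd : ∀ z, HasFDerivAt M (fderiv ℝ M z) z := fun z =>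
    (hM.differentiable (by norm_num) z).hasFDerivAt
  have hMd' : ∀ z, HasFDerivAt (fderiv ℝ M) (fderiv ℝ (fderiv ℝ M) z) z := fun z =>
    ((hM.fderiv_right (m := 1) (by norm_num)).differentiable one_ne_zero z).hasFDerivAt
  -- The implicit function theorem is applied to `Θ = 0`; the partial derivative of `Θ` in the
  -- second variable is the operator assumed invertible.
  let Θ : X × Y → Y := fun z => z.2 - (a + K z.1) - M (b + Z z)
  have hΘ : ContDiff ℝ 2 Θ :=
    (contDiff_snd.sub (contDiff_const.add (K.contDiff.comp contDiff_fst))).sub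
      (hM.comp (contDiff_const.add Z.contDiff))
  have hΘd : fderiv ℝ Θ (0, y₀) ∘L .inr ℝ X Y =
      1 - (fderiv ℝ M q).comp (Z.comp (ContinuousLinearMap.inr ℝ X Y)) := by
    have h2 : HasFDerivAt (fun z => b + Z z) Z (0, y₀) := Z.hasFDerivAt.const_add b
    have h3 : HasFDerivAt (fun z => M (b + Z z)) ((fderiv ℝ M q).comp Z) (0, y₀) := by
      have := hMd q
      rw [hq] at this ⊢
      exact this.comp (0, y₀) h2
    have h4 : HasFDerivAt (fun z : X × Y => a + K z.1) (K.comp (ContinuousLinearMap.fst ℝ X Y))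
        (0, y₀) := (K.comp (ContinuousLinearMap.fst ℝ X Y)).hasFDerivAt.const_add a
    have h5 : HasFDerivAt Θ _ (0, y₀) := (hasFDerivAt_snd.sub h4).sub h3
    rw [h5.fderiv]
    ext y
    simp
  have hinv' : (fderiv ℝ Θ (0, y₀) ∘L .inr ℝ X Y).IsInvertible := by
    rw [hΘd]
    obtain ⟨v, hv⟩ := hinv
    exact ⟨ContinuousLinearEquiv.ofUnit v, hv⟩
  have hΘc : ContDiffAt ℝ 2 Θ (0, y₀) := hΘ.contDiffAt
  obtain ⟨S, hS, hS0, hSimp⟩ : ∃ S : X → Y, ContDiffAt ℝ 2 S 0 ∧ S 0 = y₀ ∧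
      ∀ᶠ c in 𝓝 0, Θ (c, S c) = Θ (0, y₀) :=
    ⟨hΘc.implicitFunction (by norm_num) hinv',
      hΘc.contDiffAt_implicitFunction (by norm_num) hinv',
      hΘc.implicitFunction_apply_self (by norm_num) hinv',
      hΘc.eventually_apply_implicitFunction (by norm_num) hinv'⟩
  have hΘ0 : Θ (0, y₀) = 0 := by
    simp only [Θ, ← hq, map_zero, add_zero]
    nth_rewrite 1 [h0]
    abel
  have hSe : ∀ᶠ c in 𝓝 0, S c = a + K c + M (b + Z (c, S c)) := by
    filter_upwards [hSimp] with c hc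
    rw [hΘ0] at hc
    simp only [Θ, sub_eq_zero] at hc
    rw [sub_eq_iff_eq_add] at hc
    exact hc.trans (add_comm _ _)
  obtain ⟨hd1, hd2⟩ := contDiffAt_two_eventually_hasFDerivAt hS
  have hpair : ∀ c', HasFDerivAt S (fderiv ℝ S c') c' → HasFDerivAt (fun c => b + Z (c, S c))
      (Z.comp ((ContinuousLinearMap.id ℝ X).prod (fderiv ℝ S c'))) c' := fun c' h =>
    (Z.hasFDerivAt.comp c' ((hasFDerivAt_id c').prodMk h)).const_add b
  -- The differentiated fixed-point equation is kept on a whole neighborhood of 0, so that it can be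
  -- differentiated once more at 0.
  have hSd : ∀ᶠ c' in 𝓝 0, ∀ c, fderiv ℝ S c' c =
      K c + fderiv ℝ M (b + Z (c', S c')) (Z (c, fderiv ℝ S c' c)) := by
    filter_upwards [hSe.eventually_nhds, hd1] with c' h1 h2 c
    have h4 := (hMd _).comp c' (hpair c' h2)
    have h6 := ((K.hasFDerivAt.const_add a).add h4).congr_of_eventuallyEq (f₁ := S) h1
    nth_rewrite 1 [h6.fderiv]
    simp
  have hq0 : b + Z (0, S 0) = q := by rw [hS0, hq]
  refine ⟨S, hS, hS0, hSe, fun c => ?_, fun c => ?_⟩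
  · have := hSd.self_of_nhds c
    rwa [hq0] at this
  · have h4 : HasFDerivAt (fun c' => fderiv ℝ M (b + Z (c', S c')))
        ((fderiv ℝ (fderiv ℝ M) q).comp
          (Z.comp ((ContinuousLinearMap.id ℝ X).prod (fderiv ℝ S 0)))) 0 := by
      have h := hMd' (b + Z (0, S 0))
      have := h.comp (0 : X) (hpair 0 hd1.self_of_nhds)
      rwa [hq0] at this
    have h5 : HasFDerivAt (fun c' => fderiv ℝ S c' c)
        ((ContinuousLinearMap.apply ℝ Y c).comp (fderiv ℝ (fderiv ℝ S) 0)) 0 :=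
      (ContinuousLinearMap.apply ℝ Y c).hasFDerivAt.comp (0 : X) hd2
    have h6 : HasFDerivAt (fun c' => Z (c, fderiv ℝ S c' c))
        (Z.comp (ContinuousLinearMap.prod 0
          ((ContinuousLinearMap.apply ℝ Y c).comp (fderiv ℝ (fderiv ℝ S) 0)))) 0 :=
      Z.hasFDerivAt.comp (0 : X) ((hasFDerivAt_const c _).prodMk h5)
    have h7 := (h4.clm_apply h6).const_add (K c)
    have h8 := h7.congr_of_eventuallyEq (f₁ := fun c' => fderiv ℝ S c' c)
      (hSd.mono fun c' hc' => hc' c)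
    have h9 := DFunLike.congr_fun (h5.unique h8) c
    simpa [hq0] using h9

variable {T : ℝ} (hT : 0 ≤ T)

lemma fderiv_superpose {F : E × U → E} (hF : ContDiff ℝ 2 F) (z : C(Icc 0 T, E × U)) :
    fderiv ℝ (fun z => primitive hT (superpose F hF.continuous z)) z =
      (primitive hT).comp (pointwiseApply (superpose (fderiv ℝ F)
        ((hF.fderiv_right (m := 1) (by norm_num)).continuous) z)) := by
  have h := hasFDerivAt_superpose (I := Icc 0 T) (hF.of_le (by norm_num) : ContDiff ℝ 1 F) z
  exact ((primitive hT).hasFDerivAt.comp z h).fderiv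

lemma HasFDerivAt.clm_comp_left {A B C : Type} [NormedAddCommGroup A] [NormedSpace ℝ A]
    [NormedAddCommGroup B] [NormedSpace ℝ B] [NormedAddCommGroup C] [NormedSpace ℝ C]
    (L : B →L[ℝ] C) {f : A → B} {f' : A →L[ℝ] B} {z : A} (h : HasFDerivAt f f' z) :
    HasFDerivAt (fun z => L (f z)) (L.comp f') z :=
  L.hasFDerivAt.comp z h

lemma fderiv_fderiv_superpose {F : E × U → E} (hF : ContDiff ℝ 2 F) (z v : C(Icc 0 T, E × U)) :
    ∃ r : C(Icc 0 T, E), (∀ t, r t = fderiv ℝ (fderiv ℝ F) (z t) (v t) (v t)) ∧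
      fderiv ℝ (fderiv ℝ (fun z => primitive hT (superpose F hF.continuous z))) z v v =
        primitive hT r := by
  have hDF : ContDiff ℝ 1 (fderiv ℝ F) := hF.fderiv_right (by norm_num)
  have h : HasFDerivAt (superpose (fderiv ℝ F) hDF.continuous)
    (pointwiseApply (superpose (fderiv ℝ (fderiv ℝ F)) (hDF.continuous_fderiv one_ne_zero) z)) z :=
    hasFDerivAt_superpose hDF z
  have h1 : fderiv ℝ (fun z => primitive hT (superpose F hF.continuous z)) = fun z =>
      (primitive hT).comp (pointwiseApply (superpose (fderiv ℝ F) hDF.continuous z)) :=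
    funext fun z => fderiv_superpose hT hF z
  let PA : C(Icc 0 T, E × U →L[ℝ] E) →L[ℝ] C(Icc 0 T, E × U) →L[ℝ] C(Icc 0 T, E) := pointwiseApply
  let cmp : (C(Icc 0 T, E × U) →L[ℝ] C(Icc 0 T, E)) →L[ℝ] (C(Icc 0 T, E × U) →L[ℝ] C(Icc 0 T, E)) :=
    ContinuousLinearMap.compL ℝ C(Icc 0 T, E × U) C(Icc 0 T, E) C(Icc 0 T, E) (primitive hT)
  have h3 : HasFDerivAt (fderiv ℝ (fun z => primitive hT (superpose F hF.continuous z)))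
      ((cmp.comp PA).comp (pointwiseApply
        (superpose (fderiv ℝ (fderiv ℝ F)) (hDF.continuous_fderiv one_ne_zero) z))) z := by
    rw [h1]; exact HasFDerivAt.clm_comp_left
      (B := C(Icc 0 T, E × U →L[ℝ] E)) (C := C(Icc 0 T, E × U) →L[ℝ] C(Icc 0 T, E)) (cmp.comp PA) h
  exact ⟨pointwiseApply (pointwiseApply
    (superpose (fderiv ℝ (fderiv ℝ F)) (hDF.continuous_fderiv one_ne_zero) z) v) v, fun t => rfl,
    by rw [h3.fderiv]; rfl⟩

/-- The perturbed solution map of the integral equation `x = x₀ + ∫₀ᵗ F (x, u)` near a reference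
solution, with the equations satisfied by its first and second derivatives. -/
theorem exists_solutionMap {F : E × U → E} (hF : ContDiff ℝ 2 F) (x₀ : E) (x : C(Icc 0 T, E))
    (u : C(Icc 0 T, U))
    (hx : x = constFun x₀ + primitive hT (superpose F hF.continuous (pairFun (x, u)))) :
    ∃ S : E × C(Icc 0 T, U) → C(Icc 0 T, E), ContDiffAt ℝ 2 S 0 ∧ S 0 = x ∧
      (∀ᶠ c in 𝓝 0, S c = constFun (x₀ + c.1) +
        primitive hT (superpose F hF.continuous (pairFun (S c, u + c.2)))) ∧
      (∀ c, ∃ r : C(Icc 0 T, E), (∀ t, r t = fderiv ℝ F (x t, u t) (fderiv ℝ S 0 c t, c.2 t)) ∧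
        fderiv ℝ S 0 c = constFun c.1 + primitive hT r) ∧
      ∀ c, ∃ r : C(Icc 0 T, E), (∀ t, r t = fderiv ℝ F (x t, u t)
        (fderiv ℝ (fderiv ℝ S) 0 c c t, 0) + fderiv ℝ (fderiv ℝ F) (x t, u t)
          (fderiv ℝ S 0 c t, c.2 t) (fderiv ℝ S 0 c t, c.2 t)) ∧
        fderiv ℝ (fderiv ℝ S) 0 c c = primitive hT r := by
  have hDF : ContDiff ℝ 1 (fderiv ℝ F) := hF.fderiv_right (by norm_num)
  let PF : C(Icc 0 T, E) × C(Icc 0 T, U) →L[ℝ] C(Icc 0 T, E × U) := pairFun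
  let Z : (E × C(Icc 0 T, U)) × C(Icc 0 T, E) →L[ℝ] C(Icc 0 T, E × U) :=
    PF.comp ((ContinuousLinearMap.snd ℝ _ _).prod
      ((ContinuousLinearMap.snd ℝ _ _).comp (ContinuousLinearMap.fst ℝ _ _)))
  let K : E × C(Icc 0 T, U) →L[ℝ] C(Icc 0 T, E) :=
    (constFun (E := E) (I := Icc 0 T)).comp (ContinuousLinearMap.fst ℝ _ _)
  have hZ : ∀ c y, pairFun (0, u) + Z (c, y) = pairFun (y, u + c.2) := fun c y => by
    change PF (0, u) + PF (y, c.2) = PF (y, u + c.2)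
    rw [← map_add]; simp
  have hM : ContDiff ℝ 2 (fun z => primitive hT (superpose F hF.continuous z)) :=
    (primitive hT).contDiff.comp (contDiff_superpose hF)
  obtain ⟨S, h1, h2, h3, h4, h5⟩ := exists_implicit_solution hM (constFun x₀) x (pairFun (0, u))
    (pairFun (x, u)) K Z (by rw [hZ]; simp) hx (by
      -- The partial derivative in the state is a Volterra operator whose coefficient is `F_x` along
      -- the reference, so invertibility holds for every `T`.
      let A : C(Icc 0 T, E →L[ℝ] E) :=
        ((ContinuousLinearMap.compL ℝ E (E × U) E).flip (ContinuousLinearMap.inl ℝ E U)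
          ).compLeftContinuous ℝ (Icc 0 T) (superpose (fderiv ℝ F) hDF.continuous (pairFun (x, u)))
      convert isUnit_one_sub_volterra hT A using 2
      rw [fderiv_superpose hT hF]
      ext1 y
      change primitive hT _ = primitive hT _
      congr 1
      ext t
      change fderiv ℝ F _ (PF (y, 0) t) = fderiv ℝ F _ (y t, 0)
      simp [PF])
  refine ⟨S, h1, h2, ?_, fun c => ⟨pointwiseApply (superpose (fderiv ℝ F) hDF.continuous
    (pairFun (x, u))) (Z (c, fderiv ℝ S 0 c)), fun t => ?_, ?_⟩, fun c => ?_⟩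
  · filter_upwards [h3] with c hc
    rw [hZ] at hc
    refine hc.trans ?_
    rw [map_add]
    rfl
  · change fderiv ℝ F (PF (x, u) t) (PF (fderiv ℝ S 0 c, c.2) t) = _
    simp [PF]
  · have := h4 c
    rw [fderiv_superpose hT hF] at this
    exact this
  · obtain ⟨r, hr1, hr2⟩ := fderiv_fderiv_superpose hT hF (pairFun (x, u)) (Z (c, fderiv ℝ S 0 c))
    have := h5 c
    rw [hr2, fderiv_superpose hT hF, ContinuousLinearMap.comp_apply, ← map_add] at this
    refine ⟨_, fun t => ?_, this⟩
    rw [ContinuousMap.add_apply, hr1]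
    change fderiv ℝ F (PF (x, u) t) (PF (fderiv ℝ (fderiv ℝ S) 0 c c, 0) t) +
      fderiv ℝ (fderiv ℝ F) (PF (x, u) t) (PF (fderiv ℝ S 0 c, c.2) t)
        (PF (fderiv ℝ S 0 c, c.2) t) = _
    simp [PF]

end SolutionMap

/-! ### Gradients and Jacobians in coordinates -/

section Jacobians

lemma grad_dotProduct {a : ℕ} (g : (Fin a → ℝ) → ℝ) (z b : Fin a → ℝ) :
    grad g z ⬝ᵥ b = fderiv ℝ g z b := by
  conv_rhs => rw [pi_eq_sum_univ' b, map_sum]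
  simp only [dotProduct, grad, map_smul, smul_eq_mul]
  exact Finset.sum_congr rfl fun i _ => mul_comm _ _

lemma jac_mulVec {a b : ℕ} (g : (Fin a → ℝ) → Fin b → ℝ) (z c : Fin a → ℝ) :
    jac g z *ᵥ c = fderiv ℝ g z c := by
  rw [jac, LinearMap.toMatrix'_mulVec]; rfl

/-- Pairing with a vector as a continuous linear functional, linear in the vector. -/
def dotL {a : ℕ} : (Fin a → ℝ) →L[ℝ] (Fin a → ℝ) →L[ℝ] ℝ :=
  LinearMap.toContinuousLinearMap
    (LinearMap.toContinuousLinearMap.toLinearMap ∘ₗ (dotProductBilin ℝ ℝ))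

@[simp] lemma dotL_apply {a : ℕ} (p b : Fin a → ℝ) : dotL p b = p ⬝ᵥ b := rfl

variable {a a' k : ℕ} {Z : Type} [NormedAddCommGroup Z] [NormedSpace ℝ Z] {F : Z → Fin k → ℝ}

lemma fderiv_dotProduct_comp (hF : ContDiff ℝ 2 F) (p : Fin k → ℝ) {s : (Fin a → ℝ) → Z}
    {ι : (Fin a → ℝ) →L[ℝ] Z} (hs : ∀ x, HasFDerivAt s ι x) (x b : Fin a → ℝ) :
    fderiv ℝ (fun x' => p ⬝ᵥ F (s x')) x b = p ⬝ᵥ fderiv ℝ F (s x) (ι b) := by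
  have h1 := (dotL p).hasFDerivAt.comp x
    (((hF.differentiable (by norm_num) (s x)).hasFDerivAt).comp x (hs x))
  have h2 : HasFDerivAt (fun x' => p ⬝ᵥ F (s x')) _ x := h1
  rw [h2.fderiv]
  rfl

/-- One formula for all second derivatives of the Hamiltonian. The slices `s y` free the variable
differentiated first and all have the same derivative `ι`. The point `r y` at which the gradient is
taken may move with `y`, as it does when both derivatives are in the same variable. -/
lemma dotProduct_jac_grad (hF : ContDiff ℝ 2 F) (p : Fin k → ℝ)
    {s : (Fin a' → ℝ) → (Fin a → ℝ) → Z} {ι : (Fin a → ℝ) →L[ℝ] Z} {ι' : (Fin a' → ℝ) →L[ℝ] Z}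
    {r : (Fin a' → ℝ) → Fin a → ℝ} {y : Fin a' → ℝ}
    (hs : ∀ y x, HasFDerivAt (s y) ι x) {s' : (Fin a' → ℝ) → Z} (hs' : HasFDerivAt s' ι' y)
    (hr : ∀ y, s y (r y) = s' y) (b : Fin a → ℝ) (c : Fin a' → ℝ) :
    b ⬝ᵥ jac (fun y => grad (fun x => p ⬝ᵥ F (s y x)) (r y)) y *ᵥ c =
      p ⬝ᵥ fderiv ℝ (fderiv ℝ F) (s' y) (ι' c) (ι b) := by
  have hg : (fun y => grad (fun x => p ⬝ᵥ F (s y x)) (r y)) =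
      fun y i => p ⬝ᵥ fderiv ℝ F (s' y) (ι (Pi.single i 1)) := by
    funext y i
    rw [grad, fderiv_dotProduct_comp hF p (hs y), hr]
  have hD : HasFDerivAt (fderiv ℝ F) (fderiv ℝ (fderiv ℝ F) (s' y)) (s' y) :=
    ((hF.fderiv_right (m := 1) (by norm_num)).differentiable one_ne_zero _).hasFDerivAt
  have h1 : ∀ b, HasFDerivAt (fun y => p ⬝ᵥ fderiv ℝ F (s' y) (ι b))
      ((dotL p).comp ((ContinuousLinearMap.apply ℝ (Fin k → ℝ) (ι b)).comp
        ((fderiv ℝ (fderiv ℝ F) (s' y)).comp ι'))) y := fun b =>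
    (dotL p).hasFDerivAt.comp y ((ContinuousLinearMap.apply ℝ (Fin k → ℝ) (ι b)).hasFDerivAt.comp y
      (hD.comp y hs'))
  rw [jac_mulVec, hg, (hasFDerivAt_pi.2 fun i => h1 (Pi.single i 1)).fderiv]
  conv_rhs => rw [pi_eq_sum_univ' b, map_sum, map_sum, dotProduct_sum]
  simp only [dotProduct, ContinuousLinearMap.pi_apply, map_smul]
  refine Finset.sum_congr rfl fun i _ => ?_
  simp [dotProduct, Finset.mul_sum]
  exact Finset.sum_congr rfl fun i _ => by ring

end Jacobians

/-! ### Derivatives of the dynamics and of the Hamiltonian -/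

namespace ControlProblem

variable {n l m dφ dη : ℕ} (P : ControlProblem n l m dφ dη) (w : StateControl n l m)
  (lam : Multiplier n dφ dη)

/-- The dynamics as a function of one variable. -/
def Fz (z : (Fin n → ℝ) × (Fin l → ℝ) × (Fin m → ℝ)) : Fin n → ℝ := P.F z.1 z.2.1 z.2.2

/-- The value of a process at time `t`. -/
def _root_.StateControl.pt (w : StateControl n l m) (t : ℝ) :
    (Fin n → ℝ) × (Fin l → ℝ) × (Fin m → ℝ) := (w.x t, w.u t, w.v t)

/-- The embedding of the states. -/
def ιx : (Fin n → ℝ) →L[ℝ] (Fin n → ℝ) × (Fin l → ℝ) × (Fin m → ℝ) := .inl ℝ _ _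

/-- The embedding of the nonlinear controls. -/
def ιu : (Fin l → ℝ) →L[ℝ] (Fin n → ℝ) × (Fin l → ℝ) × (Fin m → ℝ) :=
  (ContinuousLinearMap.inr ℝ _ _).comp (.inl ℝ _ _)

/-- The embedding of the affine controls. -/
def ιv : (Fin m → ℝ) →L[ℝ] (Fin n → ℝ) × (Fin l → ℝ) × (Fin m → ℝ) :=
  (ContinuousLinearMap.inr ℝ _ _).comp (.inr ℝ _ _)

@[simp] lemma ιx_apply (a : Fin n → ℝ) : ιx (l := l) (m := m) a = (a, 0, 0) := rfl
@[simp] lemma ιu_apply (a : Fin l → ℝ) : ιu (n := n) (m := m) a = (0, a, 0) := rfl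
@[simp] lemma ιv_apply (a : Fin m → ℝ) : ιv (n := n) (l := l) a = (0, 0, a) := rfl

lemma hasFDerivAt_sliceX (u : Fin l → ℝ) (v : Fin m → ℝ) (x : Fin n → ℝ) :
    HasFDerivAt (fun x => (x, u, v)) (ιx (n := n) (l := l) (m := m)) x := by
  simpa using ((ιx (n := n) (l := l) (m := m)).hasFDerivAt (x := x)).const_add (0, u, v)

lemma hasFDerivAt_sliceU (x : Fin n → ℝ) (v : Fin m → ℝ) (u : Fin l → ℝ) :
    HasFDerivAt (fun u => (x, u, v)) (ιu (n := n) (l := l) (m := m)) u := by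
  simpa using ((ιu (n := n) (l := l) (m := m)).hasFDerivAt (x := u)).const_add (x, 0, v)

lemma hasFDerivAt_sliceV (x : Fin n → ℝ) (u : Fin l → ℝ) (v : Fin m → ℝ) :
    HasFDerivAt (fun v => (x, u, v)) (ιv (n := n) (l := l) (m := m)) v := by
  simpa using ((ιv (n := n) (l := l) (m := m)).hasFDerivAt (x := v)).const_add (x, u, 0)

variable {P} (hreg : P.IsRegular)
include hreg

lemma contDiff_Fz : ContDiff ℝ 2 P.Fz := by
  have h : ∀ i, ContDiff ℝ 2 (P.f i) := fun i => (hreg.1 i).1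
  unfold Fz F
  refine ((h 0).comp (contDiff_fst.prodMk (contDiff_fst.comp contDiff_snd))).add
    (ContDiff.sum fun i _ => ContDiff.fun_smul ?_
      ((h i.succ).comp (contDiff_fst.prodMk (contDiff_fst.comp contDiff_snd))))
  exact (contDiff_apply ℝ ℝ i).comp (contDiff_snd.comp contDiff_snd)

lemma gradHx_dotProduct (p x : Fin n → ℝ) (u : Fin l → ℝ) (v : Fin m → ℝ) (b : Fin n → ℝ) :
    P.gradHx p x u v ⬝ᵥ b = p ⬝ᵥ fderiv ℝ P.Fz (x, u, v) (ιx b) :=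
  (grad_dotProduct _ _ _).trans
    (fderiv_dotProduct_comp (contDiff_Fz hreg) p (hasFDerivAt_sliceX u v) x b)

lemma gradHu_dotProduct (p x : Fin n → ℝ) (u : Fin l → ℝ) (v : Fin m → ℝ) (b : Fin l → ℝ) :
    P.gradHu p x u v ⬝ᵥ b = p ⬝ᵥ fderiv ℝ P.Fz (x, u, v) (ιu b) :=
  (grad_dotProduct _ _ _).trans
    (fderiv_dotProduct_comp (contDiff_Fz hreg) p (hasFDerivAt_sliceU x v) u b)

lemma gradHv_dotProduct (p x : Fin n → ℝ) (u : Fin l → ℝ) (v : Fin m → ℝ) (b : Fin m → ℝ) :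
    P.gradHv p x u v ⬝ᵥ b = p ⬝ᵥ fderiv ℝ P.Fz (x, u, v) (ιv b) :=
  (grad_dotProduct _ _ _).trans
    (fderiv_dotProduct_comp (contDiff_Fz hreg) p (hasFDerivAt_sliceV x u) v b)

lemma Fx_mulVec (t : ℝ) (b : Fin n → ℝ) : P.Fx w t *ᵥ b = fderiv ℝ P.Fz (w.pt t) (ιx b) := by
  have h : HasFDerivAt (P.Fz ∘ fun x => (x, w.u t, w.v t)) _ (w.x t) :=
    ((contDiff_Fz hreg).differentiable (by norm_num) (w.pt t)).hasFDerivAt.comp (w.x t)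
      (hasFDerivAt_sliceX _ _ _)
  rw [Fx, jac_mulVec]
  exact DFunLike.congr_fun h.fderiv b

lemma Fu_mulVec (t : ℝ) (b : Fin l → ℝ) : P.Fu w t *ᵥ b = fderiv ℝ P.Fz (w.pt t) (ιu b) := by
  have h : HasFDerivAt (P.Fz ∘ fun u => (w.x t, u, w.v t)) _ (w.u t) :=
    ((contDiff_Fz hreg).differentiable (by norm_num) (w.pt t)).hasFDerivAt.comp (w.u t)
      (hasFDerivAt_sliceU _ _ _)
  rw [Fu, jac_mulVec]
  exact DFunLike.congr_fun h.fderiv b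

lemma Fv_mulVec (t : ℝ) (b : Fin m → ℝ) : P.Fv w t *ᵥ b = fderiv ℝ P.Fz (w.pt t) (ιv b) := by
  have h : HasFDerivAt (P.Fz ∘ fun v => (w.x t, w.u t, v)) _ (w.v t) :=
    ((contDiff_Fz hreg).differentiable (by norm_num) (w.pt t)).hasFDerivAt.comp (w.v t)
      (hasFDerivAt_sliceV _ _ _)
  rw [Fv, jac_mulVec]
  exact DFunLike.congr_fun h.fderiv b

lemma Fx_add_Fu_add_Fv (t : ℝ) (a : Fin n → ℝ) (b : Fin l → ℝ) (c : Fin m → ℝ) :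
    P.Fx w t *ᵥ a + P.Fu w t *ᵥ b + P.Fv w t *ᵥ c = fderiv ℝ P.Fz (w.pt t) (a, b, c) := by
  rw [Fx_mulVec w hreg, Fu_mulVec w hreg, Fv_mulVec w hreg, ← map_add, ← map_add]
  simp

lemma dotProduct_Hxx (t : ℝ) (b c : Fin n → ℝ) : b ⬝ᵥ P.Hxx w lam t *ᵥ c =
    lam.2.2 t ⬝ᵥ fderiv ℝ (fderiv ℝ P.Fz) (w.pt t) (ιx c) (ιx b) :=
  dotProduct_jac_grad (contDiff_Fz hreg) _ (s := fun _ x => (x, w.u t, w.v t)) (r := fun x => x)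
    (s' := fun x => (x, w.u t, w.v t)) (fun _ => hasFDerivAt_sliceX _ _) (hasFDerivAt_sliceX _ _ _)
    (fun _ => rfl) _ _

lemma dotProduct_Hux (t : ℝ) (b : Fin l → ℝ) (c : Fin n → ℝ) : b ⬝ᵥ P.Hux w lam t *ᵥ c =
    lam.2.2 t ⬝ᵥ fderiv ℝ (fderiv ℝ P.Fz) (w.pt t) (ιx c) (ιu b) :=
  dotProduct_jac_grad (contDiff_Fz hreg) _ (s := fun x u => (x, u, w.v t)) (r := fun _ => w.u t)
    (s' := fun x => (x, w.u t, w.v t)) (fun _ => hasFDerivAt_sliceU _ _) (hasFDerivAt_sliceX _ _ _)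
    (fun _ => rfl) _ _

lemma dotProduct_Hvx (t : ℝ) (b : Fin m → ℝ) (c : Fin n → ℝ) : b ⬝ᵥ P.Hvx w lam t *ᵥ c =
    lam.2.2 t ⬝ᵥ fderiv ℝ (fderiv ℝ P.Fz) (w.pt t) (ιx c) (ιv b) :=
  dotProduct_jac_grad (contDiff_Fz hreg) _ (s := fun x v => (x, w.u t, v)) (r := fun _ => w.v t)
    (s' := fun x => (x, w.u t, w.v t)) (fun _ => hasFDerivAt_sliceV _ _) (hasFDerivAt_sliceX _ _ _)
    (fun _ => rfl) _ _

lemma dotProduct_Huu (t : ℝ) (b c : Fin l → ℝ) : b ⬝ᵥ P.Huu w lam t *ᵥ c =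
    lam.2.2 t ⬝ᵥ fderiv ℝ (fderiv ℝ P.Fz) (w.pt t) (ιu c) (ιu b) :=
  dotProduct_jac_grad (contDiff_Fz hreg) _ (s := fun _ u => (w.x t, u, w.v t)) (r := fun u => u)
    (s' := fun u => (w.x t, u, w.v t)) (fun _ => hasFDerivAt_sliceU _ _) (hasFDerivAt_sliceU _ _ _)
    (fun _ => rfl) _ _

lemma dotProduct_Hvu (t : ℝ) (b : Fin m → ℝ) (c : Fin l → ℝ) : b ⬝ᵥ P.Hvu w lam t *ᵥ c =
    lam.2.2 t ⬝ᵥ fderiv ℝ (fderiv ℝ P.Fz) (w.pt t) (ιu c) (ιv b) :=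
  dotProduct_jac_grad (contDiff_Fz hreg) _ (s := fun u v => (w.x t, u, v)) (r := fun _ => w.v t)
    (s' := fun u => (w.x t, u, w.v t)) (fun _ => hasFDerivAt_sliceV _ _) (hasFDerivAt_sliceU _ _ _)
    (fun _ => rfl) _ _

omit hreg in
lemma Fv_apply (t : ℝ) (i : Fin n) (j : Fin m) : P.Fv w t i j = P.f j.succ (w.x t, w.u t) i := by
  have h : HasFDerivAt (fun v : Fin m → ℝ => P.F (w.x t) (w.u t) v)
      (0 + ∑ i, (ContinuousLinearMap.proj (R := ℝ) (φ := fun _ : Fin m => ℝ) i).smulRight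
        (P.f i.succ (w.x t, w.u t))) (w.v t) := by
    refine (hasFDerivAt_const _ _).add (HasFDerivAt.fun_sum fun i _ => ?_)
    exact ((ContinuousLinearMap.proj (R := ℝ) (φ := fun _ : Fin m => ℝ) i).hasFDerivAt).smul_const
      (P.f i.succ (w.x t, w.u t))
  rw [Fv, jac, h.fderiv, LinearMap.toMatrix'_apply]
  simp only [Pi.single_apply, zero_add, ContinuousLinearMap.coe_coe, _root_.sum_apply,
    ContinuousLinearMap.smulRight_apply, ContinuousLinearMap.proj_apply, ite_smul, one_smul,
    zero_smul, Finset.sum_ite_eq', Finset.mem_univ, if_true]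

omit hreg in
lemma fderiv_Fz_ιv (z : (Fin n → ℝ) × (Fin l → ℝ) × (Fin m → ℝ)) (hreg : P.IsRegular)
    (a : Fin m → ℝ) :
    fderiv ℝ P.Fz z (ιv a) = ∑ i, a i • P.f i.succ (z.1, z.2.1) := by
  have h := Fv_mulVec (P := P) (⟨fun _ => z.1, fun _ => z.2.1, fun _ => z.2.2⟩ : StateControl n l m)
    hreg 0 a
  refine h.symm.trans ?_
  funext i
  simp only [mulVec, dotProduct, Fv_apply, Finset.sum_apply, Pi.smul_apply, smul_eq_mul]
  exact Finset.sum_congr rfl fun i _ => mul_comm _ _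

/-- The dynamics are affine in `v`, so a derivative in the direction of `v` is a combination of the
`f i` at `(x, u)`. Consequently `H_vv = 0`, and `H_vx` contains only first derivatives of the data,
which makes it continuously differentiable in time. -/
lemma fderiv_fderiv_Fz_ιv (z z' : (Fin n → ℝ) × (Fin l → ℝ) × (Fin m → ℝ)) (a : Fin m → ℝ) :
    fderiv ℝ (fderiv ℝ P.Fz) z z' (ιv a) =
      ∑ i, a i • fderiv ℝ (P.f i.succ) (z.1, z.2.1) (z'.1, z'.2.1) := by
  have hD : HasFDerivAt (fderiv ℝ P.Fz) (fderiv ℝ (fderiv ℝ P.Fz) z) z :=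
    (((contDiff_Fz hreg).fderiv_right (m := 1) (by norm_num)).differentiable one_ne_zero
      _).hasFDerivAt
  have h1 : HasFDerivAt (fun z => fderiv ℝ P.Fz z (ιv a)) _ z :=
    (ContinuousLinearMap.apply ℝ (Fin n → ℝ) (ιv a)).hasFDerivAt.comp z hD
  have h2 : HasFDerivAt (fun z => fderiv ℝ P.Fz z (ιv a))
      (∑ i, a i • (fderiv ℝ (P.f i.succ) (z.1, z.2.1)).comp ((ContinuousLinearMap.fst ℝ _ _).prod
        ((ContinuousLinearMap.fst ℝ _ _).comp (ContinuousLinearMap.snd ℝ _ _)))) z := by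
    simp only [fun z => fderiv_Fz_ιv z hreg a]
    refine HasFDerivAt.fun_sum fun i _ => HasFDerivAt.const_smul ?_ (a i)
    exact (((hreg.1 i.succ).1.differentiable (by norm_num)
      (z.1, z.2.1)).hasFDerivAt).comp (f := fun z : (Fin n → ℝ) × (Fin l → ℝ) × (Fin m → ℝ) =>
        (z.1, z.2.1)) z
      (hasFDerivAt_fst.prodMk (hasFDerivAt_fst.comp z hasFDerivAt_snd))
  have h3 := DFunLike.congr_fun (h1.unique h2) z'
  simpa using h3

lemma Hvx_apply (t : ℝ) (i : Fin m) (j : Fin n) : P.Hvx w lam t i j =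
    lam.2.2 t ⬝ᵥ fderiv ℝ (P.f i.succ) (w.x t, w.u t) (Pi.single j 1, 0) := by
  have h := dotProduct_Hvx (P := P) w lam hreg t (Pi.single i 1) (Pi.single j 1)
  rw [fderiv_fderiv_Fz_ιv hreg] at h
  simpa [Pi.single_apply, StateControl.pt] using h

lemma fderiv_fderiv_Fz_comm (z a b : (Fin n → ℝ) × (Fin l → ℝ) × (Fin m → ℝ)) :
    fderiv ℝ (fderiv ℝ P.Fz) z a b = fderiv ℝ (fderiv ℝ P.Fz) z b a :=
  ((contDiff_Fz hreg).contDiffAt.isSymmSndFDerivAt (by simp)).eq a b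

/-- The integrand of the second variation is the second derivative of the Hamiltonian. -/
lemma Omega_integrand (t : ℝ) (a : Fin n → ℝ) (b : Fin l → ℝ) (c : Fin m → ℝ) :
    (1 / 2) * (a ⬝ᵥ P.Hxx w lam t *ᵥ a) + b ⬝ᵥ P.Hux w lam t *ᵥ a +
        c ⬝ᵥ P.Hvx w lam t *ᵥ a + (1 / 2) * (b ⬝ᵥ P.Huu w lam t *ᵥ b) +
        c ⬝ᵥ P.Hvu w lam t *ᵥ b =
      (1 / 2) * (lam.2.2 t ⬝ᵥ fderiv ℝ (fderiv ℝ P.Fz) (w.pt t) (a, b, c) (a, b, c)) := by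
  have h0 : (a, b, c) = ιx a + ιu b + ιv c := by simp
  -- This is `H_vv = 0`, the reason why the second variation has no term quadratic in `v`.
  have h1 : fderiv ℝ (fderiv ℝ P.Fz) (w.pt t) (ιv c) (ιv c) = 0 := by
    rw [fderiv_fderiv_Fz_ιv hreg]
    refine Finset.sum_eq_zero fun i _ => ?_
    have : (((ιv c : (Fin n → ℝ) × (Fin l → ℝ) × (Fin m → ℝ))).1,
      ((ιv c : (Fin n → ℝ) × (Fin l → ℝ) × (Fin m → ℝ))).2.1) = 0 := rfl
    rw [this, map_zero, smul_zero]
  rw [h0, dotProduct_Hxx w lam hreg, dotProduct_Hux w lam hreg, dotProduct_Hvx w lam hreg,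
    dotProduct_Huu w lam hreg, dotProduct_Hvu w lam hreg]
  simp only [map_add, _root_.add_apply, dotProduct_add, h1, dotProduct_zero]
  rw [fderiv_fderiv_Fz_comm hreg _ (ιu b) (ιx a), fderiv_fderiv_Fz_comm hreg _ (ιv c) (ιx a),
    fderiv_fderiv_Fz_comm hreg _ (ιv c) (ιu b)]
  ring

end ControlProblem

/-! ### Square-integrable functions and strong convergence -/

section SquareIntegrable

variable {T : ℝ} {Z Y : Type} [NormedAddCommGroup Z] [NormedSpace ℝ Z] [NormedAddCommGroup Y]
  [NormedSpace ℝ Y] {G : Type} [NormedAddCommGroup G] [NormedSpace ℝ G]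

lemma intervalIntegral_eq_timeMeasure (hT : 0 ≤ T) (f : ℝ → G) :
    ∫ t in (0 : ℝ)..T, f t = ∫ t, f t ∂timeMeasure T := by
  rw [intervalIntegral.integral_of_le hT, integral_Icc_eq_integral_Ioc]

lemma intervalIntegrable_iff_timeMeasure (hT : 0 ≤ T) (f : ℝ → G) :
    IntervalIntegrable f volume 0 T ↔ Integrable f (timeMeasure T) :=
  intervalIntegrable_iff_integrableOn_Icc_of_le hT

lemma ae_timeMeasure_of_Icc {p : ℝ → Prop} (h : ∀ t ∈ Icc 0 T, p t) : ∀ᵐ t ∂timeMeasure T, p t :=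
  (ae_restrict_iff' measurableSet_Icc).2 (ae_of_all _ h)

lemma ae_timeMeasure_of_Ioo {p : ℝ → Prop} (h : ∀ t ∈ Ioo 0 T, p t) :
    ∀ᵐ t ∂timeMeasure T, p t := by
  rw [timeMeasure, restrict_Ioo_eq_restrict_Icc.symm]
  exact (ae_restrict_iff' measurableSet_Ioo).2 (ae_of_all _ h)

/-- The norm of `L²(0, T)`. -/
def l2norm (T : ℝ) (z : ℝ → Z) : ℝ := √(∫ t in (0 : ℝ)..T, ‖z t‖ ^ 2)

lemma l2norm_nonneg (z : ℝ → Z) : 0 ≤ l2norm T z := Real.sqrt_nonneg _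

lemma sq_l2norm (hT : 0 ≤ T) (z : ℝ → Z) : l2norm T z ^ 2 = ∫ t in (0 : ℝ)..T, ‖z t‖ ^ 2 :=
  Real.sq_sqrt (intervalIntegral.integral_nonneg hT fun _ _ => by positivity)

lemma ContinuousOn.memLp_timeMeasure {p : ENNReal} {f : ℝ → G} (hf : ContinuousOn f (Icc 0 T)) :
    MemLp f p (timeMeasure T) := by
  obtain ⟨C, hC⟩ := isCompact_Icc.exists_bound_of_continuousOn hf
  refine MemLp.mono_exponent (q := ⊤) ?_ le_top
  exact memLp_top_of_bound (hf.aestronglyMeasurable measurableSet_Icc) C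
    (ae_timeMeasure_of_Icc hC)

lemma integral_norm_mul_norm_le (hT : 0 ≤ T) {z : ℝ → Z} {y : ℝ → Y}
    (hz : MemLp z 2 (timeMeasure T)) (hy : MemLp y 2 (timeMeasure T)) :
    Integrable (fun t => ‖z t‖ * ‖y t‖) (timeMeasure T) ∧
      ∫ t in (0 : ℝ)..T, ‖z t‖ * ‖y t‖ ≤ l2norm T z * l2norm T y := by
  refine ⟨hz.norm.integrable_mul hy.norm, ?_⟩
  have h := integral_mul_le_Lp_mul_Lq_of_nonneg (μ := timeMeasure T) Real.HolderConjugate.two_two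
    (f := fun t => ‖z t‖) (g := fun t => ‖y t‖) (ae_of_all _ fun _ => norm_nonneg _)
    (ae_of_all _ fun _ => norm_nonneg _) (by simpa using hz.norm) (by simpa using hy.norm)
  simp only [Real.rpow_two] at h
  rw [intervalIntegral_eq_timeMeasure hT, l2norm, l2norm, intervalIntegral_eq_timeMeasure hT,
    intervalIntegral_eq_timeMeasure hT, Real.sqrt_eq_rpow, Real.sqrt_eq_rpow]
  exact h

lemma integral_norm_le (hT : 0 ≤ T) {z : ℝ → Z} (hz : MemLp z 2 (timeMeasure T)) :
    ∫ t in (0 : ℝ)..T, ‖z t‖ ≤ √T * l2norm T z := by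
  have h := (integral_norm_mul_norm_le hT (continuousOn_const (c := (1 : ℝ))).memLp_timeMeasure
    hz).2
  simpa [l2norm] using h

lemma aestronglyMeasurable_clm_apply {A : ℝ → Z →L[ℝ] Y} (hA : ContinuousOn A (Icc 0 T)) {z : ℝ → Z}
    (hz : AEStronglyMeasurable z (timeMeasure T)) :
    AEStronglyMeasurable (fun t => A t (z t)) (timeMeasure T) :=
  (ContinuousLinearMap.id ℝ (Z →L[ℝ] Y)).aestronglyMeasurable_comp₂
    (hA.aestronglyMeasurable measurableSet_Icc) hz

lemma MemLp.clm_apply_continuousOn {A : ℝ → Z →L[ℝ] Y} (hA : ContinuousOn A (Icc 0 T)) {z : ℝ → Z}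
    {p : ENNReal} (hz : MemLp z p (timeMeasure T)) :
    MemLp (fun t => A t (z t)) p (timeMeasure T) := by
  obtain ⟨C, hC⟩ := isCompact_Icc.exists_bound_of_continuousOn hA
  refine MemLp.of_le_mul (c := C) hz (aestronglyMeasurable_clm_apply hA hz.1)
    (ae_timeMeasure_of_Icc fun t ht => ?_)
  exact (A t).le_of_opNorm_le (hC t ht) _

lemma integrable_bilin {q : ℝ → Z →L[ℝ] Y →L[ℝ] ℝ} (hq : ContinuousOn q (Icc 0 T)) {z : ℝ → Z}
    {y : ℝ → Y} (hz : MemLp z 2 (timeMeasure T)) (hy : MemLp y 2 (timeMeasure T)) :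
    Integrable (fun t => q t (z t) (y t)) (timeMeasure T) := by
  have h1 := MemLp.clm_apply_continuousOn hq hz
  have h2 := (ContinuousLinearMap.id ℝ (Y →L[ℝ] ℝ)).memLp_of_bilin (p := 2) (q := 2) 1 h1 hy
  exact memLp_one_iff_integrable.1 h2

lemma abs_integral_bilin_le (hT : 0 ≤ T) {q : ℝ → Z →L[ℝ] Y →L[ℝ] ℝ} {C : ℝ}
    (hC : ∀ t ∈ Icc 0 T, ‖q t‖ ≤ C) {z : ℝ → Z} {y : ℝ → Y} (hz : MemLp z 2 (timeMeasure T))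
    (hy : MemLp y 2 (timeMeasure T)) :
    |∫ t in (0 : ℝ)..T, q t (z t) (y t)| ≤ C * (l2norm T z * l2norm T y) := by
  obtain ⟨h1, h2⟩ := integral_norm_mul_norm_le hT hz hy
  have hC0 : 0 ≤ C := le_trans (ContinuousLinearMap.opNorm_nonneg (q 0)) (hC 0 ⟨le_rfl, hT⟩)
  calc |∫ t in (0 : ℝ)..T, q t (z t) (y t)| ≤ ∫ t in (0 : ℝ)..T, C * (‖z t‖ * ‖y t‖) := by
        rw [← Real.norm_eq_abs]
        refine intervalIntegral.norm_integral_le_of_norm_le hT (ae_of_all _ fun t ht => ?_)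
          (((intervalIntegrable_iff_timeMeasure hT _).2 h1).const_mul C)
        calc ‖q t (z t) (y t)‖ ≤ ‖q t‖ * ‖z t‖ * ‖y t‖ := ContinuousLinearMap.le_opNorm₂ (q t) _ _
          _ ≤ C * ‖z t‖ * ‖y t‖ := mul_le_mul_of_nonneg_right
            (mul_le_mul_of_nonneg_right (hC t ⟨ht.1.le, ht.2⟩) (norm_nonneg _)) (norm_nonneg _)
          _ = _ := by ring
    _ ≤ _ := by
        rw [intervalIntegral.integral_const_mul]
        exact mul_le_mul_of_nonneg_left h2 hC0

/-- Convergence in `L²(0, T)`. -/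
structure L2Tendsto (T : ℝ) (z : ℕ → ℝ → Z) (z' : ℝ → Z) : Prop where
  mem : ∀ k, MemLp (z k) 2 (timeMeasure T)
  mem' : MemLp z' 2 (timeMeasure T)
  lim : Tendsto (fun k => l2norm T (z k - z')) atTop (𝓝 0)

lemma L2Tendsto.of_bound {z : ℕ → ℝ → Z} {z' : ℝ → Z} {y : ℕ → ℝ → Y} {y' : ℝ → Y} (hT : 0 ≤ T)
    (hy : L2Tendsto T y y') (hz : ∀ k, MemLp (z k) 2 (timeMeasure T))
    (hz' : MemLp z' 2 (timeMeasure T)) {C : ℝ} (hC : 0 ≤ C)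
    (h : ∀ k, ∀ t ∈ Icc 0 T, ‖z k t - z' t‖ ≤ C * ‖y k t - y' t‖) : L2Tendsto T z z' := by
  refine ⟨hz, hz', squeeze_zero (fun _ => l2norm_nonneg _) (fun k => ?_)
    (by simpa using hy.lim.const_mul C)⟩
  rw [← Real.sqrt_sq hC, l2norm, l2norm, ← Real.sqrt_mul (sq_nonneg C),
    ← intervalIntegral.integral_const_mul]
  refine Real.sqrt_le_sqrt (intervalIntegral.integral_mono_on hT ?_ ?_ fun t ht => ?_)
  · exact (intervalIntegrable_iff_timeMeasure hT _).2 (((hz k).sub hz').integrable_norm_pow (by simp))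
  · exact ((intervalIntegrable_iff_timeMeasure hT _).2
      (((hy.mem k).sub hy.mem').integrable_norm_pow (by simp))).const_mul _
  · rw [← mul_pow]
    exact pow_le_pow_left₀ (norm_nonneg _) (h k t ht) 2

lemma L2Tendsto.clm_apply {z : ℕ → ℝ → Z} {z' : ℝ → Z} (hT : 0 ≤ T) (hz : L2Tendsto T z z')
    {A : ℝ → Z →L[ℝ] Y} (hA : ContinuousOn A (Icc 0 T)) :
    L2Tendsto T (fun k t => A t (z k t)) (fun t => A t (z' t)) := by
  obtain ⟨C, hC⟩ := isCompact_Icc.exists_bound_of_continuousOn hA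
  refine hz.of_bound hT (fun k => MemLp.clm_apply_continuousOn hA (hz.mem k))
    (MemLp.clm_apply_continuousOn hA hz.mem') ((norm_nonneg _).trans (hC 0 ⟨le_rfl, hT⟩))
    fun k t ht => ?_
  rw [← map_sub]
  exact (A t).le_of_opNorm_le (hC t ht) _

lemma l2norm_add_sq_le (hT : 0 ≤ T) {z y : ℝ → Z} (hz : MemLp z 2 (timeMeasure T))
    (hy : MemLp y 2 (timeMeasure T)) :
    l2norm T (z + y) ^ 2 ≤ 2 * l2norm T z ^ 2 + 2 * l2norm T y ^ 2 := by
  rw [sq_l2norm hT, sq_l2norm hT, sq_l2norm hT, ← intervalIntegral.integral_const_mul,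
    ← intervalIntegral.integral_const_mul]
  have i1 := (intervalIntegrable_iff_timeMeasure hT _).2 (hz.integrable_norm_pow (p := 2) (by simp))
  have i2 := (intervalIntegrable_iff_timeMeasure hT _).2 (hy.integrable_norm_pow (p := 2) (by simp))
  have i3 := (intervalIntegrable_iff_timeMeasure hT _).2
    ((hz.add hy).integrable_norm_pow (p := 2) (by simp))
  rw [← intervalIntegral.integral_add (i1.const_mul 2) (i2.const_mul 2)]
  refine intervalIntegral.integral_mono_on hT i3 ((i1.const_mul 2).add (i2.const_mul 2))
    fun t _ => ?_
  have := norm_add_le (z t) (y t)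
  simp only [Pi.add_apply]
  nlinarith [norm_nonneg (z t + y t), sq_nonneg (‖z t‖ - ‖y t‖), norm_nonneg (z t), norm_nonneg (y t)]

lemma L2Tendsto.of_sq {z : ℕ → ℝ → Z} {z' : ℝ → Z} (hz : ∀ k, MemLp (z k) 2 (timeMeasure T))
    (hz' : MemLp z' 2 (timeMeasure T))
    (h : Tendsto (fun k => l2norm T (z k - z') ^ 2) atTop (𝓝 0)) : L2Tendsto T z z' :=
  ⟨hz, hz', by simpa [Real.sqrt_sq (l2norm_nonneg _)] using h.sqrt⟩

lemma L2Tendsto.add {z y : ℕ → ℝ → Z} {z' y' : ℝ → Z} (hT : 0 ≤ T) (hz : L2Tendsto T z z')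
    (hy : L2Tendsto T y y') : L2Tendsto T (fun k => z k + y k) (z' + y') := by
  refine L2Tendsto.of_sq (fun k => (hz.mem k).add (hy.mem k)) (hz.mem'.add hy.mem')
    (squeeze_zero (fun _ => sq_nonneg _) (fun k => ?_)
      (by simpa using ((hz.lim.pow 2).const_mul 2).add ((hy.lim.pow 2).const_mul 2)))
  have := l2norm_add_sq_le hT ((hz.mem k).sub hz.mem') ((hy.mem k).sub hy.mem')
  rwa [show z k - z' + (y k - y') = z k + y k - (z' + y') by abel] at this

lemma L2Tendsto.clm {z : ℕ → ℝ → Z} {z' : ℝ → Z} (hT : 0 ≤ T) (hz : L2Tendsto T z z')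
    (A : Z →L[ℝ] Y) : L2Tendsto T (fun k t => A (z k t)) (fun t => A (z' t)) :=
  hz.clm_apply hT continuousOn_const

lemma L2Tendsto.prodMk {z : ℕ → ℝ → Z} {z' : ℝ → Z} {y : ℕ → ℝ → Y} {y' : ℝ → Y} (hT : 0 ≤ T)
    (hz : L2Tendsto T z z') (hy : L2Tendsto T y y') :
    L2Tendsto T (fun k t => (z k t, y k t)) (fun t => (z' t, y' t)) := by
  have := (hz.clm hT (ContinuousLinearMap.inl ℝ Z Y)).add hT (hy.clm hT (ContinuousLinearMap.inr ℝ Z Y))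
  convert this using 2
  · ext <;> simp
  · simp

lemma L2Tendsto.const {z : ℝ → Z} (hz : MemLp z 2 (timeMeasure T)) :
    L2Tendsto T (fun _ => z) z :=
  ⟨fun _ => hz, hz, by simp [l2norm]⟩

lemma L2Tendsto.of_uniform {z : ℕ → ℝ → Z} {z' : ℝ → Z} (hT : 0 ≤ T)
    (hz : ∀ k, ContinuousOn (z k) (Icc 0 T)) (hz' : ContinuousOn z' (Icc 0 T)) {b : ℕ → ℝ}
    (hb : Tendsto b atTop (𝓝 0)) (h : ∀ k, ∀ t ∈ Icc 0 T, ‖z k t - z' t‖ ≤ b k) :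
    L2Tendsto T z z' := by
  have hb0 : ∀ k, 0 ≤ b k := fun k => (norm_nonneg _).trans (h k 0 ⟨le_rfl, hT⟩)
  have hm : ∀ k, MemLp (fun _ : ℝ => b k) 2 (timeMeasure T) := fun k =>
    continuousOn_const.memLp_timeMeasure
  have h1 : L2Tendsto T (fun k _ => b k) (fun _ => 0) := by
    refine ⟨hm, continuousOn_const.memLp_timeMeasure, ?_⟩
    have h2 : Tendsto (fun k => √(T * b k ^ 2)) atTop (𝓝 0) := by
      simpa using ((hb.pow 2).const_mul T).sqrt
    refine h2.congr fun k => ?_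
    simp [l2norm]
  refine h1.of_bound hT (fun k => (hz k).memLp_timeMeasure) hz'.memLp_timeMeasure zero_le_one
    fun k t ht => ?_
  rw [sub_zero, one_mul, Real.norm_of_nonneg (hb0 k)]
  exact h k t ht

/-- The difference is expanded bilinearly around the limits, and each of the three pieces is bounded
by Cauchy–Schwarz with a uniform bound for `q` on the compact interval. -/
lemma L2Tendsto.integral_bilin {z : ℕ → ℝ → Z} {z' : ℝ → Z} {y : ℕ → ℝ → Y} {y' : ℝ → Y}
    (hT : 0 ≤ T) (hz : L2Tendsto T z z') (hy : L2Tendsto T y y') {q : ℝ → Z →L[ℝ] Y →L[ℝ] ℝ}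
    (hq : ContinuousOn q (Icc 0 T)) :
    Tendsto (fun k => ∫ t in (0 : ℝ)..T, q t (z k t) (y k t)) atTop
      (𝓝 (∫ t in (0 : ℝ)..T, q t (z' t) (y' t))) := by
  obtain ⟨C, hC⟩ := IsCompact.exists_bound_of_continuousOn
    (E := Z →L[ℝ] Y →L[ℝ] ℝ) isCompact_Icc hq
  rw [tendsto_iff_norm_sub_tendsto_zero]
  have hlim : Tendsto (fun k => C * (l2norm T (z k - z') * l2norm T (y k - y')) +
      C * (l2norm T (z k - z') * l2norm T y') + C * (l2norm T z' * l2norm T (y k - y'))) atTop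
      (𝓝 0) := by
    simpa using (((hz.lim.mul hy.lim).const_mul C).add ((hz.lim.mul_const _).const_mul C)).add
      ((hy.lim.const_mul _).const_mul C)
  refine squeeze_zero (fun _ => norm_nonneg _) (fun k => ?_) hlim
  have mz := (hz.mem k).sub hz.mem'
  have my := (hy.mem k).sub hy.mem'
  have hint : ∀ {a : ℝ → Z} {b : ℝ → Y}, MemLp a 2 (timeMeasure T) → MemLp b 2 (timeMeasure T) →
      IntervalIntegrable (fun t => q t (a t) (b t)) volume 0 T := fun ha hb =>
    (intervalIntegrable_iff_timeMeasure hT _).2 (integrable_bilin hq ha hb)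
  have hsplit : (∫ t in (0 : ℝ)..T, q t (z k t) (y k t)) - ∫ t in (0 : ℝ)..T, q t (z' t) (y' t) =
      (∫ t in (0 : ℝ)..T, q t ((z k - z') t) ((y k - y') t)) +
        (∫ t in (0 : ℝ)..T, q t ((z k - z') t) (y' t)) +
          ∫ t in (0 : ℝ)..T, q t (z' t) ((y k - y') t) := by
    rw [← intervalIntegral.integral_sub (hint (hz.mem k) (hy.mem k)) (hint hz.mem' hy.mem'),
      ← intervalIntegral.integral_add (hint mz my) (hint mz hy.mem'),
      ← intervalIntegral.integral_add ((hint mz my).add (hint mz hy.mem')) (hint hz.mem' my)]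
    congr 1
    ext t
    simp only [Pi.sub_apply, map_sub, _root_.sub_apply]
    ring
  rw [hsplit]
  refine (norm_add₃_le).trans (add_le_add (add_le_add ?_ ?_) ?_)
  · exact abs_integral_bilin_le hT hC mz my
  · exact abs_integral_bilin_le hT hC mz hy.mem'
  · exact abs_integral_bilin_le hT hC hz.mem' my

/-- Smooth functions are dense in `L²(0, T)`. -/
lemma exists_smooth_l2Tendsto [FiniteDimensional ℝ Z] (hT : 0 ≤ T) {z : ℝ → Z}
    (hz : MemLp z 2 (timeMeasure T)) :
    ∃ g : ℕ → ℝ → Z, (∀ k, ContDiff ℝ ∞ (g k)) ∧ L2Tendsto T g z := by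
  have h : ∀ k : ℕ, ∃ g : ℝ → Z, HasCompactSupport g ∧ ContDiff ℝ ∞ g ∧
      eLpNorm (z - g) 2 (timeMeasure T) ≤ ENNReal.ofReal (1 / ((k : ℝ) + 1)) := fun k =>
    hz.exist_eLpNorm_sub_le (by simp) (by simp) (by positivity)
  choose g _ hg1 hg2 using h
  have hm : ∀ k, MemLp (g k) 2 (timeMeasure T) := fun k =>
    (hg1 k).continuous.continuousOn.memLp_timeMeasure
  refine ⟨g, hg1, hm, hz, squeeze_zero (fun _ => l2norm_nonneg _) (fun k => ?_)
    tendsto_one_div_add_atTop_nhds_zero_nat⟩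
  have h1 := hg2 k
  rw [(hz.sub (hm k)).eLpNorm_eq_integral_rpow_norm (by simp) (by simp),
    ENNReal.ofReal_le_ofReal_iff (by positivity)] at h1
  refine le_trans (le_of_eq ?_) h1
  rw [l2norm, intervalIntegral_eq_timeMeasure hT, Real.sqrt_eq_rpow]
  simp [norm_sub_rev]

end SquareIntegrable

/-! ### Linear differential equations with continuous coefficients -/

section LinearEquations

variable {T : ℝ} {E : Type} [NormedAddCommGroup E] [NormedSpace ℝ E] [CompleteSpace E]

/-- The restriction to `[0, T]` of a function continuous there. -/
def restrictCM {x : ℝ → E} (hx : ContinuousOn x (Icc 0 T)) : C(Icc 0 T, E) :=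
  ⟨(Icc 0 T).domRestrict x, hx.domRestrict⟩

@[simp] lemma restrictCM_apply {x : ℝ → E} (hx : ContinuousOn x (Icc 0 T)) (t : Icc 0 T) :
    restrictCM hx t = x t := rfl

lemma IccExtend_restrictCM (hT : 0 ≤ T) {x : ℝ → E} (hx : ContinuousOn x (Icc 0 T)) {t : ℝ}
    (ht : t ∈ Icc 0 T) : IccExtend hT (restrictCM hx) t = x t := by
  rw [IccExtend_of_mem hT _ ht]; rfl

lemma integral_IccExtend (hT : 0 ≤ T) (g : C(Icc 0 T, E)) {x : ℝ → E}
    (h : ∀ t (ht : t ∈ Icc 0 T), g ⟨t, ht⟩ = x t) {t : ℝ} (ht : t ∈ Icc 0 T) :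
    ∫ s in (0 : ℝ)..t, IccExtend hT g s = ∫ s in (0 : ℝ)..t, x s := by
  refine intervalIntegral.integral_congr fun s hs => ?_
  rw [uIcc_of_le ht.1] at hs
  have hs' : s ∈ Icc 0 T := ⟨hs.1, hs.2.trans ht.2⟩
  rw [IccExtend_of_mem hT _ hs', h]

lemma intervalIntegrable_of_mem {r : ℝ → E} (hr : IntervalIntegrable r volume 0 T) {t : ℝ}
    (ht : t ∈ Icc 0 T) : IntervalIntegrable r volume 0 t :=
  hr.mono_set (by rw [uIcc_of_le ht.1, uIcc_of_le (ht.1.trans ht.2)]; exact Icc_subset_Icc_right ht.2)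

/-- Primitives of continuous functions are continuously differentiable. -/
lemma contDiffOn_of_eq_integral (hT : 0 ≤ T) {x G : ℝ → E} (hG : ContinuousOn G (Icc 0 T))
    (hx : ∀ t ∈ Icc 0 T, x t = x 0 + ∫ s in (0 : ℝ)..t, G s) :
    ContDiffOn ℝ 1 x (Icc 0 T) ∧ ∀ t ∈ Ioo 0 T, HasDerivAt x (G t) t := by
  let Ĝ := IccExtend hT (restrictCM hG)
  have hc : Continuous Ĝ := IccExtend_continuous hT _
  have hd : ∀ t, HasDerivAt (fun t => x 0 + ∫ s in (0 : ℝ)..t, Ĝ s) (Ĝ t) t := fun t =>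
    (intervalIntegral.integral_hasDerivAt_right (hc.intervalIntegrable _ _)
      (hc.stronglyMeasurableAtFilter _ _) hc.continuousAt).const_add _
  have he : ∀ t ∈ Icc 0 T, x t = x 0 + ∫ s in (0 : ℝ)..t, Ĝ s := fun t ht => by
    rw [integral_IccExtend hT _ (fun _ _ => rfl) ht, ← hx t ht]
  constructor
  · have : ContDiff ℝ 1 (fun t => x 0 + ∫ s in (0 : ℝ)..t, Ĝ s) := by
      rw [contDiff_one_iff_deriv]
      refine ⟨fun t => (hd t).differentiableAt, ?_⟩
      rw [show deriv (fun t => x 0 + ∫ s in (0 : ℝ)..t, Ĝ s) = Ĝ from funext fun t => (hd t).deriv]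
      exact hc
    exact this.contDiffOn.congr he
  · intro t ht
    have h1 := hd t
    rw [show Ĝ t = G t from IccExtend_restrictCM hT hG (Ioo_subset_Icc_self ht)] at h1
    exact h1.congr_of_eventuallyEq
      (by filter_upwards [Icc_mem_nhds ht.1 ht.2] with s hs using he s hs)

/-- The solutions of `x' = A x + r` are bounded in terms of the data. -/
lemma exists_linear_bound (hT : 0 ≤ T) {A : ℝ → E →L[ℝ] E} (hA : ContinuousOn A (Icc 0 T)) :
    ∃ K : ℝ, 0 ≤ K ∧ ∀ x r : ℝ → E, ContinuousOn x (Icc 0 T) → IntervalIntegrable r volume 0 T →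
      (∀ t ∈ Icc 0 T, x t = x 0 + ∫ s in (0 : ℝ)..t, (A s (x s) + r s)) →
      ∀ t ∈ Icc 0 T, ‖x t‖ ≤ K * (‖x 0‖ + ∫ s in (0 : ℝ)..T, ‖r s‖) := by
  let A' : C(Icc 0 T, E →L[ℝ] E) := ⟨(Icc 0 T).domRestrict A, hA.domRestrict⟩
  refine ⟨‖volterraResolvent hT A'‖, ContinuousLinearMap.opNorm_nonneg _, fun x r hx hr h t ht => ?_⟩
  have hAx : ContinuousOn (fun s => A s (x s)) (Icc 0 T) := hA.clm_apply hx
  have hp : ContinuousOn (fun t => x 0 + ∫ s in (0 : ℝ)..t, r s) (Icc 0 T) := by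
    refine continuousOn_const.add ?_
    have := intervalIntegral.continuousOn_primitive_interval' hr left_mem_uIcc
    rwa [uIcc_of_le hT] at this
  -- The primitive of `r`, not `r` itself, is the datum of the Volterra equation. It is continuous
  -- for integrable `r` and is bounded by the L¹ norm of `r`.
  have h1 : restrictCM hx = volterra hT A' (restrictCM hx) + restrictCM hp := by
    ext s
    change x s = (∫ s in (0 : ℝ)..s, IccExtend hT (pointwiseApply A' (restrictCM hx)) s) +
      (x 0 + ∫ s in (0 : ℝ)..s, r s)
    rw [integral_IccExtend hT _ (x := fun s => A s (x s)) (fun _ _ => rfl) s.2, h s s.2,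
      intervalIntegral.integral_add (intervalIntegrable_of_mem
        (hAx.intervalIntegrable_of_Icc hT) s.2) (intervalIntegrable_of_mem hr s.2)]
    abel
  rw [← eq_volterraResolvent_iff] at h1
  have hpn : ‖restrictCM hp‖ ≤ ‖x 0‖ + ∫ s in (0 : ℝ)..T, ‖r s‖ := by
    rw [ContinuousMap.norm_le _ (add_nonneg (norm_nonneg _)
      (intervalIntegral.integral_nonneg hT fun _ _ => norm_nonneg _))]
    intro s
    refine (norm_add_le _ _).trans (add_le_add le_rfl ?_)
    refine (intervalIntegral.norm_integral_le_integral_norm s.2.1).trans ?_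
    exact intervalIntegral.integral_mono_interval le_rfl s.2.1 s.2.2
      (ae_of_all _ fun _ => norm_nonneg _) hr.norm
  calc ‖x t‖ = ‖restrictCM hx ⟨t, ht⟩‖ := rfl
    _ ≤ ‖restrictCM hx‖ := ContinuousMap.norm_coe_le_norm _ _
    _ ≤ _ := by
      rw [h1]
      exact (volterraResolvent hT A').le_of_opNorm_le_of_le le_rfl hpn

/-- Continuous dependence of the solutions of `x' = A x + r` on the initial value and on `r`. -/
lemma exists_uniform_bound_of_linear (hT : 0 ≤ T) {A : ℝ → E →L[ℝ] E}
    (hA : ContinuousOn A (Icc 0 T)) {x : ℕ → ℝ → E} {x' : ℝ → E} {r : ℕ → ℝ → E} {r' : ℝ → E}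
    (hx : ∀ k, ContinuousOn (x k) (Icc 0 T)) (hx' : ContinuousOn x' (Icc 0 T))
    (hr : L2Tendsto T r r') (h0 : Tendsto (fun k => x k 0) atTop (𝓝 (x' 0)))
    (he : ∀ k, ∀ t ∈ Icc 0 T, x k t = x k 0 + ∫ s in (0 : ℝ)..t, (A s (x k s) + r k s))
    (he' : ∀ t ∈ Icc 0 T, x' t = x' 0 + ∫ s in (0 : ℝ)..t, (A s (x' s) + r' s)) :
    ∃ b : ℕ → ℝ, Tendsto b atTop (𝓝 0) ∧ ∀ k, ∀ t ∈ Icc 0 T, ‖x k t - x' t‖ ≤ b k := by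
  obtain ⟨K, hK, hb⟩ := exists_linear_bound hT hA
  have hint : ∀ {g : ℝ → E}, MemLp g 2 (timeMeasure T) → IntervalIntegrable g volume 0 T :=
    fun hg => (intervalIntegrable_iff_timeMeasure hT _).2 (hg.integrable (by simp))
  refine ⟨fun k => K * (‖x k 0 - x' 0‖ + √T * l2norm T (r k - r')), ?_, fun k t ht => ?_⟩
  · have h1 := tendsto_iff_norm_sub_tendsto_zero.1 h0
    simpa using (h1.add (hr.lim.const_mul (√T))).const_mul K
  · refine (hb (fun t => x k t - x' t) (fun t => r k t - r' t) ((hx k).sub hx')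
      ((hint (hr.mem k)).sub (hint hr.mem')) (fun t ht => ?_) t ht).trans ?_
    · have i1 : IntervalIntegrable (fun s => A s (x k s) + r k s) volume 0 t :=
        intervalIntegrable_of_mem (((hA.clm_apply (hx k)).intervalIntegrable_of_Icc hT).add
          (hint (hr.mem k))) ht
      have i2 : IntervalIntegrable (fun s => A s (x' s) + r' s) volume 0 t :=
        intervalIntegrable_of_mem (((hA.clm_apply hx').intervalIntegrable_of_Icc hT).add
          (hint hr.mem')) ht
      rw [he k t ht, he' t ht, add_sub_add_comm, ← intervalIntegral.integral_sub i1 i2]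
      congr 2
      ext s
      rw [map_sub]
      abel
    · exact mul_le_mul_of_nonneg_left (add_le_add le_rfl
        (integral_norm_le hT ((hr.mem k).sub hr.mem'))) hK

end LinearEquations

/-! ### Sobolev functions as primitives -/

section Sobolev

variable {T : ℝ} {k : ℕ} {q : ENNReal} {x G : ℝ → Fin k → ℝ}

lemma IsSobolev.continuousOn (hT : 0 ≤ T) (hq : 1 ≤ q) (hx : IsSobolev T q x) :
    ContinuousOn x (Icc 0 T) := by
  obtain ⟨g, hg, h⟩ := hx
  have := intervalIntegral.continuousOn_primitive_interval'
    ((intervalIntegrable_iff_timeMeasure hT g).2 (hg.integrable hq)) left_mem_uIcc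
  rw [uIcc_of_le hT] at this
  exact (continuousOn_const.add this).congr h

/-- A Sobolev function is the primitive of its almost everywhere derivative. -/
lemma IsSobolev.eq_integral (hT : 0 ≤ T) (hq : 1 ≤ q) (hx : IsSobolev T q x)
    (hd : ∀ᵐ t ∂timeMeasure T, HasDerivAt x (G t) t) :
    MemLp G q (timeMeasure T) ∧ ∀ t ∈ Icc 0 T, x t = x 0 + ∫ s in (0 : ℝ)..t, G s := by
  obtain ⟨g, hg, h⟩ := hx
  have hgi := (intervalIntegrable_iff_timeMeasure hT g).2 (hg.integrable hq)
  have h1 : ∀ᵐ t ∂timeMeasure T, HasDerivAt x (g t) t := by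
    have h2 := hgi.ae_hasDerivAt_integral
    rw [uIcc_of_le hT] at h2
    have h3 : ∀ᵐ t ∂timeMeasure T, t ∈ Ioo 0 T := ae_timeMeasure_of_Ioo fun _ h => h
    filter_upwards [ae_restrict_of_ae h2, h3] with t h4 h5
    refine ((h4 (Ioo_subset_Icc_self h5) 0 ⟨le_rfl, hT⟩).const_add (x 0)).congr_of_eventuallyEq ?_
    filter_upwards [Icc_mem_nhds h5.1 h5.2] with s hs using h s hs
  have h2 : g =ᵐ[timeMeasure T] G := by
    filter_upwards [h1, hd] with t a b using a.unique b
  refine ⟨hg.ae_eq h2, fun t ht => ?_⟩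
  rw [h t ht]
  congr 1
  refine intervalIntegral.integral_congr_ae ?_
  have h3 := (ae_restrict_iff' measurableSet_Icc).1 h2
  filter_upwards [h3] with s hs hst
  rw [uIoc_of_le ht.1] at hst
  exact hs ⟨hst.1.le, hst.2.trans ht.2⟩

lemma isSobolev_of_eq_integral (hG : ContinuousOn G (Icc 0 T))
    (hx : ∀ t ∈ Icc 0 T, x t = x 0 + ∫ s in (0 : ℝ)..t, G s) : IsSobolev T q x :=
  ⟨G, hG.memLp_timeMeasure, hx⟩

end Sobolev

/-! ### Second derivatives of compositions -/

section SecondDerivatives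

variable {X Y W : Type} [NormedAddCommGroup X] [NormedSpace ℝ X] [NormedAddCommGroup Y]
  [NormedSpace ℝ Y] [NormedAddCommGroup W] [NormedSpace ℝ W]

lemma fderiv_fderiv_clm_comp (L : Y →L[ℝ] W) {G : X → Y} {a : X} (hG : ContDiffAt ℝ 2 G a) :
    (∀ v, fderiv ℝ (fun c => L (G c)) a v = L (fderiv ℝ G a v)) ∧
      ∀ v w, fderiv ℝ (fderiv ℝ (fun c => L (G c))) a v w = L (fderiv ℝ (fderiv ℝ G) a v w) := by
  obtain ⟨h1, h2⟩ := contDiffAt_two_eventually_hasFDerivAt hG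
  have h3 : fderiv ℝ (fun c => L (G c)) =ᶠ[𝓝 a] fun c => L.comp (fderiv ℝ G c) := by
    filter_upwards [h1] with c hc
    exact (L.hasFDerivAt.comp c hc).fderiv
  refine ⟨fun v => by rw [h3.self_of_nhds]; rfl, fun v w => ?_⟩
  rw [h3.fderiv_eq]
  have h4 := (ContinuousLinearMap.compL ℝ X Y W L).hasFDerivAt.comp a h2
  have h5 : HasFDerivAt (fun c => L.comp (fderiv ℝ G c)) _ a := h4
  rw [h5.fderiv]
  rfl

/-- For an endpoint function composed with the solution map, the last term, with the second
derivative of `S`, is the one that the adjoint state converts into an integral. -/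
lemma fderiv_fderiv_comp_diag {g : Y → W} (hg : ContDiff ℝ 2 g) {S : X → Y} {a : X}
    (hS : ContDiffAt ℝ 2 S a) (c : X) :
    fderiv ℝ (fun c => g (S c)) a c = fderiv ℝ g (S a) (fderiv ℝ S a c) ∧
      fderiv ℝ (fderiv ℝ (fun c => g (S c))) a c c =
        fderiv ℝ (fderiv ℝ g) (S a) (fderiv ℝ S a c) (fderiv ℝ S a c) +
          fderiv ℝ g (S a) (fderiv ℝ (fderiv ℝ S) a c c) := by
  obtain ⟨h1, h2⟩ := contDiffAt_two_eventually_hasFDerivAt hS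
  have hg1 : ∀ z, HasFDerivAt g (fderiv ℝ g z) z := fun z =>
    (hg.differentiable (by norm_num) z).hasFDerivAt
  have hg2 : HasFDerivAt (fderiv ℝ g) (fderiv ℝ (fderiv ℝ g) (S a)) (S a) :=
    ((hg.fderiv_right (m := 1) (by norm_num)).differentiable one_ne_zero _).hasFDerivAt
  have h3 : fderiv ℝ (fun c => g (S c)) =ᶠ[𝓝 a] fun c => (fderiv ℝ g (S c)).comp (fderiv ℝ S c) := by
    filter_upwards [h1] with c hc
    exact ((hg1 _).comp c hc).fderiv
  refine ⟨by rw [h3.self_of_nhds]; rfl, ?_⟩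
  rw [h3.fderiv_eq]
  have h4 : HasFDerivAt (fun c => (fderiv ℝ g (S c)).comp (fderiv ℝ S c)) _ a :=
    (hg2.comp a h1.self_of_nhds).clm_comp h2
  rw [h4.fderiv]
  simp [add_comm]

end SecondDerivatives

/-! ### The adjoint equation -/

section Adjoint

variable {T : ℝ} {n : ℕ}

/-- Transposition of endomorphisms of `ℝⁿ`. -/
def trL : ((Fin n → ℝ) →L[ℝ] (Fin n → ℝ)) →L[ℝ] (Fin n → ℝ) →L[ℝ] (Fin n → ℝ) :=
  LinearMap.toContinuousLinearMap
    { toFun := fun A => LinearMap.toContinuousLinearMap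
        (Matrix.toLin' (LinearMap.toMatrix' (A : (Fin n → ℝ) →ₗ[ℝ] (Fin n → ℝ)))ᵀ)
      map_add' := fun A B => by
        ext v i
        simp
      map_smul' := fun c A => by
        ext v i
        simp }

lemma trL_dotProduct (A : (Fin n → ℝ) →L[ℝ] (Fin n → ℝ)) (p b : Fin n → ℝ) :
    trL A p ⬝ᵥ b = p ⬝ᵥ A b := by
  change (LinearMap.toMatrix' (A : (Fin n → ℝ) →ₗ[ℝ] (Fin n → ℝ)))ᵀ *ᵥ p ⬝ᵥ b = _
  rw [mulVec_transpose, ← dotProduct_mulVec, LinearMap.toMatrix'_mulVec]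
  rfl

/-- Integration by parts for a state and an adjoint state. -/
lemma pairing_eq_integral (hT : 0 ≤ T) {A : ℝ → (Fin n → ℝ) →L[ℝ] (Fin n → ℝ)}
    (hA : ContinuousOn A (Icc 0 T)) {p x r : ℝ → Fin n → ℝ} (hp : ContinuousOn p (Icc 0 T))
    (hx : ContinuousOn x (Icc 0 T)) (hr : ContinuousOn r (Icc 0 T))
    (hpe : ∀ t ∈ Icc 0 T, p t = p 0 + ∫ s in (0 : ℝ)..t, -trL (A s) (p s))
    (hxe : ∀ t ∈ Icc 0 T, x t = x 0 + ∫ s in (0 : ℝ)..t, (A s (x s) + r s)) :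
    p T ⬝ᵥ x T - p 0 ⬝ᵥ x 0 = ∫ t in (0 : ℝ)..T, p t ⬝ᵥ r t := by
  have h1 := (contDiffOn_of_eq_integral hT
    ((trL.continuous.comp_continuousOn hA).clm_apply hp).neg hpe).2
  have h2 := (contDiffOn_of_eq_integral hT ((hA.clm_apply hx).add hr) hxe).2
  have hd : ∀ t ∈ Ioo 0 T, HasDerivAt (fun t => p t ⬝ᵥ x t) (p t ⬝ᵥ r t) t := by
    intro t ht
    have h3 : HasDerivAt (fun t => dotL (p t) (x t)) _ t :=
      (dotL.hasFDerivAt.comp_hasDerivAt t (h1 t ht)).clm_apply (h2 t ht)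
    refine HasDerivAt.congr_deriv (f := fun t => p t ⬝ᵥ x t) h3 ?_
    change (-(trL (A t) (p t))) ⬝ᵥ x t + p t ⬝ᵥ (A t (x t) + r t) = _
    rw [neg_dotProduct, trL_dotProduct, dotProduct_add]
    ring
  have hc : ContinuousOn (fun t => p t ⬝ᵥ r t) (Icc 0 T) :=
    (dotL.continuous.comp_continuousOn hp).clm_apply hr
  exact (intervalIntegral.integral_eq_sub_of_hasDerivAt_of_le hT
    ((dotL.continuous.comp_continuousOn hp).clm_apply hx) hd
    (hc.intervalIntegrable_of_Icc hT)).symm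

/-- Time reversal of an integral equation. -/
lemma reverse_integral_eq {E : Type} [NormedAddCommGroup E] [NormedSpace ℝ E]
    [CompleteSpace E] {p G : ℝ → E}
    (hG : IntervalIntegrable G volume 0 T) (hp : ∀ t ∈ Icc 0 T, p t = p 0 + ∫ s in (0 : ℝ)..t, G s)
    {t : ℝ} (ht : t ∈ Icc 0 T) : p (T - t) = p T + ∫ s in (0 : ℝ)..t, -G (T - s) := by
  have hT : 0 ≤ T := ht.1.trans ht.2
  have h1 : T - t ∈ Icc 0 T := ⟨sub_nonneg.2 ht.2, sub_le_self _ ht.1⟩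
  rw [intervalIntegral.integral_neg, intervalIntegral.integral_comp_sub_left (fun s => G s) T,
    sub_zero, hp _ h1, hp T ⟨hT, le_rfl⟩, ← intervalIntegral.integral_interval_sub_left hG
      (intervalIntegrable_of_mem hG h1)]
  abel

/-- The linear map sending a terminal value to the solution of the adjoint equation. -/
lemma exists_adjoint (hT : 0 ≤ T) {A : ℝ → (Fin n → ℝ) →L[ℝ] (Fin n → ℝ)}
    (hA : ContinuousOn A (Icc 0 T)) :
    ∃ p : (Fin n → ℝ) →L[ℝ] C(Icc 0 T, Fin n → ℝ), ∀ q, IccExtend hT (p q) T = q ∧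
      ∀ t ∈ Icc 0 T, IccExtend hT (p q) t = IccExtend hT (p q) 0 +
        ∫ s in (0 : ℝ)..t, -trL (A s) (IccExtend hT (p q) s) := by
  -- Time reversal turns the terminal value problem into an initial value problem for the transposed
  -- coefficient, which the Volterra resolvent solves linearly in `q`.
  let rev : C(Icc 0 T, Icc 0 T) := ⟨fun t => ⟨T - t, sub_nonneg.2 t.2.2, sub_le_self _ t.2.1⟩,
    by fun_prop⟩
  let A' : C(Icc 0 T, (Fin n → ℝ) →L[ℝ] (Fin n → ℝ)) :=
    ⟨fun t => trL (A (rev t)), trL.continuous.comp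
      ((hA.domRestrict (s := Icc 0 T)).comp rev.continuous)⟩
  let cf : (Fin n → ℝ) →L[ℝ] C(Icc 0 T, Fin n → ℝ) := constFun
  let RV : C(Icc 0 T, Fin n → ℝ) →L[ℝ] C(Icc 0 T, Fin n → ℝ) :=
    LinearMap.mkContinuous { toFun := fun x => x.comp rev
                             map_add' := fun _ _ => rfl
                             map_smul' := fun _ _ => rfl } 1 (fun x => by
      rw [one_mul, ContinuousMap.norm_le _ (norm_nonneg _)]
      exact fun t => x.norm_coe_le_norm _)
  refine ⟨RV.comp ((volterraResolvent hT A').comp cf), fun q => ?_⟩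
  set π := volterraResolvent hT A' (cf q) with hπ
  have hπ' := (eq_volterraResolvent_iff hT A' π (cf q)).1 hπ
  have hπt : ∀ t (ht : t ∈ Icc 0 T), π ⟨t, ht⟩ = q +
      ∫ s in (0 : ℝ)..t, trL (A (T - s)) (IccExtend hT π s) := by
    intro t ht
    have := DFunLike.congr_fun hπ' ⟨t, ht⟩
    rw [this, ContinuousMap.add_apply, add_comm]
    change q + ∫ s in (0 : ℝ)..t, IccExtend hT (pointwiseApply A' π) s = _
    congr 1
    refine integral_IccExtend hT _ (fun s hs => ?_) ht
    rw [IccExtend_of_mem hT _ hs]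
    rfl
  have hp : ∀ t ∈ Icc 0 T, IccExtend hT (RV π) t = IccExtend hT π (T - t) := fun t ht => by
    have h1 : T - t ∈ Icc 0 T := ⟨sub_nonneg.2 ht.2, sub_le_self _ ht.1⟩
    rw [IccExtend_of_mem hT _ ht, IccExtend_of_mem hT _ h1]
    rfl
  have h0 : (0 : ℝ) ∈ Icc 0 T := ⟨le_rfl, hT⟩
  have hTm : T ∈ Icc 0 T := ⟨hT, le_rfl⟩
  have hπ0 : IccExtend hT π 0 = q := by
    rw [IccExtend_of_mem hT _ h0, hπt 0 h0]; simp
  change IccExtend hT (RV π) T = q ∧ ∀ t ∈ Icc 0 T, IccExtend hT (RV π) t =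
    IccExtend hT (RV π) 0 + ∫ s in (0 : ℝ)..t, -trL (A s) (IccExtend hT (RV π) s)
  refine ⟨by rw [hp T hTm, sub_self, hπ0], fun t ht => ?_⟩
  have hAr : ContinuousOn (fun s => A (T - s)) (Icc 0 T) :=
    hA.comp (by fun_prop) fun s hs => ⟨sub_nonneg.2 hs.2, sub_le_self _ hs.1⟩
  have hG : IntervalIntegrable (fun s => trL (A (T - s)) (IccExtend hT π s)) volume 0 T :=
    ((trL.continuous.comp_continuousOn hAr).clm_apply
      (IccExtend_continuous hT π).continuousOn).intervalIntegrable_of_Icc hT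
  have hrev := reverse_integral_eq (p := IccExtend hT π) hG (fun s hs => by
    rw [hπ0, ← hπt s hs, IccExtend_of_mem hT _ hs]) ht
  rw [hp t ht, hp 0 h0, sub_zero, hrev]
  congr 1
  refine intervalIntegral.integral_congr fun s hs => ?_
  rw [uIcc_of_le ht.1] at hs
  beta_reduce
  rw [hp s ⟨hs.1, hs.2.trans ht.2⟩, sub_sub_cancel]

/-- The solution of the adjoint equation with a given terminal value is unique. -/
lemma adjoint_unique (hT : 0 ≤ T) {A : ℝ → (Fin n → ℝ) →L[ℝ] (Fin n → ℝ)}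
    (hA : ContinuousOn A (Icc 0 T)) {p p' : ℝ → Fin n → ℝ} (hp : ContinuousOn p (Icc 0 T))
    (hp' : ContinuousOn p' (Icc 0 T)) (hpT : p T = p' T)
    (hpe : ∀ t ∈ Icc 0 T, p t = p 0 + ∫ s in (0 : ℝ)..t, -trL (A s) (p s))
    (hpe' : ∀ t ∈ Icc 0 T, p' t = p' 0 + ∫ s in (0 : ℝ)..t, -trL (A s) (p' s)) :
    ∀ t ∈ Icc 0 T, p t = p' t := by
  have hmaps : MapsTo (fun s => T - s) (Icc 0 T) (Icc 0 T) := fun s hs =>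
    ⟨sub_nonneg.2 hs.2, sub_le_self _ hs.1⟩
  have hrevc : ContinuousOn (fun s => T - s) (Icc 0 T) := by fun_prop
  have hAr : ContinuousOn (fun s => trL (A (T - s))) (Icc 0 T) :=
    trL.continuous.comp_continuousOn (hA.comp hrevc hmaps)
  obtain ⟨K, hK, hb⟩ := exists_linear_bound hT hAr
  have hi : ∀ {p : ℝ → Fin n → ℝ}, ContinuousOn p (Icc 0 T) →
      IntervalIntegrable (fun s => -trL (A s) (p s)) volume 0 T := fun hp =>
    (((trL.continuous.comp_continuousOn hA).clm_apply hp).intervalIntegrable_of_Icc hT).neg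
  have hi2 : ∀ {p : ℝ → Fin n → ℝ}, ContinuousOn p (Icc 0 T) → ∀ t ∈ Icc 0 T,
      IntervalIntegrable (fun s => - -trL (A (T - s)) (p (T - s))) volume 0 t := fun hp t ht =>
    intervalIntegrable_of_mem
      ((hAr.clm_apply (hp.comp hrevc hmaps)).neg.neg.intervalIntegrable_of_Icc hT) ht
  have key := hb (fun t => p (T - t) - p' (T - t)) (fun _ => 0)
    ((hp.comp hrevc hmaps).sub (hp'.comp hrevc hmaps)) intervalIntegrable_const (fun t ht => by
      rw [reverse_integral_eq (hi hp) hpe ht, reverse_integral_eq (hi hp') hpe' ht,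
        add_sub_add_comm, ← intervalIntegral.integral_sub (hi2 hp t ht) (hi2 hp' t ht)]
      simp)
  intro t ht
  have h1 := key (T - t) (hmaps ht)
  simp only [sub_sub_cancel, sub_zero, hpT, sub_self, norm_zero, intervalIntegral.integral_zero,
    add_zero, mul_zero] at h1
  exact sub_eq_zero.1 (norm_le_zero_iff.1 h1)

end Adjoint

/-! ### The reference process, its linearization and endpoint multipliers -/

namespace ControlProblem

variable {n l m dφ dη : ℕ} {P : ControlProblem n l m dφ dη} {w : StateControl n l m}

/-- Standing properties of a reference process with smooth controls. -/
structure IsReference (P : ControlProblem n l m dφ dη) (w : StateControl n l m) : Prop where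
  pos : 0 < P.T
  reg : P.IsRegular
  cx : ContDiffOn ℝ 1 w.x (Icc 0 P.T)
  cu : ContDiffOn ℝ 1 w.u (Icc 0 P.T)
  cv : ContDiffOn ℝ 1 w.v (Icc 0 P.T)
  eq : ∀ t ∈ Icc 0 P.T, w.x t = w.x 0 + ∫ s in (0 : ℝ)..t, P.Fz (w.pt s)

/-- The state is the primitive of a continuous function, hence C¹; one derivative of the smooth
controls is all that the argument keeps. -/
lemma isReference_of_isTrajectory (hT : 0 < P.T) (hreg : P.IsRegular)
    (hu : ContDiffOn ℝ ∞ w.u (Icc 0 P.T)) (hv : ContDiffOn ℝ ∞ w.v (Icc 0 P.T))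
    (htr : P.IsTrajectory w) : P.IsReference w := by
  have hx := htr.1.1.continuousOn hT.le (by simp)
  have he := (htr.1.1.eq_integral hT.le (by simp) htr.2).2
  have hc : ContinuousOn (fun t => P.Fz (w.pt t)) (Icc 0 P.T) :=
    (contDiff_Fz hreg).continuous.comp_continuousOn
      (hx.prodMk (hu.continuousOn.prodMk hv.continuousOn))
  exact ⟨hT, hreg, (contDiffOn_of_eq_integral hT.le hc he).1, hu.of_le (by simp),
    hv.of_le (by simp), he⟩

/-- Perturbations of the initial state and of the controls. -/
abbrev Dir (P : ControlProblem n l m dφ dη) : Type :=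
  (Fin n → ℝ) × C(Icc 0 P.T, (Fin l → ℝ) × (Fin m → ℝ))

/-- The space of endpoint multipliers. -/
abbrev EndMult (_ : ControlProblem n l m dφ dη) : Type :=
  EuclideanSpace ℝ (Fin (dφ + 1) ⊕ Fin dη)

/-- The derivative of the dynamics along the reference process. -/
def dF (P : ControlProblem n l m dφ dη) (w : StateControl n l m) (t : ℝ) :
    (Fin n → ℝ) × (Fin l → ℝ) × (Fin m → ℝ) →L[ℝ] (Fin n → ℝ) := fderiv ℝ P.Fz (w.pt t)

/-- The second derivative of the dynamics along the reference process. -/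
def ddF (P : ControlProblem n l m dφ dη) (w : StateControl n l m) (t : ℝ) :
    (Fin n → ℝ) × (Fin l → ℝ) × (Fin m → ℝ) →L[ℝ]
      (Fin n → ℝ) × (Fin l → ℝ) × (Fin m → ℝ) →L[ℝ] (Fin n → ℝ) :=
  fderiv ℝ (fderiv ℝ P.Fz) (w.pt t)

namespace IsReference

variable (h : P.IsReference w)
include h

lemma nonneg : 0 ≤ P.T := h.pos.le

lemma continuousOn_pt : ContinuousOn w.pt (Icc 0 P.T) :=
  h.cx.continuousOn.prodMk (h.cu.continuousOn.prodMk h.cv.continuousOn)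

lemma continuousOn_dF : ContinuousOn (P.dF w) (Icc 0 P.T) :=
  ((contDiff_Fz h.reg).continuous_fderiv (by norm_num)).comp_continuousOn h.continuousOn_pt

lemma continuousOn_ddF : ContinuousOn (P.ddF w) (Icc 0 P.T) :=
  (((contDiff_Fz h.reg).fderiv_right (m := 1) (by norm_num)).continuous_fderiv
    one_ne_zero).comp_continuousOn h.continuousOn_pt

lemma continuousOn_dF_ιx : ContinuousOn (fun t => (P.dF w t).comp ιx) (Icc 0 P.T) :=
  h.continuousOn_dF.clm_comp continuousOn_const

/-- The equivalence records uniqueness along with existence; uniqueness later identifies this map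
with the derivative of the nonlinear solution map. -/
lemma exists_linState : ∃ x : P.Dir →L[ℝ] C(Icc 0 P.T, Fin n → ℝ), ∀ (c : P.Dir) y,
    y = x c ↔ ∀ t, y t = c.1 + ∫ s in (0 : ℝ)..t, P.dF w s (IccExtend h.nonneg y s,
      IccExtend h.nonneg c.2 s) := by
  let A' : C(Icc 0 P.T, (Fin n → ℝ) →L[ℝ] (Fin n → ℝ)) :=
    ⟨(Icc 0 P.T).domRestrict fun t => (P.dF w t).comp ιx, h.continuousOn_dF_ιx.domRestrict⟩
  let B' : C(Icc 0 P.T, (Fin l → ℝ) × (Fin m → ℝ) →L[ℝ] (Fin n → ℝ)) :=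
    ⟨(Icc 0 P.T).domRestrict fun t => (P.dF w t).comp (.inr ℝ _ _),
      (h.continuousOn_dF.clm_comp continuousOn_const).domRestrict⟩
  let cf : (Fin n → ℝ) →L[ℝ] C(Icc 0 P.T, Fin n → ℝ) := constFun
  let PB : C(Icc 0 P.T, (Fin l → ℝ) × (Fin m → ℝ)) →L[ℝ] C(Icc 0 P.T, Fin n → ℝ) :=
    pointwiseApply B'
  let pr : C(Icc 0 P.T, Fin n → ℝ) →L[ℝ] C(Icc 0 P.T, Fin n → ℝ) := primitive h.nonneg
  let L : P.Dir →L[ℝ] C(Icc 0 P.T, Fin n → ℝ) :=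
    cf.comp (.fst ℝ _ _) + pr.comp (PB.comp (.snd ℝ _ _))
  refine ⟨(volterraResolvent h.nonneg A').comp L, fun c y => ?_⟩
  refine (eq_volterraResolvent_iff h.nonneg A' y (L c)).trans ?_
  rw [ContinuousMap.ext_iff]
  refine forall_congr' fun t => ?_
  have h1 : (volterra h.nonneg A' y + L c) t = c.1 + ∫ s in (0 : ℝ)..t,
      P.dF w s (IccExtend h.nonneg y s, IccExtend h.nonneg c.2 s) := by
    have h2 : (volterra h.nonneg A' y + L c) = cf c.1 + pr (pointwiseApply A' y + PB c.2) := by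
      rw [map_add]
      change pr (pointwiseApply A' y) + (cf c.1 + pr (PB c.2)) = _
      abel
    rw [h2]
    change c.1 + ∫ s in (0 : ℝ)..t, _ = _
    congr 1
    refine integral_IccExtend h.nonneg _ (fun s hs => ?_) t.2
    rw [IccExtend_of_mem _ _ hs, IccExtend_of_mem _ _ hs]
    change P.dF w s (y ⟨s, hs⟩, 0) + P.dF w s (0, c.2 ⟨s, hs⟩) = _
    rw [← map_add]
    simp
  rw [h1]

/-- The response of the state in the linearized equation. -/
def linState : P.Dir →L[ℝ] C(Icc 0 P.T, Fin n → ℝ) := Classical.choose h.exists_linState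

lemma eq_linState_iff (c : P.Dir) (y : C(Icc 0 P.T, Fin n → ℝ)) : y = h.linState c ↔
    ∀ t, y t = c.1 + ∫ s in (0 : ℝ)..t, P.dF w s (IccExtend h.nonneg y s,
      IccExtend h.nonneg c.2 s) := Classical.choose_spec h.exists_linState c y

/-- The direction in the space of processes determined by a perturbation. -/
def dir (c : P.Dir) : StateControl n l m where
  x := IccExtend h.nonneg (h.linState c)
  u := fun t => (IccExtend h.nonneg c.2 t).1
  v := fun t => (IccExtend h.nonneg c.2 t).2

lemma dir_pt (c : P.Dir) (t : ℝ) :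
    (h.dir c).pt t = (IccExtend h.nonneg (h.linState c) t, IccExtend h.nonneg c.2 t) := rfl

lemma continuous_dir_x (c : P.Dir) : Continuous (h.dir c).x := IccExtend_continuous _ _
lemma continuous_dir_u (c : P.Dir) : Continuous (h.dir c).u :=
  continuous_fst.comp (IccExtend_continuous _ _)
lemma continuous_dir_v (c : P.Dir) : Continuous (h.dir c).v :=
  continuous_snd.comp (IccExtend_continuous _ _)
lemma continuous_dir_pt (c : P.Dir) : Continuous (h.dir c).pt :=
  (h.continuous_dir_x c).prodMk ((h.continuous_dir_u c).prodMk (h.continuous_dir_v c))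

lemma dir_x_eq (c : P.Dir) {t : ℝ} (ht : t ∈ Icc 0 P.T) :
    (h.dir c).x t = c.1 + ∫ s in (0 : ℝ)..t, P.dF w s ((h.dir c).pt s) := by
  have := (h.eq_linState_iff c _).1 rfl ⟨t, ht⟩
  exact (IccExtend_of_mem h.nonneg (h.linState c) ht).trans this

lemma dir_x_zero (c : P.Dir) : (h.dir c).x 0 = c.1 := by
  rw [h.dir_x_eq c ⟨le_rfl, h.nonneg⟩]; simp

lemma dir_pt_add (a b : P.Dir) (t : ℝ) :
    (h.dir (a + b)).pt t = (h.dir a).pt t + (h.dir b).pt t := by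
  simp [dir_pt, IccExtend]

lemma dir_pt_smul (r : ℝ) (b : P.Dir) (t : ℝ) :
    (h.dir (r • b)).pt t = r • (h.dir b).pt t := by
  simp [dir_pt, IccExtend]

/-- The endpoints of the linearized trajectory. -/
def ends (c : P.Dir) : (Fin n → ℝ) × (Fin n → ℝ) := ((h.dir c).x 0, (h.dir c).x P.T)

/-- The adjoint state with a given terminal value. -/
def adj : (Fin n → ℝ) →L[ℝ] C(Icc 0 P.T, Fin n → ℝ) :=
  Classical.choose (exists_adjoint h.nonneg h.continuousOn_dF_ιx)

lemma adj_spec (q : Fin n → ℝ) : IccExtend h.nonneg (h.adj q) P.T = q ∧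
    ∀ t ∈ Icc 0 P.T, IccExtend h.nonneg (h.adj q) t = IccExtend h.nonneg (h.adj q) 0 +
      ∫ s in (0 : ℝ)..t, -trL ((P.dF w s).comp ιx) (IccExtend h.nonneg (h.adj q) s) :=
  Classical.choose_spec (exists_adjoint h.nonneg h.continuousOn_dF_ιx) q

omit h in
/-- The terminal gradient of the endpoint Lagrangian. -/
def termGrad (P : ControlProblem n l m dφ dη) (w : StateControl n l m) :
    P.EndMult →ₗ[ℝ] (Fin n → ℝ) where
  toFun μ k := ∑ i, μ (.inl i) * fderiv ℝ (P.φ i) (w.x 0, w.x P.T) (0, Pi.single k 1) +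
    ∑ j, μ (.inr j) * fderiv ℝ (P.η j) (w.x 0, w.x P.T) (0, Pi.single k 1)
  map_add' μ ν := by
    ext k
    simp only [PiLp.add_apply, Pi.add_apply, add_mul, Finset.sum_add_distrib]
    ring
  map_smul' r μ := by
    ext k
    simp [mul_add, Finset.mul_sum, mul_assoc]

/-- The triple `(α, β, p)` determined by an endpoint multiplier. -/
def mult : P.EndMult →ₗ[ℝ] Multiplier n dφ dη where
  toFun μ := (fun i => μ (.inl i), fun j => μ (.inr j), IccExtend h.nonneg (h.adj (termGrad P w μ)))
  map_add' μ ν := by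
    refine Prod.ext rfl (Prod.ext rfl ?_)
    ext t
    simp [IccExtend]
  map_smul' r μ := by
    refine Prod.ext rfl (Prod.ext rfl ?_)
    ext t
    simp [IccExtend]

lemma continuous_mult_p (μ : P.EndMult) : Continuous (h.mult μ).2.2 := IccExtend_continuous _ _

lemma mult_p_eq (μ : P.EndMult) {t : ℝ} (ht : t ∈ Icc 0 P.T) : (h.mult μ).2.2 t =
    (h.mult μ).2.2 0 + ∫ s in (0 : ℝ)..t, -trL ((P.dF w s).comp ιx) ((h.mult μ).2.2 s) :=
  (h.adj_spec _).2 t ht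

lemma mult_p_T (μ : P.EndMult) : (h.mult μ).2.2 P.T = termGrad P w μ := (h.adj_spec _).1

omit h in
lemma contDiff_ell (hreg : P.IsRegular) (lam : Multiplier n dφ dη) : ContDiff ℝ 2 (P.ell lam) :=
  (ContDiff.sum fun i _ => contDiff_const.mul (hreg.2.1 i).1).add
    (ContDiff.sum fun j _ => contDiff_const.mul (hreg.2.2 j).1)

omit h in
lemma fderiv_ell (hreg : P.IsRegular) (lam : Multiplier n dφ dη) (q a : (Fin n → ℝ) × (Fin n → ℝ)) :
    fderiv ℝ (P.ell lam) q a =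
      ∑ i, lam.1 i * fderiv ℝ (P.φ i) q a + ∑ j, lam.2.1 j * fderiv ℝ (P.η j) q a := by
  have h1 : HasFDerivAt (P.ell lam) (∑ i, lam.1 i • fderiv ℝ (P.φ i) q +
      ∑ j, lam.2.1 j • fderiv ℝ (P.η j) q) q := by
    refine (HasFDerivAt.fun_sum fun i _ => ?_).add (HasFDerivAt.fun_sum fun j _ => ?_)
    · exact (((hreg.2.1 i).1.differentiable (by norm_num)) q).hasFDerivAt.const_mul _
    · exact (((hreg.2.2 j).1.differentiable (by norm_num)) q).hasFDerivAt.const_mul _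
  rw [h1.fderiv]
  simp

omit h in
lemma fderiv_fderiv_ell (hreg : P.IsRegular) (lam : Multiplier n dφ dη)
    (q a b : (Fin n → ℝ) × (Fin n → ℝ)) :
    fderiv ℝ (fderiv ℝ (P.ell lam)) q a b = ∑ i, lam.1 i * fderiv ℝ (fderiv ℝ (P.φ i)) q a b +
      ∑ j, lam.2.1 j * fderiv ℝ (fderiv ℝ (P.η j)) q a b := by
  have h0 : fderiv ℝ (P.ell lam) = fun q => ∑ i, lam.1 i • fderiv ℝ (P.φ i) q +
      ∑ j, lam.2.1 j • fderiv ℝ (P.η j) q := by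
    ext1 q
    refine ContinuousLinearMap.ext fun a => ?_
    rw [fderiv_ell hreg]
    simp
  have h1 : HasFDerivAt (fderiv ℝ (P.ell lam)) (∑ i, lam.1 i • fderiv ℝ (fderiv ℝ (P.φ i)) q +
      ∑ j, lam.2.1 j • fderiv ℝ (fderiv ℝ (P.η j)) q) q := by
    rw [h0]
    refine (HasFDerivAt.fun_sum fun i _ => ?_).add (HasFDerivAt.fun_sum fun j _ => ?_)
    · exact ((((hreg.2.1 i).1.fderiv_right (m := 1) (by norm_num)).differentiable one_ne_zero)
        q).hasFDerivAt.fun_const_smul _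
    · exact ((((hreg.2.2 j).1.fderiv_right (m := 1) (by norm_num)).differentiable one_ne_zero)
        q).hasFDerivAt.fun_const_smul _
  rw [h1.fderiv]
  simp

lemma termGrad_dotProduct (μ : P.EndMult) (b : Fin n → ℝ) :
    termGrad P w μ ⬝ᵥ b = fderiv ℝ (P.ell (h.mult μ)) (w.x 0, w.x P.T) (0, b) := by
  have h1 : (0, b) = ∑ k, b k • ((0, Pi.single k 1) : (Fin n → ℝ) × (Fin n → ℝ)) := by
    refine Prod.ext ?_ ?_
    · simp [Prod.fst_sum]
    · simp only [Prod.snd_sum, Prod.smul_snd]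
      exact pi_eq_sum_univ' b
  rw [h1, map_sum, dotProduct]
  refine Finset.sum_congr rfl fun k _ => ?_
  rw [map_smul, fderiv_ell h.reg, smul_eq_mul, mul_comm]
  rfl

/-- Integration by parts for the adjoint state of a multiplier. -/
lemma pairing (μ : P.EndMult) {x r : ℝ → Fin n → ℝ} (hx : ContinuousOn x (Icc 0 P.T))
    (hr : ContinuousOn r (Icc 0 P.T))
    (hxe : ∀ t ∈ Icc 0 P.T, x t = x 0 + ∫ s in (0 : ℝ)..t, (P.dF w s (ιx (x s)) + r s)) :
    fderiv ℝ (P.ell (h.mult μ)) (w.x 0, w.x P.T) (x 0, x P.T) =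
      fderiv ℝ (P.ell (h.mult μ)) (w.x 0, w.x P.T) (x 0, 0) + (h.mult μ).2.2 0 ⬝ᵥ x 0 +
        ∫ t in (0 : ℝ)..P.T, (h.mult μ).2.2 t ⬝ᵥ r t := by
  rw [← pairing_eq_integral h.nonneg h.continuousOn_dF_ιx (h.continuous_mult_p μ).continuousOn hx hr
    (fun t ht => h.mult_p_eq μ ht) hxe, mult_p_T, termGrad_dotProduct h]
  have : ((x 0, x P.T) : (Fin n → ℝ) × (Fin n → ℝ)) = (x 0, 0) + (0, x P.T) := by simp
  rw [this, map_add]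
  ring

end IsReference

end ControlProblem

/-! ### The multiplier rule with an index bound -/

namespace ControlProblem

variable {n l m dφ dη : ℕ} {P : ControlProblem n l m dφ dη} {w : StateControl n l m}

/-- The endpoint cost and constraints, as a map vanishing at the endpoints of `w`. -/
def endMap (P : ControlProblem n l m dφ dη) (w : StateControl n l m)
    (q : (Fin n → ℝ) × (Fin n → ℝ)) : P.EndMult :=
  WithLp.toLp 2 (Sum.elim (fun i => P.φ i q - P.φ i (w.x 0, w.x P.T)) (fun j => P.η j q))

lemma contDiff_endMap (hreg : P.IsRegular) : ContDiff ℝ 2 (P.endMap w) := by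
  rw [contDiff_euclidean]
  rintro (i | j)
  · exact (hreg.2.1 i).1.sub contDiff_const
  · exact (hreg.2.2 j).1

/-- Evaluation at the endpoints. -/
def evalEnds {T : ℝ} (hT : 0 ≤ T) : C(Icc 0 T, Fin n → ℝ) →L[ℝ] (Fin n → ℝ) × (Fin n → ℝ) :=
  (ContinuousMap.evalCLM ℝ (⟨0, le_rfl, hT⟩ : Icc 0 T)).prod
    (ContinuousMap.evalCLM ℝ (⟨T, hT, le_rfl⟩ : Icc 0 T))

lemma evalEnds_apply {T : ℝ} (hT : 0 ≤ T) (x : C(Icc 0 T, Fin n → ℝ)) :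
    evalEnds hT x = (IccExtend hT x 0, IccExtend hT x T) := by
  rw [IccExtend_of_mem hT _ ⟨le_rfl, hT⟩, IccExtend_of_mem hT _ ⟨hT, le_rfl⟩]
  rfl

lemma eLpNorm_top_lt {k : ℕ} {T ε ε' : ℝ} (h0 : 0 ≤ ε') (hε : ε' < ε) {f : ℝ → Fin k → ℝ}
    (hf : ∀ t ∈ Icc 0 T, ‖f t‖ ≤ ε') : eLpNorm f ⊤ (timeMeasure T) < ENNReal.ofReal ε := by
  rw [eLpNorm_exponent_top]
  exact (eLpNormEssSup_le_of_ae_bound (ae_timeMeasure_of_Icc hf)).trans_lt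
    ((ENNReal.ofReal_lt_ofReal_iff (h0.trans_lt hε)).2 hε)

namespace IsReference

variable (h : P.IsReference w)
include h

/-- A weak minimum makes the endpoint system infeasible for small perturbations. -/
lemma eventually_infeasible (hw : P.IsWeakMinimum w)
    (hact : ∀ i : Fin dφ, P.φ i.succ (w.x 0, w.x P.T) = 0)
    {S : P.Dir → C(Icc 0 P.T, Fin n → ℝ)} (hS : ContinuousAt S 0)
    (hS0 : ∀ t, S 0 t = w.x t)
    (hSe : ∀ᶠ c in 𝓝 0, ∀ t, S c t = w.x 0 + c.1 + ∫ s in (0 : ℝ)..t,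
      P.Fz (IccExtend h.nonneg (S c) s, (w.u s, w.v s) + IccExtend h.nonneg c.2 s)) :
    ∀ᶠ c in 𝓝 0, ¬ ((∀ k, k.isLeft → P.endMap w (evalEnds h.nonneg (S c)) k < 0) ∧
      ∀ k, ¬ k.isLeft → P.endMap w (evalEnds h.nonneg (S c)) k = 0) := by
  obtain ⟨hfeas, ε, hε, hmin⟩ := hw
  have hnear : ∀ᶠ c in 𝓝 (0 : P.Dir), dist (S c) (S 0) < ε / 2 :=
    (Metric.tendsto_nhds.1 hS) _ (half_pos hε)
  have hnear2 : ∀ᶠ c in 𝓝 (0 : P.Dir), dist c 0 < ε / 2 := Metric.ball_mem_nhds _ (half_pos hε)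
  filter_upwards [hSe, hnear, hnear2] with c hc hd hd2
  rintro ⟨hneg, hzero⟩
  have hc2 : ∀ t, ‖IccExtend h.nonneg c.2 t‖ ≤ ε / 2 := fun t => by
    have h1 : ‖c.2‖ ≤ ‖c‖ := norm_snd_le c
    have h2 : ‖c‖ < ε / 2 := by simpa using hd2
    exact ((c.2.norm_coe_le_norm _).trans h1).trans h2.le
  -- A solution of the endpoint system would give a feasible process within `ε / 2` of `w` in all
  -- three norms and with strictly smaller cost. Halving the radius makes the bounds on the
  -- essential suprema strict.
  let w' : StateControl n l m := ⟨IccExtend h.nonneg (S c),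
    fun t => w.u t + (IccExtend h.nonneg c.2 t).1, fun t => w.v t + (IccExtend h.nonneg c.2 t).2⟩
  have hxc : Continuous w'.x := IccExtend_continuous _ _
  have huc : ContinuousOn w'.u (Icc 0 P.T) := h.cu.continuousOn.add
    (continuous_fst.comp (IccExtend_continuous h.nonneg c.2)).continuousOn
  have hvc : ContinuousOn w'.v (Icc 0 P.T) := h.cv.continuousOn.add
    (continuous_snd.comp (IccExtend_continuous h.nonneg c.2)).continuousOn
  have hFc : ContinuousOn (fun t => P.Fz (w'.pt t)) (Icc 0 P.T) :=
    (contDiff_Fz h.reg).continuous.comp_continuousOn (hxc.continuousOn.prodMk (huc.prodMk hvc))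
  have hxt : ∀ t ∈ Icc 0 P.T, w'.x t = w.x 0 + c.1 + ∫ s in (0 : ℝ)..t, P.Fz (w'.pt s) :=
    fun t ht => (IccExtend_of_mem h.nonneg (S c) ht).trans (hc ⟨t, ht⟩)
  have hx0 : w'.x 0 = w.x 0 + c.1 := by
    rw [hxt 0 ⟨le_rfl, h.nonneg⟩]; simp
  rw [← hx0] at hxt
  have hends : evalEnds h.nonneg (S c) = (w'.x 0, w'.x P.T) := evalEnds_apply _ _
  have hfeas' : P.IsFeasible w' := by
    refine ⟨⟨⟨isSobolev_of_eq_integral hFc hxt, huc.memLp_timeMeasure, hvc.memLp_timeMeasure⟩,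
      ae_timeMeasure_of_Ioo (contDiffOn_of_eq_integral h.nonneg hFc hxt).2⟩, fun j => ?_, fun i => ?_⟩
    · have := hzero (.inr j) (by simp)
      rw [hends] at this
      exact this
    · have := hneg (.inl i.succ) (by simp)
      rw [hends] at this
      have h1 : P.φ i.succ (w'.x 0, w'.x P.T) - P.φ i.succ (w.x 0, w.x P.T) < 0 := this
      rw [hact, sub_zero] at h1
      exact h1.le
  have hhalf : ε / 2 < ε := half_lt_self hε
  have hcost := hmin w' hfeas'
    (eLpNorm_top_lt (half_pos hε).le hhalf fun t ht => by
      have h1 : w'.x t = S c ⟨t, ht⟩ := IccExtend_of_mem h.nonneg (S c) ht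
      rw [h1, ← hS0 ⟨t, ht⟩, ← dist_eq_norm]
      exact (ContinuousMap.dist_apply_le_dist _).trans hd.le)
    (eLpNorm_top_lt (half_pos hε).le hhalf fun t ht => by
      change ‖w.u t + (IccExtend h.nonneg c.2 t).1 - w.u t‖ ≤ _
      rw [add_sub_cancel_left]
      exact (norm_fst_le _).trans (hc2 t))
    (eLpNorm_top_lt (half_pos hε).le hhalf fun t ht => by
      change ‖w.v t + (IccExtend h.nonneg c.2 t).2 - w.v t‖ ≤ _
      rw [add_sub_cancel_left]
      exact (norm_snd_le _).trans (hc2 t))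
  have := hneg (.inl 0) (by simp)
  rw [hends] at this
  have h1 : P.φ 0 (w'.x 0, w'.x P.T) - P.φ 0 (w.x 0, w.x P.T) < 0 := this
  linarith

/-- The solution map of the controlled equation near the reference process. -/
lemma exists_solution : ∃ S : P.Dir → C(Icc 0 P.T, Fin n → ℝ), ContDiffAt ℝ 2 S 0 ∧
    (∀ t, S 0 t = w.x t) ∧
    (∀ᶠ c in 𝓝 0, ∀ t, S c t = w.x 0 + c.1 + ∫ s in (0 : ℝ)..t,
      P.Fz (IccExtend h.nonneg (S c) s, (w.u s, w.v s) + IccExtend h.nonneg c.2 s)) ∧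
    (∀ c, fderiv ℝ S 0 c = h.linState c) ∧
    ∀ c, ∀ t ∈ Icc 0 P.T, IccExtend h.nonneg (fderiv ℝ (fderiv ℝ S) 0 c c) t =
      ∫ s in (0 : ℝ)..t, (P.dF w s (ιx (IccExtend h.nonneg (fderiv ℝ (fderiv ℝ S) 0 c c) s)) +
        P.ddF w s ((h.dir c).pt s) ((h.dir c).pt s)) := by
  let x := restrictCM h.cx.continuousOn
  let u := restrictCM (h.cu.continuousOn.prodMk h.cv.continuousOn)
  obtain ⟨S, h1, h2, h3, h4, h5⟩ := exists_solutionMap h.nonneg (contDiff_Fz h.reg) (w.x 0) x u (by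
    ext1 t
    change w.x t = w.x 0 + ∫ s in (0 : ℝ)..t, IccExtend h.nonneg _ s
    rw [integral_IccExtend h.nonneg _ (x := fun s => P.Fz (w.pt s)) (fun s hs => ?_) t.2]
    · exact h.eq t t.2
    · rw [superpose_apply, pairFun_apply]
      rfl)
  have hlin : ∀ c, fderiv ℝ S 0 c = h.linState c := by
    intro c
    rw [eq_linState_iff]
    intro t
    obtain ⟨r, hr1, hr2⟩ := h4 c
    have hr3 := DFunLike.congr_fun hr2 t
    refine hr3.trans ?_
    change c.1 + ∫ s in (0 : ℝ)..t, IccExtend h.nonneg r s = _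
    congr 1
    refine integral_IccExtend h.nonneg _ (fun s hs => ?_) t.2
    rw [hr1, IccExtend_of_mem _ _ hs, IccExtend_of_mem _ _ hs]
    rfl
  refine ⟨S, h1, fun t => by rw [h2]; rfl, ?_, hlin, fun c t ht => ?_⟩
  · filter_upwards [h3] with c hc t
    refine (DFunLike.congr_fun hc t).trans ?_
    change w.x 0 + c.1 + ∫ s in (0 : ℝ)..t, IccExtend h.nonneg _ s = _
    congr 1
    refine integral_IccExtend h.nonneg _ (fun s hs => ?_) t.2
    rw [superpose_apply, pairFun_apply, IccExtend_of_mem _ _ hs, IccExtend_of_mem _ _ hs]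
    rfl
  · obtain ⟨r, hr1, hr2⟩ := h5 c
    rw [IccExtend_of_mem _ _ ht]
    refine (DFunLike.congr_fun hr2 ⟨t, ht⟩).trans ?_
    change ∫ s in (0 : ℝ)..t, IccExtend h.nonneg r s = _
    refine integral_IccExtend h.nonneg _ (fun s hs => ?_) ht
    rw [hr1, IccExtend_of_mem _ _ hs, dir_pt, IccExtend_of_mem _ _ hs, IccExtend_of_mem _ _ hs,
      hlin]
    rfl

lemma Omega_dir (lam : Multiplier n dφ dη) (c : P.Dir) :
    P.Omega w lam (h.dir c) = (1 / 2) * fderiv ℝ (fderiv ℝ (P.ell lam)) (w.x 0, w.x P.T)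
      (h.ends c) (h.ends c) + ∫ t in (0 : ℝ)..P.T,
        (1 / 2) * (lam.2.2 t ⬝ᵥ P.ddF w t ((h.dir c).pt t) ((h.dir c).pt t)) := by
  unfold Omega
  simp only [Omega_integrand w lam h.reg]
  rfl

omit h in
lemma inner_endMap (h : P.IsReference w) (μ : P.EndMult) (q : (Fin n → ℝ) × (Fin n → ℝ)) :
    inner ℝ μ (P.endMap w q) =
      P.ell (h.mult μ) q - ∑ i, μ (.inl i) * P.φ i (w.x 0, w.x P.T) := by
  simp only [PiLp.inner_apply, Fintype.sum_sum_type, endMap, ell, mult, LinearMap.coe_mk,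
    AddHom.coe_mk, Sum.elim_inl, Sum.elim_inr, RCLike.inner_apply, conj_trivial, sub_mul,
    Finset.sum_sub_distrib]
  simp only [mul_comm]
  ring

/-- The multiplier rule, with a second-order condition in a critical direction and a bound on the
index of the second variation. -/
theorem exists_multiplier (hw : P.IsWeakMinimum w)
    (hact : ∀ i : Fin dφ, P.φ i.succ (w.x 0, w.x P.T) = 0) (c₀ : P.Dir)
    (hφ : ∀ i, fderiv ℝ (P.φ i) (w.x 0, w.x P.T) (h.ends c₀) ≤ 0)
    (hη : ∀ j, fderiv ℝ (P.η j) (w.x 0, w.x P.T) (h.ends c₀) = 0) :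
    ∃ μ : P.EndMult, ‖μ‖ = 1 ∧ (∀ i, 0 ≤ μ (.inl i)) ∧
      (∀ c, fderiv ℝ (P.ell (h.mult μ)) (w.x 0, w.x P.T) (h.ends c) = 0) ∧
      0 ≤ P.Omega w (h.mult μ) (h.dir c₀) ∧
      ∀ v : Fin (3 * Fintype.card (Fin (dφ + 1) ⊕ Fin dη) + 1) → P.Dir,
        ∃ c : EuclideanSpace ℝ (Fin (3 * Fintype.card (Fin (dφ + 1) ⊕ Fin dη) + 1)), ‖c‖ = 1 ∧
          0 ≤ P.Omega w (h.mult μ) (h.dir (∑ i, c i • v i)) := by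
  obtain ⟨S, hS, hS0, hSe, hS1, hS2⟩ := h.exists_solution
  have hq0 : evalEnds h.nonneg (S 0) = (w.x 0, w.x P.T) := by
    refine Prod.ext ?_ ?_
    · exact hS0 _
    · exact hS0 _
  let g : C(Icc 0 P.T, Fin n → ℝ) → P.EndMult := fun x => P.endMap w (evalEnds h.nonneg x)
  have hg : ContDiff ℝ 2 g := (contDiff_endMap h.reg).comp (evalEnds h.nonneg).contDiff
  have hG : ContDiffAt ℝ 2 (fun c => g (S c)) 0 := hg.contDiffAt.comp 0 hS
  have hends : ∀ c, evalEnds h.nonneg (fderiv ℝ S 0 c) = h.ends c := fun c => by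
    rw [hS1]; exact evalEnds_apply _ _
  have hL1 : ∀ (L : P.EndMult →L[ℝ] ℝ) c, L (fderiv ℝ (fun c => g (S c)) 0 c) =
      fderiv ℝ (fun q => L (P.endMap w q)) (w.x 0, w.x P.T) (h.ends c) := by
    intro L c
    rw [← (fderiv_fderiv_clm_comp L hG).1]
    have h1 : ContDiff ℝ 2 fun q => L (P.endMap w q) := L.contDiff.comp (contDiff_endMap h.reg)
    have h2 := (fderiv_fderiv_comp_diag (g := fun x => L (P.endMap w (evalEnds h.nonneg x)))
      (h1.comp (evalEnds h.nonneg).contDiff) hS c).1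
    refine h2.trans ?_
    have h3 := (fderiv_fderiv_comp_continuousLinearMap (evalEnds (n := n) h.nonneg) (a := S 0)
      (h1.contDiffAt)).1
    rw [h3, ContinuousLinearMap.comp_apply, hends, hq0]
  have hinner1 : ∀ μ c, inner ℝ μ (fderiv ℝ (fun c => g (S c)) 0 c) =
      fderiv ℝ (P.ell (h.mult μ)) (w.x 0, w.x P.T) (h.ends c) := by
    intro μ c
    refine (hL1 (innerSL ℝ μ) c).trans ?_
    simp only [innerSL_apply_apply, inner_endMap h, fderiv_sub_const]
  -- The second derivative of the solution map solves the linearized equation with zero initial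
  -- value and with the second derivative of the dynamics as source. Pairing it with the adjoint
  -- state turns its endpoint term into `∫ p F''`, and adding `D²ℓ` gives `2Ω`. The zero initial
  -- value removes the boundary terms at 0, so stationarity of `μ` is not required.
  have hinner2 : ∀ μ c, inner ℝ μ (fderiv ℝ (fderiv ℝ (fun c => g (S c))) 0 c c) =
      2 * P.Omega w (h.mult μ) (h.dir c) := by
    intro μ c
    refine ((fderiv_fderiv_clm_comp (innerSL ℝ μ) hG).2 c c).symm.trans ?_
    have hell := contDiff_ell h.reg (h.mult μ)
    have h0 : (fun c => innerSL ℝ μ (g (S c))) = fun c => P.ell (h.mult μ) (evalEnds h.nonneg (S c)) -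
        ∑ i, μ (.inl i) * P.φ i (w.x 0, w.x P.T) := by
      funext c
      exact inner_endMap h μ _
    rw [h0, show fderiv ℝ (fun c => P.ell (h.mult μ) (evalEnds h.nonneg (S c)) -
        ∑ i, μ (.inl i) * P.φ i (w.x 0, w.x P.T)) =
        fderiv ℝ (fun c => P.ell (h.mult μ) (evalEnds h.nonneg (S c))) from
        funext fun c => fderiv_sub_const _]
    have h2 := (fderiv_fderiv_comp_diag (g := fun x => P.ell (h.mult μ) (evalEnds h.nonneg x))
      (hell.comp (evalEnds h.nonneg).contDiff) hS c).2
    refine h2.trans ?_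
    obtain ⟨h3, h4⟩ := fderiv_fderiv_comp_continuousLinearMap (evalEnds (n := n) h.nonneg)
      (a := S 0) (G := P.ell (h.mult μ)) hell.contDiffAt
    rw [h3, h4, ContinuousLinearMap.comp_apply, hends, hq0, evalEnds_apply]
    set y := IccExtend h.nonneg (fderiv ℝ (fderiv ℝ S) 0 c c) with hy
    have hyc : Continuous y := IccExtend_continuous _ _
    have hy0 : y 0 = 0 := (hS2 c 0 ⟨le_rfl, h.nonneg⟩).trans (by simp)
    have hpt := h.continuous_dir_pt c
    have hrc : ContinuousOn (fun t => P.ddF w t ((h.dir c).pt t) ((h.dir c).pt t)) (Icc 0 P.T) :=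
      (h.continuousOn_ddF.clm_apply hpt.continuousOn).clm_apply hpt.continuousOn
    rw [h.pairing μ hyc.continuousOn hrc (fun t ht => by rw [hy0, zero_add]; exact hS2 c t ht), hy0,
      dotProduct_zero, Omega_dir h, intervalIntegral.integral_const_mul]
    have h00 : ((0, 0) : (Fin n → ℝ) × (Fin n → ℝ)) = 0 := rfl
    rw [h00, map_zero]
    ring
  obtain ⟨μ, m1, m2, m3, m4, m5⟩ := exists_multiplier_of_finite_index
    (p := fun k : Fin (dφ + 1) ⊕ Fin dη => k.isLeft = true) (G := fun c => g (S c)) hG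
    (by
      ext k
      change P.endMap w (evalEnds h.nonneg (S 0)) k = 0
      rw [hq0]
      rcases k with i | j
      · exact sub_self _
      · exact hw.1.2.1 j)
    (h.eventually_infeasible hw hact hS.continuousAt hS0 hSe) c₀
    (by
      rintro (i | j) hk
      · refine le_trans (le_of_eq ?_) (hφ i)
        refine (hL1 (EuclideanSpace.proj (Sum.inl i)) c₀).trans ?_
        change fderiv ℝ (fun q => P.φ i q - P.φ i (w.x 0, w.x P.T)) _ _ = _
        rw [fderiv_sub_const]
      · simp at hk)
    (by
      rintro (i | j) hk
      · simp at hk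
      · refine Eq.trans ?_ (hη j)
        exact hL1 (EuclideanSpace.proj (Sum.inr j)) c₀)
  refine ⟨μ, m1, fun i => m2 (.inl i) rfl, fun c => ?_, ?_, fun v => ?_⟩
  · rw [← hinner1]; exact m3 c
  · have := m4
    rw [hinner2] at this
    linarith
  · obtain ⟨c, hc1, hc2⟩ := m5 v
    refine ⟨c, hc1, ?_⟩
    rw [hinner2] at hc2
    linarith

end IsReference

end ControlProblem

/-! ### Lagrange multipliers and their endpoint parts -/

namespace ControlProblem

variable {n l m dφ dη : ℕ} {P : ControlProblem n l m dφ dη} {w : StateControl n l m}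

/-- The part `(α, β)` of a multiplier. -/
def toEnd (P : ControlProblem n l m dφ dη) : Multiplier n dφ dη →ₗ[ℝ] P.EndMult where
  toFun lam := WithLp.toLp 2 (Sum.elim lam.1 lam.2.1)
  map_add' a b := by
    ext k
    rcases k with i | j <;> rfl
  map_smul' r a := by
    ext k
    rcases k with i | j <;> rfl

/-- Equality of multipliers on `[0, T]`. -/
def Agree (P : ControlProblem n l m dφ dη) (lam lam' : Multiplier n dφ dη) : Prop :=
  lam.1 = lam'.1 ∧ lam.2.1 = lam'.2.1 ∧ ∀ t ∈ Icc 0 P.T, lam.2.2 t = lam'.2.2 t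

lemma Agree.ell_eq {lam lam' : Multiplier n dφ dη} (ha : P.Agree lam lam') :
    P.ell lam = P.ell lam' := by
  funext q
  simp only [ell, ha.1, ha.2.1]

lemma Agree.Omega_eq (hT : 0 ≤ P.T) {lam lam' : Multiplier n dφ dη} (ha : P.Agree lam lam')
    (d : StateControl n l m) : P.Omega w lam d = P.Omega w lam' d := by
  unfold Omega ellSecond
  rw [ha.ell_eq]
  congr 1
  refine intervalIntegral.integral_congr fun t ht => ?_
  rw [uIcc_of_le hT] at ht
  simp only [Hxx, Hux, Hvx, Huu, Hvu, ha.2.2 t ht]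

namespace IsReference

variable (h : P.IsReference w)
include h

lemma trL_dF_eq_gradHx (p : Fin n → ℝ) (t : ℝ) :
    trL ((P.dF w t).comp ιx) p = P.gradHx p (w.x t) (w.u t) (w.v t) := by
  refine dotProduct_eq _ _ fun b => ?_
  rw [trL_dotProduct, gradHx_dotProduct h.reg]
  rfl

lemma fderiv_ell_left (lam : Multiplier n dφ dη) (a : Fin n → ℝ) :
    grad (fun a => P.ell lam (a, w.x P.T)) (w.x 0) ⬝ᵥ a =
      fderiv ℝ (P.ell lam) (w.x 0, w.x P.T) (a, 0) := by
  have h1 : HasFDerivAt (fun a => P.ell lam (a, w.x P.T)) ((fderiv ℝ (P.ell lam)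
      (w.x 0, w.x P.T)).comp (.inl ℝ _ _)) (w.x 0) := by
    have h2 : HasFDerivAt (fun a => ((a, w.x P.T) : (Fin n → ℝ) × (Fin n → ℝ)))
      (ContinuousLinearMap.inl ℝ _ _) (w.x 0) := hasFDerivAt_prodMk_left _ _
    exact ((contDiff_ell h.reg lam).differentiable (by norm_num) _).hasFDerivAt.comp _ h2
  rw [grad_dotProduct, h1.fderiv]
  rfl

lemma fderiv_ell_right (lam : Multiplier n dφ dη) (a : Fin n → ℝ) :
    grad (fun b => P.ell lam (w.x 0, b)) (w.x P.T) ⬝ᵥ a =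
      fderiv ℝ (P.ell lam) (w.x 0, w.x P.T) (0, a) := by
  have h1 : HasFDerivAt (fun b => P.ell lam (w.x 0, b)) ((fderiv ℝ (P.ell lam)
      (w.x 0, w.x P.T)).comp (.inr ℝ _ _)) (w.x P.T) := by
    have h2 : HasFDerivAt (fun b => ((w.x 0, b) : (Fin n → ℝ) × (Fin n → ℝ)))
      (ContinuousLinearMap.inr ℝ _ _) (w.x P.T) := hasFDerivAt_prodMk_right _ _
    exact ((contDiff_ell h.reg lam).differentiable (by norm_num) _).hasFDerivAt.comp _ h2
  rw [grad_dotProduct, h1.fderiv]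
  rfl

lemma termGrad_eq (μ : P.EndMult) :
    termGrad P w μ = grad (fun b => P.ell (h.mult μ) (w.x 0, b)) (w.x P.T) := by
  refine dotProduct_eq _ _ fun b => ?_
  rw [fderiv_ell_right h, termGrad_dotProduct h]

/-- The first variation of the endpoint Lagrangian. -/
lemma fderiv_ell_ends (μ : P.EndMult) (c : P.Dir) :
    fderiv ℝ (P.ell (h.mult μ)) (w.x 0, w.x P.T) (h.ends c) =
      fderiv ℝ (P.ell (h.mult μ)) (w.x 0, w.x P.T) (c.1, 0) + (h.mult μ).2.2 0 ⬝ᵥ c.1 +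
        ∫ t in (0 : ℝ)..P.T, (h.mult μ).2.2 t ⬝ᵥ P.dF w t (0, IccExtend h.nonneg c.2 t) := by
  have hc : ContinuousOn (fun t => P.dF w t (0, IccExtend h.nonneg c.2 t)) (Icc 0 P.T) :=
    h.continuousOn_dF.clm_apply
      (continuous_const.prodMk (IccExtend_continuous h.nonneg c.2)).continuousOn
  have := h.pairing μ (h.continuous_dir_x c).continuousOn hc (fun t ht => by
    rw [h.dir_x_eq c ht, dir_x_zero]
    congr 2
    ext1 s
    rw [← map_add]
    congr 1
    simp [dir_pt]
    rfl)
  rw [ends, this, dir_x_zero]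

/-- A stationary normalized endpoint multiplier is a Lagrange multiplier. -/
lemma mult_mem_multipliers {μ : P.EndMult} (hn : ∑ i, |μ (.inl i)| + ∑ j, |μ (.inr j)| = 1)
    (hα : ∀ i, 0 ≤ μ (.inl i))
    (hst : ∀ c, fderiv ℝ (P.ell (h.mult μ)) (w.x 0, w.x P.T) (h.ends c) = 0) :
    h.mult μ ∈ P.multipliers w := by
  set p := (h.mult μ).2.2 with hp
  have hpc : Continuous p := h.continuous_mult_p μ
  have hrc : ContinuousOn (fun s => -trL ((P.dF w s).comp ιx) (p s)) (Icc 0 P.T) :=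
    ((trL.continuous.comp_continuousOn h.continuousOn_dF_ιx).clm_apply hpc.continuousOn).neg
  have hpe : ∀ t ∈ Icc 0 P.T, p t = p 0 + ∫ s in (0 : ℝ)..t, -trL ((P.dF w s).comp ιx) (p s) :=
    fun t ht => h.mult_p_eq μ ht
  have hcontrol : ∀ t ∈ Icc 0 P.T, ∀ b : (Fin l → ℝ) × (Fin m → ℝ), p t ⬝ᵥ P.dF w t (0, b) = 0 := by
    -- Stationarity is tested with the control perturbation `(H_u, H_v)` itself. The first variation
    -- is then the integral of the sum of squares of its components, and continuity forces both
    -- gradients to vanish at every time.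
    let ρ : ℝ → (Fin l → ℝ) × (Fin m → ℝ) := fun t =>
      (P.gradHu (p t) (w.x t) (w.u t) (w.v t), P.gradHv (p t) (w.x t) (w.u t) (w.v t))
    have hρ : ∀ t b, (ρ t).1 ⬝ᵥ b.1 + (ρ t).2 ⬝ᵥ b.2 = p t ⬝ᵥ P.dF w t (0, b) := fun t b => by
      simp only [ρ]
      rw [gradHu_dotProduct h.reg, gradHv_dotProduct h.reg, ← dotProduct_add, ← map_add]
      simp [dF, StateControl.pt]
    have hlin : ∀ b, ContinuousOn (fun t => p t ⬝ᵥ P.dF w t b) (Icc 0 P.T) := fun b =>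
      (dotL.continuous.comp_continuousOn hpc.continuousOn).clm_apply
        (h.continuousOn_dF.clm_apply continuousOn_const)
    have hρc : ContinuousOn ρ (Icc 0 P.T) := by
      refine ContinuousOn.prodMk (continuousOn_pi.2 fun i => ?_) (continuousOn_pi.2 fun i => ?_)
      · refine (hlin (0, Pi.single i 1, 0)).congr fun t _ => ?_
        exact Eq.trans (by simp [ρ]) (hρ t (Pi.single i 1, 0))
      · refine (hlin (0, 0, Pi.single i 1)).congr fun t _ => ?_
        exact Eq.trans (by simp [ρ]) (hρ t (0, Pi.single i 1))
    have h0 := hst (0, restrictCM hρc)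
    rw [fderiv_ell_ends] at h0
    have h00 : ((0, 0) : (Fin n → ℝ) × (Fin n → ℝ)) = 0 := rfl
    simp only [h00, map_zero, dotProduct_zero, add_zero, zero_add] at h0
    have hint : ∫ t in (0 : ℝ)..P.T, ((ρ t).1 ⬝ᵥ (ρ t).1 + (ρ t).2 ⬝ᵥ (ρ t).2) = 0 := by
      refine Eq.trans (intervalIntegral.integral_congr fun t ht => ?_) h0
      rw [uIcc_of_le h.nonneg] at ht
      rw [hρ, IccExtend_restrictCM h.nonneg hρc ht]
    have hnn : ∀ t, 0 ≤ (ρ t).1 ⬝ᵥ (ρ t).1 + (ρ t).2 ⬝ᵥ (ρ t).2 := fun t =>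
      add_nonneg (Finset.sum_nonneg fun i _ => mul_self_nonneg _)
        (Finset.sum_nonneg fun i _ => mul_self_nonneg _)
    have hcc : ContinuousOn (fun t => (ρ t).1 ⬝ᵥ (ρ t).1 + (ρ t).2 ⬝ᵥ (ρ t).2) (Icc 0 P.T) :=
      ((dotL.continuous.comp_continuousOn hρc.fst).clm_apply hρc.fst).add
        ((dotL.continuous.comp_continuousOn hρc.snd).clm_apply hρc.snd)
    have hz : ∀ t ∈ Icc 0 P.T, (ρ t).1 ⬝ᵥ (ρ t).1 + (ρ t).2 ⬝ᵥ (ρ t).2 = 0 := by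
      intro t ht
      by_contra hne
      have := intervalIntegral.integral_pos h.pos hcc (fun t _ => hnn t)
        ⟨t, ht, lt_of_le_of_ne (hnn t) (Ne.symm hne)⟩
      exact this.ne' hint
    intro t ht b
    have h1 := hz t ht
    have ha : 0 ≤ (ρ t).1 ⬝ᵥ (ρ t).1 := Finset.sum_nonneg fun i _ => mul_self_nonneg _
    have hb : 0 ≤ (ρ t).2 ⬝ᵥ (ρ t).2 := Finset.sum_nonneg fun i _ => mul_self_nonneg _
    have h2 : (ρ t).1 = 0 := dotProduct_self_eq_zero.1 (by linarith)
    have h3 : (ρ t).2 = 0 := dotProduct_self_eq_zero.1 (by linarith)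
    rw [← hρ, h2, h3]
    simp
  refine ⟨hn, hα, isSobolev_of_eq_integral hrc hpe, ae_timeMeasure_of_Ioo fun t ht => ?_, ?_, ?_,
    ae_timeMeasure_of_Icc fun t ht => ⟨?_, ?_⟩⟩
  · have := (contDiffOn_of_eq_integral h.nonneg hrc hpe).2 t ht
    rwa [h.trL_dF_eq_gradHx] at this
  · refine dotProduct_eq _ _ fun a => ?_
    -- With unperturbed controls the first variation is `D_{x₀}ℓ a + p₀ a`, which gives the
    -- condition at 0. The condition at `T` is built into the definition of the adjoint state.
    have h1 := hst (a, 0)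
    rw [fderiv_ell_ends] at h1
    have h2 : ∫ t in (0 : ℝ)..P.T, (h.mult μ).2.2 t ⬝ᵥ P.dF w t
        (0, IccExtend h.nonneg (0 : C(Icc 0 P.T, (Fin l → ℝ) × (Fin m → ℝ))) t) = 0 := by
      refine Eq.trans (intervalIntegral.integral_congr (g := fun _ => (0 : ℝ)) fun t _ => ?_)
        intervalIntegral.integral_zero
      have : (((0, IccExtend h.nonneg (0 : C(Icc 0 P.T, (Fin l → ℝ) × (Fin m → ℝ))) t)) :
        (Fin n → ℝ) × (Fin l → ℝ) × (Fin m → ℝ)) = 0 := rfl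
      simp only [this, map_zero, dotProduct_zero]
    rw [h2] at h1
    rw [neg_dotProduct, fderiv_ell_left h]
    linarith
  · exact (h.mult_p_T μ).trans (h.termGrad_eq μ)
  · refine dotProduct_eq _ _ fun b => ?_
    rw [gradHu_dotProduct h.reg, zero_dotProduct]
    exact hcontrol t ht (b, 0)
  · refine dotProduct_eq _ _ fun b => ?_
    rw [gradHv_dotProduct h.reg, zero_dotProduct]
    exact hcontrol t ht (0, b)

/-- A Lagrange multiplier is determined on `[0, T]` by its endpoint part, which is stationary. -/
lemma of_mem_multipliers {lam : Multiplier n dφ dη} (hl : lam ∈ P.multipliers w) :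
    P.Agree lam (h.mult (P.toEnd lam)) ∧ ∀ c,
      fderiv ℝ (P.ell (h.mult (P.toEnd lam))) (w.x 0, w.x P.T) (h.ends c) = 0 := by
  obtain ⟨hn, hα, hs, hd, h0, hTe, hH⟩ := hl
  have hpc := hs.continuousOn h.nonneg (by simp)
  have hpe := (hs.eq_integral h.nonneg (by simp) hd).2
  simp only [← h.trL_dF_eq_gradHx] at hpe
  have hell : P.ell lam = P.ell (h.mult (P.toEnd lam)) := rfl
  have hpT : lam.2.2 P.T = (h.mult (P.toEnd lam)).2.2 P.T := by
    rw [hTe, mult_p_T, termGrad_eq h, hell]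
  have hag := adjoint_unique h.nonneg h.continuousOn_dF_ιx hpc
    (h.continuous_mult_p _).continuousOn hpT hpe fun t ht => h.mult_p_eq _ ht
  refine ⟨⟨rfl, rfl, hag⟩, fun c => ?_⟩
  rw [fderiv_ell_ends, ← hag 0 ⟨le_rfl, h.nonneg⟩, h0, neg_dotProduct, fderiv_ell_left h, hell,
    add_neg_cancel, zero_add, intervalIntegral_eq_timeMeasure h.nonneg]
  refine integral_eq_zero_of_ae ?_
  have hIcc : ∀ᵐ t ∂timeMeasure P.T, t ∈ Icc 0 P.T := ae_timeMeasure_of_Icc fun _ h => h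
  filter_upwards [hH, hIcc] with t h1 ht
  rw [← hag t ht]
  have h2 := gradHu_dotProduct h.reg (lam.2.2 t) (w.x t) (w.u t) (w.v t) (IccExtend h.nonneg c.2 t).1
  have h3 := gradHv_dotProduct h.reg (lam.2.2 t) (w.x t) (w.u t) (w.v t) (IccExtend h.nonneg c.2 t).2
  rw [h1.1, zero_dotProduct] at h2
  rw [h1.2, zero_dotProduct] at h3
  have h4 : ((0, IccExtend h.nonneg c.2 t) : (Fin n → ℝ) × (Fin l → ℝ) × (Fin m → ℝ)) =
      ιu (IccExtend h.nonneg c.2 t).1 + ιv (IccExtend h.nonneg c.2 t).2 := by simp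
  rw [h4, map_add, dotProduct_add]
  change lam.2.2 t ⬝ᵥ fderiv ℝ P.Fz (w.x t, w.u t, w.v t) _ +
    lam.2.2 t ⬝ᵥ fderiv ℝ P.Fz (w.x t, w.u t, w.v t) _ = 0
  rw [← h2, ← h3, add_zero]

end IsReference

end ControlProblem

/-! ### Matrix functions of time -/

section MatrixCalculus

variable {a b : ℕ} {T : ℝ}

lemma dotProduct_transpose_mulVec (M : Matrix (Fin a) (Fin b) ℝ) (x : Fin b → ℝ) (y : Fin a → ℝ) :
    x ⬝ᵥ Mᵀ *ᵥ y = y ⬝ᵥ M *ᵥ x := by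
  rw [mulVec_transpose, dotProduct_comm, ← dotProduct_mulVec]

lemma Matrix.ext_dotProduct {M N : Matrix (Fin a) (Fin b) ℝ}
    (h : ∀ x y, x ⬝ᵥ M *ᵥ y = x ⬝ᵥ N *ᵥ y) : M = N := by
  ext i j
  simpa using h (Pi.single i 1) (Pi.single j 1)

lemma continuousOn_matrix {M : ℝ → Matrix (Fin a) (Fin b) ℝ} {s : Set ℝ}
    (h : ∀ x y, ContinuousOn (fun t => x ⬝ᵥ M t *ᵥ y) s) : ContinuousOn M s := by
  refine continuousOn_pi.2 fun i => continuousOn_pi.2 fun j => ?_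
  simpa using h (Pi.single i 1) (Pi.single j 1)

/-- Matrix-valued functions with continuously differentiable entries on `[0, T]`. -/
def MatC1 (T : ℝ) (M : ℝ → Matrix (Fin a) (Fin b) ℝ) : Prop :=
  ∀ i j, ContDiffOn ℝ 1 (fun t => M t i j) (Icc 0 T)

/-- The continuous extension to `[0, T]` of the entrywise derivative. -/
def matDerivWithin (T : ℝ) (M : ℝ → Matrix (Fin a) (Fin b) ℝ) (t : ℝ) : Matrix (Fin a) (Fin b) ℝ :=
  Matrix.of fun i j => derivWithin (fun s => M s i j) (Icc 0 T) t

lemma MatC1.continuousOn {M : ℝ → Matrix (Fin a) (Fin b) ℝ} (hM : MatC1 T M) :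
    ContinuousOn M (Icc 0 T) :=
  continuousOn_pi.2 fun i => continuousOn_pi.2 fun j => (hM i j).continuousOn

lemma MatC1.continuousOn_matDerivWithin {M : ℝ → Matrix (Fin a) (Fin b) ℝ} (hT : 0 < T)
    (hM : MatC1 T M) : ContinuousOn (matDerivWithin T M) (Icc 0 T) :=
  continuousOn_pi.2 fun i => continuousOn_pi.2 fun j =>
    (hM i j).continuousOn_derivWithin (uniqueDiffOn_Icc hT) le_rfl

/-- At the ends of the interval a two-sided derivative depends on values outside `[0, T]`. On the
open interval it agrees with the one-sided version, which is continuous up to the ends, and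
integrals do not see the difference. -/
lemma matDeriv_eq (M : ℝ → Matrix (Fin a) (Fin b) ℝ) {t : ℝ} (ht : t ∈ Ioo 0 T) :
    matDeriv M t = matDerivWithin T M t := by
  ext i j
  exact (derivWithin_of_mem_nhds (Icc_mem_nhds ht.1 ht.2)).symm

lemma MatC1.hasDerivAt {M : ℝ → Matrix (Fin a) (Fin b) ℝ} (hM : MatC1 T M) {t : ℝ}
    (ht : t ∈ Ioo 0 T) (i : Fin a) (j : Fin b) :
    HasDerivAt (fun s => M s i j) (matDerivWithin T M t i j) t :=
  (((hM i j).differentiableOn one_ne_zero) t (Ioo_subset_Icc_self ht)).hasDerivWithinAt.hasDerivAt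
    (Icc_mem_nhds ht.1 ht.2)

lemma MatC1.hasDerivAt_mulVec {M : ℝ → Matrix (Fin a) (Fin b) ℝ} (hM : MatC1 T M) {t : ℝ}
    (ht : t ∈ Ioo 0 T) {y : ℝ → Fin b → ℝ} {y' : Fin b → ℝ} (hy : HasDerivAt y y' t) :
    HasDerivAt (fun s => M s *ᵥ y s) (matDerivWithin T M t *ᵥ y t + M t *ᵥ y') t := by
  rw [hasDerivAt_pi] at hy ⊢
  intro i
  have := HasDerivAt.fun_sum (u := Finset.univ) fun j _ => (hM.hasDerivAt ht i j).mul (hy j)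
  refine this.congr_deriv ?_
  rw [Finset.sum_add_distrib]
  rfl

lemma HasDerivAt.dotProduct {x y : ℝ → Fin a → ℝ} {x' y' : Fin a → ℝ} {t : ℝ}
    (hx : HasDerivAt x x' t) (hy : HasDerivAt y y' t) :
    HasDerivAt (fun s => x s ⬝ᵥ y s) (x' ⬝ᵥ y t + x t ⬝ᵥ y') t := by
  rw [hasDerivAt_pi] at hx hy
  have := HasDerivAt.fun_sum (u := Finset.univ) fun j _ => (hx j).mul (hy j)
  refine this.congr_deriv ?_
  rw [Finset.sum_add_distrib]
  rfl

lemma MatC1.mul {c : ℕ} {M : ℝ → Matrix (Fin a) (Fin b) ℝ} {N : ℝ → Matrix (Fin b) (Fin c) ℝ}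
    (hM : MatC1 T M) (hN : MatC1 T N) : MatC1 T (fun t => M t * N t) := fun i j =>
  (ContDiffOn.sum (s := Finset.univ) fun k _ => (hM i k).mul (hN k j) :
    ContDiffOn ℝ 1 (fun t => ∑ k, M t i k * N t k j) (Icc 0 T))

variable {Z : Type} [NormedAddCommGroup Z] [NormedSpace ℝ Z] [FiniteDimensional ℝ Z]

/-- The bilinear form `(z, z') ↦ (π z)ᵀ M (π' z')`, linear in the matrix `M`. -/
def matForm (π : Z →L[ℝ] (Fin a → ℝ)) (π' : Z →L[ℝ] (Fin b → ℝ)) :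
    Matrix (Fin a) (Fin b) ℝ →ₗ[ℝ] Z →L[ℝ] Z →L[ℝ] ℝ where
  toFun M := LinearMap.toContinuousLinearMap (LinearMap.toContinuousLinearMap.toLinearMap ∘ₗ
    LinearMap.mk₂ ℝ (fun z z' => π z ⬝ᵥ M *ᵥ π' z') (by simp [add_dotProduct])
      (by simp) (by simp [mulVec_add]) (by simp [mulVec_smul]))
  map_add' M N := by
    refine ContinuousLinearMap.ext fun z => ContinuousLinearMap.ext fun z' => ?_
    change π z ⬝ᵥ (M + N) *ᵥ π' z' = π z ⬝ᵥ M *ᵥ π' z' + π z ⬝ᵥ N *ᵥ π' z'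
    rw [add_mulVec, dotProduct_add]
  map_smul' r M := by
    refine ContinuousLinearMap.ext fun z => ContinuousLinearMap.ext fun z' => ?_
    change π z ⬝ᵥ (r • M) *ᵥ π' z' = r * (π z ⬝ᵥ M *ᵥ π' z')
    rw [smul_mulVec, dotProduct_smul, smul_eq_mul]

@[simp] lemma matForm_apply (π : Z →L[ℝ] (Fin a → ℝ)) (π' : Z →L[ℝ] (Fin b → ℝ))
    (M : Matrix (Fin a) (Fin b) ℝ) (z z' : Z) : matForm π π' M z z' = π z ⬝ᵥ M *ᵥ π' z' := rfl

lemma continuous_matForm (π : Z →L[ℝ] (Fin a → ℝ)) (π' : Z →L[ℝ] (Fin b → ℝ)) :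
    Continuous (matForm π π') :=
  LinearMap.continuous_of_finiteDimensional (F' := Z →L[ℝ] Z →L[ℝ] ℝ) (matForm π π')

instance continuousAdd_bilin {Z : Type} [NormedAddCommGroup Z] [NormedSpace ℝ Z] :
    ContinuousAdd (Z →L[ℝ] Z →L[ℝ] ℝ) := by
  have h : IsTopologicalAddGroup (Z →L[ℝ] Z →L[ℝ] ℝ) := inferInstance
  exact h.toContinuousAdd

end MatrixCalculus

/-! ### Goh's transformation: the algebraic identity and continuity of the coefficients -/

namespace ControlProblem

variable {n l m dφ dη : ℕ} {P : ControlProblem n l m dφ dη} {w : StateControl n l m}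

/-- The algebraic identity behind Goh's transformation. -/
lemma goh_algebra (Fx : Matrix (Fin n) (Fin n) ℝ) (Fu : Matrix (Fin n) (Fin l) ℝ)
    (Fv dFv : Matrix (Fin n) (Fin m) ℝ) (Hxx : Matrix (Fin n) (Fin n) ℝ)
    (Hux : Matrix (Fin l) (Fin n) ℝ) (Hvx dHvx : Matrix (Fin m) (Fin n) ℝ)
    (Huu : Matrix (Fin l) (Fin l) ℝ) (Hvu : Matrix (Fin m) (Fin l) ℝ)
    (dS : Matrix (Fin m) (Fin m) ℝ) (hsym : Hxxᵀ = Hxx) (ξ : Fin n → ℝ) (u : Fin l → ℝ)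
    (y v : Fin m → ℝ) :
    (1 / 2) * ((ξ + Fv *ᵥ y) ⬝ᵥ Hxx *ᵥ (ξ + Fv *ᵥ y)) + u ⬝ᵥ Hux *ᵥ (ξ + Fv *ᵥ y) +
        v ⬝ᵥ Hvx *ᵥ (ξ + Fv *ᵥ y) + (1 / 2) * (u ⬝ᵥ Huu *ᵥ u) + v ⬝ᵥ Hvu *ᵥ u =
      ((1 / 2) * (ξ ⬝ᵥ Hxx *ᵥ ξ) + u ⬝ᵥ Hux *ᵥ ξ + y ⬝ᵥ (Fvᵀ * Hxx - dHvx - Hvx * Fx) *ᵥ ξ +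
        (1 / 2) * (u ⬝ᵥ Huu *ᵥ u) + y ⬝ᵥ (Fvᵀ * Huxᵀ - Hvx * Fu) *ᵥ u +
        (1 / 2) * (y ⬝ᵥ (Fvᵀ * Hxx * Fv - (Hvx * (Fx * Fv - dFv) + (Hvx * (Fx * Fv - dFv))ᵀ) - dS)
          *ᵥ y)) +
      (v ⬝ᵥ Hvx *ᵥ ξ + y ⬝ᵥ (dHvx *ᵥ ξ + Hvx *ᵥ (Fx *ᵥ ξ + Fu *ᵥ u + (Fx * Fv - dFv) *ᵥ y)) +
        (1 / 2) * (v ⬝ᵥ ((1 / 2 : ℝ) • (Hvx * Fv + (Hvx * Fv)ᵀ)) *ᵥ y +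
          y ⬝ᵥ (dS *ᵥ y + ((1 / 2 : ℝ) • (Hvx * Fv + (Hvx * Fv)ᵀ)) *ᵥ v))) +
      v ⬝ᵥ Hvu *ᵥ u + v ⬝ᵥ ((1 / 2 : ℝ) • (Hvx * Fv - (Hvx * Fv)ᵀ)) *ᵥ y := by
  -- The right-hand side consists of the transformed integrand, of the time derivative of `y ⬝ᵥ Hvx
  -- ξ + ½ y ⬝ᵥ S y` when `ẏ = v`, and of the two terms `v ⬝ᵥ Hvu u` and `v ⬝ᵥ V y`, which are not
  -- integrated by parts. Symmetry of `Hxx` merges its two cross terms.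
  have e1 : ξ ⬝ᵥ Hxx *ᵥ (Fv *ᵥ y) = (Fv *ᵥ y) ⬝ᵥ Hxx *ᵥ ξ := by
    rw [← dotProduct_transpose_mulVec, hsym]
  simp only [mulVec_add, add_mulVec, sub_mulVec, smul_mulVec, dotProduct_add, dotProduct_sub,
    dotProduct_smul, add_dotProduct, dotProduct_transpose_mulVec, ← mulVec_mulVec, smul_eq_mul,
    mulVec_sub]
  rw [e1, dotProduct_comm (Hxx *ᵥ ξ) (Fv *ᵥ y), dotProduct_comm (Hxx *ᵥ Fv *ᵥ y) (Fv *ᵥ y),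
    dotProduct_comm (Huxᵀ *ᵥ u) (Fv *ᵥ y), dotProduct_transpose_mulVec]
  ring

/-- The state, nonlinear control and transformed control at time `t`. -/
def _root_.TransformedDirection.pt (d : TransformedDirection n l m) (t : ℝ) :
    (Fin n → ℝ) × (Fin l → ℝ) × (Fin m → ℝ) := (d.ξ t, d.u t, d.y t)

/-- The continuous version of the matrix `B` on `[0, T]`. -/
def cB (P : ControlProblem n l m dφ dη) (w : StateControl n l m) (t : ℝ) :
    Matrix (Fin n) (Fin m) ℝ := P.Fx w t * P.Fv w t - matDerivWithin P.T (P.Fv w) t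

/-- The continuous version of the matrix `M` on `[0, T]`. -/
def cM (P : ControlProblem n l m dφ dη) (w : StateControl n l m) (lam : Multiplier n dφ dη)
    (t : ℝ) : Matrix (Fin m) (Fin n) ℝ :=
  (P.Fv w t)ᵀ * P.Hxx w lam t - matDerivWithin P.T (P.Hvx w lam) t - P.Hvx w lam t * P.Fx w t

/-- The continuous version of the matrix `R` on `[0, T]`. -/
def cR (P : ControlProblem n l m dφ dη) (w : StateControl n l m) (lam : Multiplier n dφ dη)
    (t : ℝ) : Matrix (Fin m) (Fin m) ℝ :=
  (P.Fv w t)ᵀ * P.Hxx w lam t * P.Fv w t -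
    (P.Hvx w lam t * P.cB w t + (P.Hvx w lam t * P.cB w t)ᵀ) - matDerivWithin P.T (P.gohS w lam) t

lemma gohB_eq {t : ℝ} (ht : t ∈ Ioo 0 P.T) : P.gohB w t = P.cB w t := by
  rw [gohB, cB, matDeriv_eq _ ht]

lemma gohM_eq (lam : Multiplier n dφ dη) {t : ℝ} (ht : t ∈ Ioo 0 P.T) :
    P.gohM w lam t = P.cM w lam t := by
  rw [gohM, cM, matDeriv_eq _ ht]

lemma gohR_eq (lam : Multiplier n dφ dη) {t : ℝ} (ht : t ∈ Ioo 0 P.T) :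
    P.gohR w lam t = P.cR w lam t := by
  rw [gohR, cR, matDeriv_eq _ ht, gohB_eq ht]

/-- The projection to the states. -/
def πx : (Fin n → ℝ) × (Fin l → ℝ) × (Fin m → ℝ) →L[ℝ] (Fin n → ℝ) := .fst ℝ _ _

/-- The projection to the nonlinear controls. -/
def πu : (Fin n → ℝ) × (Fin l → ℝ) × (Fin m → ℝ) →L[ℝ] (Fin l → ℝ) :=
  (ContinuousLinearMap.fst ℝ _ _).comp (.snd ℝ _ _)

/-- The projection to the affine controls. -/
def πv : (Fin n → ℝ) × (Fin l → ℝ) × (Fin m → ℝ) →L[ℝ] (Fin m → ℝ) :=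
  (ContinuousLinearMap.snd ℝ _ _).comp (.snd ℝ _ _)

/-- The bilinear form whose quadratic form is the integrand of `Ω_{P₂}`. -/
def qP2 (P : ControlProblem n l m dφ dη) (w : StateControl n l m) (lam : Multiplier n dφ dη)
    (t : ℝ) : (Fin n → ℝ) × (Fin l → ℝ) × (Fin m → ℝ) →L[ℝ]
      (Fin n → ℝ) × (Fin l → ℝ) × (Fin m → ℝ) →L[ℝ] ℝ :=
  (1 / 2 : ℝ) • matForm πx πx (P.Hxx w lam t) + matForm πu πx (P.Hux w lam t) +
    matForm πv πx (P.cM w lam t) + (1 / 2 : ℝ) • matForm πu πu (P.Huu w lam t) +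
    matForm πv πu (P.gohE w lam t) + (1 / 2 : ℝ) • matForm πv πv (P.cR w lam t)

lemma OmegaP2_eq (hT : 0 ≤ P.T) (lam : Multiplier n dφ dη) (d : TransformedDirection n l m) :
    P.OmegaP2 w lam d = P.gohEndpoint w lam (d.ξ 0) (d.ξ P.T) d.h +
      ∫ t in (0 : ℝ)..P.T, P.qP2 w lam t (d.pt t) (d.pt t) := by
  unfold OmegaP2
  congr 1
  refine intervalIntegral.integral_congr_Ioo_of_le hT fun t ht => ?_
  simp only [gohM_eq lam ht, gohR_eq lam ht]
  rfl

namespace IsReference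

variable (h : P.IsReference w)
include h

lemma matC1_Fv : MatC1 P.T (P.Fv w) := by
  intro i j
  simp only [Fv_apply]
  have h1 : ContDiff ℝ 1 fun z => P.f j.succ z i :=
    (contDiff_apply ℝ ℝ i).comp ((h.reg.1 j.succ).1.of_le (by norm_num))
  exact h1.comp_contDiffOn (h.cx.prodMk h.cu)

lemma matC1_Hvx {lam : Multiplier n dφ dη} (hp : ContDiffOn ℝ 1 lam.2.2 (Icc 0 P.T)) :
    MatC1 P.T (P.Hvx w lam) := by
  intro i j
  simp only [Hvx_apply w lam h.reg]
  have h1 : ContDiff ℝ 1 fun z => fderiv ℝ (P.f i.succ) z (Pi.single j 1, 0) :=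
    ((h.reg.1 i.succ).1.fderiv_right (m := 1) (by norm_num)).clm_apply contDiff_const
  exact (dotL.contDiff.comp_contDiffOn hp).clm_apply (h1.comp_contDiffOn (h.cx.prodMk h.cu))

lemma matC1_gohS {lam : Multiplier n dφ dη} (hp : ContDiffOn ℝ 1 lam.2.2 (Icc 0 P.T)) :
    MatC1 P.T (P.gohS w lam) := by
  have h1 := (h.matC1_Hvx hp).mul h.matC1_Fv
  intro i j
  exact contDiffOn_const.mul ((h1 i j).add (h1 j i))

lemma continuousOn_Fx : ContinuousOn (P.Fx w) (Icc 0 P.T) :=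
  continuousOn_matrix fun x y => by
    simp only [Fx_mulVec w h.reg]
    exact (dotL x).continuous.comp_continuousOn (h.continuousOn_dF.clm_apply continuousOn_const)

lemma continuousOn_Fu : ContinuousOn (P.Fu w) (Icc 0 P.T) :=
  continuousOn_matrix fun x y => by
    simp only [Fu_mulVec w h.reg]
    exact (dotL x).continuous.comp_continuousOn (h.continuousOn_dF.clm_apply continuousOn_const)

lemma continuousOn_p_ddF {lam : Multiplier n dφ dη} (hp : ContinuousOn lam.2.2 (Icc 0 P.T))
    (a b : (Fin n → ℝ) × (Fin l → ℝ) × (Fin m → ℝ)) :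
    ContinuousOn (fun t => lam.2.2 t ⬝ᵥ P.ddF w t a b) (Icc 0 P.T) :=
  (dotL.continuous.comp_continuousOn hp).clm_apply
    ((h.continuousOn_ddF.clm_apply continuousOn_const).clm_apply continuousOn_const)

lemma continuousOn_Hxx {lam : Multiplier n dφ dη} (hp : ContinuousOn lam.2.2 (Icc 0 P.T)) :
    ContinuousOn (P.Hxx w lam) (Icc 0 P.T) :=
  continuousOn_matrix fun x y => by
    simp only [dotProduct_Hxx w lam h.reg]; exact h.continuousOn_p_ddF hp _ _

lemma continuousOn_Hux {lam : Multiplier n dφ dη} (hp : ContinuousOn lam.2.2 (Icc 0 P.T)) :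
    ContinuousOn (P.Hux w lam) (Icc 0 P.T) :=
  continuousOn_matrix fun x y => by
    simp only [dotProduct_Hux w lam h.reg]; exact h.continuousOn_p_ddF hp _ _

lemma continuousOn_Huu {lam : Multiplier n dφ dη} (hp : ContinuousOn lam.2.2 (Icc 0 P.T)) :
    ContinuousOn (P.Huu w lam) (Icc 0 P.T) :=
  continuousOn_matrix fun x y => by
    simp only [dotProduct_Huu w lam h.reg]; exact h.continuousOn_p_ddF hp _ _

lemma continuousOn_Hvu {lam : Multiplier n dφ dη} (hp : ContinuousOn lam.2.2 (Icc 0 P.T)) :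
    ContinuousOn (P.Hvu w lam) (Icc 0 P.T) :=
  continuousOn_matrix fun x y => by
    simp only [dotProduct_Hvu w lam h.reg]; exact h.continuousOn_p_ddF hp _ _

lemma continuousOn_cB : ContinuousOn (P.cB w) (Icc 0 P.T) := by
  have h1 := h.continuousOn_Fx
  have h2 := h.matC1_Fv.continuousOn
  have h3 := h.matC1_Fv.continuousOn_matDerivWithin h.pos
  unfold cB
  fun_prop

lemma continuousOn_gohE {lam : Multiplier n dφ dη} (hp : ContDiffOn ℝ 1 lam.2.2 (Icc 0 P.T)) :
    ContinuousOn (P.gohE w lam) (Icc 0 P.T) := by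
  have h1 := h.matC1_Fv.continuousOn
  have h2 := h.continuousOn_Hux hp.continuousOn
  have h3 := (h.matC1_Hvx hp).continuousOn
  have h4 := h.continuousOn_Fu
  unfold gohE
  fun_prop

lemma continuousOn_cM {lam : Multiplier n dφ dη} (hp : ContDiffOn ℝ 1 lam.2.2 (Icc 0 P.T)) :
    ContinuousOn (P.cM w lam) (Icc 0 P.T) := by
  have h1 := h.matC1_Fv.continuousOn
  have h2 := h.continuousOn_Hxx hp.continuousOn
  have h3 := (h.matC1_Hvx hp).continuousOn
  have h4 := h.continuousOn_Fx
  have h5 := (h.matC1_Hvx hp).continuousOn_matDerivWithin h.pos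
  unfold cM
  fun_prop

lemma continuousOn_cR {lam : Multiplier n dφ dη} (hp : ContDiffOn ℝ 1 lam.2.2 (Icc 0 P.T)) :
    ContinuousOn (P.cR w lam) (Icc 0 P.T) := by
  have h1 := h.matC1_Fv.continuousOn
  have h2 := h.continuousOn_Hxx hp.continuousOn
  have h3 := (h.matC1_Hvx hp).continuousOn
  have h4 := h.continuousOn_cB
  have h5 := (h.matC1_gohS hp).continuousOn_matDerivWithin h.pos
  unfold cR
  fun_prop

lemma continuousOn_gohV {lam : Multiplier n dφ dη} (hp : ContDiffOn ℝ 1 lam.2.2 (Icc 0 P.T)) :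
    ContinuousOn (P.gohV w lam) (Icc 0 P.T) := by
  have h1 := h.matC1_Fv.continuousOn
  have h3 := (h.matC1_Hvx hp).continuousOn
  unfold gohV
  fun_prop

lemma continuousOn_qP2 {lam : Multiplier n dφ dη} (hp : ContDiffOn ℝ 1 lam.2.2 (Icc 0 P.T)) :
    ContinuousOn (P.qP2 w lam) (Icc 0 P.T) := by
  have h1 := (continuous_matForm (πx (n := n) (l := l) (m := m)) πx).comp_continuousOn
    (h.continuousOn_Hxx hp.continuousOn)
  have h2 := (continuous_matForm (πu (n := n) (l := l) (m := m)) πx).comp_continuousOn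
    (h.continuousOn_Hux hp.continuousOn)
  have h3 := (continuous_matForm (πv (n := n) (l := l) (m := m)) πx).comp_continuousOn
    (h.continuousOn_cM hp)
  have h4 := (continuous_matForm (πu (n := n) (l := l) (m := m)) πu).comp_continuousOn
    (h.continuousOn_Huu hp.continuousOn)
  have h5 := (continuous_matForm (πv (n := n) (l := l) (m := m)) πu).comp_continuousOn
    (h.continuousOn_gohE hp)
  have h6 := (continuous_matForm (πv (n := n) (l := l) (m := m)) πv).comp_continuousOn
    (h.continuousOn_cR hp)
  exact ((((h1.const_smul (1 / 2 : ℝ)).add h2).add h3).add (h4.const_smul (1 / 2 : ℝ))).add h5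
    |>.add (h6.const_smul (1 / 2 : ℝ))

lemma contDiffOn_mult_p (μ : P.EndMult) : ContDiffOn ℝ 1 (h.mult μ).2.2 (Icc 0 P.T) :=
  (contDiffOn_of_eq_integral h.nonneg
    ((trL.continuous.comp_continuousOn h.continuousOn_dF_ιx).clm_apply
      (h.continuous_mult_p μ).continuousOn).neg fun _ ht => h.mult_p_eq μ ht).1

end IsReference

end ControlProblem

/-! ### Goh's transformation of the second variation -/

namespace ControlProblem

variable {n l m dφ dη : ℕ} {P : ControlProblem n l m dφ dη} {w : StateControl n l m}

namespace IsReference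

variable (h : P.IsReference w)
include h

/-- The primitive of the affine control of a direction. -/
def dirY (c : P.Dir) (t : ℝ) : Fin m → ℝ := ∫ s in (0 : ℝ)..t, (h.dir c).v s

lemma hasDerivAt_dirY (c : P.Dir) (t : ℝ) : HasDerivAt (h.dirY c) ((h.dir c).v t) t :=
  intervalIntegral.integral_hasDerivAt_right ((h.continuous_dir_v c).intervalIntegrable _ _)
    ((h.continuous_dir_v c).stronglyMeasurableAtFilter _ _) (h.continuous_dir_v c).continuousAt

lemma continuous_dirY (c : P.Dir) : Continuous (h.dirY c) :=
  continuous_iff_continuousAt.2 fun t => (h.hasDerivAt_dirY c t).continuousAt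

lemma dirY_zero (c : P.Dir) : h.dirY c 0 = 0 := intervalIntegral.integral_same

/-- Goh's transformation of a direction. -/
def goh (c : P.Dir) : TransformedDirection n l m where
  ξ := fun t => (h.dir c).x t - P.Fv w t *ᵥ h.dirY c t
  u := (h.dir c).u
  y := h.dirY c
  h := h.dirY c P.T

lemma continuousOn_goh_ξ (c : P.Dir) : ContinuousOn (h.goh c).ξ (Icc 0 P.T) := by
  have h1 := h.matC1_Fv.continuousOn
  have h2 := h.continuous_dirY c
  have h3 := h.continuous_dir_x c
  unfold goh
  fun_prop

lemma continuousOn_goh_pt (c : P.Dir) : ContinuousOn (h.goh c).pt (Icc 0 P.T) :=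
  (h.continuousOn_goh_ξ c).prodMk
    ((h.continuous_dir_u c).continuousOn.prodMk (h.continuous_dirY c).continuousOn)

lemma goh_ξ_zero (c : P.Dir) : (h.goh c).ξ 0 = c.1 := by
  change (h.dir c).x 0 - P.Fv w 0 *ᵥ h.dirY c 0 = c.1
  rw [dirY_zero, mulVec_zero, sub_zero, dir_x_zero]

lemma hasDerivAt_dir_x (c : P.Dir) {t : ℝ} (ht : t ∈ Ioo 0 P.T) :
    HasDerivAt (h.dir c).x (P.Fx w t *ᵥ (h.dir c).x t + P.Fu w t *ᵥ (h.dir c).u t +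
      P.Fv w t *ᵥ (h.dir c).v t) t := by
  rw [Fx_add_Fu_add_Fv w h.reg]
  exact (contDiffOn_of_eq_integral h.nonneg
    (h.continuousOn_dF.clm_apply (h.continuous_dir_pt c).continuousOn) fun t ht => by
      rw [dir_x_zero]; exact h.dir_x_eq c ht).2 t ht

lemma hasDerivAt_goh_ξ (c : P.Dir) {t : ℝ} (ht : t ∈ Ioo 0 P.T) :
    HasDerivAt (h.goh c).ξ (P.Fx w t *ᵥ (h.goh c).ξ t + P.Fu w t *ᵥ (h.goh c).u t +
      P.cB w t *ᵥ (h.goh c).y t) t := by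
  have h1 := (h.hasDerivAt_dir_x c ht).sub (h.matC1_Fv.hasDerivAt_mulVec ht (h.hasDerivAt_dirY c t))
  refine h1.congr_deriv ?_
  simp only [goh, cB, mulVec_sub, sub_mulVec, mulVec_mulVec]
  abel

lemma continuousOn_goh_rhs (c : P.Dir) : ContinuousOn (fun t => P.Fx w t *ᵥ (h.goh c).ξ t +
    P.Fu w t *ᵥ (h.goh c).u t + P.cB w t *ᵥ (h.goh c).y t) (Icc 0 P.T) := by
  have h1 := h.continuousOn_Fx
  have h2 := h.continuousOn_Fu
  have h3 := h.continuousOn_cB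
  have h4 := h.continuousOn_goh_ξ c
  have h5 : ContinuousOn (h.goh c).u (Icc 0 P.T) := (h.continuous_dir_u c).continuousOn
  have h6 : ContinuousOn (h.goh c).y (Icc 0 P.T) := (h.continuous_dirY c).continuousOn
  fun_prop

lemma goh_ξ_eq (c : P.Dir) {t : ℝ} (ht : t ∈ Icc 0 P.T) : (h.goh c).ξ t = (h.goh c).ξ 0 +
    ∫ s in (0 : ℝ)..t, (P.Fx w s *ᵥ (h.goh c).ξ s + P.Fu w s *ᵥ (h.goh c).u s +
      P.cB w s *ᵥ (h.goh c).y s) := by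
  have hsub : Icc 0 t ⊆ Icc 0 P.T := Icc_subset_Icc_right ht.2
  have := intervalIntegral.integral_eq_sub_of_hasDerivAt_of_le ht.1
    ((h.continuousOn_goh_ξ c).mono hsub)
    (fun s hs => h.hasDerivAt_goh_ξ c ⟨hs.1, hs.2.trans_le ht.2⟩)
    (((h.continuousOn_goh_rhs c).mono hsub).intervalIntegrable_of_Icc ht.1)
  rw [this]
  abel

lemma Hxx_symm (lam : Multiplier n dφ dη) (t : ℝ) : (P.Hxx w lam t)ᵀ = P.Hxx w lam t := by
  refine Matrix.ext_dotProduct fun x y => ?_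
  rw [dotProduct_transpose_mulVec, dotProduct_Hxx w lam h.reg, dotProduct_Hxx w lam h.reg,
    fderiv_fderiv_Fz_comm h.reg]

omit h in
lemma _root_.ContinuousOn.dotProduct_mulVec {a b : ℕ} {s : Set ℝ} {x : ℝ → Fin a → ℝ}
    {M : ℝ → Matrix (Fin a) (Fin b) ℝ} {y : ℝ → Fin b → ℝ} (hx : ContinuousOn x s)
    (hM : ContinuousOn M s) (hy : ContinuousOn y s) :
    ContinuousOn (fun t => x t ⬝ᵥ M t *ᵥ y t) s := by
  fun_prop

/-- The effect of Goh's transformation on the second variation. -/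
lemma Omega_dir_eq_goh {lam : Multiplier n dφ dη} (hp : ContDiffOn ℝ 1 lam.2.2 (Icc 0 P.T))
    (c : P.Dir) : P.Omega w lam (h.dir c) = P.OmegaP2 w lam (h.goh c) +
      ((∫ t in (0 : ℝ)..P.T, (h.dir c).v t ⬝ᵥ P.Hvu w lam t *ᵥ (h.dir c).u t) +
        ∫ t in (0 : ℝ)..P.T, (h.dir c).v t ⬝ᵥ P.gohV w lam t *ᵥ h.dirY c t) := by
  set ξ := (h.goh c).ξ with hξ
  set y := h.dirY c with hy
  set u := (h.dir c).u with hu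
  set v := (h.dir c).v with hv
  have cξ : ContinuousOn ξ (Icc 0 P.T) := h.continuousOn_goh_ξ c
  have cy : Continuous y := h.continuous_dirY c
  have cu : Continuous u := h.continuous_dir_u c
  have cv : Continuous v := h.continuous_dir_v c
  have cHvx := (h.matC1_Hvx hp).continuousOn
  have cS := (h.matC1_gohS hp).continuousOn
  have cdHvx := (h.matC1_Hvx hp).continuousOn_matDerivWithin h.pos
  have cdS := (h.matC1_gohS hp).continuousOn_matDerivWithin h.pos
  have cHvu := h.continuousOn_Hvu hp.continuousOn
  have cV := h.continuousOn_gohV hp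
  -- The boundary function of the integration by parts: it vanishes at 0 because `y` does, and its
  -- value at `T` is the part of the transformed endpoint term not coming from `D²ℓ`.
  let Φ : ℝ → ℝ := fun t => y t ⬝ᵥ P.Hvx w lam t *ᵥ ξ t + (1 / 2) * (y t ⬝ᵥ P.gohS w lam t *ᵥ y t)
  let Φ' : ℝ → ℝ := fun t => v t ⬝ᵥ P.Hvx w lam t *ᵥ ξ t +
    y t ⬝ᵥ (matDerivWithin P.T (P.Hvx w lam) t *ᵥ ξ t + P.Hvx w lam t *ᵥ (P.Fx w t *ᵥ ξ t +
      P.Fu w t *ᵥ u t + P.cB w t *ᵥ y t)) +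
    (1 / 2) * (v t ⬝ᵥ P.gohS w lam t *ᵥ y t + y t ⬝ᵥ (matDerivWithin P.T (P.gohS w lam) t *ᵥ y t +
      P.gohS w lam t *ᵥ v t))
  have hΦ : ContinuousOn Φ (Icc 0 P.T) := (cy.continuousOn.dotProduct_mulVec cHvx cξ).add
    (continuousOn_const.mul (cy.continuousOn.dotProduct_mulVec cS cy.continuousOn))
  have crhs := h.continuousOn_goh_rhs c
  have hΦ' : ContinuousOn Φ' (Icc 0 P.T) := by
    have e1 := cv.continuousOn.dotProduct_mulVec cHvx cξ
    have e2 := cy.continuousOn.dotProduct_mulVec cdHvx cξ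
    have e3 := cy.continuousOn.dotProduct_mulVec cHvx crhs
    have e4 := cv.continuousOn.dotProduct_mulVec cS cy.continuousOn
    have e5 := cy.continuousOn.dotProduct_mulVec cdS cy.continuousOn
    have e6 := cy.continuousOn.dotProduct_mulVec cS cv.continuousOn
    refine ((e1.add (e2.add e3)).add (continuousOn_const (c := (1 / 2 : ℝ)) |>.mul
      (e4.add (e5.add e6)))).congr fun t _ => ?_
    simp only [Φ', dotProduct_add]
    rfl
  have hd : ∀ t ∈ Ioo 0 P.T, HasDerivAt Φ (Φ' t) t := by
    intro t ht
    have d1 := h.hasDerivAt_dirY c t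
    have d2 := h.hasDerivAt_goh_ξ c ht
    exact (d1.dotProduct ((h.matC1_Hvx hp).hasDerivAt_mulVec ht d2)).add
      ((d1.dotProduct ((h.matC1_gohS hp).hasDerivAt_mulVec ht d1)).const_mul _)
  have hFTC := intervalIntegral.integral_eq_sub_of_hasDerivAt_of_le h.nonneg hΦ hd
    (hΦ'.intervalIntegrable_of_Icc h.nonneg)
  have hΦ0 : Φ 0 = 0 := by
    have : y 0 = 0 := h.dirY_zero c
    simp [Φ, this]
  rw [hΦ0, sub_zero] at hFTC
  have cq : ContinuousOn (fun t => P.qP2 w lam t ((h.goh c).pt t) ((h.goh c).pt t)) (Icc 0 P.T) :=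
    ((h.continuousOn_qP2 hp).clm_apply (h.continuousOn_goh_pt c)).clm_apply (h.continuousOn_goh_pt c)
  have c1 : ContinuousOn (fun t => v t ⬝ᵥ P.Hvu w lam t *ᵥ u t) (Icc 0 P.T) :=
    cv.continuousOn.dotProduct_mulVec cHvu cu.continuousOn
  have c2 : ContinuousOn (fun t => v t ⬝ᵥ P.gohV w lam t *ᵥ y t) (Icc 0 P.T) :=
    cv.continuousOn.dotProduct_mulVec cV cy.continuousOn
  have hx : ∀ t, (h.dir c).x t = ξ t + P.Fv w t *ᵥ y t := fun t => by
    simp [hξ, hy, goh]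
  have hint : ∫ t in (0 : ℝ)..P.T,
      ((1 / 2) * ((h.dir c).x t ⬝ᵥ P.Hxx w lam t *ᵥ (h.dir c).x t) +
        u t ⬝ᵥ P.Hux w lam t *ᵥ (h.dir c).x t + v t ⬝ᵥ P.Hvx w lam t *ᵥ (h.dir c).x t +
        (1 / 2) * (u t ⬝ᵥ P.Huu w lam t *ᵥ u t) + v t ⬝ᵥ P.Hvu w lam t *ᵥ u t) =
      (∫ t in (0 : ℝ)..P.T, P.qP2 w lam t ((h.goh c).pt t) ((h.goh c).pt t)) + Φ P.T +
        ((∫ t in (0 : ℝ)..P.T, v t ⬝ᵥ P.Hvu w lam t *ᵥ u t) +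
          ∫ t in (0 : ℝ)..P.T, v t ⬝ᵥ P.gohV w lam t *ᵥ y t) := by
    have i1 := cq.intervalIntegrable_of_Icc (μ := volume) h.nonneg
    have i2 := hΦ'.intervalIntegrable_of_Icc (μ := volume) h.nonneg
    have i3 := c1.intervalIntegrable_of_Icc (μ := volume) h.nonneg
    have i4 := c2.intervalIntegrable_of_Icc (μ := volume) h.nonneg
    have hsum := intervalIntegral.integral_add (i1.add i2) (i3.add i4)
    refine Eq.trans ?_ (hsum.trans (congrArg₂ (· + ·) ((intervalIntegral.integral_add i1 i2).trans
      (congrArg₂ (· + ·) rfl hFTC)) (intervalIntegral.integral_add i3 i4)))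
    refine intervalIntegral.integral_congr fun t _ => ?_
    have key := goh_algebra (P.Fx w t) (P.Fu w t) (P.Fv w t) (matDerivWithin P.T (P.Fv w) t)
      (P.Hxx w lam t) (P.Hux w lam t) (P.Hvx w lam t) (matDerivWithin P.T (P.Hvx w lam) t)
      (P.Huu w lam t) (P.Hvu w lam t) (matDerivWithin P.T (P.gohS w lam) t) (h.Hxx_symm lam t)
      (ξ t) (u t) (y t) (v t)
    simp only [hx]
    rw [key, add_assoc]
    rfl
  rw [OmegaP2_eq h.nonneg]
  unfold Omega gohEndpoint
  rw [hint]
  have e1 : P.ellSecond w lam ((h.dir c).x 0, (h.dir c).x P.T) =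
      P.ellSecond w lam ((h.goh c).ξ 0, (h.goh c).ξ P.T + P.Fv w P.T *ᵥ (h.goh c).h) := by
    rw [goh_ξ_zero, dir_x_zero, hx]
    rfl
  have e2 : Φ P.T = (h.goh c).h ⬝ᵥ (P.Hvx w lam P.T *ᵥ (h.goh c).ξ P.T +
      (1 / 2 : ℝ) • (P.gohS w lam P.T *ᵥ (h.goh c).h)) := by
    rw [dotProduct_add, dotProduct_smul]
    rfl
  rw [e1, e2]
  ring

end IsReference

end ControlProblem

/-! ### Perturbations supported in a short interval -/

/-- The interval starts at `t₀`, or ends there when `t₀ = T`, so that it stays inside `[0, T]` even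
if `t₀` is an end point. -/
lemma exists_subinterval {T t₀ δ : ℝ} (hT : 0 < T) (ht₀ : t₀ ∈ Icc 0 T) (hδ : 0 < δ) {p : ℝ → Prop}
    (hp : ∀ᶠ t in 𝓝[Icc 0 T] t₀, p t) :
    ∃ a b, a < b ∧ b - a ≤ δ ∧ 0 ≤ a ∧ b ≤ T ∧ ∀ t ∈ Icc a b, p t := by
  obtain ⟨ε, hε, hs⟩ := Metric.mem_nhdsWithin_iff.1 hp
  have hs' : ∀ t, |t - t₀| < ε → t ∈ Icc 0 T → p t := fun t h1 h2 => hs ⟨h1, h2⟩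
  rcases ht₀.2.lt_or_eq with h | h
  · refine ⟨t₀, t₀ + min (min δ (ε / 2)) (T - t₀), ?_, ?_, ht₀.1, ?_, fun t ht => hs' t ?_ ?_⟩
    · have : 0 < min (min δ (ε / 2)) (T - t₀) := by
        rw [lt_min_iff, lt_min_iff]; exact ⟨⟨hδ, by linarith⟩, by linarith⟩
      linarith
    · have : min (min δ (ε / 2)) (T - t₀) ≤ δ := (min_le_left _ _).trans (min_le_left _ _)
      linarith
    · have : min (min δ (ε / 2)) (T - t₀) ≤ T - t₀ := min_le_right _ _
      linarith
    · have : min (min δ (ε / 2)) (T - t₀) ≤ ε / 2 := (min_le_left _ _).trans (min_le_right _ _)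
      rw [abs_lt]; constructor <;> linarith [ht.1, ht.2]
    · have : min (min δ (ε / 2)) (T - t₀) ≤ T - t₀ := min_le_right _ _
      exact ⟨ht₀.1.trans ht.1, by linarith [ht.2]⟩
  · subst h
    refine ⟨t₀ - min (min δ (ε / 2)) t₀, t₀, ?_, ?_, ?_, le_rfl, fun t ht => hs' t ?_ ?_⟩
    · have : 0 < min (min δ (ε / 2)) t₀ := by
        rw [lt_min_iff, lt_min_iff]; exact ⟨⟨hδ, by linarith⟩, by linarith⟩
      linarith
    · have : min (min δ (ε / 2)) t₀ ≤ δ := (min_le_left _ _).trans (min_le_left _ _)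
      linarith
    · have : min (min δ (ε / 2)) t₀ ≤ t₀ := min_le_right _ _
      linarith
    · have : min (min δ (ε / 2)) t₀ ≤ ε / 2 := (min_le_left _ _).trans (min_le_right _ _)
      rw [abs_lt]; constructor <;> linarith [ht.1, ht.2]
    · have : min (min δ (ε / 2)) t₀ ≤ t₀ := min_le_right _ _
      exact ⟨by linarith [ht.1], ht.2⟩

/-- A smooth function that is positive exactly on the interval `(a, b)`. -/
def bump (a b t : ℝ) : ℝ := expNegInvGlue ((t - a) * (b - t))

lemma contDiff_bump (a b : ℝ) : ContDiff ℝ 1 (bump a b) :=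
  expNegInvGlue.contDiff.comp ((contDiff_id.sub contDiff_const).mul (contDiff_const.sub contDiff_id))

lemma bump_eq_zero {a b t : ℝ} (hab : a < b) (ht : t ∉ Ioo a b) : bump a b t = 0 := by
  refine expNegInvGlue.zero_of_nonpos ?_
  rw [mem_Ioo, not_and_or, not_lt, not_lt] at ht
  rcases ht with h | h
  · exact mul_nonpos_of_nonpos_of_nonneg (by linarith) (by linarith)
  · exact mul_nonpos_of_nonneg_of_nonpos (by linarith) (by linarith)

lemma bump_pos {a b t : ℝ} (ht : t ∈ Ioo a b) : 0 < bump a b t :=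
  expNegInvGlue.pos_of_pos (mul_pos (by linarith [ht.1]) (by linarith [ht.2]))

/-- A nonzero polynomial has only finitely many roots, so it cannot vanish on the whole support of
the bump. Polynomial multiples of one bump thus provide subspaces of every dimension with support in
the same interval. -/
lemma integral_sq_bump_pos {T a b : ℝ} (hab : a < b) (ha : 0 ≤ a) (hb : b ≤ T)
    {q : Polynomial ℝ} (hq : q ≠ 0) : 0 < ∫ t in (0 : ℝ)..T, (q.eval t * bump a b t) ^ 2 := by
  have hc : Continuous fun t => (q.eval t * bump a b t) ^ 2 := by
    have := (contDiff_bump a b).continuous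
    fun_prop
  have : ∃ c ∈ Ioo a b, q.eval c ≠ 0 := by
    by_contra! hcon
    exact hq (q.eq_zero_of_infinite_isRoot ((Ioo_infinite hab).mono fun t ht => hcon t ht))
  obtain ⟨c, hc1, hc2⟩ := this
  refine intervalIntegral.integral_pos (by linarith) hc.continuousOn
    (fun t _ => sq_nonneg _) ⟨c, ⟨by linarith [hc1.1], by linarith [hc1.2]⟩, ?_⟩
  exact sq_pos_of_ne_zero (mul_ne_zero hc2 (bump_pos hc1).ne')

/-- Cauchy–Schwarz on the support. The factor `b - a` makes contributions of the state, controlled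
by the L¹ norm of the perturbation, negligible against L² terms when the interval is short. -/
lemma sq_integral_abs_le {T a b : ℝ} (hab : a < b) (ha : 0 ≤ a) (hb : b ≤ T) {f : ℝ → ℝ}
    (hf : Continuous f) (hs : ∀ t, t ∉ Ioo a b → f t = 0) :
    (∫ t in (0 : ℝ)..T, |f t|) ^ 2 ≤ (b - a) * ∫ t in (0 : ℝ)..T, f t ^ 2 := by
  have hsupp : ∀ g : ℝ → ℝ, (∀ t, t ∉ Ioo a b → g t = 0) →
      ∫ t in (0 : ℝ)..T, g t = ∫ t in a..b, g t := fun g hg => by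
    have h1 : Function.support g ⊆ Ioo a b := fun t ht => by
      by_contra hcon
      exact ht (hg t hcon)
    rw [intervalIntegral.integral_eq_integral_of_support_subset (h1.trans Ioo_subset_Ioc_self),
      intervalIntegral.integral_eq_integral_of_support_subset
        (h1.trans (fun t ht => ⟨by linarith [ht.1], by linarith [ht.2]⟩))]
  rw [hsupp _ fun t ht => by rw [hs t ht, abs_zero], hsupp _ fun t ht => by rw [hs t ht]; norm_num]
  set m := ∫ t in a..b, |f t| with hm
  have hba : 0 < b - a := by linarith
  have h0 : 0 ≤ ∫ t in a..b, (|f t| - m / (b - a)) ^ 2 :=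
    intervalIntegral.integral_nonneg hab.le fun _ _ => sq_nonneg _
  have i1 : IntervalIntegrable (fun t => f t ^ 2) volume a b := (hf.pow 2).intervalIntegrable _ _
  have i2 : IntervalIntegrable (fun t => 2 * (m / (b - a)) * |f t|) volume a b :=
    (hf.abs.const_mul _).intervalIntegrable _ _
  have h1 : ∫ t in a..b, (|f t| - m / (b - a)) ^ 2 =
      (∫ t in a..b, f t ^ 2) - 2 * (m / (b - a)) * m + (b - a) * (m / (b - a)) ^ 2 := by
    rw [hm, ← intervalIntegral.integral_const_mul, ← hm, ← intervalIntegral.integral_sub i1 i2,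
      ← smul_eq_mul (b - a), ← intervalIntegral.integral_const, ← intervalIntegral.integral_add
        (i1.sub i2) intervalIntegrable_const]
    refine intervalIntegral.integral_congr fun t _ => ?_
    rw [sub_sq, sq_abs]
    ring
  rw [h1] at h0
  have h2 : (∫ t in a..b, f t ^ 2) - 2 * (m / (b - a)) * m + (b - a) * (m / (b - a)) ^ 2 =
      (∫ t in a..b, f t ^ 2) - m ^ 2 / (b - a) := by
    field_simp
    ring
  rw [h2, sub_nonneg, div_le_iff₀ hba] at h0
  linarith

/-! ### Finite index forces `H_vu = 0` -/

namespace ControlProblem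

variable {n l m dφ dη : ℕ} {P : ControlProblem n l m dφ dη} {w : StateControl n l m}

/-- Control perturbations built from polynomials. -/
def polyDir (P : ControlProblem n l m dφ dη) (r₀ r₁ : C(ℝ, (Fin l → ℝ) × (Fin m → ℝ))) :
    Polynomial ℝ →ₗ[ℝ] P.Dir where
  toFun q := (0, ⟨fun t => q.eval (t : ℝ) • r₀ t + q.derivative.eval (t : ℝ) • r₁ t, by fun_prop⟩)
  map_add' q q' := by
    refine Prod.ext (by simp) (ContinuousMap.ext fun t => ?_)
    simp only [Polynomial.eval_add, Polynomial.derivative_add, add_smul, ContinuousMap.coe_mk,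
      Prod.snd_add, ContinuousMap.add_apply]
    abel
  map_smul' r q := by
    refine Prod.ext (by simp) (ContinuousMap.ext fun t => ?_)
    simp [mul_smul]

namespace IsReference

variable (h : P.IsReference w)
include h

/-- The index of the second variation is less than `N`. -/
def IndexLt (N : ℕ) (lam : Multiplier n dφ dη) : Prop :=
  ∀ v : Fin N → P.Dir, ∃ c : EuclideanSpace ℝ (Fin N), ‖c‖ = 1 ∧
    0 ≤ P.Omega w lam (h.dir (∑ i, c i • v i))

lemma polyDir_snd (r₀ r₁ : C(ℝ, (Fin l → ℝ) × (Fin m → ℝ))) (q : Polynomial ℝ) {t : ℝ}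
    (ht : t ∈ Icc 0 P.T) : IccExtend h.nonneg (P.polyDir r₀ r₁ q).2 t =
      q.eval t • r₀ t + q.derivative.eval t • r₁ t := IccExtend_of_mem h.nonneg _ ht

/-- The index condition is applied to the images of the first `N` monomials. Nontriviality is read
off from the polynomial, so `D` need not be injective. -/
lemma IndexLt.exists_polynomial {N : ℕ} {lam : Multiplier n dφ dη} (hN : h.IndexLt N lam)
    (D : Polynomial ℝ →ₗ[ℝ] P.Dir) :
    ∃ q : Polynomial ℝ, q ≠ 0 ∧ 0 ≤ P.Omega w lam (h.dir (D q)) := by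
  obtain ⟨c, hc1, hc2⟩ := hN fun i => D (Polynomial.X ^ (i : ℕ))
  refine ⟨∑ i, c i • Polynomial.X ^ (i : ℕ), fun h0 => ?_, ?_⟩
  · have : c = 0 := by
      ext i
      have h1 := congrArg (fun q => Polynomial.coeff q (i : ℕ)) h0
      simpa [Polynomial.finsetSum_coeff, Polynomial.coeff_X_pow, Fin.val_inj] using h1
    rw [this, norm_zero] at hc1
    exact zero_ne_one hc1
  · rw [map_sum]
    simpa only [map_smul] using hc2

lemma continuousOn_Hvx {lam : Multiplier n dφ dη} (hp : ContDiffOn ℝ 1 lam.2.2 (Icc 0 P.T)) :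
    ContinuousOn (P.Hvx w lam) (Icc 0 P.T) := (h.matC1_Hvx hp).continuousOn

omit h in
/-- The terms of the second variation that contain the state. -/
def qState (P : ControlProblem n l m dφ dη) (w : StateControl n l m) (lam : Multiplier n dφ dη)
    (t : ℝ) : (Fin n → ℝ) × (Fin l → ℝ) × (Fin m → ℝ) →L[ℝ]
      (Fin n → ℝ) × (Fin l → ℝ) × (Fin m → ℝ) →L[ℝ] ℝ :=
  (1 / 2 : ℝ) • matForm πx πx (P.Hxx w lam t) + matForm πu πx (P.Hux w lam t) +
    matForm πv πx (P.Hvx w lam t)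

lemma continuousOn_qState {lam : Multiplier n dφ dη} (hp : ContDiffOn ℝ 1 lam.2.2 (Icc 0 P.T)) :
    ContinuousOn (qState P w lam) (Icc 0 P.T) := by
  have h1 := (continuous_matForm (πx (n := n) (l := l) (m := m)) πx).comp_continuousOn
    (h.continuousOn_Hxx hp.continuousOn)
  have h2 := (continuous_matForm (πu (n := n) (l := l) (m := m)) πx).comp_continuousOn
    (h.continuousOn_Hux hp.continuousOn)
  have h3 := (continuous_matForm (πv (n := n) (l := l) (m := m)) πx).comp_continuousOn
    (h.continuousOn_Hvx hp)
  exact ((h1.const_smul (1 / 2 : ℝ)).add h2).add h3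

/-- The state is controlled by the perturbation of the controls. -/
lemma exists_dir_x_bound : ∃ K : ℝ, 0 ≤ K ∧ ∀ c : P.Dir, ∀ t ∈ Icc 0 P.T,
    ‖(h.dir c).x t‖ ≤ K * (‖c.1‖ + ∫ s in (0 : ℝ)..P.T, ‖IccExtend h.nonneg c.2 s‖) := by
  obtain ⟨K, hK0, hK⟩ := exists_linear_bound h.nonneg h.continuousOn_dF_ιx
  have hAr : ContinuousOn (fun t => (P.dF w t).comp
    (ContinuousLinearMap.inr ℝ (Fin n → ℝ) ((Fin l → ℝ) × (Fin m → ℝ)))) (Icc 0 P.T) :=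
    h.continuousOn_dF.clm_comp continuousOn_const
  obtain ⟨C, hC⟩ := isCompact_Icc.exists_bound_of_continuousOn hAr
  have hC0 : 0 ≤ C := (norm_nonneg _).trans (hC 0 ⟨le_rfl, h.nonneg⟩)
  refine ⟨K * (1 + C), by positivity, fun c t ht => ?_⟩
  have hc : Continuous (IccExtend h.nonneg c.2) := IccExtend_continuous _ _
  have hrc := hAr.clm_apply hc.continuousOn
  have h1 := hK (h.dir c).x _ (h.continuous_dir_x c).continuousOn
    (hrc.intervalIntegrable_of_Icc h.nonneg) (fun t ht => by
      rw [h.dir_x_eq c ht, h.dir_x_zero]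
      refine congrArg _ (intervalIntegral.integral_congr fun s _ => ?_)
      change _ = P.dF w s ((h.dir c).x s, 0) + P.dF w s (0, IccExtend h.nonneg c.2 s)
      rw [← map_add]
      simp [dir_pt]
      rfl) t ht
  rw [h.dir_x_zero] at h1
  have hi : 0 ≤ ∫ s in (0 : ℝ)..P.T, ‖IccExtend h.nonneg c.2 s‖ :=
    intervalIntegral.integral_nonneg h.nonneg fun _ _ => norm_nonneg _
  have h2 : ∫ s in (0 : ℝ)..P.T, ‖((P.dF w s).comp
      (ContinuousLinearMap.inr ℝ (Fin n → ℝ) ((Fin l → ℝ) × (Fin m → ℝ))))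
        (IccExtend h.nonneg c.2 s)‖ ≤ C * ∫ s in (0 : ℝ)..P.T, ‖IccExtend h.nonneg c.2 s‖ := by
    rw [← intervalIntegral.integral_const_mul]
    exact intervalIntegral.integral_mono_on h.nonneg (hrc.norm.intervalIntegrable_of_Icc h.nonneg)
      ((hc.norm.const_mul C).intervalIntegrable _ _)
      fun s hs => ContinuousLinearMap.le_of_opNorm_le _ (hC s hs) _
  refine h1.trans ?_
  rw [mul_assoc]
  refine mul_le_mul_of_nonneg_left ?_ hK0
  nlinarith [norm_nonneg c.1, mul_nonneg hC0 (norm_nonneg c.1)]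

/-- The second variation differs from its control part by a term of lower order. -/
lemma exists_Omega_bound {lam : Multiplier n dφ dη} (hp : ContDiffOn ℝ 1 lam.2.2 (Icc 0 P.T)) :
    ∃ C : ℝ, 0 ≤ C ∧ ∀ c : P.Dir, c.1 = 0 →
      P.Omega w lam (h.dir c) ≤ (∫ t in (0 : ℝ)..P.T,
        ((1 / 2) * ((h.dir c).u t ⬝ᵥ P.Huu w lam t *ᵥ (h.dir c).u t) +
          (h.dir c).v t ⬝ᵥ P.Hvu w lam t *ᵥ (h.dir c).u t)) +
        C * (∫ t in (0 : ℝ)..P.T, ‖IccExtend h.nonneg c.2 t‖) ^ 2 := by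
  obtain ⟨K, hK0, hK⟩ := h.exists_dir_x_bound
  have hq := h.continuousOn_qState hp
  obtain ⟨Q, hQ⟩ := IsCompact.exists_bound_of_continuousOn
    (E := (Fin n → ℝ) × (Fin l → ℝ) × (Fin m → ℝ) →L[ℝ]
      (Fin n → ℝ) × (Fin l → ℝ) × (Fin m → ℝ) →L[ℝ] ℝ) isCompact_Icc hq
  have hQ0 : 0 ≤ Q := le_trans (ContinuousLinearMap.opNorm_nonneg _) (hQ 0 ⟨le_rfl, h.nonneg⟩)
  let L := fderiv ℝ (fderiv ℝ (P.ell lam)) (w.x 0, w.x P.T)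
  refine ⟨(1 / 2) * (‖L‖ * K ^ 2) + Q * (P.T * K ^ 2 + K), by have := h.pos; positivity,
    fun c hc => ?_⟩
  set M := ∫ t in (0 : ℝ)..P.T, ‖IccExtend h.nonneg c.2 t‖ with hM
  have hM0 : 0 ≤ M := intervalIntegral.integral_nonneg h.nonneg fun _ _ => norm_nonneg _
  have hx : ∀ t ∈ Icc 0 P.T, ‖(h.dir c).x t‖ ≤ K * M := fun t ht => by
    simpa [hc] using hK c t ht
  have cx := (h.continuous_dir_x c).continuousOn (s := Icc 0 P.T)
  have cu := (h.continuous_dir_u c).continuousOn (s := Icc 0 P.T)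
  have cv := (h.continuous_dir_v c).continuousOn (s := Icc 0 P.T)
  have cr : Continuous (IccExtend h.nonneg c.2) := IccExtend_continuous _ _
  have c1 : ContinuousOn (fun t => qState P w lam t ((h.dir c).pt t) (ιx ((h.dir c).x t)))
      (Icc 0 P.T) := (hq.clm_apply (h.continuous_dir_pt c).continuousOn).clm_apply
    (ιx.continuous.comp_continuousOn cx)
  have c2 : ContinuousOn (fun t => (1 / 2) * ((h.dir c).u t ⬝ᵥ P.Huu w lam t *ᵥ (h.dir c).u t) +
      (h.dir c).v t ⬝ᵥ P.Hvu w lam t *ᵥ (h.dir c).u t) (Icc 0 P.T) :=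
    (continuousOn_const.mul (cu.dotProduct_mulVec (h.continuousOn_Huu hp.continuousOn) cu)).add
      (cv.dotProduct_mulVec (h.continuousOn_Hvu hp.continuousOn) cu)
  have hsplit : ∫ t in (0 : ℝ)..P.T, ((1 / 2) * ((h.dir c).x t ⬝ᵥ P.Hxx w lam t *ᵥ (h.dir c).x t) +
      (h.dir c).u t ⬝ᵥ P.Hux w lam t *ᵥ (h.dir c).x t +
        (h.dir c).v t ⬝ᵥ P.Hvx w lam t *ᵥ (h.dir c).x t +
        (1 / 2) * ((h.dir c).u t ⬝ᵥ P.Huu w lam t *ᵥ (h.dir c).u t) +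
        (h.dir c).v t ⬝ᵥ P.Hvu w lam t *ᵥ (h.dir c).u t) =
      (∫ t in (0 : ℝ)..P.T, qState P w lam t ((h.dir c).pt t) (ιx ((h.dir c).x t))) +
        ∫ t in (0 : ℝ)..P.T, ((1 / 2) * ((h.dir c).u t ⬝ᵥ P.Huu w lam t *ᵥ (h.dir c).u t) +
          (h.dir c).v t ⬝ᵥ P.Hvu w lam t *ᵥ (h.dir c).u t) := by
    rw [← intervalIntegral.integral_add (c1.intervalIntegrable_of_Icc h.nonneg)
      (c2.intervalIntegrable_of_Icc h.nonneg)]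
    refine intervalIntegral.integral_congr fun t _ => ?_
    exact add_assoc _ _ _
  have hb1 : ∫ t in (0 : ℝ)..P.T, qState P w lam t ((h.dir c).pt t) (ιx ((h.dir c).x t)) ≤
      Q * (P.T * (K * M) ^ 2 + K * M * M) := by
    have e1 : ∫ t in (0 : ℝ)..P.T, Q * ((K * M + ‖IccExtend h.nonneg c.2 t‖) * (K * M)) =
        Q * (P.T * (K * M) ^ 2 + K * M * M) := by
      rw [intervalIntegral.integral_const_mul, intervalIntegral.integral_mul_const,
        intervalIntegral.integral_add intervalIntegrable_const (cr.norm.intervalIntegrable _ _),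
        intervalIntegral.integral_const, ← hM, smul_eq_mul]
      ring
    rw [← e1]
    refine intervalIntegral.integral_mono_on h.nonneg (c1.intervalIntegrable_of_Icc h.nonneg)
      (Continuous.intervalIntegrable (by fun_prop) _ _) fun t ht => ?_
    have hx1 := hx t ht
    have e2 : ‖(h.dir c).pt t‖ ≤ K * M + ‖IccExtend h.nonneg c.2 t‖ := by
      refine max_le (hx1.trans (le_add_of_nonneg_right (norm_nonneg _))) ?_
      exact le_add_of_nonneg_left (by positivity)
    have e3 : ‖ιx (n := n) (l := l) (m := m) ((h.dir c).x t)‖ ≤ K * M := by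
      have : ‖ιx (n := n) (l := l) (m := m) ((h.dir c).x t)‖ = ‖(h.dir c).x t‖ := by
        simp [ιx, Prod.norm_def]
      rw [this]; exact hx1
    calc _ ≤ ‖qState P w lam t ((h.dir c).pt t) (ιx ((h.dir c).x t))‖ := le_abs_self _
      _ ≤ ‖qState P w lam t‖ * ‖(h.dir c).pt t‖ * ‖ιx (n := n) (l := l) (m := m) ((h.dir c).x t)‖ :=
        ContinuousLinearMap.le_opNorm₂ (qState P w lam t) _ _
      _ ≤ Q * (K * M + ‖IccExtend h.nonneg c.2 t‖) * (K * M) := by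
        refine mul_le_mul (mul_le_mul (hQ t ht) e2 (norm_nonneg _) hQ0) e3 (norm_nonneg _) ?_
        positivity
      _ = _ := by ring
  have hb2 : P.ellSecond w lam ((h.dir c).x 0, (h.dir c).x P.T) ≤ ‖L‖ * (K * M) ^ 2 := by
    have e1 : ‖((h.dir c).x 0, (h.dir c).x P.T)‖ ≤ K * M :=
      max_le (hx 0 ⟨le_rfl, h.nonneg⟩) (hx P.T ⟨h.nonneg, le_rfl⟩)
    calc _ ≤ ‖L ((h.dir c).x 0, (h.dir c).x P.T) ((h.dir c).x 0, (h.dir c).x P.T)‖ := le_abs_self _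
      _ ≤ ‖L‖ * ‖((h.dir c).x 0, (h.dir c).x P.T)‖ * ‖((h.dir c).x 0, (h.dir c).x P.T)‖ :=
        ContinuousLinearMap.le_opNorm₂ L _ _
      _ ≤ ‖L‖ * (K * M) * (K * M) := by gcongr
      _ = _ := by ring
  unfold Omega
  rw [hsplit]
  linarith [hb1, hb2, show (1 / 2) * (‖L‖ * (K * M) ^ 2) + Q * (P.T * (K * M) ^ 2 + K * M * M) =
    ((1 / 2) * (‖L‖ * K ^ 2) + Q * (P.T * K ^ 2 + K)) * M ^ 2 by ring]

set_option maxHeartbeats 1000000 in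
/-- If the index of the second variation is finite then `H_vu` vanishes. -/
lemma IndexLt.Hvu_eq_zero {N : ℕ} {lam : Multiplier n dφ dη} (hN : h.IndexLt N lam)
    (hp : ContDiffOn ℝ 1 lam.2.2 (Icc 0 P.T)) {t₀ : ℝ} (ht₀ : t₀ ∈ Icc 0 P.T) :
    P.Hvu w lam t₀ = 0 := by
  ext i j
  by_contra hne
  change P.Hvu w lam t₀ i j ≠ 0 at hne
  set σ := P.Hvu w lam t₀ i j with hσ
  have hσ2 : 0 < σ ^ 2 / 2 := by positivity
  have cH := h.continuousOn_Hvu hp.continuousOn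
  have cHij : ContinuousOn (fun t => σ * P.Hvu w lam t i j) (Icc 0 P.T) := by fun_prop
  have cUjj : ContinuousOn (fun t => P.Huu w lam t j j) (Icc 0 P.T) := by
    have := h.continuousOn_Huu hp.continuousOn
    fun_prop
  obtain ⟨C₁, hC₁⟩ := isCompact_Icc.exists_bound_of_continuousOn cUjj
  obtain ⟨C, hC0, hC⟩ := h.exists_Omega_bound hp
  have hC₁0 : 0 ≤ C₁ := (norm_nonneg _).trans (hC₁ 0 ⟨le_rfl, h.nonneg⟩)
  -- The perturbation moves `u` along `e_j` and `v` along `-κσ e_i`. Since `H_vv = 0`, enlarging `κ`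
  -- costs nothing in `v²`, and this value makes the mixed term outweigh the `H_uu` term by at least
  -- 1 throughout the interval.
  let κ := (C₁ + 1) / (σ ^ 2 / 2)
  have hκ0 : 0 ≤ κ := by positivity
  have hκ : κ * (σ ^ 2 / 2) = C₁ + 1 := div_mul_cancel₀ _ hσ2.ne'
  let B := (1 + κ * |σ|) ^ 2
  have hB : 0 < B := by positivity
  have hev : ∀ᶠ t in 𝓝[Icc 0 P.T] t₀, σ ^ 2 / 2 < σ * P.Hvu w lam t i j :=
    (cHij t₀ ht₀).eventually (lt_mem_nhds (by
      change σ ^ 2 / 2 < σ * σ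
      nlinarith))
  -- The state terms are at most `C B (b - a) A`, where `A` is the squared L² norm of the scalar
  -- profile and `B` accounts for the size of its direction. This length makes them at most `A / 2`,
  -- while the control terms are at most `-A`.
  obtain ⟨a, b, hab, hδ, ha, hb, hs⟩ := exists_subinterval h.pos ht₀
    (δ := 1 / (2 * (C + 1) * B)) (by positivity) hev
  let r : C(ℝ, (Fin l → ℝ) × (Fin m → ℝ)) :=
    ⟨fun t => (bump a b t • Pi.single j 1, bump a b t • Pi.single i (-κ * σ)), by
      have := (contDiff_bump a b).continuous
      fun_prop⟩
  obtain ⟨q, hq0, hq⟩ := hN.exists_polynomial h (P.polyDir r 0)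
  have hA := integral_sq_bump_pos hab ha hb hq0
  set f : ℝ → ℝ := fun t => q.eval t * bump a b t with hf
  have cf : Continuous f := by
    have := (contDiff_bump a b).continuous
    fun_prop
  change 0 < ∫ t in (0 : ℝ)..P.T, f t ^ 2 at hA
  set A := ∫ t in (0 : ℝ)..P.T, f t ^ 2 with hAdef
  have hfs : ∀ t, t ∉ Ioo a b → f t = 0 := fun t ht => by simp [hf, bump_eq_zero hab ht]
  have hru : ∀ t ∈ Icc 0 P.T, IccExtend h.nonneg (P.polyDir r 0 q).2 t =
      (f t • Pi.single j 1, f t • Pi.single i (-κ * σ)) := fun t ht => by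
    rw [h.polyDir_snd _ _ _ ht]
    simp [r, hf, mul_smul]
  have h1 := hC (P.polyDir r 0 q) rfl
  have hm : ∫ t in (0 : ℝ)..P.T, ‖IccExtend h.nonneg (P.polyDir r 0 q).2 t‖ ≤
      (1 + κ * |σ|) * ∫ t in (0 : ℝ)..P.T, |f t| := by
    rw [← intervalIntegral.integral_const_mul]
    refine intervalIntegral.integral_mono_on h.nonneg
      ((IccExtend_continuous _ _).norm.intervalIntegrable _ _)
      ((cf.abs.const_mul _).intervalIntegrable _ _) fun t ht => ?_
    rw [hru t ht]
    have e1 : ‖(f t • Pi.single j 1 : Fin l → ℝ)‖ = |f t| := by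
      rw [norm_smul, Pi.norm_single]; simp
    have e2 : ‖(f t • Pi.single i (-κ * σ) : Fin m → ℝ)‖ = |f t| * (κ * |σ|) := by
      rw [norm_smul, Pi.norm_single]; simp [abs_of_nonneg hκ0]
    refine max_le ?_ ?_
    · change ‖(f t • Pi.single j 1 : Fin l → ℝ)‖ ≤ _
      rw [e1]; nlinarith [abs_nonneg (f t), mul_nonneg (mul_nonneg hκ0 (abs_nonneg σ)) (abs_nonneg (f t))]
    · change ‖(f t • Pi.single i (-κ * σ) : Fin m → ℝ)‖ ≤ _
      rw [e2]; nlinarith [abs_nonneg (f t)]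
  have hm0 : 0 ≤ ∫ t in (0 : ℝ)..P.T, ‖IccExtend h.nonneg (P.polyDir r 0 q).2 t‖ :=
    intervalIntegral.integral_nonneg h.nonneg fun _ _ => norm_nonneg _
  have hsq : C * (∫ t in (0 : ℝ)..P.T, ‖IccExtend h.nonneg (P.polyDir r 0 q).2 t‖) ^ 2 ≤
      (1 / 2) * A := by
    have e1 := pow_le_pow_left₀ hm0 hm 2
    have e2 := sq_integral_abs_le hab ha hb cf hfs
    rw [mul_pow] at e1
    have e3 : B * ((b - a) * A) ≤ B * (1 / (2 * (C + 1) * B) * A) := by gcongr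
    have e4 : B * (1 / (2 * (C + 1) * B) * A) = A / (2 * (C + 1)) := by field_simp
    have e5 : (∫ t in (0 : ℝ)..P.T, ‖IccExtend h.nonneg (P.polyDir r 0 q).2 t‖) ^ 2 ≤
        A / (2 * (C + 1)) := by
      rw [← e4]
      exact (e1.trans (mul_le_mul_of_nonneg_left e2 hB.le)).trans e3
    calc _ ≤ C * (A / (2 * (C + 1))) := mul_le_mul_of_nonneg_left e5 hC0
      _ = (C / (C + 1)) * ((1 / 2) * A) := by field_simp
      _ ≤ 1 * ((1 / 2) * A) := by
        refine mul_le_mul_of_nonneg_right ?_ (by positivity)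
        rw [div_le_one (by linarith)]; linarith
      _ = _ := one_mul _
  have hint : (∫ t in (0 : ℝ)..P.T,
      ((1 / 2) * ((h.dir (P.polyDir r 0 q)).u t ⬝ᵥ P.Huu w lam t *ᵥ (h.dir (P.polyDir r 0 q)).u t) +
        (h.dir (P.polyDir r 0 q)).v t ⬝ᵥ P.Hvu w lam t *ᵥ (h.dir (P.polyDir r 0 q)).u t)) ≤ -A := by
    rw [hAdef, ← intervalIntegral.integral_neg]
    have cu := (h.continuous_dir_u (P.polyDir r 0 q)).continuousOn (s := Icc 0 P.T)
    have cv := (h.continuous_dir_v (P.polyDir r 0 q)).continuousOn (s := Icc 0 P.T)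
    refine intervalIntegral.integral_mono_on h.nonneg
      (ContinuousOn.intervalIntegrable_of_Icc h.nonneg
        ((continuousOn_const.mul (cu.dotProduct_mulVec (h.continuousOn_Huu hp.continuousOn) cu)).add
          (cv.dotProduct_mulVec cH cu))) ((cf.pow 2).neg.intervalIntegrable _ _) fun t ht => ?_
    have eu : (h.dir (P.polyDir r 0 q)).u t = f t • Pi.single j 1 := congrArg Prod.fst (hru t ht)
    have ev : (h.dir (P.polyDir r 0 q)).v t = f t • Pi.single i (-κ * σ) :=
      congrArg Prod.snd (hru t ht)
    rw [eu, ev]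
    simp only [mulVec_smul, dotProduct_smul, smul_dotProduct, smul_eq_mul, mulVec_single_one,
      single_dotProduct, Matrix.col_apply, one_mul]
    by_cases hts : t ∈ Ioo a b
    · have e1 := hs t ⟨hts.1.le, hts.2.le⟩
      have e2 := (abs_le.1 (hC₁ t ht)).2
      have e3 : κ * (σ ^ 2 / 2) ≤ κ * (σ * P.Hvu w lam t i j) :=
        mul_le_mul_of_nonneg_left e1.le hκ0
      rw [hκ] at e3
      have e4 : (1 / 2) * P.Huu w lam t j j - κ * (σ * P.Hvu w lam t i j) ≤ -1 := by linarith
      nlinarith [mul_le_mul_of_nonneg_left e4 (sq_nonneg (f t))]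
    · rw [hfs t hts]
      simp
  linarith

end IsReference

end ControlProblem

/-- A matrix as a continuous linear map. -/
def mulVecL {a b : ℕ} : Matrix (Fin a) (Fin b) ℝ →ₗ[ℝ] (Fin b → ℝ) →L[ℝ] (Fin a → ℝ) :=
  LinearMap.toContinuousLinearMap.toLinearMap ∘ₗ Matrix.toLin'.toLinearMap

@[simp] lemma mulVecL_apply {a b : ℕ} (M : Matrix (Fin a) (Fin b) ℝ) (x : Fin b → ℝ) :
    mulVecL M x = M *ᵥ x := rfl

lemma _root_.ContinuousOn.mulVecL {a b : ℕ} {M : ℝ → Matrix (Fin a) (Fin b) ℝ} {s : Set ℝ}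
    (hM : ContinuousOn M s) : ContinuousOn (fun t => mulVecL (M t)) s :=
  (LinearMap.continuous_of_finiteDimensional
    (F' := (Fin b → ℝ) →L[ℝ] (Fin a → ℝ)) _root_.mulVecL).comp_continuousOn hM

/-! ### Finite index forces the Goh matrix to vanish -/

namespace ControlProblem

variable {n l m dφ dη : ℕ} {P : ControlProblem n l m dφ dη} {w : StateControl n l m}

namespace IsReference

variable (h : P.IsReference w)
include h

/-- When `u`, the initial value and the final `y` vanish, the transformed state is driven by `B y`
alone. The whole form is then controlled by `y` in L², with no reference to its derivative `v`; this
is the gain of Goh's transformation. -/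
lemma exists_OmegaP2_bound {lam : Multiplier n dφ dη} (hp : ContDiffOn ℝ 1 lam.2.2 (Icc 0 P.T)) :
    ∃ C : ℝ, 0 ≤ C ∧ ∀ c : P.Dir, c.1 = 0 → (∀ t, (h.dir c).u t = 0) → h.dirY c P.T = 0 →
      P.OmegaP2 w lam (h.goh c) ≤ C * ∫ t in (0 : ℝ)..P.T, ‖h.dirY c t‖ ^ 2 := by
  obtain ⟨K, hK0, hK⟩ := exists_linear_bound h.nonneg h.continuousOn_Fx.mulVecL
  have hB := h.continuousOn_cB.mulVecL
  obtain ⟨B, hB'⟩ := isCompact_Icc.exists_bound_of_continuousOn hB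
  have hB0 : 0 ≤ B := (norm_nonneg _).trans (hB' 0 ⟨le_rfl, h.nonneg⟩)
  have hq := h.continuousOn_qP2 hp
  obtain ⟨Q, hQ⟩ := IsCompact.exists_bound_of_continuousOn
    (E := (Fin n → ℝ) × (Fin l → ℝ) × (Fin m → ℝ) →L[ℝ]
      (Fin n → ℝ) × (Fin l → ℝ) × (Fin m → ℝ) →L[ℝ] ℝ) isCompact_Icc hq
  have hQ0 : 0 ≤ Q := le_trans (ContinuousLinearMap.opNorm_nonneg _) (hQ 0 ⟨le_rfl, h.nonneg⟩)
  let L := fderiv ℝ (fderiv ℝ (P.ell lam)) (w.x 0, w.x P.T)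
  have hT := h.pos
  refine ⟨(1 / 2) * (‖L‖ * (K * (B * √P.T)) ^ 2) + Q * (P.T * (K * (B * √P.T)) ^ 2 + 1),
    by positivity, fun c hc hu hy => ?_⟩
  rw [← sq_l2norm h.nonneg]
  set N := l2norm P.T (h.dirY c) with hN
  have hN0 : 0 ≤ N := l2norm_nonneg _
  have cy := h.continuous_dirY c
  have hry := hB.clm_apply cy.continuousOn
  have hξ : ∀ t ∈ Icc 0 P.T, ‖(h.goh c).ξ t‖ ≤ K * (B * √P.T) * N := by
    intro t ht
    have h1 := hK (h.goh c).ξ _ (h.continuousOn_goh_ξ c) (hry.intervalIntegrable_of_Icc h.nonneg)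
      (fun t ht => by
        rw [h.goh_ξ_eq c ht]
        refine congrArg _ (intervalIntegral.integral_congr fun s _ => ?_)
        have : (h.goh c).u s = 0 := hu s
        simp only [this, mulVec_zero, add_zero, mulVecL_apply]
        rfl) t ht
    rw [h.goh_ξ_zero, hc, norm_zero, zero_add] at h1
    refine h1.trans ?_
    rw [mul_assoc, mul_assoc]
    refine mul_le_mul_of_nonneg_left ?_ hK0
    refine le_trans ?_ (mul_le_mul_of_nonneg_left
      (integral_norm_le h.nonneg (cy.continuousOn.memLp_timeMeasure)) hB0)
    rw [← intervalIntegral.integral_const_mul]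
    exact intervalIntegral.integral_mono_on h.nonneg (hry.norm.intervalIntegrable_of_Icc h.nonneg)
      ((cy.norm.const_mul B).intervalIntegrable _ _)
      fun s hs => ContinuousLinearMap.le_of_opNorm_le _ (hB' s hs) _
  have mpt := (h.continuousOn_goh_pt c).memLp_timeMeasure (p := 2)
  have h1 := (le_abs_self _).trans (abs_integral_bilin_le h.nonneg hQ mpt mpt)
  have h2 : l2norm P.T (h.goh c).pt * l2norm P.T (h.goh c).pt ≤
      P.T * (K * (B * √P.T) * N) ^ 2 + N ^ 2 := by
    rw [← sq, sq_l2norm h.nonneg, hN, sq_l2norm h.nonneg, ← hN]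
    have e1 : ∫ t in (0 : ℝ)..P.T, ((K * (B * √P.T) * N) ^ 2 + ‖h.dirY c t‖ ^ 2) =
        P.T * (K * (B * √P.T) * N) ^ 2 + ∫ t in (0 : ℝ)..P.T, ‖h.dirY c t‖ ^ 2 := by
      rw [intervalIntegral.integral_add intervalIntegrable_const
        (Continuous.intervalIntegrable (u := fun t => ‖h.dirY c t‖ ^ 2) (by fun_prop) _ _),
        intervalIntegral.integral_const, smul_eq_mul,
        sub_zero]
    rw [← e1]
    refine intervalIntegral.integral_mono_on h.nonneg
      (((h.continuousOn_goh_pt c).norm.pow 2).intervalIntegrable_of_Icc h.nonneg)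
      (Continuous.intervalIntegrable (by fun_prop) _ _) fun t ht => ?_
    have hmax : ‖(h.goh c).pt t‖ = max ‖(h.goh c).ξ t‖ (max ‖(h.dir c).u t‖ ‖h.dirY c t‖) := rfl
    rw [hmax, hu, norm_zero, max_eq_right (norm_nonneg (h.dirY c t))]
    rcases max_choice ‖(h.goh c).ξ t‖ ‖h.dirY c t‖ with e | e
    · rw [e]
      exact (pow_le_pow_left₀ (norm_nonneg _) (hξ t ht) 2).trans
        (le_add_of_nonneg_right (sq_nonneg _))
    · rw [e]
      exact le_add_of_nonneg_left (sq_nonneg _)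
  have h3 : P.gohEndpoint w lam ((h.goh c).ξ 0) ((h.goh c).ξ P.T) (h.goh c).h ≤
      (1 / 2) * (‖L‖ * (K * (B * √P.T) * N) ^ 2) := by
    have e0 : (h.goh c).h = 0 := hy
    unfold gohEndpoint
    rw [e0, mulVec_zero, add_zero, zero_dotProduct, add_zero]
    have e1 : ‖((h.goh c).ξ 0, (h.goh c).ξ P.T)‖ ≤ K * (B * √P.T) * N :=
      max_le (hξ 0 ⟨le_rfl, h.nonneg⟩) (hξ P.T ⟨h.nonneg, le_rfl⟩)
    refine mul_le_mul_of_nonneg_left ?_ (by norm_num)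
    calc _ ≤ ‖L ((h.goh c).ξ 0, (h.goh c).ξ P.T) ((h.goh c).ξ 0, (h.goh c).ξ P.T)‖ := le_abs_self _
      _ ≤ ‖L‖ * ‖((h.goh c).ξ 0, (h.goh c).ξ P.T)‖ * ‖((h.goh c).ξ 0, (h.goh c).ξ P.T)‖ :=
        ContinuousLinearMap.le_opNorm₂ L _ _
      _ ≤ ‖L‖ * (K * (B * √P.T) * N) * (K * (B * √P.T) * N) := by gcongr
      _ = _ := by ring
  rw [OmegaP2_eq h.nonneg]
  have h4 := mul_le_mul_of_nonneg_left h2 hQ0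
  nlinarith [h1, h3, h4]

omit h in
lemma gohV_antisymm (lam : Multiplier n dφ dη) (t : ℝ) (i j : Fin m) :
    P.gohV w lam t j i = - P.gohV w lam t i j := by
  simp only [gohV, Matrix.smul_apply, Matrix.sub_apply, Matrix.transpose_apply, smul_eq_mul]
  ring

-- The two vectors are the velocity and the position of `ρ e` when the unit vector `e` rotates in a
-- coordinate plane with angular speed `κ`. An antisymmetric matrix ignores the radial velocity `ρ'`
-- and sees only the rotation, so the value is a multiple of `ρ²`.
omit h in
lemma rotation_algebra {V : Matrix (Fin m) (Fin m) ℝ} (hV : ∀ i j, V j i = -V i j) (i j : Fin m)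
    (κ ρ ρ' c s : ℝ) (hcs : c ^ 2 + s ^ 2 = 1) :
    (ρ' • (Pi.single i c + Pi.single j s) + (κ * ρ) • (Pi.single i (-s) + Pi.single j c)) ⬝ᵥ
      V *ᵥ (ρ • (Pi.single i c + Pi.single j s)) = -κ * V i j * ρ ^ 2 := by
  have h1 : ∀ (a b : Fin m) (x y : ℝ), (Pi.single a x : Fin m → ℝ) ⬝ᵥ V *ᵥ Pi.single b y =
      x * V a b * y := fun a b x y => by
    rw [single_dotProduct, mulVec_single]
    simp [mul_assoc]
  have hi : V i i = 0 := by have := hV i i; linarith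
  have hj : V j j = 0 := by have := hV j j; linarith
  simp only [mulVec_smul, mulVec_add, add_dotProduct, smul_dotProduct, dotProduct_smul,
    dotProduct_add, h1, smul_eq_mul, hi, hj, hV i j]
  have : s ^ 2 = 1 - c ^ 2 := by linarith
  linear_combination (-κ * V i j * ρ ^ 2) * hcs

set_option maxHeartbeats 1000000 in
/-- If the index of the second variation is finite then the Goh matrix vanishes. -/
lemma IndexLt.gohV_eq_zero {N : ℕ} {lam : Multiplier n dφ dη} (hN : h.IndexLt N lam)
    (hp : ContDiffOn ℝ 1 lam.2.2 (Icc 0 P.T)) {t₀ : ℝ} (ht₀ : t₀ ∈ Icc 0 P.T) :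
    P.gohV w lam t₀ = 0 := by
  ext i j
  by_contra hne
  change P.gohV w lam t₀ i j ≠ 0 at hne
  set σ := P.gohV w lam t₀ i j with hσ
  have hσ2 : 0 < σ ^ 2 / 2 := by positivity
  have cV := h.continuousOn_gohV hp
  have cVij : ContinuousOn (fun t => σ * P.gohV w lam t i j) (Icc 0 P.T) := by fun_prop
  obtain ⟨C, hC0, hC⟩ := h.exists_OmegaP2_bound hp
  -- With angular speed `κ = kσ` the Goh term is at most `-(4C + 1) f²`, whereas the transformed
  -- form is at most `4C ∫ f²`; the 4 comes from the bound `‖e t‖ ≤ 2`. The total is negative for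
  -- every nonzero polynomial, whatever the length of the interval.
  let k := (4 * C + 1) / (σ ^ 2 / 2)
  have hk0 : 0 ≤ k := by positivity
  have hk : k * (σ ^ 2 / 2) = 4 * C + 1 := div_mul_cancel₀ _ hσ2.ne'
  set κ := k * σ with hκ
  have hev : ∀ᶠ t in 𝓝[Icc 0 P.T] t₀, σ ^ 2 / 2 < σ * P.gohV w lam t i j :=
    (cVij t₀ ht₀).eventually (lt_mem_nhds (by
      change σ ^ 2 / 2 < σ * σ
      nlinarith))
  obtain ⟨a, b, hab, -, ha, hb, hs⟩ := exists_subinterval h.pos ht₀ one_pos hev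
  have cψ := (contDiff_bump a b).continuous
  have cψ' := (contDiff_bump a b).continuous_deriv le_rfl
  have dψ : ∀ t, HasDerivAt (bump a b) (deriv (bump a b) t) t := fun t =>
    ((contDiff_bump a b).differentiable one_ne_zero t).hasDerivAt
  let e : ℝ → Fin m → ℝ := fun t => Pi.single i (Real.cos (κ * t)) + Pi.single j (Real.sin (κ * t))
  let e' : ℝ → Fin m → ℝ := fun t => Pi.single i (-Real.sin (κ * t)) + Pi.single j (Real.cos (κ * t))
  have csing : ∀ (i : Fin m) {f : ℝ → ℝ}, Continuous f →
      Continuous fun t => (Pi.single i (f t) : Fin m → ℝ) := fun i f hf =>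
    (continuous_single i).comp hf
  have ce : Continuous e := (csing i (by fun_prop)).add (csing j (by fun_prop))
  have ce' : Continuous e' := (csing i (by fun_prop)).add (csing j (by fun_prop))
  have dsing : ∀ (i : Fin m) {f : ℝ → ℝ} {f' t : ℝ}, HasDerivAt f f' t →
      HasDerivAt (fun t => (Pi.single i (f t) : Fin m → ℝ)) (Pi.single i f') t := fun i f f' t hf =>
    (ContinuousLinearMap.single ℝ (fun _ : Fin m => ℝ) i).hasFDerivAt.comp_hasDerivAt t hf
  have de : ∀ t, HasDerivAt e (κ • e' t) t := fun t => by
    have h0 : HasDerivAt (fun t => κ * t) κ t := by simpa using (hasDerivAt_id t).const_mul κ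
    refine ((dsing i h0.cos).add (dsing j h0.sin)).congr_deriv ?_
    simp only [e', smul_add, ← Pi.single_smul, smul_eq_mul]
    rw [mul_comm κ (-Real.sin (κ * t)), mul_comm κ (Real.cos (κ * t))]
  -- Together with `r₁` this makes the affine control the derivative of the curve `q ψ e`, where `ψ`
  -- is the bump. The term with `q'` is the reason for the second function. The primitive is then
  -- that curve, and it vanishes at both ends.
  let r₀ : C(ℝ, (Fin l → ℝ) × (Fin m → ℝ)) :=
    ⟨fun t => (0, deriv (bump a b) t • e t + (κ * bump a b t) • e' t), by fun_prop⟩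
  let r₁ : C(ℝ, (Fin l → ℝ) × (Fin m → ℝ)) := ⟨fun t => (0, bump a b t • e t), by fun_prop⟩
  obtain ⟨q, hq0, hq⟩ := hN.exists_polynomial h (P.polyDir r₀ r₁)
  set d := P.polyDir r₀ r₁ q with hd
  have hA := integral_sq_bump_pos hab ha hb hq0
  set f : ℝ → ℝ := fun t => q.eval t * bump a b t with hf
  have cf : Continuous f := by fun_prop
  change 0 < ∫ t in (0 : ℝ)..P.T, f t ^ 2 at hA
  set A := ∫ t in (0 : ℝ)..P.T, f t ^ 2 with hAdef
  have hfs : ∀ t, t ∉ Ioo a b → f t = 0 := fun t ht => by simp [hf, bump_eq_zero hab ht]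
  let f' : ℝ → ℝ := fun t => q.derivative.eval t * bump a b t + q.eval t * deriv (bump a b) t
  have cf' : Continuous f' := by fun_prop
  have df : ∀ t, HasDerivAt f (f' t) t := fun t => (q.hasDerivAt t).mul (dψ t)
  have hr : ∀ t ∈ Icc 0 P.T, IccExtend h.nonneg d.2 t = (0, f' t • e t + (κ * f t) • e' t) :=
    fun t ht => by
      rw [hd, h.polyDir_snd _ _ _ ht]
      refine Prod.ext (by simp [r₀, r₁]) ?_
      simp only [r₀, r₁, f', hf, ContinuousMap.coe_mk, Prod.smul_mk, Prod.snd_add, smul_add,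
        smul_smul, add_smul]
      rw [show q.eval t * (κ * bump a b t) = κ * (q.eval t * bump a b t) by ring]
      abel
  have hu : ∀ t, (h.dir d).u t = 0 := fun t =>
    have hmem := (projIcc 0 P.T h.nonneg t).2
    congrArg Prod.fst ((IccExtend_of_mem h.nonneg d.2 hmem).symm.trans (hr _ hmem))
  have hY : ∀ t ∈ Icc 0 P.T, h.dirY d t = f t • e t := fun t ht => by
    have h1 : h.dirY d t = ∫ s in (0 : ℝ)..t, (f' s • e s + (κ * f s) • e' s) := by
      refine intervalIntegral.integral_congr fun s hs => ?_
      rw [uIcc_of_le ht.1] at hs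
      exact congrArg Prod.snd (hr s ⟨hs.1, hs.2.trans ht.2⟩)
    have h2 := intervalIntegral.integral_eq_sub_of_hasDerivAt (a := 0) (b := t)
      (f := fun s => f s • e s) (f' := fun s => f' s • e s + (κ * f s) • e' s) (fun s _ => by
        refine ((df s).smul (de s)).congr_deriv ?_
        rw [smul_smul, mul_comm κ, add_comm])
      (Continuous.intervalIntegrable (by fun_prop) _ _)
    rw [h1, h2, hfs 0 (fun hcon => by linarith [hcon.1]), zero_smul, sub_zero]
  have hYT : h.dirY d P.T = 0 := by
    rw [hY P.T ⟨h.nonneg, le_rfl⟩, hfs P.T (fun hcon => by linarith [hcon.2]), zero_smul]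
  have h1 := hC d rfl hu hYT
  have h2 : ∫ t in (0 : ℝ)..P.T, ‖h.dirY d t‖ ^ 2 ≤ 4 * A := by
    rw [hAdef, ← intervalIntegral.integral_const_mul]
    refine intervalIntegral.integral_mono_on h.nonneg
      (((h.continuous_dirY d).norm.pow 2).intervalIntegrable _ _)
      (((cf.pow 2).const_mul 4).intervalIntegrable _ _) fun t ht => ?_
    rw [hY t ht, norm_smul, mul_pow, Real.norm_eq_abs, sq_abs]
    have e1 : ‖e t‖ ≤ 2 := by
      refine (norm_add_le _ _).trans ?_
      rw [Pi.norm_single, Pi.norm_single]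
      have := Real.abs_cos_le_one (κ * t)
      have := Real.abs_sin_le_one (κ * t)
      simp only [Real.norm_eq_abs]
      linarith
    have e2 : ‖e t‖ ^ 2 ≤ 2 ^ 2 := pow_le_pow_left₀ (norm_nonneg _) e1 2
    nlinarith [sq_nonneg (f t)]
  have h3 : ∫ t in (0 : ℝ)..P.T, (h.dir d).v t ⬝ᵥ P.gohV w lam t *ᵥ h.dirY d t ≤
      -(4 * C + 1) * A := by
    rw [hAdef, ← intervalIntegral.integral_const_mul]
    refine intervalIntegral.integral_mono_on h.nonneg
      (ContinuousOn.intervalIntegrable_of_Icc h.nonneg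
        ((h.continuous_dir_v d).continuousOn.dotProduct_mulVec cV
          (h.continuous_dirY d).continuousOn))
      (((cf.pow 2).const_mul _).intervalIntegrable _ _) fun t ht => ?_
    have ev : (h.dir d).v t = f' t • e t + (κ * f t) • e' t := congrArg Prod.snd (hr t ht)
    rw [ev, hY t ht, rotation_algebra (gohV_antisymm lam t) i j κ (f t) (f' t) _ _
      (Real.cos_sq_add_sin_sq (κ * t))]
    by_cases hts : t ∈ Ioo a b
    · have e1 := mul_le_mul_of_nonneg_left (hs t ⟨hts.1.le, hts.2.le⟩).le hk0
      rw [hk] at e1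
      have e2 : -κ * P.gohV w lam t i j ≤ -(4 * C + 1) := by rw [hκ]; linarith
      exact mul_le_mul_of_nonneg_right e2 (sq_nonneg _)
    · rw [hfs t hts]; simp
  have h4 : ∫ t in (0 : ℝ)..P.T, (h.dir d).v t ⬝ᵥ P.Hvu w lam t *ᵥ (h.dir d).u t = 0 := by
    simp [hu]
  rw [h.Omega_dir_eq_goh hp, h4] at hq
  nlinarith [mul_le_mul_of_nonneg_left h2 hC0]

end IsReference

end ControlProblem

/-! ### Finite index implies weak lower semicontinuity -/

/-- A symmetric bilinear form of finite index becomes nonnegative after adding finitely many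
squares. -/
lemma exists_finite_correction {X : Type} [AddCommGroup X] [Module ℝ X] (B : X →ₗ[ℝ] X →ₗ[ℝ] ℝ)
    (hB : ∀ x y, B x y = B y x) {N : ℕ} (hN : ∀ v : Fin N → X, ∃ c : EuclideanSpace ℝ (Fin N),
      ‖c‖ = 1 ∧ 0 ≤ B (∑ i, c i • v i) (∑ i, c i • v i)) :
    ∃ k, ∃ v : Fin k → X, ∀ x, 0 ≤ B x x + ∑ i, B (v i) x ^ 2 := by
  by_contra! hcon
  -- If no finite correction worked, vectors orthonormal for `-B` could be added one at a time: a
  -- vector violating the corrected inequality keeps a negative square after its components along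
  -- the earlier vectors are removed. The first `N` of them contradict the index bound.
  have hex : ∀ k, ∃ v : Fin k → X, ∀ i j, B (v i) (v j) = if i = j then -1 else 0 := by
    intro k
    induction k with
    | zero => exact ⟨fun i => i.elim0, fun i => i.elim0⟩
    | succ k ih =>
      obtain ⟨v, hv⟩ := ih
      obtain ⟨x, hx⟩ := hcon k v
      let y := x + ∑ i, B (v i) x • v i
      have hyv : ∀ j, B (v j) y = 0 := fun j => by
        simp [y, hv]
      have hyy : B y y = B x x + ∑ i, B (v i) x ^ 2 := by
        have h1 : B y y = B x y := by
          have h2 : B y y = B y x + ∑ i, B (v i) x * B y (v i) := by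
            change B y (x + ∑ i, B (v i) x • v i) = _
            simp only [map_add, map_sum, map_smul, smul_eq_mul]
          rw [h2, hB y x]
          simp [fun i => hB y (v i), hyv]
        rw [h1]
        simp only [y, map_add, map_sum, map_smul, smul_eq_mul]
        congr 1
        refine Finset.sum_congr rfl fun i _ => ?_
        rw [hB x (v i), sq]
      have hneg : B y y < 0 := by rw [hyy]; exact hx
      let z := (√(-B y y))⁻¹ • y
      have hzz : B z z = -1 := by
        have h1 : √(-B y y) ^ 2 = -B y y := Real.sq_sqrt (by linarith)
        have h2 : √(-B y y) ≠ 0 := (Real.sqrt_pos.2 (by linarith)).ne'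
        simp only [z, map_smul, LinearMap.smul_apply, smul_eq_mul]
        field_simp
        linarith
      have hvz : ∀ j, B (v j) z = 0 := fun j => by simp [z, hyv]
      refine ⟨Fin.snoc v z, fun i j => ?_⟩
      refine Fin.lastCases ?_ (fun i => ?_) i <;> refine Fin.lastCases ?_ (fun j => ?_) j
      · simp [hzz]
      · simp [hB z, hvz, (Fin.castSucc_lt_last j).ne']
      · simp [hvz, (Fin.castSucc_lt_last i).ne]
      · simp [hv, Fin.castSucc_inj]
  obtain ⟨v, hv⟩ := hex N
  obtain ⟨c, hc1, hc2⟩ := hN v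
  have : B (∑ i, c i • v i) (∑ i, c i • v i) = -‖c‖ ^ 2 := by
    rw [EuclideanSpace.norm_sq_eq]
    simp [hv, LinearMap.sum_apply, sq]
  rw [this, hc1] at hc2
  norm_num at hc2

/-- The initial value of an absolutely continuous function as a weakly continuous functional. -/
lemma initial_value_eq {T : ℝ} (hT : 0 ≤ T) {x g : ℝ → ℝ} (hg : IntervalIntegrable g volume 0 T)
    (hx : ∀ t ∈ Icc 0 T, x t = x 0 + ∫ s in (0 : ℝ)..t, g s) :
    T * x 0 = (∫ t in (0 : ℝ)..T, x t) + ∫ t in (0 : ℝ)..T, g t * (t - T) := by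
  let y : ℝ → ℝ := fun t => x 0 + ∫ s in (0 : ℝ)..t, g s
  have h1 : AbsolutelyContinuousOnInterval y 0 T := by
    have h2 := hg.absolutelyContinuousOnInterval_intervalIntegral (c := 0) (by simp)
    have h3 : AbsolutelyContinuousOnInterval (fun _ : ℝ => x 0) 0 T :=
      (contDiff_const.contDiffOn (n := 1)).absolutelyContinuousOnInterval
    exact h3.add h2
  have h2 : AbsolutelyContinuousOnInterval (fun t : ℝ => t - T) 0 T :=
    ((contDiff_id.sub contDiff_const).contDiffOn (n := 1)).absolutelyContinuousOnInterval
  have h3 := AbsolutelyContinuousOnInterval.integral_mul_deriv_eq_deriv_mul h2 h1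
  have hy0 : y 0 = x 0 := by simp [y]
  have e1 : ∫ t in (0 : ℝ)..T, deriv (fun t : ℝ => t - T) t * y t = ∫ t in (0 : ℝ)..T, x t := by
    refine intervalIntegral.integral_congr fun t ht => ?_
    rw [uIcc_of_le hT] at ht
    simp only [deriv_sub_const, deriv_id'', one_mul]
    exact (hx t ht).symm
  have e2 : ∫ t in (0 : ℝ)..T, (t - T) * deriv y t = ∫ t in (0 : ℝ)..T, g t * (t - T) := by
    refine intervalIntegral.integral_congr_ae ?_
    filter_upwards [hg.ae_hasDerivAt_integral] with t ht htm
    have := (ht (uIoc_subset_uIcc htm) 0 (by simp)).const_add (x 0)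
    rw [this.deriv, mul_comm]
  rw [e1, e2, hy0, sub_self, zero_mul] at h3
  linarith

/-- The vector representing a functional on `ℝᵏ`, pulled back along `ι`. -/
def rep {k : ℕ} {Z : Type} [NormedAddCommGroup Z] [NormedSpace ℝ Z] (ι : (Fin k → ℝ) →L[ℝ] Z) :
    (Z →L[ℝ] ℝ) →L[ℝ] (Fin k → ℝ) :=
  ContinuousLinearMap.pi fun i => ContinuousLinearMap.apply ℝ ℝ (ι (Pi.single i 1))

lemma dotProduct_rep {k : ℕ} {Z : Type} [NormedAddCommGroup Z] [NormedSpace ℝ Z]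
    (ι : (Fin k → ℝ) →L[ℝ] Z) (φ : Z →L[ℝ] ℝ) (x : Fin k → ℝ) : x ⬝ᵥ rep ι φ = φ (ι x) := by
  conv_rhs => rw [pi_eq_sum_univ' x, map_sum, map_sum]
  refine Finset.sum_congr rfl fun i _ => ?_
  rw [map_smul, map_smul, smul_eq_mul]
  rfl

/-! ### The second variation as a bilinear form and its weak limits -/

namespace ControlProblem

variable {n l m dφ dη : ℕ} {P : ControlProblem n l m dφ dη} {w : StateControl n l m}

/-- The integrand of the second variation as a bilinear form. -/
def qOm (P : ControlProblem n l m dφ dη) (w : StateControl n l m) (lam : Multiplier n dφ dη)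
    (t : ℝ) : (Fin n → ℝ) × (Fin l → ℝ) × (Fin m → ℝ) →L[ℝ]
      (Fin n → ℝ) × (Fin l → ℝ) × (Fin m → ℝ) →L[ℝ] ℝ :=
  (ContinuousLinearMap.compL ℝ ((Fin n → ℝ) × (Fin l → ℝ) × (Fin m → ℝ)) (Fin n → ℝ) ℝ
    (dotL ((1 / 2 : ℝ) • lam.2.2 t))).comp (P.ddF w t)

lemma qOm_apply (lam : Multiplier n dφ dη) (t : ℝ) (a b : (Fin n → ℝ) × (Fin l → ℝ) × (Fin m → ℝ)) :
    P.qOm w lam t a b = (1 / 2) * (lam.2.2 t ⬝ᵥ P.ddF w t a b) := by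
  change ((1 / 2 : ℝ) • lam.2.2 t) ⬝ᵥ P.ddF w t a b = _
  rw [smul_dotProduct, smul_eq_mul]

/-- The polarization of the second variation. -/
def OmB (P : ControlProblem n l m dφ dη) (w : StateControl n l m) (lam : Multiplier n dφ dη)
    (e e' : (Fin n → ℝ) × (Fin n → ℝ)) (z z' : ℝ → (Fin n → ℝ) × (Fin l → ℝ) × (Fin m → ℝ)) : ℝ :=
  (1 / 2) * fderiv ℝ (fderiv ℝ (P.ell lam)) (w.x 0, w.x P.T) e e' +
    ∫ t in (0 : ℝ)..P.T, P.qOm w lam t (z t) (z' t)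

namespace IsReference

variable (h : P.IsReference w) {lam : Multiplier n dφ dη}
include h

lemma continuousOn_qOm (hp : ContinuousOn lam.2.2 (Icc 0 P.T)) :
    ContinuousOn (P.qOm w lam) (Icc 0 P.T) := by
  have h1 : ContinuousOn (fun t => dotL ((1 / 2 : ℝ) • lam.2.2 t)) (Icc 0 P.T) :=
    dotL.continuous.comp_continuousOn (by fun_prop)
  exact ((ContinuousLinearMap.compL ℝ ((Fin n → ℝ) × (Fin l → ℝ) × (Fin m → ℝ)) (Fin n → ℝ)
    ℝ).continuous.comp_continuousOn h1).clm_comp h.continuousOn_ddF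

lemma Omega_eq_OmB (d : StateControl n l m) :
    P.Omega w lam d = P.OmB w lam (d.x 0, d.x P.T) (d.x 0, d.x P.T) d.pt d.pt := by
  unfold Omega OmB
  simp only [Omega_integrand w lam h.reg, qOm_apply]
  rfl

lemma OmB_comm (e e' : (Fin n → ℝ) × (Fin n → ℝ))
    (z z' : ℝ → (Fin n → ℝ) × (Fin l → ℝ) × (Fin m → ℝ)) :
    P.OmB w lam e e' z z' = P.OmB w lam e' e z' z := by
  have h1 : IsSymmSndFDerivAt ℝ (P.ell lam) (w.x 0, w.x P.T) :=
    (contDiff_ell h.reg lam).contDiffAt.isSymmSndFDerivAt (by simp)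
  unfold OmB
  rw [h1 e e']
  congr 1
  refine intervalIntegral.integral_congr fun t _ => ?_
  simp only [qOm_apply, ddF]
  rw [fderiv_fderiv_Fz_comm h.reg]

lemma OmB_add_right (hp : ContinuousOn lam.2.2 (Icc 0 P.T)) (e e₁ e₂ : (Fin n → ℝ) × (Fin n → ℝ))
    {z z₁ z₂ : ℝ → (Fin n → ℝ) × (Fin l → ℝ) × (Fin m → ℝ)} (hz : MemLp z 2 (timeMeasure P.T))
    (hz₁ : MemLp z₁ 2 (timeMeasure P.T)) (hz₂ : MemLp z₂ 2 (timeMeasure P.T)) :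
    P.OmB w lam e (e₁ + e₂) z (z₁ + z₂) = P.OmB w lam e e₁ z z₁ + P.OmB w lam e e₂ z z₂ := by
  have hq := h.continuousOn_qOm hp
  have i1 := (intervalIntegrable_iff_timeMeasure h.nonneg _).2 (integrable_bilin hq hz hz₁)
  have i2 := (intervalIntegrable_iff_timeMeasure h.nonneg _).2 (integrable_bilin hq hz hz₂)
  have h1 : ∫ t in (0 : ℝ)..P.T, P.qOm w lam t (z t) ((z₁ + z₂) t) =
      (∫ t in (0 : ℝ)..P.T, P.qOm w lam t (z t) (z₁ t)) +
        ∫ t in (0 : ℝ)..P.T, P.qOm w lam t (z t) (z₂ t) := by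
    rw [← intervalIntegral.integral_add i1 i2]
    exact intervalIntegral.integral_congr fun t _ => map_add (P.qOm w lam t (z t)) (z₁ t) (z₂ t)
  unfold OmB
  rw [map_add, h1]
  ring

omit h in
lemma OmB_smul_right (r : ℝ) (e e₁ : (Fin n → ℝ) × (Fin n → ℝ))
    (z z₁ : ℝ → (Fin n → ℝ) × (Fin l → ℝ) × (Fin m → ℝ)) :
    P.OmB w lam e (r • e₁) z (r • z₁) = r * P.OmB w lam e e₁ z z₁ := by
  have h1 : ∫ t in (0 : ℝ)..P.T, P.qOm w lam t (z t) ((r • z₁) t) =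
      r * ∫ t in (0 : ℝ)..P.T, P.qOm w lam t (z t) (z₁ t) := by
    rw [← intervalIntegral.integral_const_mul]
    exact intervalIntegral.integral_congr fun t _ => map_smul (P.qOm w lam t (z t)) r (z₁ t)
  unfold OmB
  rw [map_smul, h1, smul_eq_mul]
  ring

lemma memLp_dir_pt (c : P.Dir) : MemLp (h.dir c).pt 2 (timeMeasure P.T) :=
  (h.continuous_dir_pt c).continuousOn.memLp_timeMeasure

lemma dir_pt_add' (a b : P.Dir) : (h.dir (a + b)).pt = (h.dir a).pt + (h.dir b).pt :=
  funext fun t => h.dir_pt_add a b t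

lemma dir_pt_smul' (r : ℝ) (b : P.Dir) : (h.dir (r • b)).pt = r • (h.dir b).pt :=
  funext fun t => h.dir_pt_smul r b t

lemma ends_add (a b : P.Dir) : h.ends (a + b) = h.ends a + h.ends b :=
  have key : ∀ t, (h.dir (a + b)).x t = (h.dir a).x t + (h.dir b).x t := fun t =>
    congrArg Prod.fst (h.dir_pt_add a b t)
  Prod.ext (key 0) (key P.T)

lemma ends_smul (r : ℝ) (b : P.Dir) : h.ends (r • b) = r • h.ends b :=
  have key : ∀ t, (h.dir (r • b)).x t = r • (h.dir b).x t := fun t =>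
    congrArg Prod.fst (h.dir_pt_smul r b t)
  Prod.ext (key 0) (key P.T)

/-- The second variation as a bilinear form in the perturbations. -/
def OmBDir (hp : ContinuousOn lam.2.2 (Icc 0 P.T)) : P.Dir →ₗ[ℝ] P.Dir →ₗ[ℝ] ℝ :=
  LinearMap.mk₂ ℝ (fun c c' => P.OmB w lam (h.ends c) (h.ends c') (h.dir c).pt (h.dir c').pt)
    (fun a b c => by
      rw [h.OmB_comm, h.OmB_comm (h.ends a), h.OmB_comm (h.ends b), h.ends_add, h.dir_pt_add',
        h.OmB_add_right hp _ _ _ (h.memLp_dir_pt _) (h.memLp_dir_pt _) (h.memLp_dir_pt _)])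
    (fun r a c => by
      rw [h.OmB_comm, h.OmB_comm (h.ends a), h.ends_smul, h.dir_pt_smul', OmB_smul_right]
      rfl)
    (fun a b c => by
      rw [h.ends_add, h.dir_pt_add',
        h.OmB_add_right hp _ _ _ (h.memLp_dir_pt _) (h.memLp_dir_pt _) (h.memLp_dir_pt _)])
    (fun r a c => by
      rw [h.ends_smul, h.dir_pt_smul', OmB_smul_right]
      rfl)

lemma tendsto_OmB (hp : ContinuousOn lam.2.2 (Icc 0 P.T)) {e e' : ℕ → (Fin n → ℝ) × (Fin n → ℝ)}
    {e₀ e₀' : (Fin n → ℝ) × (Fin n → ℝ)}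
    {z z' : ℕ → ℝ → (Fin n → ℝ) × (Fin l → ℝ) × (Fin m → ℝ)}
    {z₀ z₀' : ℝ → (Fin n → ℝ) × (Fin l → ℝ) × (Fin m → ℝ)} (he : Tendsto e atTop (𝓝 e₀))
    (he' : Tendsto e' atTop (𝓝 e₀')) (hz : L2Tendsto P.T z z₀) (hz' : L2Tendsto P.T z' z₀') :
    Tendsto (fun k => P.OmB w lam (e k) (e' k) (z k) (z' k)) atTop
      (𝓝 (P.OmB w lam e₀ e₀' z₀ z₀')) := by
  refine Tendsto.add (Tendsto.const_mul _ ?_)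
    (L2Tendsto.integral_bilin h.nonneg hz hz' (h.continuousOn_qOm hp))
  let L := fderiv ℝ (fderiv ℝ (P.ell lam)) (w.x 0, w.x P.T)
  have hL : Continuous fun q : ((Fin n → ℝ) × (Fin n → ℝ)) × ((Fin n → ℝ) × (Fin n → ℝ)) =>
    L q.1 q.2 := L.continuous₂
  exact (hL.tendsto (e₀, e₀')).comp (he.prodMk_nhds he')

/-- The pair `(e, z)` is a limit of endpoints and values of smooth directions. -/
def Approx (e : (Fin n → ℝ) × (Fin n → ℝ)) (z : ℝ → (Fin n → ℝ) × (Fin l → ℝ) × (Fin m → ℝ)) :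
    Prop :=
  ∃ c : ℕ → P.Dir, Tendsto (fun k => h.ends (c k)) atTop (𝓝 e) ∧
    L2Tendsto P.T (fun k => (h.dir (c k)).pt) z

lemma Approx.sub {e e' : (Fin n → ℝ) × (Fin n → ℝ)}
    {z z' : ℝ → (Fin n → ℝ) × (Fin l → ℝ) × (Fin m → ℝ)} (h1 : h.Approx e z) (h2 : h.Approx e' z') :
    h.Approx (e + (-1 : ℝ) • e') (z + (-1 : ℝ) • z') := by
  obtain ⟨c, hc1, hc2⟩ := h1
  obtain ⟨c', hc1', hc2'⟩ := h2
  refine ⟨fun k => c k + (-1 : ℝ) • c' k, ?_, ?_⟩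
  · simp only [ends_add, ends_smul]
    exact hc1.add (hc1'.const_smul _)
  · simp only [dir_pt_add', dir_pt_smul']
    exact hc2.add h.nonneg (hc2'.clm h.nonneg ((-1 : ℝ) • ContinuousLinearMap.id ℝ _))

lemma linearizedSpace_eq {d : StateControl n l m} (hd : d ∈ P.linearizedSpace w) :
    MemLp (fun t => P.dF w t (d.pt t)) 2 (timeMeasure P.T) ∧ (∀ t ∈ Icc 0 P.T,
      d.x t = d.x 0 + ∫ s in (0 : ℝ)..t, P.dF w s (d.pt s)) := by
  refine hd.1.1.eq_integral h.nonneg (by norm_num) ?_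
  filter_upwards [hd.2] with t ht
  rw [Fx_add_Fu_add_Fv w h.reg] at ht
  exact ht

lemma approx_of_mem_linearizedSpace {d : StateControl n l m} (hd : d ∈ P.linearizedSpace w) :
    h.Approx (d.x 0, d.x P.T) d.pt := by
  obtain ⟨⟨hx, hu, hv⟩, -⟩ := id hd
  have hxc := hx.continuousOn h.nonneg (by norm_num)
  obtain ⟨g₁, hg₁, hl₁⟩ := exists_smooth_l2Tendsto h.nonneg hu
  obtain ⟨g₂, hg₂, hl₂⟩ := exists_smooth_l2Tendsto h.nonneg hv
  have hg : ∀ k, Continuous fun t => (g₁ k t, g₂ k t) := fun k =>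
    (hg₁ k).continuous.prodMk (hg₂ k).continuous
  have hl := hl₁.prodMk h.nonneg hl₂
  let c : ℕ → P.Dir := fun k => (d.x 0, restrictCM (hg k).continuousOn)
  have hcv : ∀ k, ∀ t ∈ Icc 0 P.T, IccExtend h.nonneg (c k).2 t = (g₁ k t, g₂ k t) :=
    fun k t ht => IccExtend_restrictCM h.nonneg (hg k).continuousOn ht
  have hl' : L2Tendsto P.T (fun k => IccExtend h.nonneg (c k).2) fun t => (d.u t, d.v t) :=
    hl.of_bound h.nonneg (fun k => (IccExtend_continuous _ _).continuousOn.memLp_timeMeasure) hl.mem'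
      zero_le_one fun k t ht => by rw [hcv k t ht, one_mul]
  have hAr : ContinuousOn (fun t => (P.dF w t).comp
    (ContinuousLinearMap.inr ℝ (Fin n → ℝ) ((Fin l → ℝ) × (Fin m → ℝ)))) (Icc 0 P.T) :=
    h.continuousOn_dF.clm_comp continuousOn_const
  have hsplit : ∀ t (a : Fin n → ℝ) (b : (Fin l → ℝ) × (Fin m → ℝ)), P.dF w t (a, b) =
      (P.dF w t).comp ιx a + (P.dF w t).comp
        (ContinuousLinearMap.inr ℝ (Fin n → ℝ) ((Fin l → ℝ) × (Fin m → ℝ))) b := fun t a b => by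
    change _ = P.dF w t (a, 0) + P.dF w t (0, b)
    rw [← map_add]
    simp
  obtain ⟨b, hb, hbound⟩ := exists_uniform_bound_of_linear h.nonneg h.continuousOn_dF_ιx
    (x := fun k => (h.dir (c k)).x) (x' := d.x)
    (fun k => (h.continuous_dir_x _).continuousOn) hxc (hl'.clm_apply h.nonneg hAr)
    (by simp only [dir_x_zero]; exact tendsto_const_nhds)
    (fun k t ht => by
      rw [h.dir_x_eq _ ht, h.dir_x_zero]
      exact congrArg _ (intervalIntegral.integral_congr fun s _ => hsplit s _ _))
    (fun t ht => by
      rw [(h.linearizedSpace_eq hd).2 t ht]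
      exact congrArg _ (intervalIntegral.integral_congr fun s _ => hsplit s _ _))
  have hpt : ∀ t ∈ Icc 0 P.T, Tendsto (fun k => (h.dir (c k)).x t) atTop (𝓝 (d.x t)) :=
    fun t ht => tendsto_iff_norm_sub_tendsto_zero.2
      (squeeze_zero (fun _ => norm_nonneg _) (fun k => hbound k t ht) hb)
  refine ⟨c, (hpt 0 ⟨le_rfl, h.nonneg⟩).prodMk_nhds (hpt P.T ⟨h.nonneg, le_rfl⟩), ?_⟩
  exact (L2Tendsto.of_uniform h.nonneg (fun k => (h.continuous_dir_x _).continuousOn) hxc hb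
    hbound).prodMk h.nonneg hl'

/-- The endpoints of linearized trajectories depend weakly continuously on the trajectory. -/
lemma tendsto_ends {d : ℕ → StateControl n l m} {d' : StateControl n l m}
    (hd : ∀ j, d j ∈ P.linearizedSpace w) (hd' : d' ∈ P.linearizedSpace w)
    (hw : P.WeakTendstoW2 d d') : Tendsto (fun j => ((d j).x 0, (d j).x P.T)) atTop
      (𝓝 (d'.x 0, d'.x P.T)) := by
  -- Integration by parts against `t - T` writes the initial value through integrals of `x` and its
  -- derivative against fixed L² functions. Endpoint values therefore pass to weak limits.
  have key : ∀ d ∈ P.linearizedSpace w, ∀ i, (P.T * d.x 0 i = (∫ t in (0 : ℝ)..P.T,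
      d.x t ⬝ᵥ Pi.single i 1) + ∫ t in (0 : ℝ)..P.T, deriv d.x t ⬝ᵥ Pi.single i (t - P.T)) ∧
      d.x P.T i = d.x 0 i + ∫ t in (0 : ℝ)..P.T, deriv d.x t ⬝ᵥ Pi.single i 1 := by
    intro d hd i
    obtain ⟨h1, h2⟩ := h.linearizedSpace_eq hd
    have hi := (intervalIntegrable_iff_timeMeasure h.nonneg _).2 (h1.integrable (by norm_num))
    have hder : ∀ᵐ t, t ∈ Ioc 0 P.T → deriv d.x t = P.dF w t (d.pt t) := by
      have := hd.2
      rw [timeMeasure, ae_restrict_iff' measurableSet_Icc] at this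
      filter_upwards [this] with t ht htm
      rw [(ht ⟨htm.1.le, htm.2⟩).deriv, Fx_add_Fu_add_Fv w h.reg]
      rfl
    have hco : ∀ t ∈ Icc 0 P.T, d.x t i = d.x 0 i + ∫ s in (0 : ℝ)..t, P.dF w s (d.pt s) i := by
      intro t ht
      have h3 := congrFun (h2 t ht) i
      rw [h3, Pi.add_apply]
      congr 1
      exact ((ContinuousLinearMap.proj (R := ℝ) (φ := fun _ : Fin n => ℝ) i).intervalIntegral_comp_comm
        (intervalIntegrable_of_mem hi ht)).symm
    have hii : IntervalIntegrable (fun t => P.dF w t (d.pt t) i) volume 0 P.T := by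
      have := (ContinuousLinearMap.proj (R := ℝ) (φ := fun _ : Fin n => ℝ) i).integrable_comp
        ((intervalIntegrable_iff_timeMeasure h.nonneg _).1 hi)
      exact (intervalIntegrable_iff_timeMeasure h.nonneg _).2 this
    refine ⟨?_, ?_⟩
    · have h4 := initial_value_eq h.nonneg (x := fun t => d.x t i) hii hco
      rw [h4]
      refine congrArg₂ (· + ·) (intervalIntegral.integral_congr fun t _ => by simp)
        (intervalIntegral.integral_congr_ae ?_)
      filter_upwards [hder] with t ht htm
      rw [uIoc_of_le h.nonneg] at htm
      rw [ht htm]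
      simp
    · rw [hco P.T ⟨h.nonneg, le_rfl⟩]
      refine congrArg _ (intervalIntegral.integral_congr_ae ?_)
      filter_upwards [hder] with t ht htm
      rw [uIoc_of_le h.nonneg] at htm
      rw [ht htm]
      simp
  have m1 : ∀ i : Fin n, MemLp (fun _ : ℝ => (Pi.single i 1 : Fin n → ℝ)) 2 (timeMeasure P.T) :=
    fun i => continuousOn_const.memLp_timeMeasure
  have m2 : ∀ i : Fin n, MemLp (fun t : ℝ => (Pi.single i (t - P.T) : Fin n → ℝ)) 2
      (timeMeasure P.T) := fun i =>
    ((continuous_single i).comp (by fun_prop : Continuous fun t : ℝ =>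
      t - P.T)).continuousOn.memLp_timeMeasure
  have h0 : Tendsto (fun j => (d j).x 0) atTop (𝓝 (d'.x 0)) := tendsto_pi_nhds.2 fun i => by
    have h1 := ((hw.1 _ (m1 i)).add (hw.2.1 _ (m2 i))).const_mul P.T⁻¹
    simp only [← ((key _ (hd _)) i).1, ← ((key _ hd') i).1, inv_mul_cancel_left₀ h.pos.ne'] at h1
    exact h1
  refine h0.prodMk_nhds (tendsto_pi_nhds.2 fun i => ?_)
  have h1 := ((tendsto_pi_nhds.1 h0) i).add (hw.2.1 _ (m1 i))
  simp only [← ((key _ (hd _)) i).2, ← ((key _ hd') i).2] at h1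
  exact h1

lemma tendsto_OmB_of_weak (hp : ContinuousOn lam.2.2 (Icc 0 P.T)) {d : ℕ → StateControl n l m}
    {d' : StateControl n l m} (hd : ∀ j, d j ∈ P.linearizedSpace w) (hd' : d' ∈ P.linearizedSpace w)
    (hw : P.WeakTendstoW2 d d') (e : (Fin n → ℝ) × (Fin n → ℝ))
    {z : ℝ → (Fin n → ℝ) × (Fin l → ℝ) × (Fin m → ℝ)} (hz : MemLp z 2 (timeMeasure P.T)) :
    Tendsto (fun j => P.OmB w lam e ((d j).x 0, (d j).x P.T) z (d j).pt) atTop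
      (𝓝 (P.OmB w lam e (d'.x 0, d'.x P.T) z d'.pt)) := by
  have hq := MemLp.clm_apply_continuousOn (h.continuousOn_qOm hp) hz
  have hends := h.tendsto_ends hd hd' hw
  have hsplit : ∀ d ∈ P.linearizedSpace w, ∫ t in (0 : ℝ)..P.T, P.qOm w lam t (z t) (d.pt t) =
      (∫ t in (0 : ℝ)..P.T, d.x t ⬝ᵥ rep ιx (P.qOm w lam t (z t))) +
        (∫ t in (0 : ℝ)..P.T, d.u t ⬝ᵥ rep ιu (P.qOm w lam t (z t))) +
        ∫ t in (0 : ℝ)..P.T, d.v t ⬝ᵥ rep ιv (P.qOm w lam t (z t)) := by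
    intro d hd
    have mx : MemLp d.x 2 (timeMeasure P.T) :=
      (hd.1.1.continuousOn h.nonneg (by norm_num)).memLp_timeMeasure
    have hint : ∀ {k : ℕ} {x : ℝ → Fin k → ℝ} (ι : (Fin k → ℝ) →L[ℝ] _),
        MemLp x 2 (timeMeasure P.T) →
        IntervalIntegrable (fun t => x t ⬝ᵥ rep ι (P.qOm w lam t (z t))) volume 0 P.T :=
      fun ι hx => (intervalIntegrable_iff_timeMeasure h.nonneg _).2
        (integrable_bilin (q := fun _ => dotL) continuousOn_const hx ((rep ι).comp_memLp' hq))
    have i1 := hint ιx mx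
    have i2 := hint ιu hd.1.2.1
    have i3 := hint ιv hd.1.2.2
    rw [← intervalIntegral.integral_add i1 i2, ← intervalIntegral.integral_add (i1.add i2) i3]
    refine intervalIntegral.integral_congr fun t _ => ?_
    change _ = d.x t ⬝ᵥ rep ιx (P.qOm w lam t (z t)) + d.u t ⬝ᵥ rep ιu (P.qOm w lam t (z t)) +
      d.v t ⬝ᵥ rep ιv (P.qOm w lam t (z t))
    rw [dotProduct_rep, dotProduct_rep, dotProduct_rep, ← map_add, ← map_add]
    simp [StateControl.pt]
  unfold OmB
  simp only [hsplit _ (hd _), hsplit _ hd']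
  refine Tendsto.add (Tendsto.const_mul _ ?_) (((hw.1 _ ((rep ιx).comp_memLp' hq)).add
    (hw.2.2.1 _ ((rep ιu).comp_memLp' hq))).add (hw.2.2.2 _ ((rep ιv).comp_memLp' hq)))
  exact ((fderiv ℝ (fderiv ℝ (P.ell lam)) (w.x 0, w.x P.T) e).continuous.tendsto _).comp hends

/-- Finite index implies weak lower semicontinuity of the second variation. -/
lemma IndexLt.isWeaklyLsc {N : ℕ} (hN : h.IndexLt N lam)
    (hp : ContinuousOn lam.2.2 (Icc 0 P.T)) : P.IsWeaklyLsc w (P.Omega w lam) := by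
  obtain ⟨k, v, hv⟩ := exists_finite_correction (h.OmBDir hp) (fun a b => h.OmB_comm _ _ _ _)
    (fun v => by
      obtain ⟨c, hc1, hc2⟩ := hN v
      rw [h.Omega_eq_OmB] at hc2
      exact ⟨c, hc1, hc2⟩)
  -- The corrected inequality is known for continuous perturbations; strong approximation extends it
  -- to limits, in particular to the whole linearized space and to differences of its elements.
  have happrox : ∀ {e z}, h.Approx e z → 0 ≤ P.OmB w lam e e z z +
      ∑ i, P.OmB w lam (h.ends (v i)) e (h.dir (v i)).pt z ^ 2 := by
    rintro e z ⟨c, hc1, hc2⟩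
    have h1 := (h.tendsto_OmB hp hc1 hc1 hc2 hc2).add (tendsto_finsetSum Finset.univ fun i _ =>
      (h.tendsto_OmB hp (tendsto_const_nhds (x := h.ends (v i))) hc1
        (L2Tendsto.const (h.memLp_dir_pt (v i))) hc2).pow 2)
    exact ge_of_tendsto' h1 fun k => hv (c k)
  intro d d' hd hd' hwk a ha
  have happ' := h.approx_of_mem_linearizedSpace hd'
  have happ := fun j => h.approx_of_mem_linearizedSpace (hd j)
  have mem' : MemLp d'.pt 2 (timeMeasure P.T) := happ'.choose_spec.2.mem'
  have mem : ∀ j, MemLp (d j).pt 2 (timeMeasure P.T) := fun j => (happ j).choose_spec.2.mem'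
  have mneg := mem'.const_smul (-1 : ℝ)
  -- The corrected inequality for `d j - d'`, expanded. The cross term and the finitely many squared
  -- functionals are weakly continuous, so this lower bound for `Ω (d j)` tends to `Ω d'`.
  have hlow : ∀ j, P.OmB w lam (d'.x 0, d'.x P.T) ((d j).x 0, (d j).x P.T) d'.pt (d j).pt * 2 -
      P.OmB w lam (d'.x 0, d'.x P.T) (d'.x 0, d'.x P.T) d'.pt d'.pt -
      ∑ i, (P.OmB w lam (h.ends (v i)) ((d j).x 0, (d j).x P.T) (h.dir (v i)).pt (d j).pt -
        P.OmB w lam (h.ends (v i)) (d'.x 0, d'.x P.T) (h.dir (v i)).pt d'.pt) ^ 2 ≤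
      P.Omega w lam (d j) := by
    intro j
    have h1 := happrox (Approx.sub h (happ j) happ')
    have e1 : ∀ e z, MemLp z 2 (timeMeasure P.T) →
        P.OmB w lam e (((d j).x 0, (d j).x P.T) + (-1 : ℝ) • (d'.x 0, d'.x P.T)) z
          ((d j).pt + (-1 : ℝ) • d'.pt) =
        P.OmB w lam e ((d j).x 0, (d j).x P.T) z (d j).pt -
          P.OmB w lam e (d'.x 0, d'.x P.T) z d'.pt := fun e z hz => by
      rw [h.OmB_add_right hp _ _ _ hz (mem j) mneg, OmB_smul_right]
      ring
    rw [e1 _ _ ((mem j).add mneg), h.OmB_comm _ ((d j).x 0, (d j).x P.T),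
      h.OmB_comm _ (d'.x 0, d'.x P.T), e1 _ _ (mem j), e1 _ _ mem',
      h.OmB_comm ((d j).x 0, (d j).x P.T) (d'.x 0, d'.x P.T)] at h1
    simp only [fun i => e1 (h.ends (v i)) _ (h.memLp_dir_pt (v i))] at h1
    rw [h.Omega_eq_OmB]
    linarith
  have hlim := (((h.tendsto_OmB_of_weak hp hd hd' hwk (d'.x 0, d'.x P.T) mem').mul_const 2).sub_const
      (P.OmB w lam (d'.x 0, d'.x P.T) (d'.x 0, d'.x P.T) d'.pt d'.pt)).sub
    (tendsto_finsetSum Finset.univ fun i _ =>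
      ((h.tendsto_OmB_of_weak hp hd hd' hwk (h.ends (v i)) (h.memLp_dir_pt (v i))).sub_const
        (P.OmB w lam (h.ends (v i)) (d'.x 0, d'.x P.T) (h.dir (v i)).pt d'.pt)).pow 2)
  have hval : P.OmB w lam (d'.x 0, d'.x P.T) (d'.x 0, d'.x P.T) d'.pt d'.pt * 2 -
      P.OmB w lam (d'.x 0, d'.x P.T) (d'.x 0, d'.x P.T) d'.pt d'.pt -
      ∑ i, (P.OmB w lam (h.ends (v i)) (d'.x 0, d'.x P.T) (h.dir (v i)).pt d'.pt -
        P.OmB w lam (h.ends (v i)) (d'.x 0, d'.x P.T) (h.dir (v i)).pt d'.pt) ^ 2 =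
      P.Omega w lam d' := by
    rw [h.Omega_eq_OmB]
    simp only [sub_self, ne_eq, OfNat.ofNat_ne_zero, not_false_eq_true, zero_pow,
      Finset.sum_const_zero]
    ring
  rw [hval] at hlim
  filter_upwards [hlim.eventually (lt_mem_nhds ha)] with j hj
  exact hj.trans_le (hlow j)

end IsReference

end ControlProblem

/-! ### Linearity of the transformed form in the multiplier -/

lemma matDerivWithin_smul_add {a b : ℕ} {T : ℝ} (hT : 0 < T) {M N : ℝ → Matrix (Fin a) (Fin b) ℝ}
    (hM : MatC1 T M) (hN : MatC1 T N) (r : ℝ) {t : ℝ} (ht : t ∈ Icc 0 T) :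
    matDerivWithin T (fun s => r • M s + N s) t =
      r • matDerivWithin T M t + matDerivWithin T N t := by
  ext i j
  have h1 := ((hM i j).differentiableOn one_ne_zero t ht).hasDerivWithinAt
  have h2 := ((hN i j).differentiableOn one_ne_zero t ht).hasDerivWithinAt
  exact ((h1.const_mul r).add h2).derivWithin (uniqueDiffOn_Icc hT t ht)

namespace ControlProblem

variable {n l m dφ dη : ℕ} {P : ControlProblem n l m dφ dη} {w : StateControl n l m}

namespace IsReference

variable (h : P.IsReference w)
include h

lemma Hxx_smul_add (a b : Multiplier n dφ dη) (r t : ℝ) :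
    P.Hxx w (r • a + b) t = r • P.Hxx w a t + P.Hxx w b t :=
  Matrix.ext_dotProduct fun x y => by
    rw [add_mulVec, smul_mulVec, dotProduct_add, dotProduct_smul, dotProduct_Hxx w _ h.reg,
      dotProduct_Hxx w _ h.reg, dotProduct_Hxx w _ h.reg, ← smul_dotProduct, ← add_dotProduct]
    rfl

lemma Hux_smul_add (a b : Multiplier n dφ dη) (r t : ℝ) :
    P.Hux w (r • a + b) t = r • P.Hux w a t + P.Hux w b t :=
  Matrix.ext_dotProduct fun x y => by
    rw [add_mulVec, smul_mulVec, dotProduct_add, dotProduct_smul, dotProduct_Hux w _ h.reg,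
      dotProduct_Hux w _ h.reg, dotProduct_Hux w _ h.reg, ← smul_dotProduct, ← add_dotProduct]
    rfl

lemma Hvx_smul_add (a b : Multiplier n dφ dη) (r t : ℝ) :
    P.Hvx w (r • a + b) t = r • P.Hvx w a t + P.Hvx w b t :=
  Matrix.ext_dotProduct fun x y => by
    rw [add_mulVec, smul_mulVec, dotProduct_add, dotProduct_smul, dotProduct_Hvx w _ h.reg,
      dotProduct_Hvx w _ h.reg, dotProduct_Hvx w _ h.reg, ← smul_dotProduct, ← add_dotProduct]
    rfl

lemma Huu_smul_add (a b : Multiplier n dφ dη) (r t : ℝ) :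
    P.Huu w (r • a + b) t = r • P.Huu w a t + P.Huu w b t :=
  Matrix.ext_dotProduct fun x y => by
    rw [add_mulVec, smul_mulVec, dotProduct_add, dotProduct_smul, dotProduct_Huu w _ h.reg,
      dotProduct_Huu w _ h.reg, dotProduct_Huu w _ h.reg, ← smul_dotProduct, ← add_dotProduct]
    rfl

lemma gohS_smul_add (a b : Multiplier n dφ dη) (r t : ℝ) :
    P.gohS w (r • a + b) t = r • P.gohS w a t + P.gohS w b t := by
  simp only [gohS, h.Hvx_smul_add, Matrix.add_mul, Matrix.smul_mul, Matrix.transpose_add,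
    Matrix.transpose_smul, smul_add, smul_comm r (1 / 2 : ℝ)]
  abel

lemma gohV_smul_add (a b : Multiplier n dφ dη) (r t : ℝ) :
    P.gohV w (r • a + b) t = r • P.gohV w a t + P.gohV w b t := by
  simp only [gohV, h.Hvx_smul_add, Matrix.add_mul, Matrix.smul_mul, Matrix.transpose_add,
    Matrix.transpose_smul, smul_sub, smul_add, smul_comm r (1 / 2 : ℝ)]
  abel

lemma gohE_smul_add (a b : Multiplier n dφ dη) (r t : ℝ) :
    P.gohE w (r • a + b) t = r • P.gohE w a t + P.gohE w b t := by
  simp only [gohE, h.Hvx_smul_add, h.Hux_smul_add, Matrix.add_mul, Matrix.smul_mul, Matrix.mul_add,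
    Matrix.mul_smul, Matrix.transpose_add, Matrix.transpose_smul, smul_sub]
  abel

variable {a b : Multiplier n dφ dη} (ha : ContDiffOn ℝ 1 a.2.2 (Icc 0 P.T))
  (hb : ContDiffOn ℝ 1 b.2.2 (Icc 0 P.T))
include ha hb

lemma cM_smul_add (r : ℝ) {t : ℝ} (ht : t ∈ Icc 0 P.T) :
    P.cM w (r • a + b) t = r • P.cM w a t + P.cM w b t := by
  have h1 := matDerivWithin_smul_add h.pos (h.matC1_Hvx ha) (h.matC1_Hvx hb) r ht
  have h2 : P.Hvx w (r • a + b) = fun s => r • P.Hvx w a s + P.Hvx w b s :=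
    funext fun s => h.Hvx_smul_add a b r s
  simp only [cM, h.Hxx_smul_add, h2, h1, Matrix.add_mul, Matrix.smul_mul, Matrix.mul_add,
    Matrix.mul_smul, smul_sub]
  abel

lemma cR_smul_add (r : ℝ) {t : ℝ} (ht : t ∈ Icc 0 P.T) :
    P.cR w (r • a + b) t = r • P.cR w a t + P.cR w b t := by
  have h1 := matDerivWithin_smul_add h.pos (h.matC1_gohS ha) (h.matC1_gohS hb) r ht
  have h2 : P.gohS w (r • a + b) = fun s => r • P.gohS w a s + P.gohS w b s :=
    funext fun s => h.gohS_smul_add a b r s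
  simp only [cR, h.Hxx_smul_add, h.Hvx_smul_add, h2, h1, Matrix.add_mul, Matrix.smul_mul,
    Matrix.mul_add, Matrix.mul_smul, smul_sub, Matrix.transpose_add, Matrix.transpose_smul, smul_add]
  abel

lemma qP2_smul_add (r : ℝ) {t : ℝ} (ht : t ∈ Icc 0 P.T)
    (z z' : (Fin n → ℝ) × (Fin l → ℝ) × (Fin m → ℝ)) :
    P.qP2 w (r • a + b) t z z' = r * P.qP2 w a t z z' + P.qP2 w b t z z' := by
  have key : ∀ lam, P.qP2 w lam t z z' = (1 / 2) * (z.1 ⬝ᵥ P.Hxx w lam t *ᵥ z'.1) +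
      z.2.1 ⬝ᵥ P.Hux w lam t *ᵥ z'.1 + z.2.2 ⬝ᵥ P.cM w lam t *ᵥ z'.1 +
      (1 / 2) * (z.2.1 ⬝ᵥ P.Huu w lam t *ᵥ z'.2.1) + z.2.2 ⬝ᵥ P.gohE w lam t *ᵥ z'.2.1 +
      (1 / 2) * (z.2.2 ⬝ᵥ P.cR w lam t *ᵥ z'.2.2) := fun _ => rfl
  simp only [key, h.Hxx_smul_add, h.Hux_smul_add, h.Huu_smul_add, h.gohE_smul_add,
    h.cM_smul_add ha hb r ht, h.cR_smul_add ha hb r ht, add_mulVec, smul_mulVec, dotProduct_add,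
    dotProduct_smul, smul_eq_mul]
  ring

lemma OmegaP2_smul_add (r : ℝ) {d : TransformedDirection n l m}
    (hd : MemLp d.pt 2 (timeMeasure P.T)) :
    P.OmegaP2 w (r • a + b) d = r * P.OmegaP2 w a d + P.OmegaP2 w b d := by
  have i1 := (intervalIntegrable_iff_timeMeasure h.nonneg _).2
    (integrable_bilin (h.continuousOn_qP2 ha) hd hd)
  have i2 := (intervalIntegrable_iff_timeMeasure h.nonneg _).2
    (integrable_bilin (h.continuousOn_qP2 hb) hd hd)
  have h1 : ∫ t in (0 : ℝ)..P.T, P.qP2 w (r • a + b) t (d.pt t) (d.pt t) =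
      r * (∫ t in (0 : ℝ)..P.T, P.qP2 w a t (d.pt t) (d.pt t)) +
        ∫ t in (0 : ℝ)..P.T, P.qP2 w b t (d.pt t) (d.pt t) := by
    rw [← intervalIntegral.integral_const_mul, ← intervalIntegral.integral_add (i1.const_mul r) i2]
    refine intervalIntegral.integral_congr fun t ht => ?_
    rw [uIcc_of_le h.nonneg] at ht
    exact h.qP2_smul_add ha hb r ht _ _
  have h2 : ∀ ζ, P.ellSecond w (r • a + b) ζ = r * P.ellSecond w a ζ + P.ellSecond w b ζ := by
    intro ζ
    unfold ellSecond
    simp only [fderiv_fderiv_ell h.reg, Prod.fst_add, Prod.smul_fst, Prod.snd_add, Prod.smul_snd,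
      Pi.add_apply, Pi.smul_apply, smul_eq_mul, add_mul, Finset.sum_add_distrib, mul_add,
      Finset.mul_sum, mul_assoc]
    ring
  rw [OmegaP2_eq h.nonneg, OmegaP2_eq h.nonneg, OmegaP2_eq h.nonneg, h1]
  simp only [gohEndpoint, h2, h.Hvx_smul_add, h.gohS_smul_add, add_mulVec, smul_mulVec,
    dotProduct_add, dotProduct_smul, smul_eq_mul, smul_add]
  ring

end IsReference

end ControlProblem

/-! ### Density of transformed smooth directions -/

lemma integral_div_pow {T : ℝ} (hT : 0 < T) (N : ℕ) :
    ∫ t in (0 : ℝ)..T, ((t / T) ^ N) ^ 2 = T / (2 * N + 1) := by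
  have h1 : ∀ t : ℝ, ((t / T) ^ N) ^ 2 = (T ^ (2 * N))⁻¹ * t ^ (2 * N) := fun t => by
    rw [← pow_mul, div_pow, mul_comm N 2]
    ring
  simp only [h1]
  rw [intervalIntegral.integral_const_mul, integral_pow]
  have : T ^ (2 * N + 1) = T ^ (2 * N) * T := pow_succ _ _
  have h2 : T ^ (2 * N) ≠ 0 := pow_ne_zero _ hT.ne'
  simp only [this, zero_pow (Nat.succ_ne_zero _), sub_zero]
  push_cast
  field_simp

/-- Continuously differentiable functions with prescribed end values are dense in `L²(0, T)`. -/
lemma exists_contDiff_l2Tendsto {T : ℝ} (hT : 0 < T) {k : ℕ} {y : ℝ → Fin k → ℝ}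
    (hy : MemLp y 2 (timeMeasure T)) (η : Fin k → ℝ) :
    ∃ g : ℕ → ℝ → Fin k → ℝ, (∀ j, ContDiff ℝ 1 (g j)) ∧ (∀ j, g j 0 = 0) ∧ (∀ j, g j T = η) ∧
      L2Tendsto T g y := by
  obtain ⟨f, hf, hl⟩ := exists_smooth_l2Tendsto hT.le hy
  -- The end values are corrected by multiples of `((T - t) / T) ^ N` and `(t / T) ^ N`. Their
  -- squared L² norms decay like `1 / N`, so a large `N` compensates for end values of `f j` that
  -- may be unbounded in `j`; `N ≥ 1` makes each correction vanish at the opposite end.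
  have hN : ∀ j : ℕ, ∃ N : ℕ, 1 ≤ N ∧
      2 * ((‖f j 0‖ ^ 2 + ‖η - f j T‖ ^ 2) * T) / (2 * N + 1) ≤ 1 / ((j : ℝ) + 1) := by
    intro j
    set D := 2 * ((‖f j 0‖ ^ 2 + ‖η - f j T‖ ^ 2) * T) with hD
    have hD0 : 0 ≤ D := by positivity
    obtain ⟨N, hN⟩ := exists_nat_gt (D * ((j : ℝ) + 1))
    refine ⟨N + 1, Nat.le_add_left _ _, ?_⟩
    rw [div_le_div_iff₀ (by positivity) (by positivity), one_mul]
    push_cast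
    have : (0 : ℝ) ≤ N := Nat.cast_nonneg N
    linarith
  choose N hN1 hN2 using hN
  let c₁ : ℕ → ℝ → Fin k → ℝ := fun j t => (((T - t) / T) ^ N j) • (-f j 0)
  let c₂ : ℕ → ℝ → Fin k → ℝ := fun j t => ((t / T) ^ N j) • (η - f j T)
  have d1 : ∀ j, ContDiff ℝ 1 (c₁ j) := fun j =>
    (((contDiff_const.sub contDiff_id).div_const T).pow (N j)).smul contDiff_const
  have d2 : ∀ j, ContDiff ℝ 1 (c₂ j) := fun j =>
    ((contDiff_id.div_const T).pow (N j)).smul contDiff_const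
  have m1 : ∀ j, MemLp (c₁ j) 2 (timeMeasure T) := fun j =>
    (d1 j).continuous.continuousOn.memLp_timeMeasure
  have m2 : ∀ j, MemLp (c₂ j) 2 (timeMeasure T) := fun j =>
    (d2 j).continuous.continuousOn.memLp_timeMeasure
  have n2 : ∀ j, l2norm T (c₂ j) ^ 2 = T / (2 * N j + 1) * ‖η - f j T‖ ^ 2 := fun j => by
    rw [sq_l2norm hT.le, ← integral_div_pow hT, ← intervalIntegral.integral_mul_const]
    refine intervalIntegral.integral_congr fun t _ => ?_
    simp only [c₂, norm_smul, mul_pow, Real.norm_eq_abs, sq_abs]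
  have n1 : ∀ j, l2norm T (c₁ j) ^ 2 = T / (2 * N j + 1) * ‖f j 0‖ ^ 2 := fun j => by
    rw [sq_l2norm hT.le, ← integral_div_pow hT, ← intervalIntegral.integral_mul_const]
    have h1 := intervalIntegral.integral_comp_sub_left (a := 0) (b := T)
      (fun t => ((t / T) ^ N j) ^ 2 * ‖f j 0‖ ^ 2) T
    rw [sub_self, sub_zero] at h1
    rw [← h1]
    refine intervalIntegral.integral_congr fun t _ => ?_
    simp only [c₁, norm_smul, mul_pow, Real.norm_eq_abs, sq_abs, norm_neg]
  have hc : L2Tendsto T (fun j => c₁ j + c₂ j) 0 := by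
    refine L2Tendsto.of_sq (fun j => (m1 j).add (m2 j)) MemLp.zero
      (squeeze_zero (fun _ => sq_nonneg _) (fun j => ?_) tendsto_one_div_add_atTop_nhds_zero_nat)
    rw [sub_zero]
    refine (l2norm_add_sq_le hT.le (m1 j) (m2 j)).trans (le_trans (le_of_eq ?_) (hN2 j))
    rw [n1, n2]
    ring
  refine ⟨fun j => f j + (c₁ j + c₂ j), fun j => ((hf j).of_le (by simp)).add ((d1 j).add (d2 j)),
    fun j => ?_, fun j => ?_, by simpa using hl.add hT.le hc⟩
  · have : N j ≠ 0 := by have := hN1 j; omega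
    simp [c₁, c₂, this, hT.ne']
  · have : N j ≠ 0 := by have := hN1 j; omega
    simp [c₁, c₂, this, hT.ne']

namespace ControlProblem

variable {n l m dφ dη : ℕ} {P : ControlProblem n l m dφ dη} {w : StateControl n l m}

namespace IsReference

variable (h : P.IsReference w)
include h

/-- The transformed directions `goh (c k)` converge to `d`. -/
structure GohTendsto (c : ℕ → P.Dir) (d : TransformedDirection n l m) : Prop where
  zero : Tendsto (fun k => (h.goh (c k)).ξ 0) atTop (𝓝 (d.ξ 0))
  final : Tendsto (fun k => (h.goh (c k)).ξ P.T) atTop (𝓝 (d.ξ P.T))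
  aff : Tendsto (fun k => (h.goh (c k)).h) atTop (𝓝 d.h)
  pt : L2Tendsto P.T (fun k => (h.goh (c k)).pt) d.pt

lemma dirY_add (a b : P.Dir) (t : ℝ) : h.dirY (a + b) t = h.dirY a t + h.dirY b t := by
  unfold dirY
  rw [← intervalIntegral.integral_add ((h.continuous_dir_v a).intervalIntegrable _ _)
    ((h.continuous_dir_v b).intervalIntegrable _ _)]
  exact intervalIntegral.integral_congr fun s _ => congrArg (fun z => z.2.2) (h.dir_pt_add a b s)

lemma dirY_smul (r : ℝ) (b : P.Dir) (t : ℝ) : h.dirY (r • b) t = r • h.dirY b t := by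
  unfold dirY
  rw [← intervalIntegral.integral_smul]
  exact intervalIntegral.integral_congr fun s _ => congrArg (fun z => z.2.2) (h.dir_pt_smul r b s)

lemma goh_pt_add_smul (r : ℝ) (a b : P.Dir) (t : ℝ) :
    (h.goh (a + r • b)).pt t = (h.goh a).pt t + r • (h.goh b).pt t := by
  have h1 := h.dir_pt_add a (r • b) t
  rw [h.dir_pt_smul] at h1
  have hx : (h.dir (a + r • b)).x t = (h.dir a).x t + r • (h.dir b).x t := congrArg (fun z => z.1) h1
  have hu : (h.dir (a + r • b)).u t = (h.dir a).u t + r • (h.dir b).u t :=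
    congrArg (fun z => z.2.1) h1
  have hy : h.dirY (a + r • b) t = h.dirY a t + r • h.dirY b t := by rw [dirY_add, dirY_smul]
  refine Prod.ext ?_ (Prod.ext hu hy)
  change (h.dir (a + r • b)).x t - P.Fv w t *ᵥ h.dirY (a + r • b) t =
    ((h.dir a).x t - P.Fv w t *ᵥ h.dirY a t) + r • ((h.dir b).x t - P.Fv w t *ᵥ h.dirY b t)
  rw [hx, hy, mulVec_add, mulVec_smul, smul_sub]
  abel

lemma GohTendsto.add_smul {c : ℕ → P.Dir} {d : TransformedDirection n l m} (hc : h.GohTendsto c d)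
    {r : ℕ → ℝ} (hr : Tendsto r atTop (𝓝 0)) (b : P.Dir) :
    h.GohTendsto (fun k => c k + r k • b) d := by
  have key := fun k t => h.goh_pt_add_smul (r k) (c k) b t
  have hξ : ∀ k t, (h.goh (c k + r k • b)).ξ t = (h.goh (c k)).ξ t + r k • (h.goh b).ξ t :=
    fun k t => congrArg (fun z => z.1) (key k t)
  have hh : ∀ k, (h.goh (c k + r k • b)).h = (h.goh (c k)).h + r k • (h.goh b).h :=
    fun k => congrArg (fun z => z.2.2) (key k P.T)
  have hpt : ∀ k, (h.goh (c k + r k • b)).pt = (h.goh (c k)).pt + fun t => r k • (h.goh b).pt t :=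
    fun k => funext (key k)
  refine ⟨?_, ?_, ?_, ?_⟩
  · simp only [hξ]
    simpa using hc.zero.add (hr.smul_const ((h.goh b).ξ 0))
  · simp only [hξ]
    simpa using hc.final.add (hr.smul_const ((h.goh b).ξ P.T))
  · simp only [hh]
    simpa using hc.aff.add (hr.smul_const (h.goh b).h)
  · simp only [hpt]
    obtain ⟨C, hC⟩ := isCompact_Icc.exists_bound_of_continuousOn (h.continuousOn_goh_pt b)
    have h0 : L2Tendsto P.T (fun k t => r k • (h.goh b).pt t) 0 := by
      refine L2Tendsto.of_uniform h.nonneg (fun k => (h.continuousOn_goh_pt b).const_smul (r k))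
        continuousOn_const (b := fun k => |r k| * C) (by simpa using hr.abs.mul_const C)
        fun k t ht => ?_
      rw [Pi.zero_apply, sub_zero, norm_smul, Real.norm_eq_abs]
      exact mul_le_mul_of_nonneg_left (hC t ht) (abs_nonneg _)
    simpa using hc.pt.add h.nonneg h0

lemma GohTendsto.add_sum {ι : Type} (s : Finset ι) {c : ℕ → P.Dir} {d : TransformedDirection n l m}
    (hc : h.GohTendsto c d) {r : ℕ → ι → ℝ} (hr : ∀ i, Tendsto (fun k => r k i) atTop (𝓝 0))
    (b : ι → P.Dir) : h.GohTendsto (fun k => c k + ∑ i ∈ s, r k i • b i) d := by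
  classical
  induction s using Finset.induction_on with
  | empty => simpa using hc
  | insert i s his ih =>
    simp only [Finset.sum_insert his]
    have := GohTendsto.add_smul h ih (hr i) (b i)
    simpa only [add_assoc, add_comm (r _ i • b i)] using this

lemma ends_eq_goh (c : P.Dir) : h.ends c =
    ((h.goh c).ξ 0, (h.goh c).ξ P.T + P.Fv w P.T *ᵥ (h.goh c).h) := by
  rw [h.goh_ξ_zero]
  refine Prod.ext (h.dir_x_zero c) ?_
  simp [ends, goh]

lemma GohTendsto.ends {c : ℕ → P.Dir} {d : TransformedDirection n l m} (hc : h.GohTendsto c d) :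
    Tendsto (fun k => h.ends (c k)) atTop (𝓝 (d.ξ 0, d.ξ P.T + P.Fv w P.T *ᵥ d.h)) := by
  simp only [ends_eq_goh]
  exact hc.zero.prodMk_nhds (hc.final.add
    (((mulVecL (P.Fv w P.T)).continuous.tendsto _).comp hc.aff))

/-- The transforms of smooth directions are dense. -/
lemma exists_gohTendsto {d : TransformedDirection n l m} (hd : d ∈ P.coneP2 w) :
    ∃ c : ℕ → P.Dir, h.GohTendsto c d := by
  obtain ⟨hξ, hu, hy, hode, -⟩ := hd
  have hξc := hξ.continuousOn h.nonneg (by norm_num)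
  obtain ⟨f, hf, hfl⟩ := exists_smooth_l2Tendsto h.nonneg hu
  -- The derivatives of these functions serve as affine controls. An L² function has no value at
  -- `T`, so the end value of the approximants can be prescribed as `d.h` independently of `d.y`.
  obtain ⟨g, hg, hg0, hgT, hgl⟩ := exists_contDiff_l2Tendsto h.pos hy d.h
  have hgc : ∀ k, Continuous (deriv (g k)) := fun k => (hg k).continuous_deriv le_rfl
  have hr : ∀ k, Continuous fun t => (f k t, deriv (g k) t) := fun k =>
    (hf k).continuous.prodMk (hgc k)
  let c : ℕ → P.Dir := fun k => (d.ξ 0, restrictCM (hr k).continuousOn)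
  have hcv : ∀ k, ∀ t ∈ Icc 0 P.T, IccExtend h.nonneg (c k).2 t = (f k t, deriv (g k) t) :=
    fun k t ht => IccExtend_restrictCM h.nonneg (hr k).continuousOn ht
  have hcu : ∀ k, ∀ t ∈ Icc 0 P.T, (h.goh (c k)).u t = f k t := fun k t ht =>
    congrArg Prod.fst (hcv k t ht)
  have hcy : ∀ k, ∀ t ∈ Icc 0 P.T, h.dirY (c k) t = g k t := fun k t ht => by
    have h1 : h.dirY (c k) t = ∫ s in (0 : ℝ)..t, deriv (g k) s := by
      refine intervalIntegral.integral_congr fun s hs => ?_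
      rw [uIcc_of_le ht.1] at hs
      exact congrArg Prod.snd (hcv k s ⟨hs.1, hs.2.trans ht.2⟩)
    rw [h1, intervalIntegral.integral_deriv_eq_sub
      (fun s _ => (hg k).differentiable one_ne_zero s) ((hgc k).intervalIntegrable _ _), hg0, sub_zero]
  have lu : L2Tendsto P.T (fun k => (h.goh (c k)).u) d.u :=
    hfl.of_bound h.nonneg (fun k => (h.continuous_dir_u (c k)).continuousOn.memLp_timeMeasure) hu
      zero_le_one fun k t ht => by rw [hcu k t ht, one_mul]
  have ly : L2Tendsto P.T (fun k => (h.goh (c k)).y) d.y :=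
    hgl.of_bound h.nonneg (fun k => (h.continuous_dirY (c k)).continuousOn.memLp_timeMeasure) hy
      zero_le_one fun k t ht => by
        change ‖h.dirY (c k) t - d.y t‖ ≤ _
        rw [hcy k t ht, one_mul]
  have hode' : ∀ᵐ t ∂timeMeasure P.T, HasDerivAt d.ξ (P.Fx w t *ᵥ d.ξ t + P.Fu w t *ᵥ d.u t +
      P.cB w t *ᵥ d.y t) t := by
    have hIoo : ∀ᵐ t ∂timeMeasure P.T, t ∈ Ioo 0 P.T := ae_timeMeasure_of_Ioo fun _ h => h
    filter_upwards [hode, hIoo] with t h1 h2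
    rwa [gohB_eq h2] at h1
  have heq := (hξ.eq_integral h.nonneg (by norm_num) hode').2
  obtain ⟨b, hb, hbound⟩ := exists_uniform_bound_of_linear h.nonneg h.continuousOn_Fx.mulVecL
    (x := fun k => (h.goh (c k)).ξ) (x' := d.ξ) (fun k => h.continuousOn_goh_ξ _) hξc
    ((lu.clm_apply h.nonneg h.continuousOn_Fu.mulVecL).add h.nonneg
      (ly.clm_apply h.nonneg h.continuousOn_cB.mulVecL))
    (by simp only [goh_ξ_zero]; exact tendsto_const_nhds)
    (fun k t ht => by
      rw [h.goh_ξ_eq _ ht]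
      refine congrArg _ (intervalIntegral.integral_congr fun s _ => ?_)
      exact add_assoc _ _ _)
    (fun t ht => by
      rw [heq t ht]
      refine congrArg _ (intervalIntegral.integral_congr fun s _ => ?_)
      exact add_assoc _ _ _)
  have hpt : ∀ t ∈ Icc 0 P.T, Tendsto (fun k => (h.goh (c k)).ξ t) atTop (𝓝 (d.ξ t)) :=
    fun t ht => tendsto_iff_norm_sub_tendsto_zero.2
      (squeeze_zero (fun _ => norm_nonneg _) (fun k => hbound k t ht) hb)
  refine ⟨c, hpt 0 ⟨le_rfl, h.nonneg⟩, hpt P.T ⟨h.nonneg, le_rfl⟩, ?_, ?_⟩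
  · refine tendsto_const_nhds.congr fun k => ?_
    exact ((hcy k P.T ⟨h.nonneg, le_rfl⟩).trans (hgT k)).symm
  · exact (L2Tendsto.of_uniform h.nonneg (fun k => h.continuousOn_goh_ξ _) hξc hb hbound).prodMk
      h.nonneg (lu.prodMk h.nonneg ly)

/-- The transforms of smooth critical directions are dense in the transformed critical cone. -/
lemma exists_critical_gohTendsto {d : TransformedDirection n l m} (hd : d ∈ P.coneP2 w) :
    ∃ c : ℕ → P.Dir, h.GohTendsto c d ∧
      (∀ k i, fderiv ℝ (P.φ i) (w.x 0, w.x P.T) (h.ends (c k)) ≤ 0) ∧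
      ∀ k j, fderiv ℝ (P.η j) (w.x 0, w.x P.T) (h.ends (c k)) = 0 := by
  obtain ⟨c, hc⟩ := h.exists_gohTendsto hd
  let A : (Fin n → ℝ) × (Fin n → ℝ) →L[ℝ] (Fin (dφ + 1) ⊕ Fin dη → ℝ) :=
    ContinuousLinearMap.pi (Sum.elim (fun i => fderiv ℝ (P.φ i) (w.x 0, w.x P.T))
      fun j => fderiv ℝ (P.η j) (w.x 0, w.x P.T))
  let Ψ : P.Dir →ₗ[ℝ] (Fin (dφ + 1) ⊕ Fin dη → ℝ) :=
    { toFun := fun c => A (h.ends c)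
      map_add' := fun a b => by rw [ends_add, map_add]
      map_smul' := fun r a => by rw [ends_smul, map_smul]; rfl }
  set τ := A (d.ξ 0, d.ξ P.T + P.Fv w P.T *ᵥ d.h) with hτ
  have hlim : Tendsto (fun k => Ψ (c k)) atTop (𝓝 τ) := (A.continuous.tendsto _).comp (hc.ends h)
  -- The range is finite-dimensional, hence closed, so the limiting endpoint derivatives are
  -- attained by a smooth direction even when `Ψ` is not surjective.
  have hmem : τ ∈ LinearMap.range Ψ :=
    (Submodule.closed_of_finiteDimensional (LinearMap.range Ψ)).mem_of_tendsto hlim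
      (Eventually.of_forall fun k => LinearMap.mem_range_self Ψ (c k))
  obtain ⟨R₀, hR₀⟩ := Ψ.rangeRestrict.exists_rightInverse_of_surjective Ψ.range_rangeRestrict
  obtain ⟨R, hR⟩ := LinearMap.exists_extend R₀
  have hΨR : ∀ ρ ∈ LinearMap.range Ψ, Ψ (R ρ) = ρ := fun ρ hρ => by
    have h1 : R ρ = R₀ ⟨ρ, hρ⟩ := LinearMap.congr_fun hR ⟨ρ, hρ⟩
    have h2 := LinearMap.congr_fun hR₀ ⟨ρ, hρ⟩
    rw [h1]
    exact congrArg Subtype.val h2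
  -- The defect is removed along finitely many fixed directions with coefficients tending to 0. All
  -- endpoint derivatives then equal those of `d` exactly, so the directions are critical, and the
  -- limit is unchanged.
  let c' : ℕ → P.Dir := fun k => c k + ∑ i, (τ - Ψ (c k)) i • R (Pi.single i 1)
  have hc' : ∀ k, c' k = c k + R (τ - Ψ (c k)) := fun k => by
    simp only [c']
    conv_rhs => rw [pi_eq_sum_univ' (τ - Ψ (c k)), map_sum]
    simp only [map_smul]
  have hval : ∀ k, Ψ (c' k) = τ := fun k => by
    rw [hc', map_add, hΨR _ (Submodule.sub_mem _ hmem (LinearMap.mem_range_self Ψ (c k)))]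
    abel
  refine ⟨c', GohTendsto.add_sum h Finset.univ hc (fun i => ?_) _, fun k i => ?_, fun k j => ?_⟩
  · have := (tendsto_const_nhds (x := τ)).sub hlim
    rw [sub_self] at this
    exact (tendsto_pi_nhds.1 this) i
  · refine le_trans (le_of_eq ?_) (hd.2.2.2.2.2 i)
    exact congrFun (hval k) (Sum.inl i)
  · exact (congrFun (hval k) (Sum.inr j)).trans (hd.2.2.2.2.1 j)

omit h in
lemma continuous_gohEndpoint (lam : Multiplier n dφ dη) :
    Continuous fun q : (Fin n → ℝ) × (Fin n → ℝ) × (Fin m → ℝ) =>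
      P.gohEndpoint w lam q.1 q.2.1 q.2.2 := by
  let L := fderiv ℝ (fderiv ℝ (P.ell lam)) (w.x 0, w.x P.T)
  have hL : Continuous fun ζ : (Fin n → ℝ) × (Fin n → ℝ) => L ζ ζ :=
    L.continuous.clm_apply continuous_id
  have h1 : Continuous fun q : (Fin n → ℝ) × (Fin n → ℝ) × (Fin m → ℝ) =>
      ((q.1, q.2.1 + P.Fv w P.T *ᵥ q.2.2) : (Fin n → ℝ) × (Fin n → ℝ)) := by fun_prop
  have h2 : Continuous fun q : (Fin n → ℝ) × (Fin n → ℝ) × (Fin m → ℝ) =>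
      q.2.2 ⬝ᵥ (P.Hvx w lam P.T *ᵥ q.2.1 + (1 / 2 : ℝ) • (P.gohS w lam P.T *ᵥ q.2.2)) := by
    generalize P.Hvx w lam P.T = M
    generalize P.gohS w lam P.T = S
    fun_prop
  exact (continuous_const.mul (hL.comp h1)).add h2

/-- Continuity of the transformed second variation. -/
lemma GohTendsto.tendsto_OmegaP2 {lam : Multiplier n dφ dη} (hp : ContDiffOn ℝ 1 lam.2.2 (Icc 0 P.T))
    {c : ℕ → P.Dir} {d : TransformedDirection n l m} (hc : h.GohTendsto c d) :
    Tendsto (fun k => P.OmegaP2 w lam (h.goh (c k))) atTop (𝓝 (P.OmegaP2 w lam d)) := by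
  simp only [OmegaP2_eq h.nonneg]
  have hint := L2Tendsto.integral_bilin h.nonneg hc.pt hc.pt (h.continuousOn_qP2 hp)
  refine Tendsto.add ?_ hint
  have h1 : Tendsto (fun k => ((h.goh (c k)).ξ 0, (h.goh (c k)).ξ P.T, (h.goh (c k)).h)) atTop
      (𝓝 (d.ξ 0, d.ξ P.T, d.h)) :=
    hc.zero.prodMk_nhds (hc.final.prodMk_nhds hc.aff)
  have h2 := Tendsto.comp ((continuous_gohEndpoint (P := P) (w := w) lam).tendsto
    (d.ξ 0, d.ξ P.T, d.h)) h1
  exact h2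

end IsReference

end ControlProblem

/-! ### Limits of multipliers of finite index -/

/-- In finite dimension a linear form is a finite sum of coordinates times its values on a basis, so
pointwise convergence of the forms may be combined with convergence of the argument. -/
lemma tendsto_linearMap_apply {ι : Type} [Fintype ι] [DecidableEq ι]
    {f : ℕ → EuclideanSpace ℝ ι →ₗ[ℝ] ℝ} {f' : EuclideanSpace ℝ ι →ₗ[ℝ] ℝ}
    (hf : ∀ μ, Tendsto (fun k => f k μ) atTop (𝓝 (f' μ))) {μ : ℕ → EuclideanSpace ℝ ι}
    {μ' : EuclideanSpace ℝ ι} (hμ : Tendsto μ atTop (𝓝 μ')) :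
    Tendsto (fun k => f k (μ k)) atTop (𝓝 (f' μ')) := by
  have key : ∀ (g : EuclideanSpace ℝ ι →ₗ[ℝ] ℝ) ν, g ν = ∑ i, ν i * g (EuclideanSpace.single i 1) := by
    intro g ν
    conv_lhs => rw [← (EuclideanSpace.basisFun ι ℝ).sum_repr ν, map_sum]
    simp
  rw [key f' μ']
  refine Tendsto.congr (fun k => (key (f k) (μ k)).symm) (tendsto_finsetSum _ fun i _ => ?_)
  exact (((EuclideanSpace.proj (𝕜 := ℝ) i).continuous.tendsto μ').comp hμ).mul (hf _)

namespace ControlProblem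

variable {n l m dφ dη : ℕ} {P : ControlProblem n l m dφ dη} {w : StateControl n l m}

namespace IsReference

variable (h : P.IsReference w)
include h

lemma OmB_smul_add_left {a b : Multiplier n dφ dη} (ha : ContinuousOn a.2.2 (Icc 0 P.T))
    (hb : ContinuousOn b.2.2 (Icc 0 P.T)) (r : ℝ) (e e' : (Fin n → ℝ) × (Fin n → ℝ))
    {z z' : ℝ → (Fin n → ℝ) × (Fin l → ℝ) × (Fin m → ℝ)} (hz : MemLp z 2 (timeMeasure P.T))
    (hz' : MemLp z' 2 (timeMeasure P.T)) :
    P.OmB w (r • a + b) e e' z z' = r * P.OmB w a e e' z z' + P.OmB w b e e' z z' := by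
  have i1 := (intervalIntegrable_iff_timeMeasure h.nonneg _).2
    (integrable_bilin (h.continuousOn_qOm ha) hz hz')
  have i2 := (intervalIntegrable_iff_timeMeasure h.nonneg _).2
    (integrable_bilin (h.continuousOn_qOm hb) hz hz')
  have h1 : ∫ t in (0 : ℝ)..P.T, P.qOm w (r • a + b) t (z t) (z' t) =
      r * (∫ t in (0 : ℝ)..P.T, P.qOm w a t (z t) (z' t)) +
        ∫ t in (0 : ℝ)..P.T, P.qOm w b t (z t) (z' t) := by
    rw [← intervalIntegral.integral_const_mul, ← intervalIntegral.integral_add (i1.const_mul r) i2]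
    refine intervalIntegral.integral_congr fun t _ => ?_
    simp only [qOm_apply]
    change (1 / 2) * ((r • a.2.2 t + b.2.2 t) ⬝ᵥ _) = _
    rw [add_dotProduct, smul_dotProduct, smul_eq_mul]
    ring
  unfold OmB
  rw [h1]
  simp only [fderiv_fderiv_ell h.reg, Prod.fst_add, Prod.smul_fst, Prod.snd_add, Prod.smul_snd,
    Pi.add_apply, Pi.smul_apply, smul_eq_mul, add_mul, Finset.sum_add_distrib, mul_add,
    Finset.mul_sum, mul_assoc]
  ring_nf

/-- The second variation in a fixed direction, as a function of the endpoint multiplier. -/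
def omegaL {d : StateControl n l m} (hd : MemLp d.pt 2 (timeMeasure P.T)) : P.EndMult →ₗ[ℝ] ℝ where
  toFun μ := P.Omega w (h.mult μ) d
  map_add' a b := by
    have := h.OmB_smul_add_left (h.continuous_mult_p a).continuousOn
      (h.continuous_mult_p b).continuousOn 1 (d.x 0, d.x P.T) (d.x 0, d.x P.T) hd hd
    rw [one_smul, one_mul] at this
    rw [map_add, h.Omega_eq_OmB, h.Omega_eq_OmB, h.Omega_eq_OmB, this]
  map_smul' r a := by
    have := h.OmB_smul_add_left (h.continuous_mult_p a).continuousOn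
      (h.continuous_mult_p 0).continuousOn r (d.x 0, d.x P.T) (d.x 0, d.x P.T) hd hd
    have h0 := h.OmB_smul_add_left (h.continuous_mult_p 0).continuousOn
      (h.continuous_mult_p 0).continuousOn 1 (d.x 0, d.x P.T) (d.x 0, d.x P.T) hd hd
    rw [one_smul, one_mul, map_zero, add_zero] at h0
    rw [map_zero, add_zero] at this
    rw [map_smul, h.Omega_eq_OmB, h.Omega_eq_OmB, this, RingHom.id_apply, smul_eq_mul]
    linarith

lemma omegaL_apply {d : StateControl n l m} (hd : MemLp d.pt 2 (timeMeasure P.T)) (μ : P.EndMult) :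
    h.omegaL hd μ = P.Omega w (h.mult μ) d := rfl

/-- The transformed second variation as a function of the endpoint multiplier. -/
def omegaP2L {d : TransformedDirection n l m} (hd : MemLp d.pt 2 (timeMeasure P.T)) :
    P.EndMult →ₗ[ℝ] ℝ where
  toFun μ := P.OmegaP2 w (h.mult μ) d
  map_add' a b := by
    have := h.OmegaP2_smul_add (h.contDiffOn_mult_p a) (h.contDiffOn_mult_p b) 1 hd
    rw [one_smul, one_mul] at this
    rw [map_add, this]
  map_smul' r a := by
    have := h.OmegaP2_smul_add (h.contDiffOn_mult_p a) (h.contDiffOn_mult_p 0) r hd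
    have h0 := h.OmegaP2_smul_add (h.contDiffOn_mult_p 0) (h.contDiffOn_mult_p 0) 1 hd
    rw [one_smul, one_mul, map_zero, add_zero] at h0
    rw [map_zero, add_zero] at this
    rw [map_smul, this, RingHom.id_apply, smul_eq_mul]
    linarith

lemma omegaP2L_apply {d : TransformedDirection n l m} (hd : MemLp d.pt 2 (timeMeasure P.T))
    (μ : P.EndMult) : h.omegaP2L hd μ = P.OmegaP2 w (h.mult μ) d := rfl

/-- The derivative of the endpoint Lagrangian as a function of the endpoint multiplier. -/
def dellL (e : (Fin n → ℝ) × (Fin n → ℝ)) : P.EndMult →ₗ[ℝ] ℝ where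
  toFun μ := fderiv ℝ (P.ell (h.mult μ)) (w.x 0, w.x P.T) e
  map_add' a b := by
    simp only [fderiv_ell h.reg, map_add, Prod.fst_add, Prod.snd_add, Pi.add_apply, add_mul,
      Finset.sum_add_distrib]
    ring
  map_smul' r a := by
    simp only [fderiv_ell h.reg, map_smul, Prod.smul_fst, Prod.smul_snd, Pi.smul_apply, smul_eq_mul,
      mul_add, Finset.mul_sum, mul_assoc, RingHom.id_apply]

lemma dellL_apply (e : (Fin n → ℝ) × (Fin n → ℝ)) (μ : P.EndMult) :
    h.dellL e μ = fderiv ℝ (P.ell (h.mult μ)) (w.x 0, w.x P.T) e := rfl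

/-- The condition on the index is closed. -/
lemma IndexLt.of_tendsto {N : ℕ} {μ : ℕ → P.EndMult} {μ' : P.EndMult}
    (hμ : Tendsto μ atTop (𝓝 μ')) (hN : ∀ k, h.IndexLt N (h.mult (μ k))) :
    h.IndexLt N (h.mult μ') := by
  intro v
  -- The unit vectors subconverge on the compact sphere, and the second variation is a quadratic
  -- polynomial in `c` and linear in `μ`.
  choose c hc1 hc2 using fun k => hN k v
  obtain ⟨c', hc', φ, hφ, hlim⟩ := (isCompact_sphere (0 : EuclideanSpace ℝ (Fin N)) 1).tendsto_subseq
    (x := c) fun k => by simp [hc1 k]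
  refine ⟨c', by simpa using hc', ?_⟩
  have key : ∀ (μ : P.EndMult) (c : EuclideanSpace ℝ (Fin N)),
      P.Omega w (h.mult μ) (h.dir (∑ i, c i • v i)) = ∑ i, ∑ j, c i * (c j *
        h.OmBDir (h.continuous_mult_p μ).continuousOn (v i) (v j)) := by
    intro μ c
    rw [h.Omega_eq_OmB]
    change h.OmBDir (h.continuous_mult_p μ).continuousOn (∑ i, c i • v i) (∑ i, c i • v i) = _
    simp only [map_sum, LinearMap.sum_apply, map_smul, LinearMap.smul_apply, smul_eq_mul,
      Finset.mul_sum]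
    rw [Finset.sum_comm]
    exact Finset.sum_congr rfl fun i _ => Finset.sum_congr rfl fun j _ => mul_left_comm _ _ _
  have hlimi : ∀ i, Tendsto (fun k => c (φ k) i) atTop (𝓝 (c' i)) := fun i =>
    ((EuclideanSpace.proj (𝕜 := ℝ) i).continuous.tendsto c').comp hlim
  have hlim2 := tendsto_linearMap_apply
    (f := fun k => h.omegaL (h.memLp_dir_pt (∑ i, c (φ k) i • v i)))
    (f' := h.omegaL (h.memLp_dir_pt (∑ i, c' i • v i)))
    (fun μ => by
      simp only [omegaL_apply, key]
      exact tendsto_finsetSum _ fun i _ => tendsto_finsetSum _ fun j _ =>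
        (hlimi i).mul ((hlimi j).mul_const _)) (hμ.comp hφ.tendsto_atTop)
  exact ge_of_tendsto' hlim2 fun k => hc2 (φ k)

lemma Omega_dir_eq_goh_of_index {N : ℕ} {lam : Multiplier n dφ dη} (hN : h.IndexLt N lam)
    (hp : ContDiffOn ℝ 1 lam.2.2 (Icc 0 P.T)) (c : P.Dir) :
    P.Omega w lam (h.dir c) = P.OmegaP2 w lam (h.goh c) := by
  rw [h.Omega_dir_eq_goh hp]
  have e1 : ∫ t in (0 : ℝ)..P.T, (h.dir c).v t ⬝ᵥ P.Hvu w lam t *ᵥ (h.dir c).u t = 0 := by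
    refine Eq.trans (intervalIntegral.integral_congr (g := fun _ => (0 : ℝ)) fun t ht => ?_)
      intervalIntegral.integral_zero
    rw [uIcc_of_le h.nonneg] at ht
    simp only [IndexLt.Hvu_eq_zero h hN hp ht, zero_mulVec, dotProduct_zero]
  have e2 : ∫ t in (0 : ℝ)..P.T, (h.dir c).v t ⬝ᵥ P.gohV w lam t *ᵥ h.dirY c t = 0 := by
    refine Eq.trans (intervalIntegral.integral_congr (g := fun _ => (0 : ℝ)) fun t ht => ?_)
      intervalIntegral.integral_zero
    rw [uIcc_of_le h.nonneg] at ht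
    simp only [IndexLt.gohV_eq_zero h hN hp ht, zero_mulVec, dotProduct_zero]
  rw [e1, e2, add_zero, add_zero]

/-- For every direction of the transformed critical cone there is a normalized stationary
multiplier of finite index for which the transformed second variation is nonnegative. -/
theorem exists_multiplier_of_mem_coneP2 (hw : P.IsWeakMinimum w)
    (hact : ∀ i : Fin dφ, P.φ i.succ (w.x 0, w.x P.T) = 0) {d : TransformedDirection n l m}
    (hd : d ∈ P.coneP2 w) :
    ∃ μ : P.EndMult, ∃ N, h.mult μ ∈ P.multipliers w ∧ h.IndexLt N (h.mult μ) ∧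
      0 ≤ P.OmegaP2 w (h.mult μ) d := by
  obtain ⟨c, hc, hφ, hη⟩ := h.exists_critical_gohTendsto hd
  -- Each approximating direction has its own multiplier, but the index bound is the same for all
  -- and therefore holds for a limit point.
  choose μ hn hα hst hΩ hN using fun k => h.exists_multiplier hw hact (c k) (hφ k) (hη k)
  have hN' : ∀ k, h.IndexLt _ (h.mult (μ k)) := hN
  obtain ⟨μ', hμ', θ, hθ, hlim⟩ := (isCompact_sphere (0 : P.EndMult) 1).tendsto_subseq
    (x := μ) fun k => by simp [hn k]
  have hμ1 : ‖μ'‖ = 1 := by simpa using hμ'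
  have hα' : ∀ i, 0 ≤ μ' (.inl i) := fun i => ge_of_tendsto'
    (((EuclideanSpace.proj (𝕜 := ℝ) (Sum.inl i)).continuous.tendsto μ').comp hlim)
    fun k => hα (θ k) i
  have hst' : ∀ c, h.dellL (h.ends c) μ' = 0 := fun c => by
    have h1 := tendsto_linearMap_apply (f := fun _ => h.dellL (h.ends c)) (f' := h.dellL (h.ends c))
      (fun μ => tendsto_const_nhds) hlim
    exact tendsto_nhds_unique (h1.congr fun k => hst (θ k) c) tendsto_const_nhds
  have hN'' := IndexLt.of_tendsto h hlim fun k => hN' (θ k)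
  have hΩ' : 0 ≤ h.omegaP2L hc.pt.mem' μ' := by
    have hsub : h.GohTendsto (c ∘ θ) d := by
      have ht := hθ.tendsto_atTop
      exact ⟨hc.zero.comp ht, hc.final.comp ht, hc.aff.comp ht,
        fun k => hc.pt.mem (θ k), hc.pt.mem', hc.pt.lim.comp ht⟩
    have h1 := tendsto_linearMap_apply (f := fun k => h.omegaP2L (hc.pt.mem (θ k)))
      (f' := h.omegaP2L hc.pt.mem') (fun μ => GohTendsto.tendsto_OmegaP2 h (h.contDiffOn_mult_p μ) hsub)
      hlim
    refine ge_of_tendsto' h1 fun k => ?_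
    have h2 := hΩ (θ k)
    -- The inequality must be moved to the transformed form before passing to the limit: the affine
    -- controls of the approximants need not converge, only their primitives do.
    rw [h.Omega_dir_eq_goh_of_index (hN' (θ k)) (h.contDiffOn_mult_p _)] at h2
    exact h2
  -- Passage from the Euclidean normalization to the one that defines Λ; the remaining conditions
  -- are positively homogeneous.
  set s := ∑ i, |μ' (.inl i)| + ∑ j, |μ' (.inr j)| with hs
  have hspos : 0 < s := by
    refine lt_of_le_of_ne (by positivity) fun h0 => ?_
    have h1 := (add_eq_zero_iff_of_nonneg (Finset.sum_nonneg fun i _ => abs_nonneg _)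
      (Finset.sum_nonneg fun i _ => abs_nonneg _)).1 (hs.symm.trans h0.symm)
    have h2 : μ' = 0 := by
      ext k
      rcases k with i | j
      · exact abs_eq_zero.1 ((Finset.sum_eq_zero_iff_of_nonneg fun i _ => abs_nonneg _).1 h1.1 i
          (Finset.mem_univ i))
      · exact abs_eq_zero.1 ((Finset.sum_eq_zero_iff_of_nonneg fun i _ => abs_nonneg _).1 h1.2 j
          (Finset.mem_univ j))
    rw [h2, norm_zero] at hμ1
    exact zero_ne_one hμ1
  have hs0 : 0 ≤ s⁻¹ := by positivity
  refine ⟨s⁻¹ • μ', 3 * Fintype.card (Fin (dφ + 1) ⊕ Fin dη) + 1, h.mult_mem_multipliers ?_ (fun i => mul_nonneg hs0 (hα' i)) (fun c => ?_),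
    fun v => ?_, ?_⟩
  · simp only [PiLp.smul_apply, smul_eq_mul, abs_mul, abs_of_nonneg hs0, ← Finset.mul_sum]
    rw [← mul_add, ← hs, inv_mul_cancel₀ hspos.ne']
  · rw [← dellL_apply, map_smul, hst', smul_zero]
  · obtain ⟨c, hc1, hc2⟩ := hN'' v
    refine ⟨c, hc1, ?_⟩
    rw [← h.omegaL_apply (h.memLp_dir_pt _), map_smul]
    exact mul_nonneg hs0 hc2
  · rw [← h.omegaP2L_apply hc.pt.mem', map_smul]
    exact mul_nonneg hs0 hΩ'

end IsReference

end ControlProblem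

/-! ### Compactness of convex hulls and bounds along weakly convergent sequences -/

/-- In finite dimension the convex hull of a compact set is compact. -/
lemma isCompact_convexHull_of_finiteDimensional {E : Type} [NormedAddCommGroup E] [NormedSpace ℝ E]
    [FiniteDimensional ℝ E] {K : Set E} (hK : IsCompact K) : IsCompact (convexHull ℝ K) := by
  rcases K.eq_empty_or_nonempty with rfl | ⟨k₀, hk₀⟩
  · simp
  -- By Carathéodory this many points suffice, so the hull is a continuous image of a simplex times
  -- a power of `K`. Shorter combinations are padded with `k₀` at weight 0.
  let N := Module.finrank ℝ E + 1
  let Φ : (Fin N → ℝ) × (Fin N → E) → E := fun q => ∑ i, q.1 i • q.2 i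
  have hΦ : Continuous Φ := by fun_prop
  have himage : Φ '' (stdSimplex ℝ (Fin N) ×ˢ univ.pi fun _ => K) = convexHull ℝ K := by
    refine Subset.antisymm ?_ fun x hx => ?_
    · rintro - ⟨⟨c, z⟩, ⟨hc, hz⟩, rfl⟩
      exact (convex_convexHull ℝ K).sum_mem (fun i _ => hc.1 i) hc.2
        fun i _ => subset_convexHull ℝ K (hz i (mem_univ i))
    · obtain ⟨ι, hι, z, c, hz, hai, hc, hc1, rfl⟩ := eq_pos_convex_span_of_mem_convexHull hx
      have hcard : Fintype.card ι ≤ Fintype.card (Fin N) := by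
        rw [Fintype.card_fin]; exact hai.card_le_finrank_succ.trans
          (Nat.succ_le_succ (Submodule.finrank_le _))
      obtain ⟨e⟩ := Function.Embedding.nonempty_of_card_le hcard
      have e1 : ∀ i, Function.extend e c 0 (e i) = c i := fun i => e.injective.extend_apply _ _ _
      have e2 : ∀ i, Function.extend e z (fun _ => k₀) (e i) = z i :=
        fun i => e.injective.extend_apply _ _ _
      have e3 : ∀ i ∉ range e, Function.extend e c 0 i = 0 := fun i hi =>
        Function.extend_apply' _ _ _ fun ⟨a, ha⟩ => hi ⟨a, ha⟩
      have e4 : ∀ i ∉ range e, Function.extend e z (fun _ => k₀) i = k₀ := fun i hi =>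
        Function.extend_apply' _ _ _ fun ⟨a, ha⟩ => hi ⟨a, ha⟩
      refine ⟨(Function.extend e c 0, Function.extend e z fun _ => k₀), ⟨⟨fun i => ?_, ?_⟩,
        fun i _ => ?_⟩, ?_⟩
      · by_cases hi : i ∈ range e
        · obtain ⟨a, rfl⟩ := hi
          change 0 ≤ Function.extend e c 0 (e a)
          rw [e1]; exact (hc a).le
        · exact (e3 i hi).ge
      · rw [← hc1]
        exact (Fintype.sum_of_injective e e.injective _ _ e3 fun i => (e1 i).symm).symm
      · by_cases hi : i ∈ range e
        · obtain ⟨a, rfl⟩ := hi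
          change Function.extend e z (fun _ => k₀) (e a) ∈ K
          rw [e2]; exact hz (mem_range_self a)
        · change Function.extend e z (fun _ => k₀) i ∈ K
          rw [e4 i hi]; exact hk₀
      · refine (Fintype.sum_of_injective e e.injective _ _ (fun i hi => ?_) fun i => ?_).symm
        · change Function.extend e c 0 i • Function.extend e z (fun _ => k₀) i = 0
          rw [e3 i hi, zero_smul]
        · change c i • z i =
            Function.extend e c 0 (e i) • Function.extend e z (fun _ => k₀) (e i)
          rw [e1, e2]
  rw [← himage]
  exact ((isCompact_stdSimplex ℝ (Fin N)).prod (isCompact_univ_pi fun _ => hK)).image hΦ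

/-- Weakly convergent sequences are bounded. -/
lemma WeakTendstoL2.exists_bound {T : ℝ} (hT : 0 ≤ T) {k : ℕ} {z : ℕ → ℝ → Fin k → ℝ}
    {z' : ℝ → Fin k → ℝ} (hz : WeakTendstoL2 T z z') (hm : ∀ j, MemLp (z j) 2 (timeMeasure T)) :
    ∃ C, ∀ j, l2norm T (z j) ≤ C := by
  -- The uniform boundedness principle bounds these pairings. Testing the pairing with `z j` itself
  -- bounds the L² norm, because the sup norm on `ℝᵏ` is at most the Euclidean one.
  let Λ : ℕ → Lp (Fin k → ℝ) 2 (timeMeasure T) →L[ℝ] ℝ := fun j =>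
    (dotL (a := k)).lpPairing (timeMeasure T) 2 2 ((hm j).toLp (z j))
  have hΛ : ∀ j g, Λ j g = ∫ t in (0 : ℝ)..T, z j t ⬝ᵥ g t := fun j g => by
    rw [intervalIntegral_eq_timeMeasure hT]
    refine (ContinuousLinearMap.lpPairing_eq_integral _ _ _).trans (integral_congr_ae ?_)
    filter_upwards [(hm j).coeFn_toLp] with t ht
    rw [ht, dotL_apply]
  obtain ⟨C, hC⟩ := banach_steinhaus (g := Λ) fun g => by
    have h1 := hz g (Lp.memLp g)
    obtain ⟨C, hC⟩ := h1.norm.bddAbove_range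
    refine ⟨C, fun j => ?_⟩
    rw [hΛ]
    exact hC ⟨j, rfl⟩
  refine ⟨C, fun j => ?_⟩
  have hC0 : 0 ≤ C := (norm_nonneg _).trans (hC j)
  have hnorm : ‖(hm j).toLp (z j)‖ = l2norm T (z j) := by
    rw [Lp.norm_toLp, (hm j).eLpNorm_eq_integral_rpow_norm (by simp) (by simp),
      ENNReal.toReal_ofReal (by positivity), l2norm, intervalIntegral_eq_timeMeasure hT,
      Real.sqrt_eq_rpow]
    simp
  have h1 : Λ j ((hm j).toLp (z j)) ≤ C * l2norm T (z j) := by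
    rw [← hnorm]
    exact (le_abs_self _).trans ((Λ j).le_of_opNorm_le (hC j) _)
  have h2 : l2norm T (z j) ^ 2 ≤ Λ j ((hm j).toLp (z j)) := by
    have e1 : Λ j ((hm j).toLp (z j)) = ∫ t in (0 : ℝ)..T, z j t ⬝ᵥ z j t := by
      rw [hΛ, intervalIntegral_eq_timeMeasure hT, intervalIntegral_eq_timeMeasure hT]
      refine integral_congr_ae ?_
      filter_upwards [(hm j).coeFn_toLp] with t ht
      rw [ht]
    rw [e1, sq_l2norm hT]
    refine intervalIntegral.integral_mono_on hT
      ((intervalIntegrable_iff_timeMeasure hT _).2 ((hm j).integrable_norm_pow (p := 2) (by simp)))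
      ((intervalIntegrable_iff_timeMeasure hT _).2 (integrable_bilin (q := fun _ => dotL)
        continuousOn_const (hm j) (hm j))) fun t _ => ?_
    have h0 : 0 ≤ z j t ⬝ᵥ z j t := Finset.sum_nonneg fun i _ => mul_self_nonneg _
    rw [← Real.sq_sqrt h0]
    refine pow_le_pow_left₀ (norm_nonneg _) ((pi_norm_le_iff_of_nonneg (Real.sqrt_nonneg _)).2
      fun i => ?_) 2
    refine Real.le_sqrt_of_sq_le ?_
    rw [Real.norm_eq_abs, sq_abs, sq]
    exact Finset.single_le_sum (f := fun i => z j t i * z j t i) (fun i _ => mul_self_nonneg _)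
      (Finset.mem_univ i)
  by_contra! hcon
  nlinarith [l2norm_nonneg (T := T) (z j)]

/-! ### Compactness of the sets of multipliers -/

namespace ControlProblem

variable {n l m dφ dη : ℕ} {P : ControlProblem n l m dφ dη} {w : StateControl n l m}

lemma Agree.Hvx_eq {lam lam' : Multiplier n dφ dη} (ha : P.Agree lam lam') {t : ℝ}
    (ht : t ∈ Icc 0 P.T) : P.Hvx w lam t = P.Hvx w lam' t := by
  simp only [Hvx, ha.2.2 t ht]

lemma Agree.gohS_eq {lam lam' : Multiplier n dφ dη} (ha : P.Agree lam lam') {t : ℝ}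
    (ht : t ∈ Icc 0 P.T) : P.gohS w lam t = P.gohS w lam' t := by
  simp only [gohS, ha.Hvx_eq ht]

lemma Agree.gohV_eq {lam lam' : Multiplier n dφ dη} (ha : P.Agree lam lam') {t : ℝ}
    (ht : t ∈ Icc 0 P.T) : P.gohV w lam t = P.gohV w lam' t := by
  simp only [gohV, ha.Hvx_eq ht]

lemma matDerivWithin_congr {a b : ℕ} {T : ℝ} {M N : ℝ → Matrix (Fin a) (Fin b) ℝ}
    (h : ∀ t ∈ Icc 0 T, M t = N t) {t : ℝ} (ht : t ∈ Icc 0 T) :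
    matDerivWithin T M t = matDerivWithin T N t := by
  ext i j
  exact derivWithin_congr (fun s hs => by rw [h s hs]) (by rw [h t ht])

/-- Multipliers that agree on `[0, T]` may have different two-sided derivatives at its ends. The
continuous versions of the coefficients use derivatives within the interval only and give the same
integral. -/
lemma Agree.OmegaP2_eq (hT : 0 ≤ P.T) {lam lam' : Multiplier n dφ dη} (ha : P.Agree lam lam')
    (d : TransformedDirection n l m) : P.OmegaP2 w lam d = P.OmegaP2 w lam' d := by
  rw [ControlProblem.OmegaP2_eq hT, ControlProblem.OmegaP2_eq hT]
  have hTm : P.T ∈ Icc 0 P.T := ⟨hT, le_rfl⟩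
  congr 1
  · simp only [gohEndpoint, ellSecond, ha.ell_eq, ha.Hvx_eq hTm, ha.gohS_eq hTm]
  · refine intervalIntegral.integral_congr fun t ht => ?_
    rw [uIcc_of_le hT] at ht
    simp only [qP2, cM, cR, gohE, ha.Hvx_eq ht, matDerivWithin_congr (fun s hs => ha.Hvx_eq hs) ht,
      matDerivWithin_congr (fun s hs => ha.gohS_eq hs) ht, Hxx, Hux, Huu, ha.2.2 t ht]

namespace IsReference

variable (h : P.IsReference w)
include h

/-- Uniform boundedness of the second variation along weakly convergent sequences. -/
lemma exists_Omega_bound_of_weak {d : ℕ → StateControl n l m} {d' : StateControl n l m}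
    (hd : ∀ j, d j ∈ P.linearizedSpace w) (hd' : d' ∈ P.linearizedSpace w)
    (hw : P.WeakTendstoW2 d d') {lam : Multiplier n dφ dη} (hp : ContinuousOn lam.2.2 (Icc 0 P.T)) :
    ∃ C, ∀ j, |P.Omega w lam (d j)| ≤ C := by
  have mx : ∀ j, MemLp (d j).x 2 (timeMeasure P.T) := fun j =>
    ((hd j).1.1.continuousOn h.nonneg (by norm_num)).memLp_timeMeasure
  obtain ⟨C₁, hC₁⟩ := hw.1.exists_bound h.nonneg mx
  obtain ⟨C₂, hC₂⟩ := hw.2.2.1.exists_bound h.nonneg fun j => (hd j).1.2.1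
  obtain ⟨C₃, hC₃⟩ := hw.2.2.2.exists_bound h.nonneg fun j => (hd j).1.2.2
  obtain ⟨C₄, hC₄⟩ := (h.tendsto_ends hd hd' hw).norm.bddAbove_range
  have hC₄' : ∀ j, ‖((d j).x 0, (d j).x P.T)‖ ≤ C₄ := fun j => hC₄ ⟨j, rfl⟩
  have hC₄0 : 0 ≤ C₄ := (norm_nonneg _).trans (hC₄' 0)
  obtain ⟨Q, hQ⟩ := IsCompact.exists_bound_of_continuousOn
    (E := (Fin n → ℝ) × (Fin l → ℝ) × (Fin m → ℝ) →L[ℝ]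
      (Fin n → ℝ) × (Fin l → ℝ) × (Fin m → ℝ) →L[ℝ] ℝ) isCompact_Icc (h.continuousOn_qOm hp)
  have hQ0 : 0 ≤ Q := le_trans (ContinuousLinearMap.opNorm_nonneg _) (hQ 0 ⟨le_rfl, h.nonneg⟩)
  let L := fderiv ℝ (fderiv ℝ (P.ell lam)) (w.x 0, w.x P.T)
  refine ⟨(1 / 2) * (‖L‖ * C₄ * C₄) + Q * (C₁ ^ 2 + C₂ ^ 2 + C₃ ^ 2), fun j => ?_⟩
  have mpt : MemLp (d j).pt 2 (timeMeasure P.T) := (h.approx_of_mem_linearizedSpace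
    (hd j)).choose_spec.2.mem'
  have hpt : l2norm P.T (d j).pt * l2norm P.T (d j).pt ≤ C₁ ^ 2 + C₂ ^ 2 + C₃ ^ 2 := by
    have hint : ∀ {E : Type} [NormedAddCommGroup E] {f : ℝ → E}, MemLp f 2 (timeMeasure P.T) →
        IntervalIntegrable (fun t => ‖f t‖ ^ 2) volume 0 P.T := fun hf =>
      (intervalIntegrable_iff_timeMeasure h.nonneg _).2 (hf.integrable_norm_pow (p := 2) (by simp))
    have i1 := hint (mx j)
    have i2 := hint (hd j).1.2.1
    have i3 := hint (hd j).1.2.2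
    have e1 := pow_le_pow_left₀ (l2norm_nonneg _) (hC₁ j) 2
    have e2 := pow_le_pow_left₀ (l2norm_nonneg _) (hC₂ j) 2
    have e3 := pow_le_pow_left₀ (l2norm_nonneg _) (hC₃ j) 2
    refine le_trans ?_ (add_le_add (add_le_add e1 e2) e3)
    rw [← sq, sq_l2norm h.nonneg, sq_l2norm h.nonneg, sq_l2norm h.nonneg, sq_l2norm h.nonneg,
      ← intervalIntegral.integral_add i1 i2, ← intervalIntegral.integral_add (i1.add i2) i3]
    refine intervalIntegral.integral_mono_on h.nonneg (hint mpt) ((i1.add i2).add i3) fun t _ => ?_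
    change max ‖(d j).x t‖ (max ‖(d j).u t‖ ‖(d j).v t‖) ^ 2 ≤
      ‖(d j).x t‖ ^ 2 + ‖(d j).u t‖ ^ 2 + ‖(d j).v t‖ ^ 2
    rcases max_choice ‖(d j).x t‖ (max ‖(d j).u t‖ ‖(d j).v t‖) with e | e
    · rw [e]; nlinarith [sq_nonneg ‖(d j).u t‖, sq_nonneg ‖(d j).v t‖]
    · rw [e]
      rcases max_choice ‖(d j).u t‖ ‖(d j).v t‖ with e | e
      · rw [e]; nlinarith [sq_nonneg ‖(d j).x t‖, sq_nonneg ‖(d j).v t‖]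
      · rw [e]; nlinarith [sq_nonneg ‖(d j).x t‖, sq_nonneg ‖(d j).u t‖]
  rw [h.Omega_eq_OmB]
  refine (abs_add_le _ _).trans (add_le_add ?_ ((abs_integral_bilin_le h.nonneg hQ mpt mpt).trans
    (mul_le_mul_of_nonneg_left hpt hQ0)))
  rw [abs_mul, abs_of_pos (by norm_num : (0 : ℝ) < 1 / 2)]
  refine mul_le_mul_of_nonneg_left ?_ (by norm_num)
  calc _ = ‖L ((d j).x 0, (d j).x P.T) ((d j).x 0, (d j).x P.T)‖ := rfl
    _ ≤ ‖L‖ * ‖((d j).x 0, (d j).x P.T)‖ * ‖((d j).x 0, (d j).x P.T)‖ :=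
      ContinuousLinearMap.le_opNorm₂ L _ _
    _ ≤ ‖L‖ * C₄ * C₄ := mul_le_mul (mul_le_mul_of_nonneg_left (hC₄' j)
      (ContinuousLinearMap.opNorm_nonneg L)) (hC₄' j) (norm_nonneg _)
      (mul_nonneg (ContinuousLinearMap.opNorm_nonneg L) hC₄0)

lemma memLp_pt_of_mem_linearizedSpace {d : StateControl n l m} (hd : d ∈ P.linearizedSpace w) :
    MemLp d.pt 2 (timeMeasure P.T) :=
  (h.approx_of_mem_linearizedSpace hd).choose_spec.2.mem'

/-- The set of multipliers with weakly lower semicontinuous second variation is closed. -/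
lemma isWeaklyLsc_of_tendsto {μ : ℕ → P.EndMult} {μ' : P.EndMult} (hμ : Tendsto μ atTop (𝓝 μ'))
    (hl : ∀ k, P.IsWeaklyLsc w (P.Omega w (h.mult (μ k)))) :
    P.IsWeaklyLsc w (P.Omega w (h.mult μ')) := by
  intro d d' hd hd' hwk a ha
  have key : ∀ (g : P.EndMult →ₗ[ℝ] ℝ) ν, g ν = ∑ i, ν i * g (EuclideanSpace.single i 1) := by
    intro g ν
    conv_lhs => rw [← (EuclideanSpace.basisFun _ ℝ).sum_repr ν, map_sum]
    simp
  choose C hC using fun i => h.exists_Omega_bound_of_weak hd hd' hwk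
    (h.continuous_mult_p (EuclideanSpace.single i 1)).continuousOn
  -- Along a weakly convergent sequence the second variation is bounded by a constant times `‖ν‖`,
  -- uniformly in `j`. Replacing the limit multiplier by a nearby one therefore changes all values
  -- by less than `δ` at once.
  have hbound : ∀ ν j, |P.Omega w (h.mult ν) (d j)| ≤ ‖ν‖ * ∑ i, C i := by
    intro ν j
    rw [← h.omegaL_apply (h.memLp_pt_of_mem_linearizedSpace (hd j)), key, Finset.mul_sum]
    refine (Finset.abs_sum_le_sum_abs _ _).trans (Finset.sum_le_sum fun i _ => ?_)
    rw [abs_mul]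
    exact mul_le_mul (PiLp.norm_apply_le ν i) (hC i j) (abs_nonneg _) (norm_nonneg _)
  set δ := (P.Omega w (h.mult μ') d' - a) / 3 with hδ
  have hδ0 : 0 < δ := by have := sub_pos.2 ha; positivity
  have h1 := tendsto_linearMap_apply
    (f := fun _ => h.omegaL (h.memLp_pt_of_mem_linearizedSpace hd'))
    (f' := h.omegaL (h.memLp_pt_of_mem_linearizedSpace hd')) (fun _ => tendsto_const_nhds) hμ
  have h2 : Tendsto (fun k => ‖μ k - μ'‖ * ∑ i, C i) atTop (𝓝 0) := by
    simpa using (tendsto_iff_norm_sub_tendsto_zero.1 hμ).mul_const (∑ i, C i)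
  obtain ⟨k, hk1, hk2⟩ := ((h1.eventually (lt_mem_nhds (show a + 2 * δ <
    h.omegaL (h.memLp_pt_of_mem_linearizedSpace hd') μ' by
      rw [omegaL_apply]; linarith))).and (h2.eventually (gt_mem_nhds hδ0))).exists
  filter_upwards [hl k d d' hd hd' hwk _ hk1] with j hj
  have h3 := (le_abs_self _).trans (hbound (μ k - μ') j)
  rw [← h.omegaL_apply (h.memLp_pt_of_mem_linearizedSpace (hd j)), map_sub, omegaL_apply,
    omegaL_apply] at h3
  linarith

/-- The endpoint parts of `Λ^#`. -/
def sharpSet : Set P.EndMult := {μ | h.mult μ ∈ P.multipliersSharp w}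

lemma toEnd_mult (μ : P.EndMult) : P.toEnd (h.mult μ) = μ := by
  ext k
  rcases k with i | j <;> rfl

lemma mem_sharpSet_iff (μ : P.EndMult) : μ ∈ h.sharpSet ↔
    (∑ i, |μ (.inl i)| + ∑ j, |μ (.inr j)| = 1) ∧ (∀ i, 0 ≤ μ (.inl i)) ∧
      (∀ c, h.dellL (h.ends c) μ = 0) ∧ P.IsWeaklyLsc w (P.Omega w (h.mult μ)) := by
  refine ⟨fun hμ => ⟨hμ.1.1, hμ.1.2.1, fun c => ?_, hμ.2⟩,
    fun hμ => ⟨h.mult_mem_multipliers hμ.1 hμ.2.1 hμ.2.2.1, hμ.2.2.2⟩⟩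
  have := (h.of_mem_multipliers hμ.1).2 c
  rwa [toEnd_mult] at this

/-- The normalization bounds the set. The sign conditions and the normalization are closed,
stationarity is linear in the multiplier, and lower semicontinuity passes to limits by the uniform
bound along weakly convergent sequences. -/
lemma isCompact_sharpSet : IsCompact h.sharpSet := by
  have hcoord : ∀ k : Fin (dφ + 1) ⊕ Fin dη, Continuous fun μ : P.EndMult => μ k := fun k =>
    (EuclideanSpace.proj (𝕜 := ℝ) k).continuous
  have hb : h.sharpSet ⊆ Metric.closedBall 0 (Fintype.card (Fin (dφ + 1) ⊕ Fin dη)) := by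
    intro μ hμ
    have h1 := ((h.mem_sharpSet_iff μ).1 hμ).1
    have h2 : ∀ k, ‖μ k‖ ≤ 1 := by
      rintro (i | j)
      · rw [← h1]
        exact (Finset.single_le_sum (f := fun i => |μ (.inl i)|) (fun i _ => abs_nonneg _)
          (Finset.mem_univ i)).trans (le_add_of_nonneg_right (by positivity))
      · rw [← h1]
        exact (Finset.single_le_sum (f := fun j => |μ (.inr j)|) (fun i _ => abs_nonneg _)
          (Finset.mem_univ j)).trans (le_add_of_nonneg_left (by positivity))
    rw [mem_closedBall_zero_iff, ← (EuclideanSpace.basisFun _ ℝ).sum_repr μ]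
    refine (norm_sum_le _ _).trans ?_
    refine (Finset.sum_le_sum (g := fun _ => (1 : ℝ)) fun k _ => ?_).trans (by simp)
    rw [norm_smul]
    simpa using h2 k
  refine (isCompact_closedBall (0 : P.EndMult) _).of_isClosed_subset ?_ hb
  refine isSeqClosed_iff_isClosed.1 fun μ μ' hμ hlim => ?_
  simp only [mem_sharpSet_iff] at hμ ⊢
  have hl : ∀ k, Tendsto (fun j => μ j k) atTop (𝓝 (μ' k)) := fun k =>
    ((hcoord k).tendsto μ').comp hlim
  refine ⟨?_, fun i => ge_of_tendsto' (hl _) fun k => (hμ k).2.1 i, fun c => ?_,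
    h.isWeaklyLsc_of_tendsto hlim fun k => (hμ k).2.2.2⟩
  · refine tendsto_nhds_unique ((tendsto_finsetSum _ fun i _ => (hl (.inl i)).abs).add
      (tendsto_finsetSum _ fun j _ => (hl (.inr j)).abs)) ?_
    exact tendsto_const_nhds.congr fun k => ((hμ k).1).symm
  · have h1 := tendsto_linearMap_apply (f := fun _ => h.dellL (h.ends c)) (f' := h.dellL (h.ends c))
      (fun μ => tendsto_const_nhds) hlim
    exact tendsto_nhds_unique h1 (tendsto_const_nhds.congr fun k => ((hμ k).2.2.1 c).symm)

lemma mult_mem_convexHull {ν : P.EndMult} (hν : ν ∈ convexHull ℝ h.sharpSet) :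
    h.mult ν ∈ convexHull ℝ (P.multipliersSharp w) := by
  have h1 : h.mult ν ∈ h.mult '' convexHull ℝ h.sharpSet := mem_image_of_mem _ hν
  rw [LinearMap.image_convexHull] at h1
  exact convexHull_mono (image_subset_iff.2 fun μ hμ => hμ) h1

/-- Agreement on `[0, T]` with the multiplier rebuilt from the endpoint part survives convex
combinations, since `toEnd` and `mult` are linear. The hull in the infinite-dimensional space of
triples is thus governed by the hull of a compact set in finite dimension. -/
lemma of_mem_convexHull {lam : Multiplier n dφ dη} (hl : lam ∈ convexHull ℝ (P.multipliersSharp w)) :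
    P.toEnd lam ∈ convexHull ℝ h.sharpSet ∧ P.Agree lam (h.mult (P.toEnd lam)) := by
  have hsharp : ∀ lam ∈ P.multipliersSharp w, P.toEnd lam ∈ h.sharpSet := fun lam hl => by
    obtain ⟨h1, h2⟩ := h.of_mem_multipliers hl.1
    refine (h.mem_sharpSet_iff _).2 ⟨hl.1.1, hl.1.2.1, h2, ?_⟩
    rw [← show P.Omega w lam = P.Omega w (h.mult (P.toEnd lam)) from
      funext fun d => h1.Omega_eq h.nonneg d]
    exact hl.2
  refine ⟨?_, ?_⟩
  · have h1 : P.toEnd lam ∈ P.toEnd '' convexHull ℝ (P.multipliersSharp w) := mem_image_of_mem _ hl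
    rw [LinearMap.image_convexHull] at h1
    have hsub : P.toEnd '' P.multipliersSharp w ⊆ h.sharpSet := by
      rintro _ ⟨lam, hl, rfl⟩
      exact hsharp lam hl
    exact convexHull_mono hsub h1
  · have hconv : Convex ℝ {lam : Multiplier n dφ dη | P.Agree lam (h.mult (P.toEnd lam))} := by
      intro a ha b hb r s _ _ _
      refine ⟨rfl, rfl, fun t ht => ?_⟩
      rw [map_add, map_smul, map_smul, map_add, map_smul, map_smul]
      change r • a.2.2 t + s • b.2.2 t =
        r • (h.mult (P.toEnd a)).2.2 t + s • (h.mult (P.toEnd b)).2.2 t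
      rw [ha.2.2 t ht, hb.2.2 t ht]
    exact convexHull_min (fun lam hl => (h.of_mem_multipliers hl.1).1) hconv hl

/-- The endpoint parts of `G(co Λ^#)`. -/
def goodSet : Set P.EndMult := {ν | ν ∈ convexHull ℝ h.sharpSet ∧
  ∀ t ∈ Icc 0 P.T, P.gohV w (h.mult ν) t = 0}

/-- `V` is linear in the multiplier at each time, so its vanishing cuts the compact hull by a closed
subspace. -/
lemma isCompact_goodSet : IsCompact h.goodSet := by
  refine (isCompact_convexHull_of_finiteDimensional h.isCompact_sharpSet).inter_right ?_
  have hset : {ν : P.EndMult | ∀ t ∈ Icc 0 P.T, P.gohV w (h.mult ν) t = 0} =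
      ⋂ t ∈ Icc 0 P.T, {ν | P.gohV w (h.mult ν) t = 0} := by
    ext ν
    simp
  change IsClosed {ν : P.EndMult | ∀ t ∈ Icc 0 P.T, P.gohV w (h.mult ν) t = 0}
  rw [hset]
  refine isClosed_biInter fun t _ => ?_
  have h0 : P.gohV w (h.mult 0) t = 0 := by
    have := h.gohV_smul_add (h.mult 0) (h.mult 0) 1 t
    rw [one_smul, one_smul, map_zero, add_zero] at this
    simpa using this
  let g : P.EndMult →ₗ[ℝ] Matrix (Fin m) (Fin m) ℝ :=
    { toFun := fun ν => P.gohV w (h.mult ν) t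
      map_add' := fun a b => by
        have := h.gohV_smul_add (h.mult a) (h.mult b) 1 t
        rwa [one_smul, one_smul, ← map_add] at this
      map_smul' := fun r a => by
        have := h.gohV_smul_add (h.mult a) (h.mult 0) r t
        rwa [h0, add_zero, ← map_smul, ← map_add, add_zero] at this }
  exact isClosed_singleton.preimage
    (LinearMap.continuous_of_finiteDimensional (F' := Matrix (Fin m) (Fin m) ℝ) g)

end IsReference

end ControlProblem

end

/-! ### The theorem -/

theorem mainTheorem3 {n l m dφ dη : ℕ} (P : ControlProblem n l m dφ dη) (hT : 0 < P.T)
    (hreg : P.IsRegular) (w : StateControl n l m)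
    (hu : ContDiffOn ℝ ∞ w.u (Icc 0 P.T)) (hv : ContDiffOn ℝ ∞ w.v (Icc 0 P.T))
    (hact : ∀ i : Fin dφ, P.φ i.succ (w.x 0, w.x P.T) = 0)
    (hw : P.IsWeakMinimum w) :
    ∀ d ∈ P.coneP2 w, ∃ lam ∈ P.multipliersG w,
      IsMaxOn (fun mu => P.OmegaP2 w mu d) (P.multipliersG w) lam ∧ 0 ≤ P.OmegaP2 w lam d := by
  intro d hd
  have h := ControlProblem.isReference_of_isTrajectory hT hreg hu hv hw.1.1
  obtain ⟨c, hc⟩ := h.exists_gohTendsto hd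
  have hpt := hc.pt.mem'
  obtain ⟨μ, N, hμ1, hμ2, hμ3⟩ := h.exists_multiplier_of_mem_coneP2 hw hact hd
  have hsharp : μ ∈ h.sharpSet :=
    ⟨hμ1, ControlProblem.IsReference.IndexLt.isWeaklyLsc h hμ2 (h.continuous_mult_p μ).continuousOn⟩
  have hgood : μ ∈ h.goodSet := ⟨subset_convexHull ℝ _ hsharp, fun t ht =>
    ControlProblem.IsReference.IndexLt.gohV_eq_zero h hμ2 (h.contDiffOn_mult_p μ) ht⟩
  have hcont : Continuous (h.omegaP2L hpt) := LinearMap.continuous_of_finiteDimensional _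
  -- The maximum is taken over the compact set of endpoint parts. It bounds the value at every
  -- element of the original set because such an element agrees on `[0, T]` with the multiplier
  -- rebuilt from its endpoint part.
  obtain ⟨ν, hν, hmax⟩ := h.isCompact_goodSet.exists_isMaxOn ⟨μ, hgood⟩ hcont.continuousOn
  refine ⟨h.mult ν, ⟨h.mult_mem_convexHull hν.1, hν.2⟩, fun lam hlam => ?_, hμ3.trans (hmax hgood)⟩
  obtain ⟨h1, h2⟩ := h.of_mem_convexHull hlam.1
  change P.OmegaP2 w lam d ≤ P.OmegaP2 w (h.mult ν) d
  rw [h2.OmegaP2_eq h.nonneg]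
  exact hmax ⟨h1, fun t ht => by rw [← h2.gohV_eq ht]; exact hlam.2 t ht⟩
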